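/- Fix an integer $n\ge 1$ and a real number $\Gamma>1/2$. Put $\beta(t)=(1+t^2/4)^{1/2}$. For a real polynomial $p$ of degree at most $n$ and $x=(x_1,x_2),\ y=(y_1,y_2)\in\mathbb R^2$ define $$\Psi(x,y)=(x_1-y_1)(x_2^2+y_2^2)-(x_2-y_2)\,p(x_1+y_1),$$ $$\theta(x,y)=\beta(x_1-y_1)\,|x_2+y_2+p'(x_1+y_1)|\,(x_2-y_2).$$ For $\gamma\in\mathbb R$ and $R>0$ let $\mathcal O^R$ be the operator $$\mathcal O^R f(x)=\iint_{\mathbb R^2}\frac{e^{i\gamma\Psi(x,y)}\sin\theta(x,y)}{\beta(x_1-y_1)(x_2-y_2)}\,\chi_{[-R,R]}(x_1-y_1)\,f(y_1,y_2)\,dy_1\,dy_2,\qquad f\in C_c^\infty(\mathbb R^2).$$ Then there is a constant $C_{n,\Gamma}$, depending only on $n$ and $\Gamma$, such that for every real polynomial $p$ of degree at most $n$, every real $\gamma$ with $\min\{1,n/2\}\le|\gamma|\le\Gamma$ and every $R\ge 100$, the operator $\mathcal O^R$ extends to a bounded operator on $L^2(\mathbb R^2)$ with $$\|\mathcal O^R\|_{L^2(\mathbb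 R^2)\to L^2(\mathbb R^2)}\le C_{n,\Gamma}\,\log\log(10+R).$$ If $n=1$, there is moreover a constant $C_\Gamma$, depending only on $\Gamma$, such that $\|\mathcal O^R\|_{L^2(\mathbb R^2)\to L^2(\mathbb R^2)}\le C_\Gamma$ for all such $p$, $\gamma$ and $R$. -/

import Mathlib

open MeasureTheory
open scoped ContDiff Polynomial

noncomputable section

namespace SingOsc

/-- The weight `β(t) = (1 + t²/4)^{1/2}`. -/
def beta (t : ℝ) : ℝ := Real.sqrt (1 + t ^ 2 / 4)

/-- The phase `Ψ(x,y) = (x₁ - y₁)(x₂² + y₂²) - (x₂ - y₂) p(x₁ + y₁)`. -/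
def Psi (p : ℝ[X]) (x y : ℝ × ℝ) : ℝ :=
  (x.1 - y.1) * (x.2 ^ 2 + y.2 ^ 2) - (x.2 - y.2) * p.eval (x.1 + y.1)

/-- `θ(x,y) = β(x₁ - y₁) |x₂ + y₂ + p'(x₁ + y₁)| (x₂ - y₂)`. -/
def theta (p : ℝ[X]) (x y : ℝ × ℝ) : ℝ :=
  beta (x.1 - y.1) * |x.2 + y.2 + p.derivative.eval (x.1 + y.1)| * (x.2 - y.2)

/-- The integral kernel `e^{iγΨ} sin θ / (β(x₁ - y₁)(x₂ - y₂)) · χ_{[-R,R]}(x₁ - y₁)`.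
(On the null set `x₂ = y₂` the quotient takes the value `0`.) -/
def kernel (p : ℝ[X]) (γ R : ℝ) (x y : ℝ × ℝ) : ℂ :=
  Complex.exp (Complex.I * ((γ * Psi p x y : ℝ) : ℂ)) *
    ((Real.sin (theta p x y) / (beta (x.1 - y.1) * (x.2 - y.2)) : ℝ) : ℂ) *
    (Set.Icc (-R) R).indicator (fun _ => (1 : ℂ)) (x.1 - y.1)

/-- The operator `𝒪^R`, as a pointwise Lebesgue integral over `ℝ²`. -/
def oscOp (p : ℝ[X]) (γ R : ℝ) (f : ℝ × ℝ → ℂ) (x : ℝ × ℝ) : ℂ :=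
  ∫ y : ℝ × ℝ, kernel p γ R x y * f y

/-- The Hilbert space `L²(ℝ²)` of complex-valued functions. -/
abbrev L2 : Type := Lp ℂ 2 (volume : Measure (ℝ × ℝ))

/-- The bounded operator `T` on `L²(ℝ²)` extends `𝒪^R`, which is defined on `C_c^∞(ℝ²)`. -/
def Extends (p : ℝ[X]) (γ R : ℝ) (T : L2 →L[ℂ] L2) : Prop :=
  ∀ (f : ℝ × ℝ → ℂ) (hf : ContDiff ℝ ∞ f) (hs : HasCompactSupport f),
    (T ((hf.continuous.memLp_of_hasCompactSupport (p := 2) (μ := volume) hs).toLp f) :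
      ℝ × ℝ → ℂ) =ᵐ[volume] oscOp p γ R f

lemma beta_pos (t : ℝ) : 0 < beta t := Real.sqrt_pos.2 (by positivity)

/-- The integral defining `𝒪^R f(x)` converges absolutely at every point. -/
theorem integrable_kernel_mul (p : ℝ[X]) (γ R : ℝ) (f : ℝ × ℝ → ℂ)
    (hf : ContDiff ℝ ∞ f) (hs : HasCompactSupport f) (x : ℝ × ℝ) :
    Integrable (fun y => kernel p γ R x y * f y) volume := by
  have hcont : Continuous
      (fun y : ℝ × ℝ => x.2 + y.2 + p.derivative.eval (x.1 + y.1)) := by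
    have h := p.derivative.continuous
    fun_prop
  have hg : Integrable (fun y : ℝ × ℝ =>
      ((x.2 + y.2 + p.derivative.eval (x.1 + y.1) : ℝ) : ℂ) * f y) volume := by
    refine Continuous.integrable_of_hasCompactSupport ?_ (hs.mul_left)
    exact (Complex.continuous_ofReal.comp hcont).mul hf.continuous
  refine hg.mono ?_ ?_
  · refine AEStronglyMeasurable.mul ?_ hf.continuous.aestronglyMeasurable
    apply Measurable.aestronglyMeasurable
    unfold kernel
    have hΨ : Measurable (fun y => Psi p x y) := by
      have h := p.continuous
      unfold Psi
      exact Continuous.measurable (by fun_prop)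
    have hβ : Measurable (fun y : ℝ × ℝ => beta (x.1 - y.1)) := by
      unfold beta
      exact Continuous.measurable (by fun_prop)
    have hθ : Measurable (fun y => theta p x y) := by
      unfold theta
      exact (hβ.mul (hcont.abs.measurable)).mul (by fun_prop)
    refine Measurable.mul (Measurable.mul ?_ ?_) ?_
    · fun_prop
    · apply Complex.measurable_ofReal.comp
      exact (Real.measurable_sin.comp hθ).div (hβ.mul (by fun_prop))
    · exact (measurable_const.indicator measurableSet_Icc).comp (by fun_prop)
  · refine Filter.Eventually.of_forall fun y => ?_
    rw [norm_mul, norm_mul]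
    refine mul_le_mul_of_nonneg_right ?_ (norm_nonneg _)
    unfold kernel
    rw [norm_mul, norm_mul, mul_comm Complex.I, Complex.norm_exp_ofReal_mul_I, one_mul,
      Complex.norm_real, Complex.norm_real, Real.norm_eq_abs, Real.norm_eq_abs]
    have h1 : ‖(Set.Icc (-R) R).indicator (fun _ => (1 : ℂ)) (x.1 - y.1)‖ ≤ 1 := by
      refine (norm_indicator_le_norm_self _ _).trans ?_
      simp
    have h2 : |Real.sin (theta p x y) / (beta (x.1 - y.1) * (x.2 - y.2))| ≤
        |x.2 + y.2 + p.derivative.eval (x.1 + y.1)| := by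
      have hb := beta_pos (x.1 - y.1)
      rw [abs_div]
      refine div_le_of_le_mul₀ (abs_nonneg _) (abs_nonneg _) ?_
      refine Real.abs_sin_le_abs.trans (le_of_eq ?_)
      unfold theta
      rw [abs_mul, abs_mul, abs_mul, abs_abs]
      ring
    calc _ ≤ |x.2 + y.2 + p.derivative.eval (x.1 + y.1)| * 1 :=
          mul_le_mul h2 h1 (norm_nonneg _) (abs_nonneg _)
      _ = _ := mul_one _

end SingOsc

end

noncomputable section

namespace SingOsc

open scoped ENNReal ComplexConjugate

section Abstract

set_option linter.unusedSectionVars false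

variable {X Y : Type*} [MeasurableSpace X] [MeasurableSpace Y]

/-- Cauchy–Schwarz for the lower Lebesgue integral. -/
lemma lintegral_mul_sq_le {μ : Measure X} {f g : X → ℝ≥0∞} (hf : AEMeasurable f μ)
    (hg : AEMeasurable g μ) :
    (∫⁻ x, f x * g x ∂μ) ^ 2 ≤ (∫⁻ x, f x ^ 2 ∂μ) * ∫⁻ x, g x ^ 2 ∂μ := by
  have h := ENNReal.lintegral_mul_le_Lp_mul_Lq μ Real.HolderConjugate.two_two hf hg
  simp only [Pi.mul_apply] at h
  calc (∫⁻ x, f x * g x ∂μ) ^ 2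
      ≤ ((∫⁻ x, f x ^ (2 : ℝ) ∂μ) ^ (1 / 2 : ℝ) * (∫⁻ x, g x ^ (2 : ℝ) ∂μ) ^ (1 / 2 : ℝ)) ^ 2 := by
        gcongr
    _ = _ := by
        rw [mul_pow, ← ENNReal.rpow_natCast, ← ENNReal.rpow_natCast, ← ENNReal.rpow_mul,
          ← ENNReal.rpow_mul]
        norm_num

lemma enn_sqrt_sq (a : ℝ≥0∞) : a ^ (1 / 2 : ℝ) * a ^ (1 / 2 : ℝ) = a := by
  rw [← ENNReal.rpow_add_of_nonneg _ _ (by norm_num) (by norm_num)]; norm_num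

lemma lintegral_mul_sq_le_weight {μ : Measure X} {k F : X → ℝ≥0∞} (hk : AEMeasurable k μ)
    (hF : AEMeasurable F μ) :
    (∫⁻ x, k x * F x ∂μ) ^ 2 ≤ (∫⁻ x, k x ∂μ) * ∫⁻ x, k x * F x ^ 2 ∂μ := by
  have h := lintegral_mul_sq_le (μ := μ) (f := fun x => k x ^ (1 / 2 : ℝ))
    (g := fun x => k x ^ (1 / 2 : ℝ) * F x) (hk.pow_const _) ((hk.pow_const _).mul hF)
  have e1 : ∀ x, k x ^ (1 / 2 : ℝ) * (k x ^ (1 / 2 : ℝ) * F x) = k x * F x := fun x => by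
    rw [← mul_assoc, enn_sqrt_sq]
  have e2 : ∀ x, (k x ^ (1 / 2 : ℝ)) ^ 2 = k x := fun x => by rw [sq, enn_sqrt_sq]
  have e3 : ∀ x, (k x ^ (1 / 2 : ℝ) * F x) ^ 2 = k x * F x ^ 2 := fun x => by rw [mul_pow, e2]
  simpa only [e1, e2, e3] using h

/-- Schur's test. -/
lemma schur_sq {μ : Measure X} {ν : Measure Y} [SFinite μ] [SFinite ν] {k : X → Y → ℝ≥0∞}
    (hk : Measurable (Function.uncurry k)) {A B : ℝ≥0∞}
    (hA : ∀ᵐ x ∂μ, ∫⁻ y, k x y ∂ν ≤ A) (hB : ∀ᵐ y ∂ν, ∫⁻ x, k x y ∂μ ≤ B)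
    {F : Y → ℝ≥0∞} (hF : AEMeasurable F ν) :
    ∫⁻ x, (∫⁻ y, k x y * F y ∂ν) ^ 2 ∂μ ≤ A * B * ∫⁻ y, F y ^ 2 ∂ν := by
  have hk1 : ∀ x, Measurable (k x) := fun x => hk.comp measurable_prodMk_left
  calc ∫⁻ x, (∫⁻ y, k x y * F y ∂ν) ^ 2 ∂μ
      ≤ ∫⁻ x, A * ∫⁻ y, k x y * F y ^ 2 ∂ν ∂μ := by
        refine lintegral_mono_ae ?_
        filter_upwards [hA] with x hx
        exact (lintegral_mul_sq_le_weight (hk1 x).aemeasurable hF).trans (by gcongr)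
    _ = A * ∫⁻ y, ∫⁻ x, k x y * F y ^ 2 ∂μ ∂ν := by
        have hm : AEMeasurable (fun z : X × Y => k z.1 z.2 * F z.2 ^ 2) (μ.prod ν) :=
          hk.aemeasurable.mul ((hF.comp_quasiMeasurePreserving
            Measure.quasiMeasurePreserving_snd).pow_const 2)
        rw [lintegral_const_mul'', lintegral_lintegral_swap hm]
        exact hm.lintegral_prod_right'
    _ ≤ A * ∫⁻ y, B * F y ^ 2 ∂ν := by
        gcongr A * ?_
        refine lintegral_mono_ae ?_
        filter_upwards [hB] with y hy
        have hky : Measurable fun x => k x y := hk.comp measurable_prodMk_right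
        rw [lintegral_mul_const _ hky]
        gcongr
    _ = _ := by rw [lintegral_const_mul'' _ (hF.pow_const 2), mul_assoc]

/-- Schur's test for the bilinear form of a kernel. -/
lemma schur_form {μ : Measure X} [SFinite μ] {k : X → X → ℝ≥0∞}
    (hk : Measurable (Function.uncurry k)) {A B S : ℝ≥0∞}
    (hA : ∀ᵐ x ∂μ, ∫⁻ y, k x y ∂μ ≤ A) (hB : ∀ᵐ y ∂μ, ∫⁻ x, k x y ∂μ ≤ B)
    (hS : A * B ≤ S ^ 2)
    {F : X → ℝ≥0∞} (hF : AEMeasurable F μ) :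
    ∫⁻ x, ∫⁻ y, F x * F y * k x y ∂μ ∂μ ≤ S * ∫⁻ y, F y ^ 2 ∂μ := by
  have h1 := schur_sq hk hA hB hF
  have hm : AEMeasurable (fun x => ∫⁻ y, k x y * F y ∂μ) μ := by
    have : AEMeasurable (fun z : X × X => k z.1 z.2 * F z.2) (μ.prod μ) :=
      hk.aemeasurable.mul (hF.comp_quasiMeasurePreserving Measure.quasiMeasurePreserving_snd)
    exact this.lintegral_prod_right'
  have h2 := lintegral_mul_sq_le hF hm
  have e : ∫⁻ x, ∫⁻ y, F x * F y * k x y ∂μ ∂μ = ∫⁻ x, F x * ∫⁻ y, k x y * F y ∂μ ∂μ := by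
    refine lintegral_congr fun x => ?_
    rw [← lintegral_const_mul'']
    · refine lintegral_congr fun y => by ring
    · exact (hk.comp measurable_prodMk_left).aemeasurable.mul hF
  rw [e]
  refine (ENNReal.pow_le_pow_left_iff (n := 2) (by norm_num)).1 ?_
  calc _ ≤ _ := h2
    _ ≤ (∫⁻ x, F x ^ 2 ∂μ) * (S ^ 2 * ∫⁻ x, F x ^ 2 ∂μ) := by
        gcongr
        exact h1.trans (by gcongr)
    _ = _ := by ring

/-- The squared `L²` norm. -/
def sqn (μ : Measure X) (f : X → ℂ) : ℝ≥0∞ := ∫⁻ x, ‖f x‖ₑ ^ 2 ∂μ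

lemma sqn_eq (μ : Measure X) (f : X → ℂ) : sqn μ f = eLpNorm f 2 μ ^ 2 := by
  unfold sqn
  rw [eLpNorm_eq_lintegral_rpow_enorm_toReal (by norm_num) (by norm_num)]
  rw [← ENNReal.rpow_natCast, ← ENNReal.rpow_mul]
  norm_num

/-- The integral operator with kernel `K`. -/
def op (ν : Measure Y) (K : X → Y → ℂ) (f : Y → ℂ) (x : X) : ℂ := ∫ y, K x y * f y ∂ν

lemma sqn_op_le_of_enorm_le {μ : Measure X} {ν : Measure Y} [SFinite μ] [SFinite ν]
    {K : X → Y → ℂ} {k : X → Y → ℝ≥0∞}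
    (hk : Measurable (Function.uncurry k)) {A B : ℝ≥0∞}
    (hKk : ∀ᵐ x ∂μ, ∀ᵐ y ∂ν, ‖K x y‖ₑ ≤ k x y)
    (hA : ∀ᵐ x ∂μ, ∫⁻ y, k x y ∂ν ≤ A) (hB : ∀ᵐ y ∂ν, ∫⁻ x, k x y ∂μ ≤ B)
    {f : Y → ℂ} (hf : AEStronglyMeasurable f ν) :
    sqn μ (op ν K f) ≤ A * B * sqn ν f := by
  refine le_trans ?_ (schur_sq hk hA hB hf.enorm)
  unfold sqn op
  refine lintegral_mono_ae ?_
  filter_upwards [hKk] with x hx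
  gcongr
  refine (enorm_integral_le_lintegral_enorm _).trans (lintegral_mono_ae ?_)
  filter_upwards [hx] with y hy
  rw [enorm_mul]
  gcongr

lemma op_stronglyMeasurable {ν : Measure Y} [SFinite ν] {K : X → Y → ℂ} (hK : Measurable (Function.uncurry K))
    {f : Y → ℂ} (hf : AEStronglyMeasurable f ν) : StronglyMeasurable (op ν K f) := by
  have : op ν K f = op ν K (hf.mk f) := by
    funext x
    refine integral_congr_ae ?_
    filter_upwards [hf.ae_eq_mk] with y hy
    rw [hy]
  rw [this]
  have h2 : StronglyMeasurable (fun z : X × Y => K z.1 z.2 * hf.mk f z.2) :=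
    hK.stronglyMeasurable.mul (hf.stronglyMeasurable_mk.comp_measurable measurable_snd)
  exact h2.integral_prod_right'

variable {μ : Measure X} {ν : Measure Y} [IsFiniteMeasure μ] [IsFiniteMeasure ν]

lemma norm_op_le {K : X → Y → ℂ} {C : ℝ}
    (hb : ∀ x y, ‖K x y‖ ≤ C) {f : Y → ℂ} (hf : MemLp f 2 ν) (x : X) :
    ‖op ν K f x‖ ≤ C * ∫ y, ‖f y‖ ∂ν := by
  unfold op
  rw [← integral_const_mul]
  refine norm_integral_le_of_norm_le
    ((hf.integrable (by norm_num)).norm.const_mul C) (.of_forall fun y => ?_)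
  rw [norm_mul]
  exact mul_le_mul_of_nonneg_right (hb x y) (norm_nonneg _)

lemma op_memLp {K : X → Y → ℂ} (hK : Measurable (Function.uncurry K)) {C : ℝ}
    (hb : ∀ x y, ‖K x y‖ ≤ C) {f : Y → ℂ} (hf : MemLp f 2 ν) : MemLp (op ν K f) 2 μ :=
  MemLp.of_bound (op_stronglyMeasurable hK hf.1).aestronglyMeasurable _
    (.of_forall fun x => norm_op_le hb hf x)

/-- Fubini for the bilinear form of a bounded kernel. -/
lemma integral_op_mul {K : X → Y → ℂ} (hK : Measurable (Function.uncurry K)) {C : ℝ}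
    (hb : ∀ x y, ‖K x y‖ ≤ C) {f : Y → ℂ} (hf : MemLp f 2 ν) {g : X → ℂ} (hg : MemLp g 2 μ) :
    ∫ x, g x * op ν K f x ∂μ = ∫ y, op μ (fun y x => K x y) g y * f y ∂ν := by
  have hi : Integrable (fun z : X × Y => g z.1 * (K z.1 z.2 * f z.2)) (μ.prod ν) := by
    have h0 : Integrable (fun z : X × Y => g z.1 * f z.2) (μ.prod ν) :=
      (hg.integrable (by norm_num)).mul_prod (hf.integrable (by norm_num))
    have h1 := h0.bdd_mul (c := C) hK.aestronglyMeasurable (.of_forall fun z => hb z.1 z.2)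
    refine h1.congr (.of_forall fun z => ?_)
    simp only [Function.uncurry]
    ring
  unfold op
  calc ∫ x, g x * ∫ y, K x y * f y ∂ν ∂μ = ∫ x, ∫ y, g x * (K x y * f y) ∂ν ∂μ := by
        simp_rw [integral_const_mul]
    _ = ∫ y, ∫ x, g x * (K x y * f y) ∂μ ∂ν := integral_integral_swap hi
    _ = _ := by
        refine integral_congr_ae (.of_forall fun y => ?_)
        simp only
        rw [← integral_mul_const]
        refine integral_congr_ae (.of_forall fun x => ?_)
        simp only
        ring

/-- Duality: a bound for the adjoint kernel gives a bound for the kernel. -/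
lemma sqn_op_le_of_adjoint {K : X → Y → ℂ} (hK : Measurable (Function.uncurry K)) {C : ℝ}
    (hb : ∀ x y, ‖K x y‖ ≤ C) {S : ℝ≥0∞}
    (hS : ∀ g : X → ℂ, MemLp g 2 μ →
      sqn ν (op μ (fun y x => conj (K x y)) g) ≤ S * sqn μ g)
    {f : Y → ℂ} (hf : MemLp f 2 ν) : sqn μ (op ν K f) ≤ S * sqn ν f := by
  have hF := op_memLp (μ := μ) hK hb hf
  set F := op ν K f with hFdef
  have hNtop : sqn μ F ≠ ⊤ := by
    rw [sqn_eq]; exact ENNReal.pow_ne_top hF.2.ne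
  have hFc : MemLp (fun x => conj (F x)) 2 μ := hF.star
  have h1 : ‖∫ x, conj (F x) * F x ∂μ‖ₑ = sqn μ F := by
    have e : ∀ x, conj (F x) * F x = ((‖F x‖ ^ 2 : ℝ) : ℂ) := fun x => by
      rw [mul_comm, Complex.mul_conj, Complex.normSq_eq_norm_sq]
    simp_rw [e]
    rw [integral_complex_ofReal, ← ofReal_norm, Complex.norm_real, Real.norm_eq_abs,
      abs_of_nonneg (integral_nonneg fun x => by positivity),
      ofReal_integral_eq_lintegral_ofReal ?_ (.of_forall fun x => by positivity)]
    · refine lintegral_congr fun x => ?_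
      rw [ENNReal.ofReal_pow (norm_nonneg _), ofReal_norm]
    · exact hF.integrable_norm_pow (by norm_num)
  have h2 : ∀ y, op μ (fun y x => K x y) (fun x => conj (F x)) y
      = conj (op μ (fun y x => conj (K x y)) F y) := fun y => by
    unfold op
    rw [← integral_conj]
    refine integral_congr_ae (.of_forall fun x => ?_)
    simp
  have h3 : sqn μ F ≤ ∫⁻ y, ‖op μ (fun y x => conj (K x y)) F y‖ₑ * ‖f y‖ₑ ∂ν := by
    rw [← h1, hFdef, integral_op_mul hK hb hf (g := fun x => conj (F x)) hFc]
    refine (enorm_integral_le_lintegral_enorm _).trans (lintegral_mono fun y => ?_)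
    rw [enorm_mul, h2, RCLike.enorm_conj]
  have hKc : Measurable (Function.uncurry fun y x => conj (K x y)) :=
    (RCLike.continuous_conj (K := ℂ)).measurable.comp (hK.comp measurable_swap)
  have h4 := lintegral_mul_sq_le (μ := ν)
    (op_stronglyMeasurable (ν := μ) hKc hF.1).enorm.aemeasurable hf.1.enorm
  have h5 : sqn μ F ^ 2 ≤ S * sqn μ F * sqn ν f :=
    calc sqn μ F ^ 2 ≤ _ := by gcongr
      _ ≤ _ := h4
      _ ≤ _ := by
        exact mul_le_mul' (hS F hF) le_rfl
  by_cases h0 : sqn μ F = 0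
  · rw [h0]; exact bot_le
  rw [sq, mul_right_comm] at h5
  exact (ENNReal.mul_le_mul_iff_left h0 hNtop).1 h5

/-- The `T T*` method. -/
lemma sqn_op_le_of_ttstar {K : X → Y → ℂ} (hK : Measurable (Function.uncurry K)) {C : ℝ}
    (hb : ∀ x y, ‖K x y‖ ≤ C) {S : ℝ≥0∞}
    (hS : ∀ F : X → ℝ≥0∞, AEMeasurable F μ →
      ∫⁻ x, ∫⁻ x', F x * F x' * ‖∫ y, K x y * conj (K x' y) ∂ν‖ₑ ∂μ ∂μ ≤ S * ∫⁻ x, F x ^ 2 ∂μ)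
    {f : Y → ℂ} (hf : MemLp f 2 ν) : sqn μ (op ν K f) ≤ S * sqn ν f := by
  refine sqn_op_le_of_adjoint hK hb (fun g hg => ?_) hf
  set G := op μ (fun y x => conj (K x y)) g with hG
  have hKc : Measurable (Function.uncurry fun y x => conj (K x y)) :=
    (RCLike.continuous_conj (K := ℂ)).measurable.comp (hK.comp measurable_swap)
  have hbc : ∀ y x, ‖conj (K x y)‖ ≤ C := fun y x => by rw [RCLike.norm_conj]; exact hb x y
  have hGm : MemLp G 2 ν := op_memLp hKc hbc hg
  have hGc : MemLp (fun x => conj (G x)) 2 ν := hGm.star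
  have h1 : sqn ν G = ‖∫ y, conj (G y) * G y ∂ν‖ₑ := by
    have e : ∀ x, conj (G x) * G x = ((‖G x‖ ^ 2 : ℝ) : ℂ) := fun x => by
      rw [mul_comm, Complex.mul_conj, Complex.normSq_eq_norm_sq]
    simp_rw [e]
    rw [integral_complex_ofReal, ← ofReal_norm, Complex.norm_real, Real.norm_eq_abs,
      abs_of_nonneg (integral_nonneg fun x => by positivity),
      ofReal_integral_eq_lintegral_ofReal ?_ (.of_forall fun x => by positivity)]
    · refine lintegral_congr fun x => ?_
      rw [ENNReal.ofReal_pow (norm_nonneg _), ofReal_norm]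
    · exact hGm.integrable_norm_pow (by norm_num)
  have h2 : ∀ x, op ν (fun x y => conj (K x y)) (fun y => conj (G y)) x
      = ∫ x', conj (g x') * (∫ y, K x' y * conj (K x y) ∂ν) ∂μ := fun x => by
    have e := integral_op_mul (μ := ν) (ν := μ) (K := fun y x' => K x' y)
      (hK.comp measurable_swap) (fun y x => hb x y) hg.star
      (g := fun y => conj (K x y))
      (MemLp.of_bound ((RCLike.continuous_conj (K := ℂ)).measurable.comp
        (hK.comp measurable_prodMk_left)).aestronglyMeasurable C (.of_forall fun y => hbc y x))
    have e2 : ∀ y, conj (G y) = op μ (fun y x' => K x' y) (star g) y := fun y => by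
      rw [hG]
      unfold op
      rw [← integral_conj]
      refine integral_congr_ae (.of_forall fun x => ?_)
      simp
    calc _ = ∫ y, conj (K x y) * op μ (fun y x' => K x' y) (star g) y ∂ν := by
          unfold op
          refine integral_congr_ae (.of_forall fun y => ?_)
          simp only [e2]
          rfl
      _ = _ := e
      _ = _ := by
          refine integral_congr_ae (.of_forall fun x' => ?_)
          simp only [op, Pi.star_apply]
          rw [mul_comm]
          congr 1
  have h3 : ∫ y, conj (G y) * G y ∂ν
      = ∫ x, (∫ x', conj (g x') * (∫ y, K x' y * conj (K x y) ∂ν) ∂μ) * g x ∂μ := by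
    rw [hG, integral_op_mul hKc hbc hg (g := fun y => conj (G y)) hGc]
    refine integral_congr_ae (.of_forall fun x => ?_)
    simp only
    rw [h2]
  rw [h1, h3]
  refine (enorm_integral_le_lintegral_enorm _).trans ?_
  have hfin := hS (fun x => ‖g x‖ₑ) hg.1.enorm
  refine le_trans ?_ hfin
  refine lintegral_mono fun x => ?_
  rw [enorm_mul]
  calc _ ≤ (∫⁻ x', ‖conj (g x') * (∫ y, K x' y * conj (K x y) ∂ν)‖ₑ ∂μ) * ‖g x‖ₑ := by
        gcongr
        exact enorm_integral_le_lintegral_enorm _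
    _ = ∫⁻ x', ‖conj (g x') * (∫ y, K x' y * conj (K x y) ∂ν)‖ₑ * ‖g x‖ₑ ∂μ := by
        rw [lintegral_mul_const']
        simp
    _ = _ := by
        refine lintegral_congr fun x' => ?_
        have e4 : ∫ y, K x y * conj (K x' y) ∂ν = conj (∫ y, K x' y * conj (K x y) ∂ν) := by
          rw [← integral_conj]
          refine integral_congr_ae (.of_forall fun y => ?_)
          simp [mul_comm]
        rw [e4, enorm_mul, RCLike.enorm_conj, RCLike.enorm_conj]
        ring

omit [IsFiniteMeasure μ] [IsFiniteMeasure ν] in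
lemma sqn_restrict_congr {S : Set X} (hS : MeasurableSet S) {F G : X → ℂ}
    (h : ∀ x ∈ S, F x = G x) : sqn (μ.restrict S) F = sqn (μ.restrict S) G := by
  unfold sqn
  exact setLIntegral_congr_fun hS fun x hx => by simp only [h x hx]

omit [IsFiniteMeasure μ] [IsFiniteMeasure ν] in
lemma op_restrict_congr {S : Set X} {T : Set Y} (hT : MeasurableSet T) {K : X → Y → ℂ}
    (f : Y → ℂ) {x : X} (hx : x ∈ S) :
    op (ν.restrict T) (fun x y => (S ×ˢ T).indicator (Function.uncurry K) (x, y)) f x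
      = op (ν.restrict T) K f x := by
  unfold op
  refine setIntegral_congr_fun hT fun y hy => ?_
  simp only
  rw [Set.indicator_of_mem (Set.mk_mem_prod hx hy)]
  rfl

omit [IsFiniteMeasure μ] [IsFiniteMeasure ν] in
lemma norm_indicator_prod_le {S : Set X} {T : Set Y} {K : X → Y → ℂ} {C : ℝ} (hC : 0 ≤ C)
    (hb : ∀ x ∈ S, ∀ y ∈ T, ‖K x y‖ ≤ C) (x : X) (y : Y) :
    ‖(S ×ˢ T).indicator (Function.uncurry K) (x, y)‖ ≤ C := by
  by_cases h : (x, y) ∈ S ×ˢ T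
  · rw [Set.indicator_of_mem h]; exact hb x h.1 y h.2
  · rw [Set.indicator_of_notMem h]; simpa using hC

omit [IsFiniteMeasure μ] [IsFiniteMeasure ν] in
lemma sqn_op_le_of_ttstar_restrict {S : Set X} {T : Set Y} (hS : MeasurableSet S)
    (hT : MeasurableSet T) [IsFiniteMeasure (μ.restrict S)] [IsFiniteMeasure (ν.restrict T)]
    {K : X → Y → ℂ} (hK : Measurable (Function.uncurry K)) {C : ℝ} (hC : 0 ≤ C)
    (hb : ∀ x ∈ S, ∀ y ∈ T, ‖K x y‖ ≤ C) {A : ℝ≥0∞}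
    (hA : ∀ F : X → ℝ≥0∞, AEMeasurable F (μ.restrict S) →
      ∫⁻ x in S, ∫⁻ x' in S, F x * F x' * ‖∫ y in T, K x y * conj (K x' y) ∂ν‖ₑ ∂μ ∂μ
        ≤ A * ∫⁻ x in S, F x ^ 2 ∂μ)
    {f : Y → ℂ} (hf : MemLp f 2 (ν.restrict T)) :
    sqn (μ.restrict S) (op (ν.restrict T) K f) ≤ A * sqn (ν.restrict T) f := by
  rw [← sqn_restrict_congr hS (fun x hx => op_restrict_congr (K := K) hT f hx)]
  refine sqn_op_le_of_ttstar (K := fun x y => (S ×ˢ T).indicator (Function.uncurry K) (x, y))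
    (show Measurable _ from hK.indicator (hS.prod hT)) (norm_indicator_prod_le hC hb)
    (fun F hF => ?_) hf
  refine le_trans (le_of_eq ?_) (hA F hF)
  refine setLIntegral_congr_fun hS fun x hx => ?_
  refine setLIntegral_congr_fun hS fun x' hx' => ?_
  congr 2
  refine setIntegral_congr_fun hT fun y hy => ?_
  rw [Set.indicator_of_mem (Set.mk_mem_prod hx hy), Set.indicator_of_mem (Set.mk_mem_prod hx' hy)]
  rfl

omit [IsFiniteMeasure μ] [IsFiniteMeasure ν] in
lemma sqn_op_le_of_adjoint_restrict {S : Set X} {T : Set Y} (hS : MeasurableSet S)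
    (hT : MeasurableSet T) [IsFiniteMeasure (μ.restrict S)] [IsFiniteMeasure (ν.restrict T)]
    {K : X → Y → ℂ} (hK : Measurable (Function.uncurry K)) {C : ℝ} (hC : 0 ≤ C)
    (hb : ∀ x ∈ S, ∀ y ∈ T, ‖K x y‖ ≤ C) {A : ℝ≥0∞}
    (hA : ∀ g : X → ℂ, MemLp g 2 (μ.restrict S) →
      sqn (ν.restrict T) (op (μ.restrict S) (fun y x => conj (K x y)) g)
        ≤ A * sqn (μ.restrict S) g)
    {f : Y → ℂ} (hf : MemLp f 2 (ν.restrict T)) :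
    sqn (μ.restrict S) (op (ν.restrict T) K f) ≤ A * sqn (ν.restrict T) f := by
  rw [← sqn_restrict_congr hS (fun x hx => op_restrict_congr (K := K) hT f hx)]
  refine sqn_op_le_of_adjoint (K := fun x y => (S ×ˢ T).indicator (Function.uncurry K) (x, y))
    (show Measurable _ from hK.indicator (hS.prod hT)) (norm_indicator_prod_le hC hb)
    (fun g hg => ?_) hf
  refine le_trans (le_of_eq ?_) (hA g hg)
  refine sqn_restrict_congr hT fun y hy => ?_
  unfold op
  refine setIntegral_congr_fun hS fun x hx => ?_
  simp only
  rw [Set.indicator_of_mem (Set.mk_mem_prod hx hy)]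
  rfl

omit [IsFiniteMeasure μ] in
lemma sqn_add_le {f g : X → ℂ} (hf : AEStronglyMeasurable f μ) :
    sqn μ (fun x => f x + g x) ≤ 2 * sqn μ f + 2 * sqn μ g := by
  unfold sqn
  rw [← lintegral_const_mul' _ _ (by simp), ← lintegral_const_mul' _ _ (by simp),
    ← lintegral_add_left' ((hf.enorm.pow_const 2).const_mul 2)]
  refine lintegral_mono fun x => ?_
  calc ‖f x + g x‖ₑ ^ 2 ≤ (‖f x‖ₑ + ‖g x‖ₑ) ^ 2 := by gcongr; exact enorm_add_le _ _
    _ ≤ 2 * ‖f x‖ₑ ^ 2 + 2 * ‖g x‖ₑ ^ 2 := by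
      have := ENNReal.rpow_add_le_mul_rpow_add_rpow ‖f x‖ₑ ‖g x‖ₑ (p := 2) (by norm_num)
      norm_num at this
      rw [← mul_add]
      exact_mod_cast this

end Abstract

section Cotlar

variable {ι : Type*} {E : Type*}

/-- Iterated sum over tuples of length `m` with entries in `s`. -/
def tupleSum [AddCommMonoid E] (s : Finset ι) : ℕ → (List ι → E) → E
  | 0, F => F []
  | m + 1, F => ∑ i ∈ s, tupleSum s m fun l => F (i :: l)

lemma norm_tupleSum_le [SeminormedAddCommGroup E] (s : Finset ι) (m : ℕ) (F : List ι → E) :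
    ‖tupleSum s m F‖ ≤ tupleSum s m fun l => ‖F l‖ := by
  induction m generalizing F with
  | zero => exact le_rfl
  | succ m ih => exact (norm_sum_le _ _).trans (Finset.sum_le_sum fun i _ => ih _)

lemma tupleSum_mono (s : Finset ι) (m : ℕ) {F G : List ι → ℝ} (h : ∀ l, F l ≤ G l) :
    tupleSum s m F ≤ tupleSum s m G := by
  induction m generalizing F G with
  | zero => exact h _
  | succ m ih => exact Finset.sum_le_sum fun i _ => ih fun l => h _

lemma mul_tupleSum [Ring E] (s : Finset ι) (m : ℕ) (a : E) (F : List ι → E) :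
    tupleSum s m (fun l => a * F l) = a * tupleSum s m F := by
  induction m generalizing F with
  | zero => rfl
  | succ m ih => simp only [tupleSum, ih, Finset.mul_sum]

lemma sum_pow_eq_tupleSum [Ring E] (s : Finset ι) (T : ι → E) (m : ℕ) :
    (∑ i ∈ s, T i) ^ m = tupleSum s m fun l => (l.map T).prod := by
  induction m with
  | zero => simp [tupleSum]
  | succ m ih => simp only [tupleSum, List.map_cons, List.prod_cons, mul_tupleSum, ← ih, pow_succ',
      Finset.sum_mul]

/-- Product of the weights of consecutive entries. -/
def chain (w : ι → ι → ℝ) : List ι → ℝ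
  | [] => 1
  | [_] => 1
  | i :: j :: l => w i j * chain w (j :: l)

/-- Product of the squared weights of disjoint consecutive pairs. -/
def pairing (w : ι → ι → ℝ) (M : ℝ) : List ι → ℝ
  | [] => 1
  | [_] => M
  | i :: j :: l => w i j ^ 2 * pairing w M l

lemma pairing_mul_tail (w : ι → ι → ℝ) (M : ℝ) (i : ι) (l : List ι) :
    pairing w M (i :: l) * pairing w M l = M * chain w (i :: l) ^ 2 := by
  induction l generalizing i with
  | nil => simp [pairing, chain]
  | cons j l ih =>
    simp only [pairing, chain]
    rw [mul_assoc, mul_comm (pairing w M l), ih]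
    ring

variable [NormedRing E] [NormOneClass E]

lemma norm_prod_le_pairing {T : ι → E} {w : ι → ι → ℝ} {M : ℝ}
    (hM : ∀ i, ‖T i‖ ≤ M) (hw : ∀ i j, ‖T i * T j‖ ≤ w i j ^ 2) :
    ∀ l : List ι, ‖(l.map T).prod‖ ≤ pairing w M l
  | [] => by simp [pairing]
  | [i] => by simpa [pairing] using hM i
  | i :: j :: l => by
    simp only [List.map_cons, List.prod_cons, pairing, ← mul_assoc]
    exact (norm_mul_le _ _).trans (mul_le_mul (hw i j) (norm_prod_le_pairing hM hw l)
      (norm_nonneg _) (sq_nonneg _))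

lemma chain_nonneg {w : ι → ι → ℝ} (h0 : ∀ i j, 0 ≤ w i j) : ∀ l : List ι, 0 ≤ chain w l
  | [] => zero_le_one
  | [_] => zero_le_one
  | i :: j :: l => mul_nonneg (h0 i j) (chain_nonneg h0 (j :: l))

lemma norm_prod_le_chain {T : ι → E} {w : ι → ι → ℝ} {M : ℝ} (h0 : ∀ i j, 0 ≤ w i j)
    (hM0 : 0 ≤ M)
    (hM : ∀ i, ‖T i‖ ≤ M) (hw : ∀ i j, ‖T i * T j‖ ≤ w i j ^ 2) (i : ι) (l : List ι) :
    ‖((i :: l).map T).prod‖ ≤ M * chain w (i :: l) := by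
  have h1 := norm_prod_le_pairing hM hw (i :: l)
  have h2 : ‖((i :: l).map T).prod‖ ≤ M * pairing w M l := by
    simp only [List.map_cons, List.prod_cons]
    exact (norm_mul_le _ _).trans (mul_le_mul (hM i) (norm_prod_le_pairing hM hw l)
      (norm_nonneg _) hM0)
  refine (pow_le_pow_iff_left₀ (norm_nonneg _) (mul_nonneg hM0 (chain_nonneg h0 _)) two_ne_zero).1 ?_
  calc ‖((i :: l).map T).prod‖ ^ 2
      ≤ pairing w M (i :: l) * (M * pairing w M l) := by
        rw [sq]
        exact mul_le_mul h1 h2 (norm_nonneg _) ((norm_nonneg _).trans h1)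
    _ = M * (pairing w M (i :: l) * pairing w M l) := by ring
    _ = _ := by rw [pairing_mul_tail]; ring

lemma tupleSum_chain_le {w : ι → ι → ℝ} {M : ℝ} (s : Finset ι) (h0 : ∀ i j, 0 ≤ w i j)
    (hM0 : 0 ≤ M) (hsum : ∀ i, ∑ j ∈ s, w i j ≤ M) (m : ℕ) (i : ι) :
    tupleSum s m (fun l => chain w (i :: l)) ≤ M ^ m := by
  induction m generalizing i with
  | zero => simp [tupleSum, chain]
  | succ m ih =>
    simp only [tupleSum, chain, mul_tupleSum]
    calc _ ≤ ∑ j ∈ s, w i j * M ^ m :=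
          Finset.sum_le_sum fun j _ => mul_le_mul_of_nonneg_left (ih j) (h0 i j)
      _ = (∑ j ∈ s, w i j) * M ^ m := by rw [Finset.sum_mul]
      _ ≤ M * M ^ m := mul_le_mul_of_nonneg_right (hsum i) (by positivity)
      _ = _ := by ring

end Cotlar

/-- The Cotlar–Stein lemma for a finite family of self-adjoint operators. -/
theorem cotlar_stein {ι H : Type*} [NormedAddCommGroup H] [InnerProductSpace ℂ H] [CompleteSpace H]
    (s : Finset ι) (T : ι → H →L[ℂ] H) (hT : ∀ i, IsSelfAdjoint (T i)) {w : ι → ι → ℝ} {M : ℝ}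
    (h0 : ∀ i j, 0 ≤ w i j) (hM : ∀ i, ‖T i‖ ≤ M) (hw : ∀ i j, ‖T i * T j‖ ≤ w i j ^ 2)
    (hsum : ∀ i, ∑ j ∈ s, w i j ≤ M) (hM0 : 0 ≤ M) : ‖∑ i ∈ s, T i‖ ≤ M := by
  rcases subsingleton_or_nontrivial H with hH | hH
  · have : ∑ i ∈ s, T i = 0 := ContinuousLinearMap.ext fun x => Subsingleton.elim _ _
    rw [this, norm_zero]; exact hM0
  set S := ∑ i ∈ s, T i with hS
  have hSa : IsSelfAdjoint S := by
    rw [hS]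
    exact isSelfAdjoint_sum s fun i _ => hT i
  have hpow : ∀ m : ℕ, ‖S ^ (m + 1)‖ ≤ s.card * M ^ (m + 1) := fun m => by
    rw [hS, sum_pow_eq_tupleSum]
    refine (norm_tupleSum_le _ _ _).trans ?_
    simp only [tupleSum]
    calc _ ≤ ∑ i ∈ s, M * M ^ m := by
          refine Finset.sum_le_sum fun i _ => ?_
          refine (tupleSum_mono s m fun l => norm_prod_le_chain h0 hM0 hM hw i l).trans ?_
          rw [mul_tupleSum]
          exact mul_le_mul_of_nonneg_left (tupleSum_chain_le s h0 hM0 hsum m i) hM0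
      _ = _ := by rw [Finset.sum_const, nsmul_eq_mul]; ring
  have hpow2 : ∀ r : ℕ, ‖S‖ ^ 2 ^ r ≤ s.card * M ^ 2 ^ r := fun r => by
    have e : ‖S ^ 2 ^ r‖ = ‖S‖ ^ 2 ^ r := by
      have := hSa.nnnorm_pow_two_pow r
      rw [← coe_nnnorm, this]; simp
    obtain ⟨m, hm⟩ : ∃ m, 2 ^ r = m + 1 := ⟨2 ^ r - 1, (Nat.sub_add_cancel Nat.one_le_two_pow).symm⟩
    rw [← e, hm]
    exact hpow m
  by_contra hlt
  push Not at hlt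
  rcases hM0.eq_or_lt with h | h
  · have := hpow2 0
    rw [← h] at this hlt
    norm_num at this
    rw [this] at hlt
    simp at hlt
  · have hq : 1 < ‖S‖ / M := (one_lt_div h).2 hlt
    obtain ⟨r, hr⟩ := pow_unbounded_of_one_lt (s.card : ℝ) hq
    have h1 : (‖S‖ / M) ^ r ≤ (‖S‖ / M) ^ 2 ^ r :=
      pow_le_pow_right₀ hq.le Nat.lt_two_pow_self.le
    have h2 : (‖S‖ / M) ^ 2 ^ r ≤ s.card := by
      rw [div_pow, div_le_iff₀ (by positivity)]
      exact hpow2 r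
    linarith

section Clm

set_option linter.unusedSectionVars false

variable {X : Type*} [MeasurableSpace X] {μ : Measure X} [IsFiniteMeasure μ]

/-- A bounded measurable kernel on a finite measure space defines a bounded operator on `L²`. -/
lemma exists_clm_of_kernel {K : X → X → ℂ} (hK : Measurable (Function.uncurry K)) {C : ℝ}
    (hb : ∀ x y, ‖K x y‖ ≤ C) :
    ∃ T : Lp ℂ 2 μ →L[ℂ] Lp ℂ 2 μ,
      ∀ f (hf : MemLp f 2 μ), (T (hf.toLp f) : X → ℂ) =ᵐ[μ] op μ K f := by
  have hmem : ∀ f : Lp ℂ 2 μ, MemLp (op μ K f) 2 μ := fun f => op_memLp hK hb (Lp.memLp f)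
  have hint : ∀ (f : Lp ℂ 2 μ) x, Integrable (fun y => K x y * f y) μ := fun f x =>
    (((Lp.memLp f).integrable (by norm_num)).bdd_mul
      (hK.comp measurable_prodMk_left).aestronglyMeasurable (.of_forall fun y => hb x y))
  let L : Lp ℂ 2 μ →ₗ[ℂ] Lp ℂ 2 μ :=
    { toFun := fun f => (hmem f).toLp _
      map_add' := fun f g => by
        rw [← MemLp.toLp_add]
        refine MemLp.toLp_congr _ _ (.of_forall fun x => ?_)
        simp only [Pi.add_apply, op]
        rw [← integral_add (hint f x) (hint g x)]
        refine integral_congr_ae ?_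
        filter_upwards [Lp.coeFn_add f g] with y hy
        rw [hy, Pi.add_apply, mul_add]
      map_smul' := fun c f => by
        rw [RingHom.id_apply, ← MemLp.toLp_const_smul]
        refine MemLp.toLp_congr _ _ (.of_forall fun x => ?_)
        simp only [Pi.smul_apply, op, smul_eq_mul]
        rw [← integral_const_mul]
        refine integral_congr_ae ?_
        filter_upwards [Lp.coeFn_smul c f] with y hy
        rw [hy, Pi.smul_apply, smul_eq_mul]
        ring }
  have hsch : ∀ f : Lp ℂ 2 μ, ‖L f‖ ≤ (max C 0 * μ.real Set.univ) * ‖f‖ := fun f => by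
    have h1 : sqn μ (op μ K f) ≤ ENNReal.ofReal (max C 0 * μ.real Set.univ) ^ 2 * sqn μ f := by
      have hc : ∫⁻ _ : X, ENNReal.ofReal (max C 0) ∂μ
          ≤ ENNReal.ofReal (max C 0 * μ.real Set.univ) := by
        rw [lintegral_const, ENNReal.ofReal_mul (le_max_right _ _), measureReal_def,
          ENNReal.ofReal_toReal (measure_ne_top _ _)]
      rw [sq]
      refine sqn_op_le_of_enorm_le (k := fun _ _ => ENNReal.ofReal (max C 0)) measurable_const
        (.of_forall fun x => .of_forall fun y => ?_) (.of_forall fun _ => hc)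
        (.of_forall fun _ => hc) (Lp.memLp f).1
      rw [← ofReal_norm]
      exact ENNReal.ofReal_le_ofReal ((hb x y).trans (le_max_left _ _))
    rw [sqn_eq, sqn_eq, ← mul_pow] at h1
    have h2 := (ENNReal.pow_le_pow_left_iff (n := 2) (by norm_num)).1 h1
    have h3 : ‖L f‖ = (eLpNorm (op μ K f) 2 μ).toReal := Lp.norm_toLp _ (hmem f)
    rw [h3, Lp.norm_def, ← ENNReal.toReal_ofReal (r := max C 0 * μ.real Set.univ)
      (mul_nonneg (le_max_right _ _) measureReal_nonneg), ← ENNReal.toReal_mul]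
    exact ENNReal.toReal_mono (ENNReal.mul_ne_top ENNReal.ofReal_ne_top (Lp.memLp f).2.ne) h2
  refine ⟨L.mkContinuous _ hsch, fun f hf => ?_⟩
  refine ((hmem (hf.toLp f)).coeFn_toLp).trans (.of_forall fun x => ?_)
  unfold op
  refine integral_congr_ae ?_
  filter_upwards [hf.coeFn_toLp] with y hy
  rw [hy]

/-- The operator `T` on `L²` is given by the kernel `K`. -/
def HasKernel (μ : Measure X) (T : Lp ℂ 2 μ →L[ℂ] Lp ℂ 2 μ) (K : X → X → ℂ) : Prop :=
  ∀ f (hf : MemLp f 2 μ), (T (hf.toLp f) : X → ℂ) =ᵐ[μ] op μ K f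

omit [IsFiniteMeasure μ] in
lemma enorm_sq_eq_sqn (f : Lp ℂ 2 μ) : ‖f‖ₑ ^ 2 = sqn μ f := by
  rw [sqn_eq, Lp.enorm_def]

omit [IsFiniteMeasure μ] in
lemma clm_norm_le_of_sqn {T : Lp ℂ 2 μ →L[ℂ] Lp ℂ 2 μ} {A : ℝ} (hA : 0 ≤ A)
    (h : ∀ f : Lp ℂ 2 μ, sqn μ (T f) ≤ ENNReal.ofReal A ^ 2 * sqn μ f) : ‖T‖ ≤ A := by
  refine T.opNorm_le_bound hA fun f => ?_
  have h1 := h f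
  rw [← enorm_sq_eq_sqn, ← enorm_sq_eq_sqn, ← mul_pow] at h1
  have h2 := (ENNReal.pow_le_pow_left_iff (n := 2) (by norm_num)).1 h1
  rw [← ofReal_norm, ← ofReal_norm, ← ENNReal.ofReal_mul hA] at h2
  exact (ENNReal.ofReal_le_ofReal_iff (by positivity)).1 h2

omit [IsFiniteMeasure μ] in
lemma sqn_congr {f g : X → ℂ} (h : f =ᵐ[μ] g) : sqn μ f = sqn μ g := by
  unfold sqn
  refine lintegral_congr_ae ?_
  filter_upwards [h] with x hx
  rw [hx]

lemma HasKernel.ae_eq {T : Lp ℂ 2 μ →L[ℂ] Lp ℂ 2 μ} {K : X → X → ℂ} (h : HasKernel μ T K)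
    (f : Lp ℂ 2 μ) : (T f : X → ℂ) =ᵐ[μ] op μ K f := by
  have := h f (Lp.memLp f)
  rwa [Lp.toLp_coeFn] at this

lemma HasKernel.isSelfAdjoint {T : Lp ℂ 2 μ →L[ℂ] Lp ℂ 2 μ} {K : X → X → ℂ}
    (h : HasKernel μ T K) (hK : Measurable (Function.uncurry K)) {C : ℝ}
    (hb : ∀ x y, ‖K x y‖ ≤ C) (hs : ∀ x y, conj (K y x) = K x y) : IsSelfAdjoint T := by
  rw [ContinuousLinearMap.isSelfAdjoint_iff_isSymmetric]
  intro f g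
  simp only [ContinuousLinearMap.coe_coe]
  rw [L2.inner_def, L2.inner_def]
  have h1 : ∫ x, inner ℂ (T f x) (g x) ∂μ = ∫ x, g x * conj (op μ K f x) ∂μ := by
    refine integral_congr_ae ?_
    filter_upwards [h.ae_eq f] with x hx
    rw [hx, RCLike.inner_apply]
  have h2 : ∫ x, inner ℂ (f x) (T g x) ∂μ = ∫ x, conj (f x) * op μ K g x ∂μ := by
    refine integral_congr_ae ?_
    filter_upwards [h.ae_eq g] with x hx
    rw [hx, RCLike.inner_apply, mul_comm]
  rw [h1, h2, integral_op_mul hK hb (Lp.memLp g) (g := fun x => conj (f x)) (Lp.memLp f).star]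
  refine integral_congr_ae (.of_forall fun x => ?_)
  simp only
  rw [mul_comm]
  congr 1
  unfold op
  rw [← integral_conj]
  refine integral_congr_ae (.of_forall fun y => ?_)
  simp only [map_mul]
  congr 1
  rw [← hs y x]

end Clm

section Oscillatory

/-- Integration by parts against `e^{if}` for an amplitude differentiable off a countable set. -/
lemma norm_integral_exp_deriv_mul_le {a b : ℝ} (hab : a ≤ b) {f f1 P : ℝ → ℝ} {s : Set ℝ}
    (hs : s.Countable) (hf : ∀ t, HasDerivAt f (f1 t) t) (hf1 : Continuous f1)
    (hPc : ContinuousOn P (Set.Icc a b)) {P1 : ℝ → ℝ}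
    (hP : ∀ t ∈ Set.Ioo a b \ s, HasDerivAt P (P1 t) t)
    (hP1 : IntervalIntegrable P1 volume a b) :
    ‖∫ t in a..b, Complex.exp (Complex.I * (f t : ℂ)) * ((f1 t * P t : ℝ) : ℂ)‖
      ≤ |P a| + |P b| + ∫ t in a..b, |P1 t| := by
  have hfc : Continuous f := continuous_iff_continuousAt.2 fun t => (hf t).continuousAt
  have hE : Continuous fun t => Complex.exp (Complex.I * (f t : ℂ)) := by fun_prop
  have hn : ∀ t, ‖Complex.exp (Complex.I * (f t : ℂ))‖ = 1 := fun t => by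
    rw [mul_comm, Complex.norm_exp_ofReal_mul_I]
  have hderE : ∀ t, HasDerivAt (fun t => Complex.exp (Complex.I * (f t : ℂ)))
      (Complex.exp (Complex.I * (f t : ℂ)) * (Complex.I * (f1 t : ℂ))) t := fun t =>
    ((hf t).ofReal_comp.const_mul Complex.I).cexp
  have hPc' : ContinuousOn (fun t => ((P t : ℝ) : ℂ)) (Set.Icc a b) :=
    Complex.continuous_ofReal.comp_continuousOn hPc
  have i1 : IntervalIntegrable (fun t => Complex.exp (Complex.I * (f t : ℂ)) *
      (Complex.I * (f1 t : ℂ)) * (P t : ℂ)) volume a b := by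
    refine ContinuousOn.intervalIntegrable ?_
    rw [Set.uIcc_of_le hab]
    exact ((hE.mul (by fun_prop)).continuousOn).mul hPc'
  have i2 : IntervalIntegrable (fun t => Complex.exp (Complex.I * (f t : ℂ)) *
      ((P1 t : ℝ) : ℂ)) volume a b := by
    have : IntervalIntegrable (fun t => ((P1 t : ℝ) : ℂ)) volume a b :=
      ⟨hP1.1.ofReal, hP1.2.ofReal⟩
    exact this.continuousOn_mul hE.continuousOn
  have key := integral_eq_of_hasDerivAt_off_countable
    (fun t => Complex.exp (Complex.I * (f t : ℂ)) * (P t : ℂ))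
    (fun t => Complex.exp (Complex.I * (f t : ℂ)) * (Complex.I * (f1 t : ℂ)) * (P t : ℂ)
      + Complex.exp (Complex.I * (f t : ℂ)) * ((P1 t : ℝ) : ℂ)) (a := a) (b := b) hs
    (by rw [Set.uIcc_of_le hab]; exact hE.continuousOn.mul hPc')
    (fun t ht => by
      rw [min_eq_left hab, max_eq_right hab] at ht
      exact (hderE t).mul (hP t ht).ofReal_comp)
    (i1.add i2)
  rw [intervalIntegral.integral_add i1 i2] at key
  have e1 : ∫ t in a..b, Complex.exp (Complex.I * (f t : ℂ)) * ((f1 t * P t : ℝ) : ℂ)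
      = -Complex.I * ∫ t in a..b, Complex.exp (Complex.I * (f t : ℂ)) *
      (Complex.I * (f1 t : ℂ)) * (P t : ℂ) := by
    rw [← intervalIntegral.integral_const_mul]
    refine intervalIntegral.integral_congr fun t _ => ?_
    push_cast
    linear_combination (Complex.exp (Complex.I * (f t : ℂ)) * f1 t * P t) * Complex.I_sq
  have e2 := eq_sub_of_add_eq key
  rw [e1, e2, norm_mul, norm_neg, Complex.norm_I, one_mul]
  refine (norm_sub_le _ _).trans (add_le_add ((norm_sub_le _ _).trans ?_) ?_)
  · rw [norm_mul, norm_mul, hn, hn, one_mul, one_mul, Complex.norm_real, Complex.norm_real,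
      Real.norm_eq_abs, Real.norm_eq_abs, add_comm]
  · refine (intervalIntegral.norm_integral_le_integral_norm hab).trans (le_of_eq ?_)
    refine intervalIntegral.integral_congr fun t _ => ?_
    rw [norm_mul, hn, one_mul, Complex.norm_real, Real.norm_eq_abs]

/-- Regularised integration by parts: no lower bound on the phase derivative is required. -/
lemma norm_integral_exp_mul_le {a b : ℝ} (hab : a ≤ b) {f f1 A B : ℝ → ℝ} {s : Set ℝ}
    (hs : s.Countable) (hf : ∀ t, HasDerivAt f (f1 t) t) (hf1 : Continuous f1)
    (hA : ContinuousOn A (Set.Icc a b)) (hB : Continuous B) (hB0 : ∀ t, 0 < B t) {P1 : ℝ → ℝ}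
    (hP : ∀ t ∈ Set.Ioo a b \ s, HasDerivAt (fun t => f1 t / (f1 t ^ 2 + B t) * A t) (P1 t) t)
    (hP1 : IntervalIntegrable P1 volume a b) :
    ‖∫ t in a..b, Complex.exp (Complex.I * (f t : ℂ)) * ((A t : ℝ) : ℂ)‖
      ≤ (∫ t in a..b, |A t| * (B t / (f1 t ^ 2 + B t)))
        + (|f1 a / (f1 a ^ 2 + B a) * A a| + |f1 b / (f1 b ^ 2 + B b) * A b|
        + ∫ t in a..b, |P1 t|) := by
  have hfc : Continuous f := continuous_iff_continuousAt.2 fun t => (hf t).continuousAt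
  have hE : Continuous fun t => Complex.exp (Complex.I * (f t : ℂ)) := by fun_prop
  have hn : ∀ t, ‖Complex.exp (Complex.I * (f t : ℂ))‖ = 1 := fun t => by
    rw [mul_comm, Complex.norm_exp_ofReal_mul_I]
  have hpos : ∀ t, 0 < f1 t ^ 2 + B t := fun t => by have := hB0 t; positivity
  have hg : Continuous fun t => f1 t / (f1 t ^ 2 + B t) :=
    hf1.div ((hf1.pow 2).add hB) fun t => (hpos t).ne'
  have hg2 : Continuous fun t => B t / (f1 t ^ 2 + B t) :=
    hB.div ((hf1.pow 2).add hB) fun t => (hpos t).ne'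
  have hPc : ContinuousOn (fun t => f1 t / (f1 t ^ 2 + B t) * A t) (Set.Icc a b) :=
    hg.continuousOn.mul hA
  have key := norm_integral_exp_deriv_mul_le hab hs hf hf1 hPc hP hP1
  have hAB : ContinuousOn (fun t => A t * (B t / (f1 t ^ 2 + B t))) (Set.Icc a b) :=
    hA.mul hg2.continuousOn
  have e : ∀ t, Complex.exp (Complex.I * (f t : ℂ)) * ((A t : ℝ) : ℂ)
      = Complex.exp (Complex.I * (f t : ℂ)) * ((A t * (B t / (f1 t ^ 2 + B t)) : ℝ) : ℂ)
      + Complex.exp (Complex.I * (f t : ℂ)) *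
        ((f1 t * (f1 t / (f1 t ^ 2 + B t) * A t) : ℝ) : ℂ) := fun t => by
    rw [← mul_add, ← Complex.ofReal_add]
    congr 2
    have := (hpos t).ne'
    field_simp
    ring
  have hco : ∀ {F : ℝ → ℝ}, ContinuousOn F (Set.Icc a b) → IntervalIntegrable
      (fun t => Complex.exp (Complex.I * (f t : ℂ)) * ((F t : ℝ) : ℂ)) volume a b := fun hF => by
    refine ContinuousOn.intervalIntegrable ?_
    rw [Set.uIcc_of_le hab]
    exact hE.continuousOn.mul (Complex.continuous_ofReal.comp_continuousOn hF)
  have e2 : ∫ t in a..b, Complex.exp (Complex.I * (f t : ℂ)) * ((A t : ℝ) : ℂ)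
      = (∫ t in a..b, Complex.exp (Complex.I * (f t : ℂ)) *
          ((A t * (B t / (f1 t ^ 2 + B t)) : ℝ) : ℂ))
      + ∫ t in a..b, Complex.exp (Complex.I * (f t : ℂ)) *
        ((f1 t * (f1 t / (f1 t ^ 2 + B t) * A t) : ℝ) : ℂ) := by
    rw [← intervalIntegral.integral_add (hco hAB)
      (hco (F := fun t => f1 t * (f1 t / (f1 t ^ 2 + B t) * A t)) (hf1.continuousOn.mul hPc))]
    exact intervalIntegral.integral_congr fun t _ => e t
  rw [e2]
  refine (norm_add_le _ _).trans (add_le_add ?_ key)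
  refine (intervalIntegral.norm_integral_le_integral_norm hab).trans (le_of_eq ?_)
  refine intervalIntegral.integral_congr fun t _ => ?_
  rw [norm_mul, hn, one_mul, Complex.norm_real, Real.norm_eq_abs, abs_mul,
    abs_of_nonneg (div_nonneg (hB0 t).le (hpos t).le)]

open Classical in
/-- Inserting the sign of a polynomial costs a factor bounded by the number of its roots. -/
lemma norm_integral_sign_mul_le (P : ℝ[X]) {F : ℝ → ℂ} (hF : Continuous F) {B : ℝ} :
    ∀ (k : ℕ) (a b : ℝ), a ≤ b → (P.roots.toFinset.filter (· ∈ Set.Ioo a b)).card ≤ k →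
      (∀ a' b', a ≤ a' → a' ≤ b' → b' ≤ b → ‖∫ t in a'..b', F t‖ ≤ B) →
      ‖∫ t in a..b, ((SignType.sign (P.eval t) : ℝ) : ℂ) * F t‖ ≤ (k + 1) * B := by
  have hsm : Measurable fun t => ((SignType.sign (P.eval t) : ℝ) : ℂ) := by
    refine Complex.measurable_ofReal.comp ?_
    have : Measurable fun x : ℝ => ((SignType.sign x : SignType) : ℝ) := by
      have e : (fun x : ℝ => ((SignType.sign x : SignType) : ℝ))
          = fun x => if 0 < x then 1 else if x < 0 then -1 else 0 := by
        funext x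
        rw [sign_apply]
        split_ifs <;> simp
      rw [e]
      exact Measurable.ite measurableSet_Ioi measurable_const
        (Measurable.ite measurableSet_Iio measurable_const measurable_const)
    exact this.comp P.continuous.measurable
  have hint : ∀ a b, IntervalIntegrable (fun t => ((SignType.sign (P.eval t) : ℝ) : ℂ) * F t)
      volume a b := fun a b => by
    refine (hF.intervalIntegrable a b).mono_fun (hsm.mul hF.measurable).aestronglyMeasurable
      (.of_forall fun t => ?_)
    simp only
    rw [norm_mul, Complex.norm_real]
    refine mul_le_of_le_one_left (norm_nonneg _) ?_
    rcases SignType.sign (P.eval t) with _ | _ | _ <;> simp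
  intro k
  induction k using Nat.strong_induction_on with
  | _ k ih =>
  intro a b hab hcard hB
  have hB0 : 0 ≤ B := (norm_nonneg _).trans (hB a a le_rfl le_rfl hab)
  have hk1 : (1 : ℝ) ≤ k + 1 := by have : (0 : ℝ) ≤ k := k.cast_nonneg; linarith
  by_cases hP : P = 0
  · simp only [hP, Polynomial.eval_zero, sign_zero]
    simp
    positivity
  by_cases hroot : ∃ c ∈ Set.Ioo a b, P.eval c = 0
  · obtain ⟨c, hc, hPc⟩ := hroot
    have hcm : c ∈ P.roots.toFinset.filter (· ∈ Set.Ioo a b) := by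
      simp only [Finset.mem_filter, Multiset.mem_toFinset]
      exact ⟨(Polynomial.mem_roots hP).2 hPc, hc⟩
    set S := P.roots.toFinset.filter (· ∈ Set.Ioo a b)
    set S1 := P.roots.toFinset.filter (· ∈ Set.Ioo a c)
    set S2 := P.roots.toFinset.filter (· ∈ Set.Ioo c b)
    have hd : Disjoint S1 S2 := by
      rw [Finset.disjoint_left]
      intro x h1 h2
      have h1' := (Finset.mem_filter.1 h1).2.2
      have h2' := (Finset.mem_filter.1 h2).2.1
      linarith
    have hsub : S1 ∪ S2 ⊆ S.erase c := by
      intro x hx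
      rcases Finset.mem_union.1 hx with h | h
      · have h' := Finset.mem_filter.1 h
        refine Finset.mem_erase.2 ⟨h'.2.2.ne, Finset.mem_filter.2 ⟨h'.1, h'.2.1, h'.2.2.trans hc.2⟩⟩
      · have h' := Finset.mem_filter.1 h
        refine Finset.mem_erase.2 ⟨h'.2.1.ne', Finset.mem_filter.2 ⟨h'.1, hc.1.trans h'.2.1, h'.2.2⟩⟩
    have hcard2 : S1.card + S2.card + 1 ≤ k := by
      have h1 := Finset.card_le_card hsub
      rw [Finset.card_union_of_disjoint hd, Finset.card_erase_of_mem hcm] at h1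
      have h2 : 0 < S.card := Finset.card_pos.2 ⟨c, hcm⟩
      omega
    rw [← intervalIntegral.integral_add_adjacent_intervals (hint a c) (hint c b)]
    have h1 := ih S1.card (by omega) a c hc.1.le le_rfl
      fun a' b' h h' h'' => hB a' b' h h' (h''.trans hc.2.le)
    have h2 := ih S2.card (by omega) c b hc.2.le le_rfl
      fun a' b' h h' h'' => hB a' b' (hc.1.le.trans h) h' h''
    refine (norm_add_le _ _).trans ((add_le_add h1 h2).trans ?_)
    rw [← add_mul]
    refine mul_le_mul_of_nonneg_right ?_ hB0
    have : ((S1.card + S2.card + 1 : ℕ) : ℝ) ≤ k := by exact_mod_cast hcard2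
    push_cast at this
    linarith
  · push Not at hroot
    have hconst : ∃ c : ℝ, |c| ≤ 1 ∧ ∀ t ∈ Set.Ioo a b, ((SignType.sign (P.eval t) : ℝ)) = c := by
      by_cases hpos : ∃ t0 ∈ Set.Ioo a b, 0 < P.eval t0
      · obtain ⟨t0, ht0, hp⟩ := hpos
        refine ⟨1, by norm_num, fun t ht => ?_⟩
        rw [sign_pos, SignType.coe_one]
        by_contra hneg
        push Not at hneg
        have := isPreconnected_Ioo.intermediate_value ht ht0 P.continuous.continuousOn
          ⟨hneg, hp.le⟩
        obtain ⟨c, hc, h0⟩ := this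
        exact hroot c hc h0
      · push Not at hpos
        refine ⟨-1, by norm_num, fun t ht => ?_⟩
        rw [sign_neg (lt_of_le_of_ne (hpos t ht) (hroot t ht)), SignType.coe_neg_one]
    obtain ⟨c, hc1, hc⟩ := hconst
    have e : ∫ t in a..b, ((SignType.sign (P.eval t) : ℝ) : ℂ) * F t
        = (c : ℂ) * ∫ t in a..b, F t := by
      rw [← intervalIntegral.integral_const_mul, intervalIntegral.integral_of_le hab,
        intervalIntegral.integral_of_le hab, integral_Ioc_eq_integral_Ioo,
        integral_Ioc_eq_integral_Ioo]
      exact setIntegral_congr_fun measurableSet_Ioo fun t ht => by simp only [hc t ht]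
    rw [e, norm_mul, Complex.norm_real, Real.norm_eq_abs]
    have := hB a b le_rfl hab le_rfl
    calc |c| * ‖∫ t in a..b, F t‖ ≤ 1 * B := mul_le_mul hc1 this (norm_nonneg _) zero_le_one
      _ ≤ _ := mul_le_mul_of_nonneg_right hk1 hB0

end Oscillatory

section Poly

open Polynomial

lemma exists_coeff_bound (d : ℕ) : ∃ C : ℝ, 0 < C ∧ ∀ P : ℝ[X], P.natDegree ≤ d → ∀ i,
    ∃ x ∈ Set.Icc (1 : ℝ) (3 / 2), |P.coeff i| ≤ C * |P.eval x| := by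
  classical
  set v : ℕ → ℝ := fun k => 1 + k / (2 * (d + 1)) with hv
  set s := Finset.range (d + 1)
  have hinj : Set.InjOn v s := fun x _ y _ h => by
    have hd : (2 * ((d : ℝ) + 1)) ≠ 0 := by positivity
    simp only [hv, add_right_inj] at h
    rw [div_left_inj' hd] at h
    exact_mod_cast h
  have hmem : ∀ k ∈ s, v k ∈ Set.Icc (1 : ℝ) (3 / 2) := fun k hk => by
    have hk' : (k : ℝ) ≤ d := by exact_mod_cast Nat.lt_succ_iff.1 (Finset.mem_range.1 hk)
    simp only [hv]
    constructor
    · have : (0 : ℝ) ≤ k / (2 * (d + 1)) := by positivity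
      linarith
    · have : (k : ℝ) / (2 * (d + 1)) ≤ 1 / 2 := by
        rw [div_le_div_iff₀ (by positivity) (by norm_num)]
        linarith
      linarith
  refine ⟨∑ i ∈ Finset.range (d + 1), ∑ k ∈ s, |(Lagrange.basis s v k).coeff i| + 1,
    by positivity, fun P hP i => ?_⟩
  have hdeg : P.degree < s.card := by
    rw [Finset.card_range]
    exact (degree_le_natDegree).trans_lt (by exact_mod_cast Nat.lt_succ_of_le hP)
  have hrep := Lagrange.eq_interpolate hinj hdeg
  obtain ⟨k0, hk0, hmax⟩ := Finset.exists_max_image s (fun k => |P.eval (v k)|)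
    ⟨0, Finset.mem_range.2 (Nat.succ_pos d)⟩
  refine ⟨v k0, hmem k0 hk0, ?_⟩
  by_cases hi : d < i
  · rw [coeff_eq_zero_of_natDegree_lt (hP.trans_lt hi), abs_zero]
    positivity
  have hi' : i ∈ Finset.range (d + 1) := Finset.mem_range.2 (by omega)
  have h1 : P.coeff i = ∑ k ∈ s, P.eval (v k) * (Lagrange.basis s v k).coeff i := by
    conv_lhs => rw [hrep, Lagrange.interpolate_apply]
    simp [coeff_C_mul]
  rw [h1]
  calc _ ≤ ∑ k ∈ s, |P.eval (v k) * (Lagrange.basis s v k).coeff i| :=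
        Finset.abs_sum_le_sum_abs _ _
    _ ≤ ∑ k ∈ s, |(Lagrange.basis s v k).coeff i| * |P.eval (v k0)| := by
        refine Finset.sum_le_sum fun k hk => ?_
        rw [abs_mul, mul_comm]
        exact mul_le_mul_of_nonneg_left (hmax k hk) (abs_nonneg _)
    _ = (∑ k ∈ s, |(Lagrange.basis s v k).coeff i|) * |P.eval (v k0)| := by rw [Finset.sum_mul]
    _ ≤ _ := by
        refine mul_le_mul_of_nonneg_right ?_ (abs_nonneg _)
        have := Finset.single_le_sum (f := fun i => ∑ k ∈ s, |(Lagrange.basis s v k).coeff i|)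
          (fun i _ => by positivity) hi'
        linarith

/-- Away from the real parts of its complex roots a polynomial is comparable to its maximum. -/
lemma exists_root_separation (P : ℝ[X]) : ∃ ρ : Multiset ℝ, ρ.card ≤ P.natDegree ∧
    ∀ κ x y : ℝ, 0 < κ → κ ≤ 1 → |x - y| ≤ 1 → (∀ r ∈ ρ, κ ≤ |x - r|) →
      |P.eval y| * (κ / 2) ^ P.natDegree ≤ |P.eval x| := by
  by_cases hP : P = 0
  · exact ⟨0, by simp, by simp [hP]⟩
  set Q := P.map (algebraMap ℝ ℂ) with hQ
  have hsplit : Q.Splits := IsAlgClosed.splits Q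
  have hQ0 : Q ≠ 0 := (Polynomial.map_ne_zero_iff (algebraMap ℝ ℂ).injective).2 hP
  have hdegQ : Q.natDegree = P.natDegree := natDegree_map _
  have hcard : Q.roots.card = P.natDegree := by
    rw [← hdegQ]; exact hsplit.natDegree_eq_card_roots.symm
  have hev : ∀ x : ℝ, |P.eval x| = ‖Q.leadingCoeff‖ * (Q.roots.map fun r => ‖(x : ℂ) - r‖).prod := by
    intro x
    have h1 : Q.eval (x : ℂ) = ((P.eval x : ℝ) : ℂ) := by
      rw [hQ, eval_map_algebraMap, ← Complex.coe_algebraMap, aeval_algebraMap_apply]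
      simp
    have h2 : Q.eval (x : ℂ) = Q.leadingCoeff * (Q.roots.map fun r => (x : ℂ) - r).prod := by
      conv_lhs => rw [hsplit.eq_prod_roots]
      rw [eval_mul, eval_C, eval_multiset_prod, Multiset.map_map]
      simp
    have h3 : |P.eval x| = ‖Q.eval (x : ℂ)‖ := by rw [h1, Complex.norm_real, Real.norm_eq_abs]
    rw [h3, h2, norm_mul]
    congr 1
    have h4 := map_multiset_prod (normHom : ℂ →*₀ ℝ) (Q.roots.map fun r => (x : ℂ) - r)
    rw [Multiset.map_map] at h4
    exact h4
  refine ⟨Q.roots.map Complex.re, by rw [Multiset.card_map, hcard],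
    fun κ x y hκ hκ1 hxy hr => ?_⟩
  rw [hev, hev, mul_assoc, ← hcard]
  refine mul_le_mul_of_nonneg_left ?_ (norm_nonneg _)
  have hr' : ∀ r ∈ Q.roots, κ ≤ |x - r.re| := fun r h => hr _ (Multiset.mem_map_of_mem _ h)
  have e : (Q.roots.map fun r => ‖(y : ℂ) - r‖).prod * (κ / 2) ^ Q.roots.card
      = (Q.roots.map fun r => ‖(y : ℂ) - r‖ * (κ / 2)).prod := by
    rw [Multiset.prod_map_mul, Multiset.map_const', Multiset.prod_replicate]
  rw [e]
  refine Multiset.prod_map_le_prod_map₀ _ _ (fun r _ => by positivity) fun r hrm => ?_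
  have h1 : κ ≤ ‖(x : ℂ) - r‖ := by
    refine (hr' r hrm).trans ?_
    have := Complex.abs_re_le_norm ((x : ℂ) - r)
    simpa using this
  have h2 : ‖(y : ℂ) - r‖ ≤ 1 + ‖(x : ℂ) - r‖ := by
    have h3 : ‖(y : ℂ) - x‖ ≤ 1 := by
      rw [← Complex.ofReal_sub, Complex.norm_real, Real.norm_eq_abs, abs_sub_comm]
      exact hxy
    calc ‖(y : ℂ) - r‖ = ‖((y : ℂ) - x) + (x - r)‖ := by ring_nf
      _ ≤ _ := (norm_add_le _ _).trans (by linarith)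
  nlinarith [norm_nonneg ((x : ℂ) - r)]

end Poly

open Polynomial

section Phase

/-- The rescaled weight `(e² + t²/4)^{1/2}`. -/
def bet (e t : ℝ) : ℝ := Real.sqrt (e ^ 2 + t ^ 2 / 4)

/-- The larger root of `z² - tz - e² = 0`. -/
def tau (e t : ℝ) : ℝ := t / 2 + bet e t

/-- The smaller root of `z² - tz - e² = 0`. -/
def tau' (e t : ℝ) : ℝ := t / 2 - bet e t

variable {e : ℝ}

lemma bet_sq (t : ℝ) : bet e t ^ 2 = e ^ 2 + t ^ 2 / 4 := Real.sq_sqrt (by positivity)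

lemma bet_pos (he : 0 < e) (t : ℝ) : 0 < bet e t := Real.sqrt_pos.2 (by positivity)

lemma bet_neg (t : ℝ) : bet e (-t) = bet e t := by unfold bet; rw [neg_sq]

lemma hasDerivAt_bet (he : 0 < e) (t : ℝ) : HasDerivAt (bet e) (t / (4 * bet e t)) t := by
  have h0 : HasDerivAt (fun t : ℝ => e ^ 2 + t ^ 2 / 4) (2 * t / 4) t := by
    simpa using ((hasDerivAt_pow 2 t).div_const 4).const_add (e ^ 2)
  have h := h0.sqrt (by positivity)
  refine h.congr_deriv ?_
  have := (bet_pos he t).ne'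
  change 2 * t / 4 / (2 * bet e t) = _
  field_simp

lemma tau_mul_tau' (t : ℝ) : tau e t * tau' e t = -e ^ 2 := by
  unfold tau tau'
  linear_combination -bet_sq (e := e) t

lemma tau_add_tau' (t : ℝ) : tau e t + tau' e t = t := by unfold tau tau'; ring

lemma tau_pos (he : 0 < e) (t : ℝ) : 0 < tau e t := by
  have h1 := bet_sq (e := e) t
  have h2 := bet_pos he t
  have h3 : |t / 2| < bet e t :=
    abs_lt_of_sq_lt_sq (by nlinarith [pow_pos he 2]) h2.le
  unfold tau
  linarith [(abs_lt.1 h3).1]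

lemma hasDerivAt_tau (he : 0 < e) (t : ℝ) :
    HasDerivAt (tau e) (tau e t / (2 * bet e t)) t := by
  refine (((hasDerivAt_id t).div_const 2).add (hasDerivAt_bet he t)).congr_deriv ?_
  have := (bet_pos he t).ne'
  unfold tau
  field_simp
  ring

lemma hasDerivAt_tau' (he : 0 < e) (t : ℝ) :
    HasDerivAt (tau' e) (-tau' e t / (2 * bet e t)) t := by
  refine (((hasDerivAt_id t).div_const 2).sub (hasDerivAt_bet he t)).congr_deriv ?_
  have := (bet_pos he t).ne'
  unfold tau'
  field_simp
  ring

lemma exists_rep_pow (e : ℝ) (n : ℕ) : ∃ a : ℕ → ℝ, ∀ t : ℝ,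
    t ^ n = ∑ m ∈ Finset.range (n + 1), a m * (tau e t ^ m + tau' e t ^ m) := by
  induction n with
  | zero => exact ⟨fun _ => 1 / 2, fun t => by norm_num⟩
  | succ n ih =>
    obtain ⟨a, ha⟩ := ih
    have hstep : ∀ m, ∃ b : ℕ → ℝ, ∀ t : ℝ, m ≤ n → t * (tau e t ^ m + tau' e t ^ m)
        = ∑ k ∈ Finset.range (n + 1 + 1), b k * (tau e t ^ k + tau' e t ^ k) := by
      intro m
      rcases m with _ | m
      · refine ⟨fun k => if k = 1 then 2 else 0, fun t _ => ?_⟩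
        simp only [ite_mul, zero_mul, Finset.sum_ite_eq']
        rw [if_pos (Finset.mem_range.2 (by omega))]
        simp only [pow_zero, pow_one]
        rw [tau_add_tau']; ring
      · refine ⟨fun k => (if k = m + 2 then 1 else 0) + (if k = m then -e ^ 2 else 0),
          fun t hm => ?_⟩
        simp only [add_mul, ite_mul, zero_mul, Finset.sum_add_distrib, Finset.sum_ite_eq']
        rw [if_pos (Finset.mem_range.2 (by omega)), if_pos (Finset.mem_range.2 (by omega)),
          ← tau_mul_tau' (e := e) t]
        nth_rewrite 1 [← tau_add_tau' (e := e) t]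
        ring
    choose b hb using hstep
    refine ⟨fun k => ∑ m ∈ Finset.range (n + 1), a m * b m k, fun t => ?_⟩
    rw [pow_succ', ha t, Finset.mul_sum]
    simp only [Finset.sum_mul]
    rw [Finset.sum_comm]
    refine Finset.sum_congr rfl fun m hm => ?_
    have := hb m t (Nat.lt_succ_iff.1 (Finset.mem_range.1 hm))
    calc t * (a m * (tau e t ^ m + tau' e t ^ m))
        = a m * (t * (tau e t ^ m + tau' e t ^ m)) := by ring
      _ = _ := by
        rw [this, Finset.mul_sum]
        exact Finset.sum_congr rfl fun k _ => by ring

lemma exists_rep (e : ℝ) (n : ℕ) (Q : ℝ[X]) (hQ : Q.natDegree ≤ n) : ∃ a : ℕ → ℝ, ∀ t : ℝ,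
    Q.eval t = ∑ m ∈ Finset.range (n + 1), a m * (tau e t ^ m + tau' e t ^ m) := by
  choose b hb using exists_rep_pow e
  refine ⟨fun m => ∑ k ∈ Finset.range (n + 1), if m ≤ k then Q.coeff k * b k m else 0,
    fun t => ?_⟩
  rw [eval_eq_sum_range' (Nat.lt_succ_of_le hQ)]
  simp only [Finset.sum_mul]
  rw [Finset.sum_comm]
  refine Finset.sum_congr rfl fun k hk => ?_
  rw [hb k t, Finset.mul_sum]
  rw [← Finset.sum_subset (Finset.range_subset_range.2
    (Nat.succ_le_succ (Nat.lt_succ_iff.1 (Finset.mem_range.1 hk))))]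
  · refine Finset.sum_congr rfl fun m hm => ?_
    rw [if_pos (Nat.lt_succ_iff.1 (Finset.mem_range.1 hm))]
    ring
  · intro m _ hm
    rw [if_neg (by simpa using hm), zero_mul]

/-- The derivative of the phase `g Q + β Q'`. -/
def phaseDeriv (e g : ℝ) (Q : ℝ[X]) (t : ℝ) : ℝ :=
  g * Q.derivative.eval t + (t / (4 * bet e t) * Q.derivative.eval t
    + bet e t * Q.derivative.derivative.eval t)

lemma hasDerivAt_phase (he : 0 < e) (g : ℝ) (Q : ℝ[X]) (t : ℝ) :
    HasDerivAt (fun t => g * Q.eval t + bet e t * Q.derivative.eval t) (phaseDeriv e g Q t) t :=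
  ((Q.hasDerivAt t).const_mul g).add ((hasDerivAt_bet he t).mul (Q.derivative.hasDerivAt t))

lemma rep_deriv (he : 0 < e) {n : ℕ} {Q : ℝ[X]} {a : ℕ → ℝ}
    (ha : ∀ t, Q.eval t = ∑ m ∈ Finset.range (n + 1), a m * (tau e t ^ m + tau' e t ^ m)) (t : ℝ) :
    2 * bet e t * Q.derivative.eval t
      = ∑ m ∈ Finset.range (n + 1), a m * (m * (tau e t ^ m - tau' e t ^ m)) := by
  have hb := (bet_pos he t).ne'
  have h1 : HasDerivAt (fun t => ∑ m ∈ Finset.range (n + 1), a m * (tau e t ^ m + tau' e t ^ m))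
      (∑ m ∈ Finset.range (n + 1), a m * (m * tau e t ^ (m - 1) * (tau e t / (2 * bet e t))
        + m * tau' e t ^ (m - 1) * (-tau' e t / (2 * bet e t)))) t :=
    HasDerivAt.fun_sum fun m _ =>
      (((hasDerivAt_tau he t).pow m).add ((hasDerivAt_tau' he t).pow m)).const_mul (a m)
  have h2 := Q.hasDerivAt t
  have h3 : (fun t => Q.eval t) = fun t => ∑ m ∈ Finset.range (n + 1),
    a m * (tau e t ^ m + tau' e t ^ m) := funext ha
  rw [show (fun x => eval x Q) = _ from h3] at h2
  rw [h2.unique h1, Finset.mul_sum]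
  refine Finset.sum_congr rfl fun m _ => ?_
  rcases m with _ | m
  · simp
  · simp only [Nat.add_sub_cancel]
    field_simp
    ring

lemma rep_phaseDeriv (he : 0 < e) (g : ℝ) {n : ℕ} {Q : ℝ[X]} {a : ℕ → ℝ}
    (ha : ∀ t, Q.eval t = ∑ m ∈ Finset.range (n + 1), a m * (tau e t ^ m + tau' e t ^ m)) (t : ℝ) :
    2 * bet e t * phaseDeriv e g Q t
      = ∑ m ∈ Finset.range (n + 1), a m * (m * ((g + m / 2) * tau e t ^ m
        - (g - m / 2) * tau' e t ^ m)) := by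
  have hb := (bet_pos he t).ne'
  have h1 : HasDerivAt (fun t => g * Q.eval t + (1 / 2) * ∑ m ∈ Finset.range (n + 1),
      a m * (m * (tau e t ^ m - tau' e t ^ m)))
      (g * Q.derivative.eval t + (1 / 2) * ∑ m ∈ Finset.range (n + 1),
        a m * (m * (m * tau e t ^ (m - 1) * (tau e t / (2 * bet e t))
        - m * tau' e t ^ (m - 1) * (-tau' e t / (2 * bet e t))))) t :=
    ((Q.hasDerivAt t).const_mul g).add ((HasDerivAt.fun_sum fun m _ =>
      ((((hasDerivAt_tau he t).pow m).sub ((hasDerivAt_tau' he t).pow m)).const_mul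
        (m : ℝ)).const_mul (a m)).const_mul (1 / 2 : ℝ))
  have h2 := hasDerivAt_phase he g Q t
  have h3 : (fun t => g * Q.eval t + bet e t * Q.derivative.eval t) = fun t => g * Q.eval t
      + (1 / 2) * ∑ m ∈ Finset.range (n + 1), a m * (m * (tau e t ^ m - tau' e t ^ m)) := by
    funext t
    rw [← rep_deriv he ha t]
    ring
  rw [h3] at h2
  rw [h2.unique h1, mul_add, ← mul_assoc _ g, mul_comm _ g, mul_assoc g, rep_deriv he ha t,
    Finset.mul_sum, Finset.mul_sum, Finset.mul_sum, ← Finset.sum_add_distrib]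
  refine Finset.sum_congr rfl fun m _ => ?_
  rcases m with _ | m
  · simp
  · simp only [Nat.add_sub_cancel]
    field_simp
    ring

/-- The Laurent polynomial of the phase derivative, cleared of denominators. -/
def phasePoly (e g : ℝ) (n : ℕ) (a : ℕ → ℝ) : ℝ[X] :=
  ∑ m ∈ Finset.range (n + 1), (C (a m * (m * (g + m / 2))) * X ^ (n + m)
    - C (a m * (m * (g - m / 2)) * (-e ^ 2) ^ m) * X ^ (n - m))

lemma phasePoly_eval (he : 0 < e) (g : ℝ) {n : ℕ} {Q : ℝ[X]} {a : ℕ → ℝ}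
    (ha : ∀ t, Q.eval t = ∑ m ∈ Finset.range (n + 1), a m * (tau e t ^ m + tau' e t ^ m)) (t : ℝ) :
    (phasePoly e g n a).eval (tau e t) = tau e t ^ n * (2 * bet e t * phaseDeriv e g Q t) := by
  rw [rep_phaseDeriv he g ha, phasePoly, eval_finsetSum, Finset.mul_sum]
  refine Finset.sum_congr rfl fun m hm => ?_
  have hm' : m ≤ n := Nat.lt_succ_iff.1 (Finset.mem_range.1 hm)
  simp only [eval_sub, eval_mul, eval_C, eval_pow, eval_X]
  have h1 : tau e t ^ n = tau e t ^ (n - m) * tau e t ^ m := by rw [← pow_add]; congr 1; omega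
  have h2 : (-e ^ 2) ^ m = tau e t ^ m * tau' e t ^ m := by rw [← tau_mul_tau' t, mul_pow]
  rw [h2, pow_add, h1]
  ring

lemma phasePoly_natDegree (g : ℝ) (n : ℕ) (a : ℕ → ℝ) :
    (phasePoly e g n a).natDegree ≤ 2 * n := by
  unfold phasePoly
  refine natDegree_sum_le_of_forall_le (s := Finset.range (n + 1)) (n := 2 * n)
    (fun m => (C (a m * (m * (g + m / 2))) * X ^ (n + m)
      - C (a m * (m * (g - m / 2)) * (-e ^ 2) ^ m) * X ^ (n - m) : ℝ[X])) (fun m hm => ?_)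
  have hm' : m ≤ n := Nat.lt_succ_iff.1 (Finset.mem_range.1 hm)
  have h : ∀ (c : ℝ) (k : ℕ), k ≤ 2 * n → (C c * X ^ k : ℝ[X]).natDegree ≤ 2 * n :=
    fun c k hk => (natDegree_C_mul_X_pow_le c k).trans hk
  exact (natDegree_sub_le _ _).trans (max_le (h (a m * (m * (g + m / 2))) (n + m) (by omega))
    (h (a m * (m * (g - m / 2)) * (-e ^ 2) ^ m) (n - m) (by omega)))

lemma phasePoly_coeff (g : ℝ) (n : ℕ) (a : ℕ → ℝ) {k : ℕ} (hk : 1 ≤ k) (hkn : k ≤ n) :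
    (phasePoly e g n a).coeff (n + k) = a k * (k * (g + k / 2)) := by
  simp only [phasePoly, finsetSum_coeff, coeff_sub, coeff_C_mul_X_pow]
  rw [Finset.sum_eq_single k]
  · rw [if_pos rfl, if_neg (by omega), sub_zero]
  · intro m _ hmk
    rw [if_neg (by omega), if_neg (by omega), sub_zero]
  · intro h
    exact absurd (Finset.mem_range.2 (by omega)) h

lemma half_le_bet {t : ℝ} (he : 0 < e) (he1 : e ≤ 1) (ht : 1 - e ^ 2 ≤ t) : 1 / 2 ≤ bet e t := by
  unfold bet
  refine Real.le_sqrt_of_sq_le ?_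
  have h1 : 0 ≤ 1 - e ^ 2 := by nlinarith
  nlinarith [mul_self_le_mul_self h1 ht, sq_nonneg (1 - e ^ 2)]

lemma bet_le {t : ℝ} (he : 0 < e) (he1 : e ≤ 1) (ht : |t| ≤ 2) : bet e t ≤ 3 / 2 := by
  unfold bet
  refine Real.sqrt_le_iff.2 ⟨by norm_num, ?_⟩
  have := sq_abs t
  nlinarith [abs_nonneg t]

lemma window_bounds {t : ℝ} (he : 0 < e) (he1 : e ≤ 1) (h1 : 1 - e ^ 2 ≤ t)
    (h2 : t ≤ 2 - e ^ 2 / 2) : 0 ≤ t ∧ t ≤ 2 ∧ 1 ≤ tau e t ∧ tau e t ≤ 2 := by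
  have h3 : 0 ≤ 1 - e ^ 2 := by nlinarith
  refine ⟨h3.trans h1, by nlinarith, ?_, ?_⟩
  · have : 1 - t / 2 ≤ bet e t := by
      refine Real.le_sqrt_of_sq_le ?_
      nlinarith
    unfold tau; linarith
  · have : bet e t ≤ 2 - t / 2 := by
      refine Real.sqrt_le_iff.2 ⟨by nlinarith, ?_⟩
      nlinarith
    unfold tau; linarith

lemma exists_phaseDeriv_lower (n : ℕ) : ∃ C : ℝ, 0 < C ∧ ∀ (Q : ℝ[X]), Q.natDegree ≤ n →
    ∀ e g : ℝ, 0 < e → e ≤ 1 → 1 / 2 ≤ g → ∃ ρ : Multiset ℝ, ρ.card ≤ 2 * n ∧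
    ∀ κ t : ℝ, 0 < κ → κ ≤ 1 → 1 - e ^ 2 ≤ t → t ≤ 2 - e ^ 2 / 2 →
      (∀ r ∈ ρ, κ ≤ |tau e t - r|) → ∀ i, |Q.derivative.coeff i| * κ ^ (2 * n)
        ≤ C * |phaseDeriv e g Q t| := by
  obtain ⟨C1, hC1, h1⟩ := exists_coeff_bound (2 * n)
  obtain ⟨C2, hC2, h2⟩ := exists_coeff_bound n
  refine ⟨C2 * ((∑ m ∈ Finset.range (n + 1), (m : ℝ) * (2 ^ m + 1)) + 1) *
    (C1 * (2 ^ (2 * n) * (2 ^ n * 3))), by positivity, fun Q hQ e g he he1 hg => ?_⟩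
  obtain ⟨a, ha⟩ := exists_rep e n Q hQ
  set U := phasePoly e g n a with hU
  have hdeg : U.natDegree ≤ 2 * n := phasePoly_natDegree g n a
  obtain ⟨ρ, hρ, hsep⟩ := exists_root_separation U
  refine ⟨ρ, hρ.trans hdeg, fun κ t hκ hκ1 ht1 ht2 hr i => ?_⟩
  obtain ⟨ht0, ht2', hτ1, hτ2⟩ := window_bounds he he1 ht1 ht2
  have hk0 : 0 < κ ^ (2 * n) := by positivity
  have hUt : |U.eval (tau e t)| ≤ 2 ^ n * 3 * |phaseDeriv e g Q t| := by
    rw [hU, phasePoly_eval he g ha, abs_mul, abs_mul, abs_of_nonneg (pow_nonneg (by linarith) n),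
      abs_of_nonneg (by have := bet_pos he t; positivity), ← mul_assoc]
    refine mul_le_mul_of_nonneg_right ?_ (abs_nonneg _)
    refine mul_le_mul (pow_le_pow_left₀ (by linarith) hτ2 n) ?_
      (by have := bet_pos he t; positivity) (by positivity)
    have := bet_le he he1 (t := t) (by rw [abs_of_nonneg ht0]; exact ht2')
    linarith
  have hak : ∀ m ∈ Finset.range (n + 1), 1 ≤ m → |a m| * κ ^ (2 * n)
      ≤ C1 * (2 ^ (2 * n) * (2 ^ n * 3)) * |phaseDeriv e g Q t| := by
    intro m hm hm1
    have hmn : m ≤ n := Nat.lt_succ_iff.1 (Finset.mem_range.1 hm)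
    obtain ⟨y, hy, hyb⟩ := h1 U hdeg (n + m)
    rw [hU, phasePoly_coeff g n a hm1 hmn, ← hU] at hyb
    have hm1' : (1 : ℝ) ≤ m := by exact_mod_cast hm1
    have h3 : |a m| ≤ |a m * (m * (g + m / 2))| := by
      rw [abs_mul]
      refine le_mul_of_one_le_right (abs_nonneg _) ?_
      rw [abs_of_nonneg (by positivity)]
      nlinarith
    have h4 := hsep κ (tau e t) y hκ hκ1 (by rw [abs_le]; constructor <;> linarith [hy.1, hy.2]) hr
    have h5 : (κ / 2) ^ (2 * n) ≤ (κ / 2) ^ U.natDegree :=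
      pow_le_pow_of_le_one (by positivity) (by linarith) hdeg
    have h6 : |U.eval y| * κ ^ (2 * n) ≤ 2 ^ (2 * n) * |U.eval (tau e t)| := by
      have h7 := (mul_le_mul_of_nonneg_left h5 (abs_nonneg (U.eval y))).trans h4
      rw [div_pow, mul_div_assoc', div_le_iff₀ (by positivity)] at h7
      linarith
    calc |a m| * κ ^ (2 * n) ≤ C1 * |U.eval y| * κ ^ (2 * n) :=
          mul_le_mul_of_nonneg_right (h3.trans hyb) hk0.le
      _ = C1 * (|U.eval y| * κ ^ (2 * n)) := by ring
      _ ≤ C1 * (2 ^ (2 * n) * (2 ^ n * 3 * |phaseDeriv e g Q t|)) := by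
          refine mul_le_mul_of_nonneg_left (h6.trans ?_) hC1.le
          exact mul_le_mul_of_nonneg_left hUt (by positivity)
      _ = _ := by ring
  obtain ⟨x, hx, hxb⟩ := h2 Q.derivative
    ((natDegree_derivative_le Q).trans ((Nat.sub_le _ _).trans hQ)) i
  have hbx : 1 / 2 ≤ bet e x := half_le_bet he he1 (by nlinarith [hx.1, pow_pos he 2])
  have hτx1 := tau_pos he x
  have hτx2 : tau e x ≤ 2 := by
    have : bet e x ≤ 2 - x / 2 := by
      refine Real.sqrt_le_iff.2 ⟨by linarith [hx.2], ?_⟩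
      nlinarith [hx.1, hx.2]
    unfold tau; linarith
  have hτ'x : |tau' e x| ≤ 1 := by
    have h3 := tau_mul_tau' (e := e) x
    have h4 : 1 ≤ tau e x := by unfold tau; linarith [hx.1]
    rw [abs_le]
    have h5 : tau' e x = -e ^ 2 / tau e x := by
      rw [eq_div_iff hτx1.ne', mul_comm]; exact h3
    rw [h5]
    constructor
    · rw [le_div_iff₀ hτx1]; nlinarith
    · rw [div_le_iff₀ hτx1]; nlinarith [sq_nonneg e]
  have hQx : |Q.derivative.eval x| * κ ^ (2 * n)
      ≤ (∑ m ∈ Finset.range (n + 1), (m : ℝ) * (2 ^ m + 1)) *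
        (C1 * (2 ^ (2 * n) * (2 ^ n * 3)) * |phaseDeriv e g Q t|) := by
    have h3 : |Q.derivative.eval x| ≤ |2 * bet e x * Q.derivative.eval x| := by
      rw [abs_mul]
      refine le_mul_of_one_le_left (abs_nonneg _) ?_
      rw [abs_of_nonneg (by linarith)]; linarith
    rw [rep_deriv he ha] at h3
    calc _ ≤ (∑ m ∈ Finset.range (n + 1), |a m * (m * (tau e x ^ m - tau' e x ^ m))|) *
          κ ^ (2 * n) :=
          mul_le_mul_of_nonneg_right (h3.trans (Finset.abs_sum_le_sum_abs _ _)) hk0.le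
      _ ≤ _ := by
        rw [Finset.sum_mul, Finset.sum_mul]
        refine Finset.sum_le_sum fun m hm => ?_
        rcases Nat.eq_zero_or_pos m with h0 | hpos
        · simp [h0]
        have h4 := hak m hm hpos
        have h5 : |tau e x ^ m - tau' e x ^ m| ≤ 2 ^ m + 1 := by
          refine (abs_sub _ _).trans (add_le_add ?_ ?_)
          · rw [abs_pow, abs_of_pos hτx1]
            exact pow_le_pow_left₀ hτx1.le hτx2 m
          · rw [abs_pow]; exact pow_le_one₀ (abs_nonneg _) hτ'x
        rw [abs_mul, abs_mul, Nat.abs_cast]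
        calc _ = ((m : ℝ) * |tau e x ^ m - tau' e x ^ m|) * (|a m| * κ ^ (2 * n)) := by ring
          _ ≤ _ := mul_le_mul (mul_le_mul_of_nonneg_left h5 m.cast_nonneg) h4 (by positivity)
            (by positivity)
  calc _ ≤ C2 * |Q.derivative.eval x| * κ ^ (2 * n) := mul_le_mul_of_nonneg_right hxb hk0.le
    _ = C2 * (|Q.derivative.eval x| * κ ^ (2 * n)) := by ring
    _ ≤ C2 * ((∑ m ∈ Finset.range (n + 1), (m : ℝ) * (2 ^ m + 1) + 1) *
        (C1 * (2 ^ (2 * n) * (2 ^ n * 3)) * |phaseDeriv e g Q t|)) := by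
      refine mul_le_mul_of_nonneg_left (hQx.trans ?_) hC2.le
      refine mul_le_mul_of_nonneg_right (by linarith) (by positivity)
    _ = _ := by ring

end Phase

section VanDerCorput

/-- The `ℓ¹` norm of the first `n` coefficients. -/
def coeffSum (n : ℕ) (P : ℝ[X]) : ℝ := ∑ k ∈ Finset.range n, |P.coeff k|

lemma coeffSum_nonneg (n : ℕ) (P : ℝ[X]) : 0 ≤ coeffSum n P :=
  Finset.sum_nonneg fun _ _ => abs_nonneg _

lemma abs_coeff_le_coeffSum {n : ℕ} {P : ℝ[X]} {k : ℕ} (hk : k < n) :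
    |P.coeff k| ≤ coeffSum n P :=
  Finset.single_le_sum (f := fun k => |P.coeff k|) (fun _ _ => abs_nonneg _)
    (Finset.mem_range.2 hk)

lemma abs_eval_le_coeffSum {n : ℕ} {P : ℝ[X]} (hP : P.natDegree < n) {t : ℝ} (ht : |t| ≤ 2) :
    |P.eval t| ≤ 2 ^ n * coeffSum n P := by
  rw [eval_eq_sum_range' hP, coeffSum, Finset.mul_sum]
  refine (Finset.abs_sum_le_sum_abs _ _).trans (Finset.sum_le_sum fun k hk => ?_)
  rw [abs_mul, abs_pow, mul_comm]
  refine mul_le_mul_of_nonneg_right ?_ (abs_nonneg _)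
  exact (pow_le_pow_left₀ (abs_nonneg _) ht k).trans
    (pow_le_pow_right₀ (by norm_num) (Finset.mem_range.1 hk).le)

lemma coeffSum_derivative_le {n : ℕ} {P : ℝ[X]} (hP : P.natDegree < n) :
    coeffSum n P.derivative ≤ n ^ 2 * coeffSum n P := by
  calc coeffSum n P.derivative ≤ ∑ _k ∈ Finset.range n, n * coeffSum n P := by
        refine Finset.sum_le_sum fun k hk => ?_
        have hk' := Finset.mem_range.1 hk
        rw [coeff_derivative, abs_mul, mul_comm]
        rcases lt_or_ge (k + 1) n with h | h
        · refine mul_le_mul ?_ (abs_coeff_le_coeffSum h) (abs_nonneg _) n.cast_nonneg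
          rw [abs_of_nonneg (by positivity)]
          exact_mod_cast hk'
        · rw [coeff_eq_zero_of_natDegree_lt (hP.trans_le h), abs_zero, mul_zero]
          exact mul_nonneg n.cast_nonneg (coeffSum_nonneg n P)
    _ = _ := by rw [Finset.sum_const, Finset.card_range, nsmul_eq_mul]; ring

variable {e : ℝ}

/-- The derivative of `phaseDeriv`. -/
def phaseDeriv2 (e g : ℝ) (Q : ℝ[X]) (t : ℝ) : ℝ :=
  g * Q.derivative.derivative.eval t + (e ^ 2 / (4 * bet e t ^ 3) * Q.derivative.eval t
    + 2 * (t / (4 * bet e t)) * Q.derivative.derivative.eval t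
    + bet e t * Q.derivative.derivative.derivative.eval t)

lemma hasDerivAt_phaseDeriv (he : 0 < e) (g : ℝ) (Q : ℝ[X]) (t : ℝ) :
    HasDerivAt (phaseDeriv e g Q) (phaseDeriv2 e g Q t) t := by
  have hb := (bet_pos he t).ne'
  have h1 : HasDerivAt (fun t => t / (4 * bet e t)) (e ^ 2 / (4 * bet e t ^ 3)) t := by
    refine ((hasDerivAt_id t).div ((hasDerivAt_bet he t).const_mul 4)
      (by simpa using hb)).congr_deriv ?_
    have h2 : e ^ 2 = bet e t ^ 2 - t ^ 2 / 4 := by rw [bet_sq]; ring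
    rw [h2]
    simp only [id]
    field_simp
  refine ((((Q.derivative).hasDerivAt t).const_mul g).add ((h1.mul (Q.derivative.hasDerivAt t)).add
    ((hasDerivAt_bet he t).mul (Q.derivative.derivative.hasDerivAt t)))).congr_deriv ?_
  unfold phaseDeriv2
  ring

lemma continuous_bet : Continuous (bet e) := by unfold bet; fun_prop

lemma continuous_phaseDeriv2 (he : 0 < e) (g : ℝ) (Q : ℝ[X]) : Continuous (phaseDeriv2 e g Q) := by
  unfold phaseDeriv2
  have h := continuous_bet (e := e)
  have h1 := Q.derivative.continuous
  have h2 := Q.derivative.derivative.continuous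
  have h3 := Q.derivative.derivative.derivative.continuous
  have hb := fun t => (bet_pos he t).ne'
  have h4 : Continuous fun t => e ^ 2 / (4 * bet e t ^ 3) :=
    continuous_const.div (by fun_prop) fun t => by have := hb t; positivity
  have h5 : Continuous fun t => t / (4 * bet e t) :=
    continuous_id.div (by fun_prop) fun t => by have := hb t; positivity
  fun_prop

lemma abs_phaseDeriv2_le {n : ℕ} {Γ g : ℝ} {Q : ℝ[X]} (hn : 1 ≤ n) (hQ : Q.natDegree ≤ n)
    (he : 0 < e) (he1 : e ≤ 1) (hg : 1 / 2 ≤ g) (hgΓ : g ≤ Γ) {t : ℝ} (h1 : 1 - e ^ 2 ≤ t)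
    (h2 : t ≤ 2 - e ^ 2 / 2) :
    |phaseDeriv2 e g Q t| ≤ (Γ + 8) * 2 ^ n * n ^ 4 * coeffSum n Q.derivative := by
  obtain ⟨ht0, ht2, -, -⟩ := window_bounds he he1 h1 h2
  have ht : |t| ≤ 2 := by rwa [abs_of_nonneg ht0]
  have hb1 := half_le_bet he he1 h1
  have hb2 := bet_le he he1 ht
  have hd1 : Q.derivative.natDegree < n := (natDegree_derivative_le Q).trans_lt (by omega)
  have hd2 : Q.derivative.derivative.natDegree < n :=
    (natDegree_derivative_le _).trans_lt (by omega)
  have hd3 : Q.derivative.derivative.derivative.natDegree < n :=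
    (natDegree_derivative_le _).trans_lt (by omega)
  have e1 := abs_eval_le_coeffSum hd1 ht
  have e2 := abs_eval_le_coeffSum hd2 ht
  have e3 := abs_eval_le_coeffSum hd3 ht
  have c2 := coeffSum_derivative_le hd1
  have c3 := coeffSum_derivative_le hd2
  set D := coeffSum n Q.derivative
  have hD : 0 ≤ D := coeffSum_nonneg _ _
  have hn1 : (1 : ℝ) ≤ n := by exact_mod_cast hn
  have hn2 : (1 : ℝ) ≤ (n : ℝ) ^ 2 := one_le_pow₀ hn1
  set E := (2 : ℝ) ^ n * n ^ 4 * D with hE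
  have hE0 : 0 ≤ E := by positivity
  have f1 : |Q.derivative.eval t| ≤ E := by
    refine e1.trans ?_
    rw [hE, mul_assoc]
    refine mul_le_mul_of_nonneg_left (le_mul_of_one_le_left hD (one_le_pow₀ hn1)) (by positivity)
  have f2 : |Q.derivative.derivative.eval t| ≤ E := by
    refine e2.trans ?_
    rw [hE, mul_assoc]
    refine mul_le_mul_of_nonneg_left (c2.trans ?_) (by positivity)
    exact mul_le_mul_of_nonneg_right (pow_le_pow_right₀ hn1 (by norm_num)) hD
  have f3 : |Q.derivative.derivative.derivative.eval t| ≤ E := by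
    refine e3.trans ?_
    rw [hE, mul_assoc]
    refine mul_le_mul_of_nonneg_left (c3.trans ?_) (by positivity)
    calc (n : ℝ) ^ 2 * coeffSum n Q.derivative.derivative ≤ n ^ 2 * (n ^ 2 * D) :=
          mul_le_mul_of_nonneg_left c2 (by positivity)
      _ = _ := by ring
  have g1 : |e ^ 2 / (4 * bet e t ^ 3)| ≤ 2 := by
    rw [abs_of_nonneg (by positivity), div_le_iff₀ (by positivity)]
    have : (1 / 2 : ℝ) ^ 3 ≤ bet e t ^ 3 := pow_le_pow_left₀ (by norm_num) hb1 3
    nlinarith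
  have g2 : |2 * (t / (4 * bet e t))| ≤ 2 := by
    rw [abs_of_nonneg (by positivity), mul_div_assoc', div_le_iff₀ (by positivity)]
    nlinarith
  have g3 : |bet e t| ≤ 3 / 2 := by rwa [abs_of_nonneg (by linarith)]
  have g0 : |g| ≤ Γ := by rwa [abs_of_nonneg (by linarith)]
  have hΓ0 : 0 ≤ Γ := by linarith
  unfold phaseDeriv2
  calc _ ≤ |g| * |Q.derivative.derivative.eval t| + (|e ^ 2 / (4 * bet e t ^ 3)| *
        |Q.derivative.eval t| + |2 * (t / (4 * bet e t))| * |Q.derivative.derivative.eval t|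
        + |bet e t| * |Q.derivative.derivative.derivative.eval t|) := by
        simp only [← abs_mul]
        exact (abs_add_le _ _).trans (add_le_add le_rfl ((abs_add_le _ _).trans
          (add_le_add (abs_add_le _ _) le_rfl)))
    _ ≤ Γ * E + (2 * E + 2 * E + 3 / 2 * E) := by
        gcongr
    _ ≤ (Γ + 8) * E := by nlinarith
    _ = _ := by rw [hE]; ring

lemma abs_div_sq_add_le {x B : ℝ} (hB : 0 < B) : |x / (x ^ 2 + B ^ 2)| ≤ 1 / B := by
  have h : 0 < x ^ 2 + B ^ 2 := by positivity
  rw [abs_div, abs_of_pos h, div_le_div_iff₀ h hB]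
  have := sq_abs x
  nlinarith [sq_nonneg (|x| - B), abs_nonneg x]

lemma abs_sub_div_sq_add_le {x B : ℝ} (hB : 0 < B) :
    |(B ^ 2 - x ^ 2) / (x ^ 2 + B ^ 2) ^ 2| ≤ 1 / B ^ 2 := by
  have h : 0 < x ^ 2 + B ^ 2 := by positivity
  have h2 : |B ^ 2 - x ^ 2| ≤ x ^ 2 + B ^ 2 := by
    rw [abs_le]; constructor <;> nlinarith [sq_nonneg x, sq_nonneg B]
  rw [abs_div, abs_of_pos (pow_pos h 2)]
  calc |B ^ 2 - x ^ 2| / (x ^ 2 + B ^ 2) ^ 2 ≤ (x ^ 2 + B ^ 2) / (x ^ 2 + B ^ 2) ^ 2 := by gcongr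
    _ = 1 / (x ^ 2 + B ^ 2) := by field_simp
    _ ≤ 1 / B ^ 2 := by gcongr; nlinarith [sq_nonneg x]

lemma volume_tau_near_le (he : 0 < e) (he1 : e ≤ 1) {a b κ : ℝ} (ha : 1 - e ^ 2 ≤ a)
    (hb : b ≤ 2 - e ^ 2 / 2) (r : ℝ) :
    volume {t ∈ Set.Icc a b | |tau e t - r| < κ} ≤ ENNReal.ofReal (4 * κ) := by
  refine (Real.volume_le_diam _).trans ?_
  refine Metric.ediam_le fun x hx y hy => ?_
  rw [edist_dist]
  refine ENNReal.ofReal_le_ofReal ?_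
  have hmono : ∀ x y, x ∈ Set.Icc a b → y ∈ Set.Icc a b → x ≤ y →
      (1 / 2) * (y - x) ≤ tau e y - tau e x := by
    intro x y _ _ hxy
    have hbm : bet e x ≤ bet e y := by
      obtain ⟨h0, -, -, -⟩ := window_bounds he he1 (t := x) (by grind) (by grind)
      unfold bet
      gcongr
    unfold tau
    linarith
  rw [Real.dist_eq]
  have hx2 := abs_lt.1 hx.2
  have hy2 := abs_lt.1 hy.2
  rcases le_total x y with h | h
  · rw [abs_of_nonpos (by linarith)]
    linarith [hmono x y hx.1 hy.1 h]
  · rw [abs_of_nonneg (by linarith)]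
    linarith [hmono y x hy.1 hx.1 h]

set_option maxHeartbeats 1000000 in
/-- A van der Corput estimate for the phase `g Q + β Q'`, uniform over polynomials `Q`. -/
lemma exists_vanDerCorput (n : ℕ) (hn : 1 ≤ n) (Γ : ℝ) (hΓ : 1 / 2 < Γ) :
    ∃ C : ℝ, 0 < C ∧ ∀ Q : ℝ[X], Q.natDegree ≤ n → ∀ e g δ : ℝ, 0 < e → e ≤ 1 → 1 / 2 ≤ g →
    g ≤ Γ → ∀ a b : ℝ, a ≤ b → 1 - e ^ 2 ≤ a → b ≤ 2 - e ^ 2 / 2 → ∀ (A A1 : ℝ → ℝ) (A0 : ℝ),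
    (∀ t, HasDerivAt A (A1 t) t) → Continuous A1 → (∀ t ∈ Set.Icc a b, |A t| ≤ A0) →
    (∀ t ∈ Set.Icc a b, |A1 t| ≤ A0) →
    ‖∫ t in a..b, Complex.exp (Complex.I * ((δ * (g * Q.eval t + bet e t * Q.derivative.eval t) : ℝ)
      : ℂ)) * ((A t : ℝ) : ℂ)‖ ≤ C * A0 * (1 + |δ| * coeffSum n Q.derivative) ^ (-(1 / (16 * n) : ℝ)) := by
  obtain ⟨C1, hC1, hlow⟩ := exists_phaseDeriv_lower n
  set C2 := (Γ + 8) * 2 ^ n * (n : ℝ) ^ 4 with hC2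
  have hC2p : 0 ≤ C2 := by positivity
  refine ⟨2 * (8 * n + 2 * (n * C1 + 1) ^ 2 + 2 + 2 * (C2 + 1) + 2), by positivity,
    fun Q hQ e g δ he he1 hg hgΓ a b hab ha hb A A1 A0 hA hA1c hA0 hA10 => ?_⟩
  have hA00 : 0 ≤ A0 := (abs_nonneg _).trans (hA0 a ⟨le_rfl, hab⟩)
  have hn1 : (1 : ℝ) ≤ n := by exact_mod_cast hn
  have hba : b - a ≤ 2 := by nlinarith
  set D := coeffSum n Q.derivative with hD
  have hD0 : 0 ≤ D := coeffSum_nonneg _ _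
  set M := |δ| * D with hM
  have hM0 : 0 ≤ M := by positivity
  set η : ℝ := 1 / (16 * n) with hη
  have hη0 : 0 < η := by positivity
  have hη1 : η ≤ 1 / 16 := by
    rw [hη]; gcongr; linarith
  have hp2 : (2 : ℝ) ^ η ≤ 2 := by
    calc (2 : ℝ) ^ η ≤ 2 ^ (1 : ℝ) := Real.rpow_le_rpow_of_exponent_le (by norm_num) (by linarith)
      _ = 2 := Real.rpow_one 2
  set CC : ℝ := 8 * n + 2 * (n * C1 + 1) ^ 2 + 2 + 2 * (C2 + 1) + 2 with hCC
  have hCC2 : 2 ≤ CC := by rw [hCC]; linarith [sq_nonneg (n * C1 + 1)]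
  rcases le_total M 1 with hM1 | hM1
  · have h1 : ‖∫ t in a..b, Complex.exp (Complex.I * ((δ * (g * Q.eval t
        + bet e t * Q.derivative.eval t) : ℝ) : ℂ)) * ((A t : ℝ) : ℂ)‖ ≤ A0 * |b - a| := by
      refine intervalIntegral.norm_integral_le_of_norm_le_const fun t ht => ?_
      rw [Set.uIoc_of_le hab] at ht
      rw [norm_mul, mul_comm Complex.I, Complex.norm_exp_ofReal_mul_I, one_mul, Complex.norm_real]
      exact hA0 t ⟨ht.1.le, ht.2⟩
    have h2 : (1 / 2 : ℝ) ≤ (1 + M) ^ (-η) := by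
      rw [Real.rpow_neg (by linarith), one_div]
      refine inv_anti₀ (Real.rpow_pos_of_pos (by linarith) _) ?_
      exact (Real.rpow_le_rpow (by linarith) (by linarith) hη0.le).trans hp2
    refine h1.trans ?_
    rw [abs_of_nonneg (by linarith)]
    calc A0 * (b - a) ≤ A0 * 2 := by gcongr
      _ ≤ A0 * (2 * CC * (1 / 2)) := by gcongr; linarith
      _ ≤ A0 * (2 * CC * (1 + M) ^ (-η)) := by gcongr
      _ = _ := by ring
  have hMp : 0 < M := by linarith
  have hMη : M ^ (-η) ≤ 2 * (1 + M) ^ (-η) := by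
    rw [Real.rpow_neg hM0, Real.rpow_neg (by linarith), ← div_eq_mul_inv,
      le_div_iff₀ (by positivity), inv_mul_le_iff₀ (by positivity)]
    calc (1 + M) ^ η ≤ (2 * M) ^ η := by gcongr; linarith
      _ = 2 ^ η * M ^ η := Real.mul_rpow (by norm_num) hM0
      _ ≤ 2 * M ^ η := by gcongr
      _ = _ := by ring
  set κ := M ^ (-η) with hκ
  have hκ0 : 0 < κ := Real.rpow_pos_of_pos hMp _
  have hκ1 : κ ≤ 1 := Real.rpow_le_one_of_one_le_of_nonpos hM1 (by linarith)
  have hκn : M ^ (7 / 8 : ℝ) = M * κ ^ (2 * n) := by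
    rw [hκ, ← Real.rpow_natCast, ← Real.rpow_mul hM0]
    nth_rewrite 2 [← Real.rpow_one M]
    rw [← Real.rpow_add hMp]
    congr 1
    rw [hη]; push_cast; field_simp; norm_num
  set θ := M ^ (3 / 4 : ℝ) with hθ
  have hθ0 : 0 < θ := Real.rpow_pos_of_pos hMp _
  have hθκ : 1 / θ ≤ κ := by
    rw [hθ, hκ, one_div, ← Real.rpow_neg hM0]
    exact Real.rpow_le_rpow_of_exponent_le hM1 (by linarith)
  have hMθ : M * (1 / θ ^ 2) ≤ κ := by
    have : θ ^ 2 = M ^ (3 / 2 : ℝ) := by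
      rw [hθ, ← Real.rpow_natCast, ← Real.rpow_mul hM0]; norm_num
    rw [this, one_div, ← Real.rpow_neg hM0]
    nth_rewrite 1 [← Real.rpow_one M]
    rw [← Real.rpow_add hMp, hκ]
    exact Real.rpow_le_rpow_of_exponent_le hM1 (by linarith)
  have hθ78 : θ ^ 2 ≤ κ * (M ^ (7 / 8 : ℝ)) ^ 2 := by
    rw [hθ, hκ, ← Real.rpow_natCast, ← Real.rpow_mul hM0, ← Real.rpow_natCast, ← Real.rpow_mul hM0,
      ← Real.rpow_add hMp]
    refine Real.rpow_le_rpow_of_exponent_le hM1 ?_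
    push_cast; linarith
  obtain ⟨ρ, hρ, hsep⟩ := hlow Q hQ e g he he1 hg
  set f : ℝ → ℝ := fun t => δ * (g * Q.eval t + bet e t * Q.derivative.eval t) with hf
  set f1 : ℝ → ℝ := fun t => δ * phaseDeriv e g Q t with hf1
  have hfd : ∀ t, HasDerivAt f (f1 t) t := fun t => (hasDerivAt_phase he g Q t).const_mul δ
  have hf1d : ∀ t, HasDerivAt f1 (δ * phaseDeriv2 e g Q t) t := fun t =>
    (hasDerivAt_phaseDeriv he g Q t).const_mul δ
  have hf1c : Continuous f1 := continuous_iff_continuousAt.2 fun t => (hf1d t).continuousAt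
  have hAc : Continuous A := continuous_iff_continuousAt.2 fun t => (hA t).continuousAt
  have hpos : ∀ t, 0 < f1 t ^ 2 + θ ^ 2 := fun t => by positivity
  set P1 : ℝ → ℝ := fun t => δ * phaseDeriv2 e g Q t * ((θ ^ 2 - f1 t ^ 2) / (f1 t ^ 2 + θ ^ 2) ^ 2)
    * A t + f1 t / (f1 t ^ 2 + θ ^ 2) * A1 t with hP1
  have hP1d : ∀ t, HasDerivAt (fun t => f1 t / (f1 t ^ 2 + θ ^ 2) * A t) (P1 t) t := fun t => by
    have hd : HasDerivAt (fun t => f1 t / (f1 t ^ 2 + θ ^ 2)) _ t :=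
      (hf1d t).div (((hf1d t).pow 2).add_const (θ ^ 2)) (hpos t).ne'
    refine (hd.mul (hA t)).congr_deriv ?_
    have := (hpos t).ne'
    rw [hP1]
    field_simp
    ring
  have hP1c : Continuous P1 := by
    have h2 := continuous_phaseDeriv2 he g Q
    have h3 : Continuous fun t => (θ ^ 2 - f1 t ^ 2) / (f1 t ^ 2 + θ ^ 2) ^ 2 :=
      (by fun_prop : Continuous fun t => θ ^ 2 - f1 t ^ 2).div (by fun_prop)
        fun t => (pow_pos (hpos t) 2).ne'
    have h4 : Continuous fun t => f1 t / (f1 t ^ 2 + θ ^ 2) :=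
      hf1c.div (by fun_prop) fun t => (hpos t).ne'
    fun_prop
  have key := norm_integral_exp_mul_le hab (f := f) (f1 := f1) (A := A) (B := fun _ => θ ^ 2)
    (s := ∅) Set.countable_empty hfd hf1c hAc.continuousOn continuous_const
    (fun _ => by positivity) (fun t _ => hP1d t) (hP1c.intervalIntegrable a b)
  have hbdry : ∀ t ∈ Set.Icc a b, |f1 t / (f1 t ^ 2 + θ ^ 2) * A t| ≤ κ * A0 := fun t ht => by
    rw [abs_mul]
    exact mul_le_mul ((abs_div_sq_add_le hθ0).trans hθκ) (hA0 t ht) (abs_nonneg _) hκ0.le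
  have hP1b : ∫ t in a..b, |P1 t| ≤ 2 * ((C2 + 1) * κ * A0) := by
    calc _ ≤ ∫ _t in a..b, (C2 + 1) * κ * A0 := by
          refine intervalIntegral.integral_mono_on hab (hP1c.abs.intervalIntegrable _ _)
            (by simp) fun t ht => ?_
          have hb2 := abs_phaseDeriv2_le hn hQ he he1 hg hgΓ (t := t) (by linarith [ht.1])
            (by linarith [ht.2])
          rw [← hC2, ← hD] at hb2
          calc |P1 t| ≤ |δ| * |phaseDeriv2 e g Q t| *
                |(θ ^ 2 - f1 t ^ 2) / (f1 t ^ 2 + θ ^ 2) ^ 2| * |A t|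
                + |f1 t / (f1 t ^ 2 + θ ^ 2)| * |A1 t| := by
                simp only [← abs_mul]; exact abs_add_le _ _
            _ ≤ |δ| * (C2 * D) * (1 / θ ^ 2) * A0 + κ * A0 := by
                refine add_le_add ?_ (mul_le_mul ((abs_div_sq_add_le hθ0).trans hθκ) (hA10 t ht)
                  (abs_nonneg _) hκ0.le)
                refine mul_le_mul (mul_le_mul (mul_le_mul_of_nonneg_left hb2 (abs_nonneg _))
                  (abs_sub_div_sq_add_le hθ0) (abs_nonneg _) (by positivity)) (hA0 t ht)
                  (abs_nonneg _) (by positivity)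
            _ = (C2 * (M * (1 / θ ^ 2)) + κ) * A0 := by rw [hM]; ring
            _ ≤ (C2 * κ + κ) * A0 := by gcongr
            _ = _ := by ring
      _ = (b - a) * ((C2 + 1) * κ * A0) := by
          rw [intervalIntegral.integral_const, smul_eq_mul]
      _ ≤ _ := by gcongr
  have hmain : ∫ t in a..b, |A t| * (θ ^ 2 / (f1 t ^ 2 + θ ^ 2))
      ≤ A0 * (8 * n * κ + 2 * ((n * C1 + 1) ^ 2 * κ)) := by
    set S : Set ℝ := {t | ∃ r ∈ ρ, |tau e t - r| < κ} with hS
    have hSm : MeasurableSet S := by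
      have : S = ⋃ r ∈ ρ.toFinset, {t | |tau e t - r| < κ} := by
        ext t; simp [hS]
      rw [this]
      refine Finset.measurableSet_biUnion _ fun r _ => measurableSet_lt ?_ measurable_const
      have := continuous_bet (e := e)
      unfold tau
      exact Continuous.measurable (by fun_prop)
    have hvol : (volume.restrict (Set.Ioc a b)).real S ≤ 8 * n * κ := by
      rw [measureReal_restrict_apply hSm]
      refine ENNReal.toReal_le_of_le_ofReal (by positivity) ?_
      calc volume (S ∩ Set.Ioc a b)
          ≤ volume (⋃ r ∈ ρ.toFinset, {t ∈ Set.Icc a b | |tau e t - r| < κ}) := by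
            refine measure_mono ?_
            rintro t ⟨⟨r, hr, hrt⟩, ht⟩
            simp only [Set.mem_iUnion]
            exact ⟨r, Multiset.mem_toFinset.2 hr, ⟨ht.1.le, ht.2⟩, hrt⟩
        _ ≤ ∑ r ∈ ρ.toFinset, volume {t ∈ Set.Icc a b | |tau e t - r| < κ} :=
            measure_biUnion_finset_le _ _
        _ ≤ ∑ _r ∈ ρ.toFinset, ENNReal.ofReal (4 * κ) :=
            Finset.sum_le_sum fun r _ => volume_tau_near_le he he1 ha hb r
        _ = ENNReal.ofReal (ρ.toFinset.card * (4 * κ)) := by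
            rw [Finset.sum_const, nsmul_eq_mul, ENNReal.ofReal_mul (Nat.cast_nonneg _),
              ENNReal.ofReal_natCast]
        _ ≤ ENNReal.ofReal (8 * n * κ) := by
            refine ENNReal.ofReal_le_ofReal ?_
            have h1 : (ρ.toFinset.card : ℝ) ≤ 2 * n := by
              exact_mod_cast (Multiset.toFinset_card_le ρ).trans hρ
            calc _ ≤ 2 * (n : ℝ) * (4 * κ) := by gcongr
              _ = _ := by ring
    have hoff : ∀ t ∈ Set.Icc a b, t ∉ S → θ ^ 2 / (f1 t ^ 2 + θ ^ 2) ≤ (n * C1 + 1) ^ 2 * κ := by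
      intro t ht htS
      have hr : ∀ r ∈ ρ, κ ≤ |tau e t - r| := fun r hr => by
        by_contra hlt
        exact htS ⟨r, hr, not_le.1 hlt⟩
      have h1 := hsep κ t hκ0 hκ1 (by linarith [ht.1]) (by linarith [ht.2]) hr
      have h2 : M ^ (7 / 8 : ℝ) ≤ n * C1 * |f1 t| := by
        rw [hκn]
        calc M * κ ^ (2 * n) = |δ| * ∑ i ∈ Finset.range n, |Q.derivative.coeff i| * κ ^ (2 * n) := by
              rw [hM, hD, coeffSum, ← Finset.sum_mul]; ring
          _ ≤ |δ| * ∑ _i ∈ Finset.range n, C1 * |phaseDeriv e g Q t| := by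
              exact mul_le_mul_of_nonneg_left (Finset.sum_le_sum fun i _ => h1 i) (abs_nonneg _)
          _ = _ := by
              rw [Finset.sum_const, Finset.card_range, nsmul_eq_mul, hf1, abs_mul]; ring
      have h3 : (M ^ (7 / 8 : ℝ)) ^ 2 ≤ (n * C1 + 1) ^ 2 * f1 t ^ 2 := by
        calc _ ≤ (n * C1 * |f1 t|) ^ 2 := pow_le_pow_left₀ (by positivity) h2 2
          _ = (n * C1) ^ 2 * f1 t ^ 2 := by rw [mul_pow, sq_abs]
          _ ≤ _ := by gcongr; linarith
      rw [div_le_iff₀ (hpos t)]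
      calc θ ^ 2 ≤ κ * (M ^ (7 / 8 : ℝ)) ^ 2 := hθ78
        _ ≤ κ * ((n * C1 + 1) ^ 2 * f1 t ^ 2) := by gcongr
        _ ≤ κ * ((n * C1 + 1) ^ 2 * (f1 t ^ 2 + θ ^ 2)) := by gcongr; linarith [sq_nonneg θ]
        _ = _ := by ring
    calc _ ≤ ∫ t in a..b, A0 * (S.indicator (fun _ => (1 : ℝ)) t + (n * C1 + 1) ^ 2 * κ) := by
          refine intervalIntegral.integral_mono_on hab ?_ ?_ fun t ht => ?_
          · refine Continuous.intervalIntegrable (hAc.abs.mul (continuous_const.div (by fun_prop)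
              fun t => (hpos t).ne')) _ _
          · refine (IntervalIntegrable.add ?_ (by simp)).const_mul _
            rw [intervalIntegrable_iff, Set.uIoc_of_le hab]
            exact (integrable_const (1 : ℝ)).indicator hSm
          · refine mul_le_mul (hA0 t ht) ?_ (by have := hpos t; positivity) hA00
            by_cases htS : t ∈ S
            · rw [Set.indicator_of_mem htS]
              have : θ ^ 2 / (f1 t ^ 2 + θ ^ 2) ≤ 1 := by
                rw [div_le_one (hpos t)]; linarith [sq_nonneg (f1 t)]
              have : 0 ≤ (n * C1 + 1) ^ 2 * κ := by positivity
              linarith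
            · rw [Set.indicator_of_notMem htS, zero_add]
              exact hoff t ht htS
      _ = A0 * ((volume.restrict (Set.Ioc a b)).real S + (b - a) * ((n * C1 + 1) ^ 2 * κ)) := by
          rw [intervalIntegral.integral_const_mul, intervalIntegral.integral_add]
          · congr 2
            · rw [intervalIntegral.integral_of_le hab, ← integral_indicator_one hSm]
              rfl
            · rw [intervalIntegral.integral_const, smul_eq_mul]
          · rw [intervalIntegrable_iff, Set.uIoc_of_le hab]
            exact (integrable_const (1 : ℝ)).indicator hSm
          · simp
      _ ≤ _ := by gcongr
  refine key.trans ?_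
  have hfa := hbdry a ⟨le_rfl, hab⟩
  have hfb := hbdry b ⟨hab, le_rfl⟩
  calc _ ≤ A0 * (8 * n * κ + 2 * ((n * C1 + 1) ^ 2 * κ)) + (κ * A0 + κ * A0
        + 2 * ((C2 + 1) * κ * A0)) := by gcongr
    _ = (8 * n + 2 * (n * C1 + 1) ^ 2 + 2 + 2 * (C2 + 1)) * A0 * κ := by ring
    _ ≤ CC * A0 * (2 * (1 + M) ^ (-η)) := by
        gcongr
        rw [hCC]; linarith
    _ = _ := by ring

end VanDerCorput

section Weight

/-- The `m`-th derivative of `p` at `s`. -/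
def dd (p : ℝ[X]) (m : ℕ) (s : ℝ) : ℝ := (derivative^[m] p).eval s

lemma hasDerivAt_dd (p : ℝ[X]) (m : ℕ) (s : ℝ) : HasDerivAt (dd p m) (dd p (m + 1) s) s := by
  unfold dd
  rw [Function.iterate_succ_apply']
  exact Polynomial.hasDerivAt _ _

lemma dd_one (p : ℝ[X]) (s : ℝ) : dd p 1 s = p.derivative.eval s := rfl

lemma dd_zero (p : ℝ[X]) (s : ℝ) : dd p 0 s = p.eval s := rfl

@[fun_prop]
lemma continuous_dd (p : ℝ[X]) (m : ℕ) : Continuous (dd p m) :=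
  Polynomial.continuous _

lemma dd_eq_zero {n : ℕ} {p : ℝ[X]} (hp : p.natDegree ≤ n) {m : ℕ} (hm : n < m) (s : ℝ) :
    dd p m s = 0 := by
  unfold dd
  rw [iterate_derivative_eq_zero (by omega), eval_zero]

/-- The local frequency weight. -/
def nn (n : ℕ) (p : ℝ[X]) (s v : ℝ) : ℝ :=
  1 + (v + dd p 1 s) ^ 2 + ∑ m ∈ Finset.range n, dd p (m + 2) s ^ 2

variable {n : ℕ} {p : ℝ[X]}

lemma sum_dd_nonneg (n : ℕ) (p : ℝ[X]) (k : ℕ) (s : ℝ) :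
    0 ≤ ∑ m ∈ Finset.range n, dd p (m + k) s ^ 2 :=
  Finset.sum_nonneg fun _ _ => sq_nonneg _

lemma one_le_nn (s v : ℝ) : 1 ≤ nn n p s v := by
  unfold nn
  nlinarith [sum_dd_nonneg n p 2 s, sq_nonneg (v + dd p 1 s)]

lemma nn_pos (s v : ℝ) : 0 < nn n p s v := by linarith [one_le_nn (n := n) (p := p) s v]

lemma sq_w_le (s v : ℝ) : (v + dd p 1 s) ^ 2 ≤ nn n p s v := by
  unfold nn
  nlinarith [sum_dd_nonneg n p 2 s]

lemma abs_w_le (s v : ℝ) : |v + dd p 1 s| ≤ √(nn n p s v) :=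
  Real.abs_le_sqrt (sq_w_le s v)

lemma sq_dd_two_le (hp : p.natDegree ≤ n) (s v : ℝ) : dd p 2 s ^ 2 ≤ nn n p s v := by
  rcases Nat.eq_zero_or_pos n with rfl | hn
  · rw [dd_eq_zero hp (by norm_num)]
    nlinarith [one_le_nn (n := 0) (p := p) s v]
  · have := Finset.single_le_sum (f := fun m => dd p (m + 2) s ^ 2) (fun _ _ => sq_nonneg _)
      (Finset.mem_range.2 hn)
    unfold nn
    simp only [zero_add] at this
    nlinarith [sq_nonneg (v + dd p 1 s)]

lemma abs_dd_two_le (hp : p.natDegree ≤ n) (s v : ℝ) : |dd p 2 s| ≤ √(nn n p s v) :=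
  Real.abs_le_sqrt (sq_dd_two_le hp s v)

@[fun_prop]
lemma continuous_nn : Continuous fun z : ℝ × ℝ => nn n p z.1 z.2 := by
  unfold nn
  fun_prop

/-- The `s`-derivative of `nn`. -/
def nn1 (n : ℕ) (p : ℝ[X]) (s v : ℝ) : ℝ :=
  2 * (v + dd p 1 s) * dd p 2 s + ∑ m ∈ Finset.range n, 2 * dd p (m + 2) s * dd p (m + 3) s

lemma hasDerivAt_nn (s v : ℝ) : HasDerivAt (fun s => nn n p s v) (nn1 n p s v) s := by
  unfold nn nn1
  have h1 : HasDerivAt (fun s => (v + dd p 1 s) ^ 2) (2 * (v + dd p 1 s) * dd p 2 s) s := 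
    (((hasDerivAt_dd p 1 s).const_add v).fun_pow 2).congr_deriv (by simp)
  have h2 : HasDerivAt (fun s => ∑ m ∈ Finset.range n, dd p (m + 2) s ^ 2)
      (∑ m ∈ Finset.range n, 2 * dd p (m + 2) s * dd p (m + 3) s) s :=
    HasDerivAt.fun_sum fun m _ => ((hasDerivAt_dd p (m + 2) s).fun_pow 2).congr_deriv (by simp)
  exact (h1.const_add 1).add h2

lemma abs_nn1_le (hp : p.natDegree ≤ n) (s v : ℝ) : |nn1 n p s v| ≤ 3 * nn n p s v := by
  have h3 : ∑ m ∈ Finset.range n, dd p (m + 3) s ^ 2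
      ≤ ∑ m ∈ Finset.range n, dd p (m + 2) s ^ 2 := by
    have e1 := Finset.sum_range_succ (fun m => dd p (m + 2) s ^ 2) n
    have e2 := Finset.sum_range_succ' (fun m => dd p (m + 2) s ^ 2) n
    rw [dd_eq_zero hp (by omega : n < n + 2)] at e1
    have e3 : ∑ m ∈ Finset.range n, dd p (m + 3) s ^ 2
        = ∑ m ∈ Finset.range n, dd p (m + 1 + 2) s ^ 2 := rfl
    rw [e3]
    nlinarith [sq_nonneg (dd p (0 + 2) s)]
  have h2 := sq_dd_two_le hp s v
  have hS := sum_dd_nonneg n p 2 s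
  have h1 : |∑ m ∈ Finset.range n, 2 * dd p (m + 2) s * dd p (m + 3) s|
      ≤ ∑ m ∈ Finset.range n, dd p (m + 2) s ^ 2 + ∑ m ∈ Finset.range n, dd p (m + 3) s ^ 2 := by
    rw [← Finset.sum_add_distrib]
    refine (Finset.abs_sum_le_sum_abs _ _).trans (Finset.sum_le_sum fun m _ => ?_)
    rw [abs_le]
    constructor
    · linarith [sq_nonneg (dd p (m + 2) s + dd p (m + 3) s)]
    · linarith [sq_nonneg (dd p (m + 2) s - dd p (m + 3) s)]
  have h4 : |2 * (v + dd p 1 s) * dd p 2 s| ≤ (v + dd p 1 s) ^ 2 + dd p 2 s ^ 2 := by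
    rw [abs_le]
    constructor
    · linarith [sq_nonneg (v + dd p 1 s + dd p 2 s)]
    · linarith [sq_nonneg (v + dd p 1 s - dd p 2 s)]
  refine (abs_add_le _ _).trans ?_
  have h5 : nn n p s v = 1 + (v + dd p 1 s) ^ 2 + ∑ m ∈ Finset.range n, dd p (m + 2) s ^ 2 := rfl
  linarith [sq_nonneg (v + dd p 1 s)]

lemma nn_le_exp (hp : p.natDegree ≤ n) (s s' v : ℝ) :
    nn n p s' v ≤ Real.exp (3 * |s - s'|) * nn n p s v := by
  have hE : ∀ c σ : ℝ, HasDerivAt (fun σ => Real.exp (c * σ) * nn n p σ v)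
      (Real.exp (c * σ) * c * nn n p σ v + Real.exp (c * σ) * nn1 n p σ v) σ := fun c σ => by
    have h1 : HasDerivAt (fun σ => Real.exp (c * σ)) (Real.exp (c * σ) * c) σ := by
      simpa using ((hasDerivAt_id σ).const_mul c).exp
    exact h1.mul (hasDerivAt_nn σ v)
  have hup : Antitone fun σ => Real.exp (-3 * σ) * nn n p σ v := by
    refine antitone_of_hasDerivAt_nonpos (hE (-3)) fun σ => ?_
    have := (abs_le.1 (abs_nn1_le hp σ v)).2
    have h0 := Real.exp_pos (-3 * σ)
    simp only [Pi.zero_apply]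
    nlinarith
  have hdn : Monotone fun σ => Real.exp (3 * σ) * nn n p σ v := by
    refine monotone_of_hasDerivAt_nonneg (hE 3) fun σ => ?_
    have := (abs_le.1 (abs_nn1_le hp σ v)).1
    have h0 := Real.exp_pos (3 * σ)
    simp only [Pi.zero_apply]
    nlinarith
  rcases le_total s s' with h | h
  · have := hup h
    simp only at this
    rw [abs_of_nonpos (by linarith)]
    calc nn n p s' v = Real.exp (3 * s') * (Real.exp (-3 * s') * nn n p s' v) := by
          rw [← mul_assoc, ← Real.exp_add]; ring_nf; simp
      _ ≤ Real.exp (3 * s') * (Real.exp (-3 * s) * nn n p s v) := by gcongr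
      _ = _ := by rw [← mul_assoc, ← Real.exp_add]; ring_nf
  · have := hdn h
    simp only at this
    rw [abs_of_nonneg (by linarith)]
    calc nn n p s' v = Real.exp (-3 * s') * (Real.exp (3 * s') * nn n p s' v) := by
          rw [← mul_assoc, ← Real.exp_add]; ring_nf; simp
      _ ≤ Real.exp (-3 * s') * (Real.exp (3 * s) * nn n p s v) := by gcongr
      _ = _ := by rw [← mul_assoc, ← Real.exp_add]; ring_nf

lemma nn_le_add (s v v' : ℝ) : nn n p s v ≤ 2 * nn n p s v' + 2 * (v - v') ^ 2 := by
  unfold nn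
  nlinarith [sum_dd_nonneg n p 2 s, sq_nonneg (v' + dd p 1 s - (v - v'))]

/-- The smooth cutoff to the region `|u| √nn ≲ Λ`. -/
def psi (n : ℕ) (Λ : ℝ) (p : ℝ[X]) (s u v : ℝ) : ℝ := ((1 + u ^ 2 * nn n p s v / Λ ^ 2) ^ 8)⁻¹

variable {Λ : ℝ}

lemma psi_pos (s u v : ℝ) : 0 < psi n Λ p s u v := by
  have := nn_pos (n := n) (p := p) s v
  unfold psi; positivity

lemma psi_le_one (s u v : ℝ) : psi n Λ p s u v ≤ 1 := by
  have := nn_pos (n := n) (p := p) s v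
  unfold psi
  refine inv_le_one_of_one_le₀ (one_le_pow₀ ?_)
  have : 0 ≤ u ^ 2 * nn n p s v / Λ ^ 2 := by positivity
  linarith

lemma one_sub_psi_le (s u v : ℝ) :
    1 - psi n Λ p s u v ≤ 8 * min 1 (u ^ 2 * nn n p s v / Λ ^ 2) := by
  have h0 := nn_pos (n := n) (p := p) s v
  have h1 := psi_pos (n := n) (Λ := Λ) (p := p) s u v
  have hr : 0 ≤ u ^ 2 * nn n p s v / Λ ^ 2 := by positivity
  rw [mul_min_of_nonneg _ _ (by norm_num)]
  refine le_min (by linarith) ?_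
  unfold psi
  set r := u ^ 2 * nn n p s v / Λ ^ 2
  have h2 : 1 + ((8 : ℕ) : ℝ) * (-(r / (1 + r))) ≤ (1 + -(r / (1 + r))) ^ 8 := by
    refine one_add_mul_le_pow ?_ 8
    have : r / (1 + r) ≤ 1 := by rw [div_le_one (by linarith)]; linarith
    linarith
  have h3 : 1 + -(r / (1 + r)) = (1 + r)⁻¹ := by field_simp; ring
  rw [h3, inv_pow] at h2
  have h4 : r / (1 + r) ≤ r := div_le_self hr (by linarith)
  push_cast at h2
  linarith

/-- The `s`-derivative of `psi`. -/
def psi1 (n : ℕ) (Λ : ℝ) (p : ℝ[X]) (s u v : ℝ) : ℝ :=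
  -(8 * (u ^ 2 * nn1 n p s v / Λ ^ 2) / (1 + u ^ 2 * nn n p s v / Λ ^ 2) ^ 9)

lemma hasDerivAt_psi (s u v : ℝ) :
    HasDerivAt (fun s => psi n Λ p s u v) (psi1 n Λ p s u v) s := by
  have h0 := nn_pos (n := n) (p := p) s v
  have hr : 0 < 1 + u ^ 2 * nn n p s v / Λ ^ 2 := by positivity
  unfold psi psi1
  have h1 := ((((hasDerivAt_nn (n := n) (p := p) s v).const_mul (u ^ 2)).div_const
    (Λ ^ 2)).const_add 1).pow 8
  refine (h1.inv (pow_pos hr 8).ne').congr_deriv ?_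
  simp only [Pi.pow_apply]
  field_simp
  norm_num
  ring

lemma abs_psi1_le (hp : p.natDegree ≤ n) (s u v : ℝ) :
    |psi1 n Λ p s u v| ≤ 24 * min 1 (u ^ 2 * nn n p s v / Λ ^ 2) := by
  have h0 := nn_pos (n := n) (p := p) s v
  have h1 := abs_nn1_le hp s v
  have hr : 0 ≤ u ^ 2 * nn n p s v / Λ ^ 2 := by positivity
  have h2 : |u ^ 2 * nn1 n p s v / Λ ^ 2| ≤ 3 * (u ^ 2 * nn n p s v / Λ ^ 2) := by
    rw [abs_div, abs_mul, abs_of_nonneg (sq_nonneg u), abs_of_nonneg (sq_nonneg Λ)]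
    calc _ ≤ u ^ 2 * (3 * nn n p s v) / Λ ^ 2 := by gcongr
      _ = _ := by ring
  unfold psi1
  set r := u ^ 2 * nn n p s v / Λ ^ 2
  rw [abs_neg, abs_div, abs_mul, abs_of_pos (pow_pos (by linarith : 0 < 1 + r) 9),
    abs_of_pos (by norm_num : (0 : ℝ) < 8)]
  have h9 : 1 + r ≤ (1 + r) ^ 9 := le_self_pow₀ (by linarith) (by norm_num)
  rw [div_le_iff₀ (by positivity), mul_min_of_nonneg _ _ (by norm_num)]
  rcases le_total (24 * 1) (24 * r) with h | h
  · rw [min_eq_left h]; linarith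
  · rw [min_eq_right h]
    nlinarith

@[fun_prop]
lemma continuous_nn1 : Continuous fun z : ℝ × ℝ => nn1 n p z.1 z.2 := by
  unfold nn1
  fun_prop

lemma continuous_psi : Continuous fun z : ℝ × ℝ × ℝ => psi n Λ p z.1 z.2.1 z.2.2 := by
  have h : Continuous fun z : ℝ × ℝ × ℝ => nn n p z.1 z.2.2 :=
    continuous_nn.comp (f := fun z : ℝ × ℝ × ℝ => (z.1, z.2.2)) (by fun_prop)
  have hr : ∀ z : ℝ × ℝ × ℝ, 0 < 1 + z.2.1 ^ 2 * nn n p z.1 z.2.2 / Λ ^ 2 := fun z => by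
    have h0 := nn_pos (n := n) (p := p) z.1 z.2.2
    positivity
  unfold psi
  exact Continuous.inv₀ (by fun_prop) fun z => (pow_pos (hr z) 8).ne'

lemma continuous_psi1 (u v : ℝ) : Continuous fun s => psi1 n Λ p s u v := by
  have h : Continuous fun s => nn n p s v :=
    continuous_nn.comp (f := fun s : ℝ => (s, v)) (by fun_prop)
  have h1 : Continuous fun s => nn1 n p s v :=
    continuous_nn1.comp (f := fun s : ℝ => (s, v)) (by fun_prop)
  have hr : ∀ s : ℝ, 0 < 1 + u ^ 2 * nn n p s v / Λ ^ 2 := fun s => by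
    have h0 := nn_pos (n := n) (p := p) s v
    positivity
  unfold psi1
  exact (Continuous.div (by fun_prop) (by fun_prop) fun s => (pow_pos (hr s) 9).ne').neg

/-- The Poisson-type majorant `√a / (1 + a u²)`. -/
def poi (a u : ℝ) : ℝ := √a / (1 + u ^ 2 * a)

lemma poi_nonneg {a : ℝ} (ha : 0 ≤ a) (u : ℝ) : 0 ≤ poi a u := by unfold poi; positivity

lemma lintegral_poi {a : ℝ} (ha : 0 < a) :
    ∫⁻ u, ENNReal.ofReal (poi a u) = ENNReal.ofReal Real.pi := by
  have h1 : ∀ u, poi a u = √a * (1 + (√a * u) ^ 2)⁻¹ := fun u => by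
    unfold poi
    rw [mul_pow, Real.sq_sqrt ha.le, div_eq_mul_inv, mul_comm a]
  have hi : Integrable fun u => (1 + (√a * u) ^ 2)⁻¹ :=
    integrable_inv_one_add_sq.comp_mul_left' (Real.sqrt_pos.2 ha).ne'
  rw [← ofReal_integral_eq_lintegral_ofReal]
  · congr 1
    rw [integral_congr_ae (.of_forall h1), integral_const_mul, Measure.integral_comp_mul_left (fun u => (1 + u ^ 2)⁻¹) (√a),
      integral_univ_inv_one_add_sq, smul_eq_mul, abs_of_nonneg (by positivity), ← mul_assoc,
      mul_inv_cancel₀ (Real.sqrt_pos.2 ha).ne', one_mul]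
  · rw [show poi a = _ from funext h1]
    exact hi.const_mul _
  · exact .of_forall fun u => poi_nonneg ha.le u

lemma sqrt_nn_mul_le (s u v v' : ℝ) (hv : (v - v') ^ 2 = u ^ 2) :
    √(nn n p s v) ≤ 2 * √(nn n p s v') * (1 + u ^ 2) := by
  have h1 := nn_le_add (n := n) (p := p) s v v'
  have h2 := one_le_nn (n := n) (p := p) s v'
  rw [hv] at h1
  refine Real.sqrt_le_iff.2 ⟨by positivity, ?_⟩
  rw [mul_pow, mul_pow, Real.sq_sqrt (by linarith)]
  nlinarith [sq_nonneg u, mul_nonneg (sq_nonneg u) (sub_nonneg.2 h2), sq_nonneg (u ^ 2),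
    mul_nonneg (sq_nonneg (u ^ 2)) (sub_nonneg.2 h2)]

lemma psi_le (hΛ : 1 ≤ Λ) (s u v : ℝ) :
    psi n Λ p s u v ≤ Λ ^ 16 * ((1 + u ^ 2 * nn n p s v) ^ 8)⁻¹ := by
  have h0 := nn_pos (n := n) (p := p) s v
  have hΛ2 : 1 ≤ Λ ^ 2 := one_le_pow₀ hΛ
  unfold psi
  rw [← div_eq_mul_inv, le_div_iff₀ (by positivity), inv_mul_le_iff₀ (by positivity)]
  calc (1 + u ^ 2 * nn n p s v) ^ 8
      ≤ (Λ ^ 2 * (1 + u ^ 2 * nn n p s v / Λ ^ 2)) ^ 8 := by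
        refine pow_le_pow_left₀ (by positivity) ?_ 8
        rw [mul_add, mul_div_cancel₀ _ (by positivity)]
        linarith
    _ = _ := by ring

lemma sqrt_nn_mul_psi_le (hΛ : 1 ≤ Λ) (s u v v' : ℝ) (hv : (v - v') ^ 2 = u ^ 2) :
    √(nn n p s v) * psi n Λ p s u v
      ≤ 4 * Λ ^ 16 * (((1 + u ^ 2) ^ 5)⁻¹ * poi (nn n p s v') u) := by
  have h0 := one_le_nn (n := n) (p := p) s v
  have h1 := one_le_nn (n := n) (p := p) s v'
  have h2 := sqrt_nn_mul_le (n := n) (p := p) s u v v' hv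
  have h3 := psi_le (n := n) (p := p) hΛ s u v
  have h4 := nn_le_add (n := n) (p := p) s v' v
  rw [show (v' - v) ^ 2 = u ^ 2 by rw [← hv]; ring] at h4
  set N := nn n p s v
  set a := nn n p s v'
  have h5 : (1 + u ^ 2) ^ 7 * (1 + u ^ 2 * a) ≤ 2 * (1 + u ^ 2) * (1 + u ^ 2 * N) ^ 8 := by
    have e1 : 1 + u ^ 2 ≤ 1 + u ^ 2 * N := by nlinarith [sq_nonneg u]
    have e2 : 1 + u ^ 2 * a ≤ 2 * (1 + u ^ 2) * (1 + u ^ 2 * N) := by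
      nlinarith [sq_nonneg u, mul_nonneg (sq_nonneg u) (sub_nonneg.2 h4),
        mul_nonneg (mul_nonneg (sq_nonneg u) (sq_nonneg u)) (sub_nonneg.2 h0)]
    calc (1 + u ^ 2) ^ 7 * (1 + u ^ 2 * a)
        ≤ (1 + u ^ 2 * N) ^ 7 * (2 * (1 + u ^ 2) * (1 + u ^ 2 * N)) := by gcongr
      _ = _ := by ring
  have h6 : ((1 + u ^ 2 * N) ^ 8)⁻¹ ≤ 2 * (1 + u ^ 2) * ((1 + u ^ 2) ^ 7 * (1 + u ^ 2 * a))⁻¹ := by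
    rw [← div_eq_mul_inv, le_div_iff₀ (by positivity), inv_mul_le_iff₀ (by positivity)]
    linarith
  calc √N * psi n Λ p s u v ≤ 2 * √a * (1 + u ^ 2) * (Λ ^ 16 * (2 * (1 + u ^ 2) *
        ((1 + u ^ 2) ^ 7 * (1 + u ^ 2 * a))⁻¹)) := by
        refine mul_le_mul h2 (h3.trans ?_) (psi_pos _ _ _).le (by positivity)
        gcongr
    _ = _ := by
        unfold poi
        field_simp
        ring

end Weight

section KernelIntegrals

lemma lintegral_ofReal_comp_mul_left {g : ℝ → ℝ} (hg : Integrable g) (h0 : ∀ x, 0 ≤ g x) {c : ℝ}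
    (hc : 0 < c) : ∫⁻ x, ENNReal.ofReal (g (c * x)) = ENNReal.ofReal (c⁻¹ * ∫ x, g x) := by
  rw [← ofReal_integral_eq_lintegral_ofReal (hg.comp_mul_left' hc.ne')
    (.of_forall fun x => h0 _), Measure.integral_comp_mul_left, smul_eq_mul,
    abs_of_pos (inv_pos.2 hc)]

lemma integrable_of_even {f : ℝ → ℝ} (hf : IntegrableOn (fun x => f |x|) (Set.Ioi 0)) :
    Integrable fun x => f |x| := by
  have h2 : IntegrableOn (fun x => f |x|) (Set.Iic 0) := by
    rw [← Measure.map_neg_eq_self (volume : Measure ℝ)]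
    have m : MeasurableEmbedding fun x : ℝ => -x := (Homeomorph.neg ℝ).measurableEmbedding
    rw [m.integrableOn_map_iff]
    simp_rw [Function.comp_def, abs_neg, Set.neg_preimage, Set.neg_Iic, neg_zero]
    exact Iff.mpr integrableOn_Ici_iff_integrableOn_Ioi hf
  rw [← integrableOn_univ, ← Set.Iic_union_Ioi (a := (0 : ℝ))]
  exact h2.union hf

/-- The scale invariant integrable profile `|x|^{h-1} (1+|x|)^{-2h}`. -/
def profile (h x : ℝ) : ℝ := |x| ^ (h - 1) * (1 + |x|) ^ (-(2 * h))

lemma profile_nonneg (h x : ℝ) : 0 ≤ profile h x := by unfold profile; positivity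

lemma integrable_profile {h : ℝ} (hh : 0 < h) : Integrable (profile h) := by
  refine integrable_of_even (f := fun x => x ^ (h - 1) * (1 + x) ^ (-(2 * h))) ?_
  have hm : Measurable fun x : ℝ => |x| ^ (h - 1) * (1 + |x|) ^ (-(2 * h)) := by fun_prop
  rw [← Set.Ioc_union_Ioi_eq_Ioi (zero_le_one : (0 : ℝ) ≤ 1)]
  refine IntegrableOn.union ?_ ?_
  · have h1 : IntegrableOn (fun x : ℝ => x ^ (h - 1)) (Set.Ioc 0 1) := by
      rw [← intervalIntegrable_iff_integrableOn_Ioc_of_le zero_le_one]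
      exact intervalIntegral.intervalIntegrable_rpow' (by linarith)
    refine h1.mono' hm.aestronglyMeasurable ?_
    refine (ae_restrict_iff' measurableSet_Ioc).2 (.of_forall fun x hx => ?_)
    rw [abs_of_pos hx.1, Real.norm_of_nonneg (by have := hx.1; positivity)]
    refine mul_le_of_le_one_right (Real.rpow_nonneg hx.1.le _) ?_
    exact Real.rpow_le_one_of_one_le_of_nonpos (by linarith [hx.1]) (by linarith)
  · have h1 : IntegrableOn (fun x : ℝ => x ^ (-h - 1)) (Set.Ioi 1) :=
      integrableOn_Ioi_rpow_of_lt (by linarith) one_pos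
    refine h1.mono' hm.aestronglyMeasurable ?_
    refine (ae_restrict_iff' measurableSet_Ioi).2 (.of_forall fun x hx => ?_)
    have hx0 : 0 < x := lt_trans one_pos hx
    rw [abs_of_pos hx0, Real.norm_of_nonneg (by positivity),
      show -h - 1 = (h - 1) + (-(2 * h)) by ring, Real.rpow_add hx0]
    refine mul_le_mul_of_nonneg_left ?_ (by positivity)
    exact Real.rpow_le_rpow_of_nonpos hx0 (by linarith) (by linarith)

lemma lintegral_profile_scaled {h N : ℝ} (hh : 0 < h) (hN : 0 < N) :
    ∫⁻ x, ENNReal.ofReal (N * profile h (N * x)) = ENNReal.ofReal (∫ x, profile h x) := by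
  have := lintegral_ofReal_comp_mul_left ((integrable_profile hh).const_mul N)
    (fun x => mul_nonneg hN.le (profile_nonneg h x)) hN
  rw [this, integral_const_mul, ← mul_assoc, inv_mul_cancel₀ hN.ne', one_mul]

lemma lintegral_rpow_add {h ρ : ℝ} (hh : 0 < h) (hρ : 0 < ρ) :
    ∫⁻ x, ENNReal.ofReal ((ρ + |x|) ^ (-(1 + h)))
      = ENNReal.ofReal (ρ ^ (-h) * ∫ x : ℝ, (1 + ‖x‖) ^ (-(1 + h))) := by
  have hi : Integrable fun x : ℝ => ρ ^ (-(1 + h)) * (1 + ‖x‖) ^ (-(1 + h)) :=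
    (integrable_one_add_norm (by simp [hh])).const_mul _
  have := lintegral_ofReal_comp_mul_left hi (fun x => by positivity) (inv_pos.2 hρ)
  rw [integral_const_mul, inv_inv, ← mul_assoc] at this
  rw [show ρ ^ (-h) = ρ * ρ ^ (-(1 + h)) by
    nth_rewrite 2 [← Real.rpow_one ρ]; rw [← Real.rpow_add hρ]; congr 1; ring, ← this]
  refine lintegral_congr fun x => ?_
  congr 1
  rw [← Real.mul_rpow hρ.le (by positivity), Real.norm_eq_abs, abs_mul, abs_of_pos (inv_pos.2 hρ),
    mul_add, mul_one, mul_inv_cancel_left₀ hρ.ne']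

lemma inv_mul_inv_le {h ρ δ a b : ℝ} (hh : 0 < h) (hh1 : h ≤ 1) (hρ : 0 < ρ) (hδ : 0 < δ)
    (ha : 0 ≤ a) (hab : a ≤ b) (hb : δ / 2 ≤ b) :
    (ρ + a)⁻¹ * (ρ + b)⁻¹ ≤ 2 * δ ^ (h - 1) * (ρ + a) ^ (-(1 + h)) := by
  have hρa : 0 < ρ + a := by linarith
  have hρb : 0 < ρ + b := by linarith
  have e1 : (ρ + b)⁻¹ = (ρ + b) ^ (h - 1) * (ρ + b) ^ (-h) := by
    rw [← Real.rpow_add hρb, ← Real.rpow_neg_one]; congr 1; ring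
  have e2 : (ρ + a) ^ (-(1 + h)) = (ρ + a)⁻¹ * (ρ + a) ^ (-h) := by
    rw [← Real.rpow_neg_one, ← Real.rpow_add hρa]; congr 1; ring
  have h1 : (ρ + b) ^ (h - 1) ≤ (δ / 2) ^ (h - 1) :=
    Real.rpow_le_rpow_of_nonpos (by positivity) (by linarith) (by linarith)
  have h2 : (ρ + b) ^ (-h) ≤ (ρ + a) ^ (-h) :=
    Real.rpow_le_rpow_of_nonpos hρa (by linarith) (by linarith)
  have h3 : (δ / 2) ^ (h - 1) ≤ 2 * δ ^ (h - 1) := by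
    rw [Real.div_rpow hδ.le (by norm_num), div_eq_inv_mul, ← Real.rpow_neg (by norm_num)]
    refine mul_le_mul_of_nonneg_right ?_ (by positivity)
    calc (2 : ℝ) ^ (-(h - 1)) ≤ 2 ^ (1 : ℝ) :=
          Real.rpow_le_rpow_of_exponent_le (by norm_num) (by linarith)
      _ = 2 := Real.rpow_one 2
  rw [e1, e2]
  calc (ρ + a)⁻¹ * ((ρ + b) ^ (h - 1) * (ρ + b) ^ (-h))
      ≤ (ρ + a)⁻¹ * ((2 * δ ^ (h - 1)) * (ρ + a) ^ (-h)) := by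
        gcongr
        exact h1.trans h3
    _ = _ := by ring

/-- Convolution of two functions `(ρ + |u|)⁻¹`. -/
lemma lintegral_inv_mul_inv_le {h : ℝ} (hh : 0 < h) (hh1 : h ≤ 1) : ∃ C : ℝ, 0 < C ∧
    ∀ ρ x x' : ℝ, 0 < ρ → x ≠ x' →
      ∫⁻ z, ENNReal.ofReal ((ρ + |x - z|)⁻¹ * (ρ + |x' - z|)⁻¹)
        ≤ ENNReal.ofReal (C * |x - x'| ^ (h - 1) * ρ ^ (-h)) := by
  set I := ∫ x : ℝ, (1 + ‖x‖) ^ (-(1 + h)) with hI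
  have hI0 : 0 ≤ I := integral_nonneg fun x => by positivity
  refine ⟨4 * (I + 1), by positivity, fun ρ x x' hρ hx => ?_⟩
  have hδ : 0 < |x - x'| := abs_pos.2 (sub_ne_zero.2 hx)
  set δ := |x - x'|
  have hpt : ∀ z, (ρ + |x - z|)⁻¹ * (ρ + |x' - z|)⁻¹ ≤ 2 * δ ^ (h - 1) * (ρ + |x - z|) ^ (-(1 + h))
      + 2 * δ ^ (h - 1) * (ρ + |x' - z|) ^ (-(1 + h)) := fun z => by
    have htri : δ ≤ |x - z| + |x' - z| := by
      calc δ = |(x - z) - (x' - z)| := by rw [sub_sub_sub_cancel_right]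
        _ ≤ _ := abs_sub _ _
    rcases le_total |x - z| |x' - z| with hl | hl
    · have := inv_mul_inv_le hh hh1 hρ hδ (abs_nonneg _) hl (by linarith)
      have h2 : 0 ≤ 2 * δ ^ (h - 1) * (ρ + |x' - z|) ^ (-(1 + h)) := by positivity
      linarith
    · have := inv_mul_inv_le hh hh1 hρ hδ (abs_nonneg _) hl (by linarith)
      have h2 : 0 ≤ 2 * δ ^ (h - 1) * (ρ + |x - z|) ^ (-(1 + h)) := by positivity
      rw [mul_comm]
      linarith
  have hint : ∀ x : ℝ, ∫⁻ z, ENNReal.ofReal (2 * δ ^ (h - 1) * (ρ + |x - z|) ^ (-(1 + h)))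
      = ENNReal.ofReal (2 * δ ^ (h - 1) * (ρ ^ (-h) * I)) := fun x => by
    rw [lintegral_sub_left_eq_self (fun z => ENNReal.ofReal (2 * δ ^ (h - 1) *
      (ρ + |z|) ^ (-(1 + h)))) x]
    simp_rw [ENNReal.ofReal_mul (show 0 ≤ 2 * δ ^ (h - 1) by positivity)]
    rw [lintegral_const_mul' _ _ ENNReal.ofReal_ne_top, lintegral_rpow_add hh hρ]
  calc _ ≤ ∫⁻ z, (ENNReal.ofReal (2 * δ ^ (h - 1) * (ρ + |x - z|) ^ (-(1 + h)))
        + ENNReal.ofReal (2 * δ ^ (h - 1) * (ρ + |x' - z|) ^ (-(1 + h)))) := by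
        refine lintegral_mono fun z => ?_
        rw [← ENNReal.ofReal_add (by positivity) (by positivity)]
        exact ENNReal.ofReal_le_ofReal (hpt z)
    _ = ENNReal.ofReal (2 * δ ^ (h - 1) * (ρ ^ (-h) * I))
        + ENNReal.ofReal (2 * δ ^ (h - 1) * (ρ ^ (-h) * I)) := by
        rw [lintegral_add_left (by fun_prop), hint, hint]
    _ ≤ _ := by
        rw [← ENNReal.ofReal_add (by positivity) (by positivity)]
        refine ENNReal.ofReal_le_ofReal ?_
        have : 0 ≤ δ ^ (h - 1) * ρ ^ (-h) := by positivity
        nlinarith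

/-- The off-diagonal decay of the `TT*` kernel in a scale-invariant form. -/
lemma decay_le_profile {h δ N M : ℝ} (hh : 0 < h) (hh1 : h ≤ 1) (hδ : 0 < δ) (hN : 1 ≤ N)
    (hNM : N ≤ 1 + M) (hM : 1 + M ≤ 2 * N + δ) (hδM : δ ≤ M) :
    δ ^ (h - 1) * (1 + M) ^ h * (1 + δ * M) ^ (-(2 * h)) ≤ 48 * (N * profile h (N * δ)) := by
  have hM0 : 0 < M := hδ.trans_le hδM
  set z := δ * (1 + M) with hz
  set y := N * δ with hy
  have hy0 : 0 < y := by positivity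
  have hz0 : 0 < z := by positivity
  have hyz : y ≤ z := by rw [hy, hz]; nlinarith
  have h1 : (1 + δ * M) ^ (-(2 * h)) ≤ 4 * (1 + z) ^ (-(2 * h)) := by
    have e : (1 + z) / 2 ≤ 1 + δ * M := by rw [hz]; nlinarith [sq_nonneg (δ - 1)]
    calc (1 + δ * M) ^ (-(2 * h)) ≤ ((1 + z) / 2) ^ (-(2 * h)) :=
          Real.rpow_le_rpow_of_nonpos (by positivity) e (by linarith)
      _ = 2 ^ (2 * h) * (1 + z) ^ (-(2 * h)) := by
          rw [Real.div_rpow (by positivity) (by norm_num), div_eq_inv_mul,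
            ← Real.rpow_neg (by norm_num), neg_neg]
      _ ≤ _ := by
          refine mul_le_mul_of_nonneg_right ?_ (by positivity)
          calc (2 : ℝ) ^ (2 * h) ≤ 2 ^ (2 : ℝ) :=
                Real.rpow_le_rpow_of_exponent_le (by norm_num) (by linarith)
            _ = 4 := by norm_num
  have hq : z / (1 + z) ^ 2 ≤ 12 * (y / (1 + y) ^ 2) := by
    rw [mul_div_assoc', div_le_div_iff₀ (by positivity) (by positivity)]
    rcases le_total 1 y with hy1 | hy1
    · have : z * (1 + y) ^ 2 ≤ z * (4 * y ^ 2) := by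
        gcongr; nlinarith
      have h3 : y * z ^ 2 ≤ y * (1 + z) ^ 2 := by gcongr; linarith
      nlinarith [mul_le_mul_of_nonneg_left hyz (mul_pos hy0 hz0).le]
    · have hδ1 : δ ≤ 1 := by nlinarith
      have hz3 : z ≤ 3 * y := by rw [hz, hy]; nlinarith
      have h3 : (1 + y) ^ 2 ≤ (1 + z) ^ 2 := by gcongr
      have h4 : 0 ≤ (1 + z) ^ 2 := by positivity
      calc z * (1 + y) ^ 2 ≤ 3 * y * (1 + z) ^ 2 := by gcongr
        _ ≤ 12 * y * (1 + z) ^ 2 := by gcongr; norm_num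
  have hpow : ∀ x : ℝ, 0 < x → (x / (1 + x) ^ 2) ^ h = x ^ h * (1 + x) ^ (-(2 * h)) := fun x hx => by
    rw [Real.div_rpow hx.le (by positivity), ← Real.rpow_natCast, ← Real.rpow_mul (by positivity),
      div_eq_mul_inv, ← Real.rpow_neg (by positivity)]
    norm_num
  have h2 : z ^ h * (1 + z) ^ (-(2 * h)) ≤ 12 * (y ^ h * (1 + y) ^ (-(2 * h))) := by
    rw [← hpow z hz0, ← hpow y hy0]
    calc (z / (1 + z) ^ 2) ^ h ≤ (12 * (y / (1 + y) ^ 2)) ^ h :=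
          Real.rpow_le_rpow (by positivity) hq hh.le
      _ = 12 ^ h * (y / (1 + y) ^ 2) ^ h := Real.mul_rpow (by norm_num) (by positivity)
      _ ≤ _ := by
          refine mul_le_mul_of_nonneg_right ?_ (by positivity)
          calc (12 : ℝ) ^ h ≤ 12 ^ (1 : ℝ) :=
                Real.rpow_le_rpow_of_exponent_le (by norm_num) hh1
            _ = 12 := Real.rpow_one _
  have e1 : δ ^ (h - 1) * (1 + M) ^ h = δ⁻¹ * z ^ h := by
    rw [hz, Real.mul_rpow hδ.le (by positivity), Real.rpow_sub_one hδ.ne', div_eq_inv_mul]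
    ring
  have e2 : N * profile h (N * δ) = δ⁻¹ * (y ^ h * (1 + y) ^ (-(2 * h))) := by
    unfold profile
    rw [← hy, abs_of_pos hy0, Real.rpow_sub_one hy0.ne', hy]
    field_simp
  rw [e1, e2]
  calc δ⁻¹ * z ^ h * (1 + δ * M) ^ (-(2 * h)) ≤ δ⁻¹ * z ^ h * (4 * (1 + z) ^ (-(2 * h))) := by
        gcongr
    _ = 4 * (δ⁻¹ * (z ^ h * (1 + z) ^ (-(2 * h)))) := by ring
    _ ≤ 4 * (δ⁻¹ * (12 * (y ^ h * (1 + y) ^ (-(2 * h))))) := by gcongr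
    _ = _ := by ring

end KernelIntegrals

section RowKernel

/-- The sign function with real values. -/
def sgn (x : ℝ) : ℝ := (SignType.sign x : SignType)

lemma sgn_mul (x y : ℝ) : sgn (x * y) = sgn x * sgn y := by
  unfold sgn
  rw [sign_mul, SignType.coe_mul]

lemma abs_sgn_le (x : ℝ) : |sgn x| ≤ 1 := by
  unfold sgn
  rcases lt_trichotomy x 0 with h | h | h <;> simp [h]

lemma sgn_of_pos {x : ℝ} (h : 0 < x) : sgn x = 1 := by simp [sgn, h]

lemma sgn_of_neg {x : ℝ} (h : x < 0) : sgn x = -1 := by simp [sgn, h]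

@[fun_prop]
lemma measurable_sgn : Measurable sgn := by
  have e : sgn = fun x => if 0 < x then 1 else if x < 0 then -1 else 0 := by
    funext x
    rcases lt_trichotomy x 0 with h | h | h
    · rw [sgn_of_neg h, if_neg (by linarith), if_pos h]
    · simp [h, sgn]
    · rw [sgn_of_pos h, if_pos h]
  rw [e]
  exact Measurable.ite measurableSet_Ioi measurable_const
    (Measurable.ite measurableSet_Iio measurable_const measurable_const)

/-- The half of the high-frequency kernel with a fixed direction of oscillation, along the row
`x₁ = a`, `y₁ = a - σ t`. -/
def rowK (n : ℕ) (Λ : ℝ) (p : ℝ[X]) (e γ a σ x2 : ℝ) (y : ℝ × ℝ) : ℂ :=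
  ((σ * sgn (x2 + y.2 + dd p 1 (2 * a - σ * y.1)) *
      (1 - psi n Λ p (2 * a - σ * y.1) (x2 - y.2) (x2 + y.2)) /
      (2 * bet e y.1 * (x2 - y.2)) : ℝ) : ℂ) *
    Complex.exp (Complex.I * ((-((x2 - y.2) * (γ * ((2 * a - σ * y.1) * (x2 + y.2)
      + dd p 0 (2 * a - σ * y.1))
      - σ * bet e y.1 * (x2 + y.2 + dd p 1 (2 * a - σ * y.1)))) : ℝ) : ℂ))

variable {n : ℕ} {p : ℝ[X]} {Λ e γ a σ : ℝ}

/-- The affine polynomial `2a - σ X`. -/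
def linp (a σ : ℝ) : ℝ[X] := C (2 * a) - C σ * X

lemma linp_eval (a σ t : ℝ) : (linp a σ).eval t = 2 * a - σ * t := by simp [linp]

lemma linp_derivative (a σ : ℝ) : derivative (linp a σ) = C (-σ) := by simp [linp]

lemma linp_natDegree (a σ : ℝ) : (linp a σ).natDegree ≤ 1 := by
  unfold linp
  exact (natDegree_sub_le _ _).trans (max_le ((natDegree_C _).trans_le zero_le_one)
    ((natDegree_C_mul_le σ X).trans natDegree_X_le))

lemma iterate_derivative_comp_linp (P : ℝ[X]) (k : ℕ) :
    derivative^[k] (P.comp (linp a σ)) = C ((-σ) ^ k) * (derivative^[k] P).comp (linp a σ) := by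
  induction k with
  | zero => simp
  | succ k ih =>
    rw [Function.iterate_succ_apply', ih, derivative_mul, derivative_C, zero_mul, zero_add,
      derivative_comp, linp_derivative, Function.iterate_succ_apply', pow_succ, C_mul]
    ring

/-- The polynomial `t ↦ V s + p(s)`, `s = 2a - σ t`. -/
def phaseQ (p : ℝ[X]) (a σ V : ℝ) : ℝ[X] := (C V * X + p).comp (linp a σ)

lemma phaseQ_eval (V t : ℝ) :
    (phaseQ p a σ V).eval t = (2 * a - σ * t) * V + dd p 0 (2 * a - σ * t) := by
  unfold phaseQ
  rw [eval_comp, linp_eval, dd_zero]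
  simp
  ring

lemma phaseQ_derivative_eval (V t : ℝ) :
    (phaseQ p a σ V).derivative.eval t = -σ * (V + dd p 1 (2 * a - σ * t)) := by
  unfold phaseQ
  rw [derivative_comp, eval_mul, linp_derivative, eval_comp, linp_eval, dd_one]
  simp

lemma phaseQ_natDegree (hn : 1 ≤ n) (hp : p.natDegree ≤ n) (V : ℝ) :
    (phaseQ p a σ V).natDegree ≤ n := by
  unfold phaseQ
  rw [natDegree_comp]
  have h1 : (C V * X + p).natDegree ≤ n :=
    (natDegree_add_le _ _).trans (max_le (((natDegree_C_mul_le V X).trans natDegree_X_le).trans hn) hp)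
  calc _ ≤ n * 1 := Nat.mul_le_mul h1 (linp_natDegree a σ)
    _ = n := mul_one n

/-- The polynomial `t ↦ c + p'(s)`, `s = 2a - σ t`. -/
def signP (p : ℝ[X]) (a σ c : ℝ) : ℝ[X] := (C c + derivative p).comp (linp a σ)

lemma signP_eval (c t : ℝ) : (signP p a σ c).eval t = c + dd p 1 (2 * a - σ * t) := by
  unfold signP
  rw [eval_comp, linp_eval, dd_one]
  simp

lemma signP_natDegree (hp : p.natDegree ≤ n) (c : ℝ) : (signP p a σ c).natDegree ≤ n := by
  unfold signP
  rw [natDegree_comp]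
  have h1 : (C c + derivative p).natDegree ≤ n :=
    (natDegree_add_le _ _).trans (max_le (by simp) ((natDegree_derivative_le p).trans (by omega)))
  calc _ ≤ n * 1 := Nat.mul_le_mul h1 (linp_natDegree a σ)
    _ = n := mul_one n

/-- The size of the higher derivatives of `p`. -/
def nu (n : ℕ) (p : ℝ[X]) (s : ℝ) : ℝ := ∑ m ∈ Finset.range n, |dd p (m + 2) s|

lemma nu_nonneg (s : ℝ) : 0 ≤ nu n p s := Finset.sum_nonneg fun _ _ => abs_nonneg _

lemma sum_sq_le_nu_sq (s : ℝ) : ∑ m ∈ Finset.range n, dd p (m + 2) s ^ 2 ≤ nu n p s ^ 2 := by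
  unfold nu
  rw [sq (∑ m ∈ Finset.range n, |dd p (m + 2) s|), Finset.sum_mul]
  refine Finset.sum_le_sum fun m hm => ?_
  rw [← sq_abs, sq]
  exact mul_le_mul_of_nonneg_left
    (Finset.single_le_sum (f := fun m => |dd p (m + 2) s|) (fun _ _ => abs_nonneg _) hm)
    (abs_nonneg _)

lemma coeffSum_phaseQ_ge (hn : 1 ≤ n) (hp : p.natDegree ≤ n) (hσ : |σ| = 1) (V : ℝ) :
    |V + dd p 1 (2 * a)| + nu n p (2 * a)
      ≤ n.factorial * coeffSum n (phaseQ p a σ V).derivative := by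
  have hk : ∀ k < n, |(derivative^[k + 1] (C V * X + p)).eval (2 * a)|
      ≤ n.factorial * |(phaseQ p a σ V).derivative.coeff k| := fun k hk => by
    have h1 : (derivative^[k + 1] (phaseQ p a σ V)).eval 0
        = k.factorial * (phaseQ p a σ V).derivative.coeff k := by
      rw [← coeff_zero_eq_eval_zero, Function.iterate_succ_apply, coeff_iterate_derivative]
      simp [Nat.descFactorial_self]
    have h2 : (derivative^[k + 1] (phaseQ p a σ V)).eval 0
        = (-σ) ^ (k + 1) * (derivative^[k + 1] (C V * X + p)).eval (2 * a) := by
      rw [phaseQ, iterate_derivative_comp_linp, eval_mul, eval_C, eval_comp, linp_eval]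
      simp
    have h3 : |(derivative^[k + 1] (C V * X + p)).eval (2 * a)|
        = k.factorial * |(phaseQ p a σ V).derivative.coeff k| := by
      have := congrArg abs (h2.symm.trans h1)
      rw [abs_mul, abs_pow, abs_neg, hσ, one_pow, one_mul, abs_mul, Nat.abs_cast] at this
      exact this
    rw [h3]
    refine mul_le_mul_of_nonneg_right ?_ (abs_nonneg _)
    exact_mod_cast Nat.factorial_le hk.le
  unfold coeffSum
  rw [Finset.mul_sum]
  refine le_trans ?_ (Finset.sum_le_sum fun k hk' => hk k (Finset.mem_range.1 hk'))
  obtain ⟨n, rfl⟩ := Nat.exists_eq_add_of_le' hn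
  unfold nu
  rw [Finset.sum_range_succ (fun m => |dd p (m + 2) (2 * a)|),
    dd_eq_zero hp (by omega : n + 1 < n + 2), abs_zero, add_zero, add_comm, Finset.sum_range_succ'
      (fun k => |(derivative^[k + 1] (C V * X + p)).eval (2 * a)|)]
  have e0 : derivative (C V * X + p) = C V + derivative p := by simp
  have e1 : ∀ k, derivative^[k + 1 + 1] (C V * X + p) = derivative^[k + 2] p := fun k => by
    rw [Function.iterate_succ_apply, e0, Function.iterate_succ_apply, derivative_add,
      derivative_C, zero_add]
    rfl
  refine add_le_add (le_of_eq ?_) (le_of_eq ?_)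
  · refine Finset.sum_congr rfl fun k _ => ?_
    rw [e1]; rfl
  · rw [zero_add, Function.iterate_one, e0, eval_add, eval_C, dd_one]

lemma min_one_le (hp : p.natDegree ≤ n) (hΛ : 1 ≤ Λ) {s x2 z N : ℝ} (hs : |2 * a - s| ≤ 2)
    (hN : 1 + |x2 + dd p 1 (2 * a) / 2| + nu n p (2 * a) ≤ N) :
    min 1 ((x2 - z) ^ 2 * nn n p s (x2 + z) / Λ ^ 2)
      ≤ 64 * Real.exp 6 * (|x2 - z| * (√Λ / N + |x2 - z|)⁻¹) := by
  set X := x2 + dd p 1 (2 * a) / 2 with hX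
  have hν := nu_nonneg (n := n) (p := p) (2 * a)
  have hN1 : 1 ≤ N := by linarith [abs_nonneg X]
  have hE : 1 ≤ Real.exp 6 := Real.one_le_exp (by norm_num)
  have hΛ1 : 1 ≤ √Λ := Real.one_le_sqrt.2 hΛ
  have hΛ2 : √Λ ^ 2 = Λ := Real.sq_sqrt (by linarith)
  set x := |x2 - z| with hx
  have hx0 : 0 ≤ x := abs_nonneg _
  have hxs : (x2 - z) ^ 2 = x ^ 2 := (sq_abs _).symm
  set ρ := √Λ / N with hρ
  have hρ0 : 0 < ρ := by positivity
  rw [← div_eq_mul_inv, mul_div_assoc', le_div_iff₀ (by positivity)]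
  rcases le_total ρ x with h | h
  · calc _ ≤ 1 * (ρ + x) := mul_le_mul_of_nonneg_right (min_le_left _ _) (by positivity)
      _ ≤ 64 * Real.exp 6 * x := by nlinarith
  · have h1 : nn n p s (x2 + z) ≤ Real.exp 6 * (8 * (N + x) ^ 2) := by
      have e1 := nn_le_exp hp (2 * a) s (x2 + z)
      have e2 : Real.exp (3 * |2 * a - s|) ≤ Real.exp 6 := Real.exp_le_exp.2 (by linarith)
      have e3 : nn n p (2 * a) (x2 + z) ≤ 8 * (N + x) ^ 2 := by
        have e4 : (x2 + z + dd p 1 (2 * a)) ^ 2 ≤ (2 * |X| + x) ^ 2 := by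
          rw [← sq_abs]
          refine pow_le_pow_left₀ (abs_nonneg _) ?_ 2
          calc |x2 + z + dd p 1 (2 * a)| = |2 * X - (x2 - z)| := by rw [hX]; congr 1; ring
            _ ≤ |2 * X| + |x2 - z| := abs_sub _ _
            _ = 2 * |X| + x := by rw [abs_mul, abs_two]
        have e5 := sum_sq_le_nu_sq (n := n) (p := p) (2 * a)
        have e6 : 2 * |X| + x ≤ 2 * (N + x) := by linarith
        have e7 : (2 * |X| + x) ^ 2 ≤ (2 * (N + x)) ^ 2 :=
          pow_le_pow_left₀ (by positivity) e6 2
        have e8 : nu n p (2 * a) ^ 2 ≤ (N + x) ^ 2 :=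
          pow_le_pow_left₀ hν (by linarith [abs_nonneg X]) 2
        have e9 : 1 ≤ (N + x) ^ 2 := one_le_pow₀ (by linarith)
        unfold nn
        linarith
      calc _ ≤ _ := e1
        _ ≤ Real.exp 6 * (8 * (N + x) ^ 2) := mul_le_mul e2 e3 (nn_pos _ _).le (by positivity)
    have hxN : x * N ≤ √Λ := by rwa [hρ, le_div_iff₀ (by positivity)] at h
    have hxΛ : x ≤ √Λ := by nlinarith
    have hxx : x * (N + x) ≤ 2 * √Λ * (√Λ * (x / ρ)) := by
      have : √Λ * (x / ρ) = x * N := by rw [hρ]; field_simp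
      rw [this]
      nlinarith [mul_nonneg hx0 (by linarith : 0 ≤ N)]
    have hxρ : x / ρ ≤ 1 := (div_le_one hρ0).2 h
    have hr : (x2 - z) ^ 2 * nn n p s (x2 + z) / Λ ^ 2 ≤ 32 * Real.exp 6 * (x / ρ) := by
      rw [div_le_iff₀ (by positivity), hxs]
      calc x ^ 2 * nn n p s (x2 + z) ≤ x ^ 2 * (Real.exp 6 * (8 * (N + x) ^ 2)) := by gcongr
        _ = 8 * Real.exp 6 * (x * (N + x)) ^ 2 := by ring
        _ ≤ 8 * Real.exp 6 * (2 * √Λ * (√Λ * (x / ρ))) ^ 2 := by gcongr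
        _ = 32 * Real.exp 6 * ((x / ρ) * (x / ρ)) * (√Λ ^ 2) ^ 2 := by ring
        _ ≤ 32 * Real.exp 6 * ((x / ρ) * 1) * (√Λ ^ 2) ^ 2 := by gcongr
        _ = _ := by rw [hΛ2]; ring
    calc _ ≤ (32 * Real.exp 6 * (x / ρ)) * (ρ + x) :=
          mul_le_mul_of_nonneg_right ((min_le_right _ _).trans hr) (by positivity)
      _ ≤ (32 * Real.exp 6 * (x / ρ)) * (ρ + ρ) := by gcongr
      _ = _ := by field_simp; ring

/-- The amplitude of the `TT*` kernel of a row. -/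
def ampl (n : ℕ) (Λ : ℝ) (p : ℝ[X]) (e a σ x2 x2' z t : ℝ) : ℝ :=
  (1 - psi n Λ p (2 * a - σ * t) (x2 - z) (x2 + z)) *
    (1 - psi n Λ p (2 * a - σ * t) (x2' - z) (x2' + z)) * (4 * e ^ 2 + t ^ 2)⁻¹

/-- The `t`-derivative of `ampl`. -/
def ampl1 (n : ℕ) (Λ : ℝ) (p : ℝ[X]) (e a σ x2 x2' z t : ℝ) : ℝ :=
  (σ * psi1 n Λ p (2 * a - σ * t) (x2 - z) (x2 + z) *
    (1 - psi n Λ p (2 * a - σ * t) (x2' - z) (x2' + z)) +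
  (1 - psi n Λ p (2 * a - σ * t) (x2 - z) (x2 + z)) *
    (σ * psi1 n Λ p (2 * a - σ * t) (x2' - z) (x2' + z))) * (4 * e ^ 2 + t ^ 2)⁻¹ +
  (1 - psi n Λ p (2 * a - σ * t) (x2 - z) (x2 + z)) *
    (1 - psi n Λ p (2 * a - σ * t) (x2' - z) (x2' + z)) *
    (-(2 * t) / (4 * e ^ 2 + t ^ 2) ^ 2)

lemma hasDerivAt_ampl (he : 0 < e) (x2 x2' z t : ℝ) :
    HasDerivAt (ampl n Λ p e a σ x2 x2' z) (ampl1 n Λ p e a σ x2 x2' z t) t := by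
  have hl : HasDerivAt (fun t => 2 * a - σ * t) (-σ) t := by
    simpa using ((hasDerivAt_id t).const_mul σ).const_sub (2 * a)
  have h1 : ∀ u v, HasDerivAt (fun t => 1 - psi n Λ p (2 * a - σ * t) u v)
      (σ * psi1 n Λ p (2 * a - σ * t) u v) t := fun u v =>
    ((HasDerivAt.comp t (h₂ := fun s => psi n Λ p s u v) (hasDerivAt_psi (2 * a - σ * t) u v)
      hl).const_sub 1).congr_deriv (by ring)
  have h2 : HasDerivAt (fun t => (4 * e ^ 2 + t ^ 2)⁻¹) (-(2 * t) / (4 * e ^ 2 + t ^ 2) ^ 2) t := by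
    have h3 : HasDerivAt (fun t : ℝ => 4 * e ^ 2 + t ^ 2) (2 * t) t := by
      simpa using ((hasDerivAt_id t).fun_pow 2).const_add (4 * e ^ 2)
    exact h3.inv (by positivity)
  exact ((h1 _ _).mul (h1 _ _)).mul h2

lemma continuous_ampl1 (he : 0 < e) (x2 x2' z : ℝ) :
    Continuous (ampl1 n Λ p e a σ x2 x2' z) := by
  have h1 : ∀ u v, Continuous fun t => psi1 n Λ p (2 * a - σ * t) u v := fun u v =>
    (continuous_psi1 u v).comp (by fun_prop)
  have h2 : ∀ u v, Continuous fun t => psi n Λ p (2 * a - σ * t) u v := fun u v =>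
    continuous_psi.comp (f := fun t => (2 * a - σ * t, u, v)) (by fun_prop)
  have h3 : ∀ t : ℝ, 4 * e ^ 2 + t ^ 2 ≠ 0 := fun t => by positivity
  have h4 : Continuous fun t : ℝ => (4 * e ^ 2 + t ^ 2)⁻¹ := Continuous.inv₀ (by fun_prop) h3
  have h5 : Continuous fun t : ℝ => -(2 * t) / (4 * e ^ 2 + t ^ 2) ^ 2 :=
    Continuous.div (by fun_prop) (by fun_prop) fun t => pow_ne_zero 2 (h3 t)
  unfold ampl1
  have := h1 (x2 - z) (x2 + z)
  have := h1 (x2' - z) (x2' + z)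
  have := h2 (x2 - z) (x2 + z)
  have := h2 (x2' - z) (x2' + z)
  fun_prop

lemma ampl_bounds (hp : p.natDegree ≤ n) (he : 0 < e) (he1 : e ≤ 1) (hσ : |σ| = 1) {x2 x2' z t m m' : ℝ}
    (h1 : 1 - e ^ 2 ≤ t) (h2 : t ≤ 2 - e ^ 2 / 2)
    (hm : min 1 ((x2 - z) ^ 2 * nn n p (2 * a - σ * t) (x2 + z) / Λ ^ 2) ≤ m)
    (hm' : min 1 ((x2' - z) ^ 2 * nn n p (2 * a - σ * t) (x2' + z) / Λ ^ 2) ≤ m') :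
    |ampl n Λ p e a σ x2 x2' z t| ≤ 640 * (m * m') ∧
      |ampl1 n Λ p e a σ x2 x2' z t| ≤ 640 * (m * m') := by
  obtain ⟨ht0, ht2, -, -⟩ := window_bounds he he1 h1 h2
  have hb : 1 ≤ 4 * e ^ 2 + t ^ 2 := by
    have := half_le_bet he he1 h1
    have h3 := bet_sq (e := e) t
    nlinarith
  have hi : |(4 * e ^ 2 + t ^ 2)⁻¹| ≤ 1 := by
    rw [abs_of_nonneg (by positivity)]; exact inv_le_one_of_one_le₀ hb
  have hi2 : |-(2 * t) / (4 * e ^ 2 + t ^ 2) ^ 2| ≤ 4 := by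
    rw [abs_div, abs_neg, abs_of_nonneg (by positivity : 0 ≤ 2 * t), abs_of_nonneg (by positivity),
      div_le_iff₀ (by positivity)]
    have : 1 ≤ (4 * e ^ 2 + t ^ 2) ^ 2 := one_le_pow₀ hb
    linarith
  have key : ∀ {y μ : ℝ}, min 1 ((y - z) ^ 2 * nn n p (2 * a - σ * t) (y + z) / Λ ^ 2) ≤ μ →
      |1 - psi n Λ p (2 * a - σ * t) (y - z) (y + z)| ≤ 8 * μ ∧
      |σ * psi1 n Λ p (2 * a - σ * t) (y - z) (y + z)| ≤ 24 * μ := fun {y μ} h => by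
    constructor
    · have h1 := psi_le_one (n := n) (Λ := Λ) (p := p) (2 * a - σ * t) (y - z) (y + z)
      rw [abs_of_nonneg (by linarith)]
      exact (one_sub_psi_le _ _ _).trans (by linarith)
    · rw [abs_mul, hσ, one_mul]
      exact (abs_psi1_le hp _ _ _).trans (by linarith)
  obtain ⟨k1, k2⟩ := key hm
  obtain ⟨k3, k4⟩ := key hm'
  have hm0 : 0 ≤ m := by linarith [abs_nonneg (1 - psi n Λ p (2 * a - σ * t) (x2 - z) (x2 + z))]
  have hm0' : 0 ≤ m' := by
    linarith [abs_nonneg (1 - psi n Λ p (2 * a - σ * t) (x2' - z) (x2' + z))]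
  have hmm : 0 ≤ m * m' := by positivity
  constructor
  · unfold ampl
    rw [abs_mul, abs_mul]
    calc _ ≤ (8 * m) * (8 * m') * 1 := by gcongr
      _ ≤ _ := by linarith
  · unfold ampl1
    refine (abs_add_le _ _).trans ?_
    rw [abs_mul (_ + _), abs_mul (_ * _) (_ / _), abs_mul (1 - _) (1 - _)]
    calc _ ≤ ((24 * m) * (8 * m') + (8 * m) * (24 * m')) * 1 + (8 * m) * (8 * m') * 4 := by
          refine add_le_add (mul_le_mul ((abs_add_le _ _).trans (add_le_add ?_ ?_)) hi
            (abs_nonneg _) (by positivity)) (by gcongr)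
          · rw [abs_mul _ (1 - _)]; gcongr
          · rw [abs_mul (1 - _) _]; gcongr
      _ = _ := by ring

lemma rowK_mul_conj (hσ : σ ^ 2 = 1) (x2 x2' z t : ℝ) :
    rowK n Λ p e γ a σ x2 (t, z) * conj (rowK n Λ p e γ a σ x2' (t, z))
      = (((x2 - z)⁻¹ * (x2' - z)⁻¹ : ℝ) : ℂ) *
        (((sgn ((signP p a σ (x2 + z) * signP p a σ (x2' + z)).eval t) : ℝ) : ℂ) *
        (Complex.exp (Complex.I * ((-(x2 - x2') * (γ * (phaseQ p a σ (x2 + x2')).eval t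
          + bet e t * (phaseQ p a σ (x2 + x2')).derivative.eval t) : ℝ) : ℂ)) *
        ((ampl n Λ p e a σ x2 x2' z t : ℝ) : ℂ))) := by
  have hexp : ∀ θ : ℝ, conj (Complex.exp (Complex.I * (θ : ℂ)))
      = Complex.exp (Complex.I * ((-θ : ℝ) : ℂ)) := fun θ => by
    rw [← Complex.exp_conj, map_mul, Complex.conj_I, Complex.conj_ofReal]
    push_cast; ring_nf
  unfold rowK
  rw [map_mul, Complex.conj_ofReal, hexp, eval_mul, signP_eval, signP_eval, phaseQ_eval,
    phaseQ_derivative_eval, sgn_mul]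
  have hb := bet_sq (e := e) t
  have hb4 : (4 * e ^ 2 + t ^ 2)⁻¹ = (2 * bet e t)⁻¹ * (2 * bet e t)⁻¹ := by
    rw [← mul_inv]; congr 1; linear_combination -4 * hb
  have hamp : ∀ S S' A A' : ℝ, σ * S * A / (2 * bet e t * (x2 - z)) *
      (σ * S' * A' / (2 * bet e t * (x2' - z)))
      = (x2 - z)⁻¹ * (x2' - z)⁻¹ * (S * S') * (A * A' * (4 * e ^ 2 + t ^ 2)⁻¹) := by
    intro S S' A A'
    rw [hb4]
    simp only [div_eq_mul_inv, mul_inv]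
    linear_combination (S * A * (2⁻¹ * (bet e t)⁻¹ * (x2 - z)⁻¹) *
      (S' * A' * (2⁻¹ * (bet e t)⁻¹ * (x2' - z)⁻¹))) * hσ
  rw [mul_mul_mul_comm, ← Complex.exp_add, ← mul_add, ← Complex.ofReal_add, ← Complex.ofReal_mul,
    hamp]
  unfold ampl
  push_cast
  rw [show ∀ A B E D : ℂ, A * (B * (E * D)) = A * B * D * E from fun A B E D => by ring]
  congr 2
  ring_nf

end RowKernel

section RowBound

variable {n : ℕ} {p : ℝ[X]} {Λ e γ a σ : ℝ}

/-- The parameter measure of a row. -/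
def rowμ (lo hi M : ℝ) : Measure (ℝ × ℝ) :=
  (volume.restrict (Set.Ioc lo hi)).prod (volume.restrict (Set.Icc (-M) M))

lemma exists_row_inner_bound (n : ℕ) (hn : 1 ≤ n) (Γ : ℝ) (hΓ : 1 / 2 < Γ) :
    ∃ C : ℝ, 0 < C ∧ ∀ p : ℝ[X], p.natDegree ≤ n → ∀ e γ Λ a σ lo hi : ℝ, 0 < e → e ≤ 1 →
    1 / 2 ≤ γ → γ ≤ Γ → 1 ≤ Λ → |σ| = 1 → 1 - e ^ 2 ≤ lo → lo ≤ hi → hi ≤ 2 - e ^ 2 / 2 →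
    ∀ x2 x2' M z : ℝ, M = |x2 + x2' + dd p 1 (2 * a)| + nu n p (2 * a) →
    |x2 + dd p 1 (2 * a) / 2| + nu n p (2 * a) ≤ M →
    |x2' + dd p 1 (2 * a) / 2| + nu n p (2 * a) ≤ M →
    ‖∫ t in Set.Ioc lo hi, rowK n Λ p e γ a σ x2 (t, z) * conj (rowK n Λ p e γ a σ x2' (t, z))‖
      ≤ C * (1 + |x2 - x2'| * M) ^ (-(1 / (16 * n) : ℝ)) *
        ((√Λ / (1 + M) + |x2 - z|)⁻¹ * (√Λ / (1 + M) + |x2' - z|)⁻¹) := by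
  obtain ⟨Cv, hCv, hvdc⟩ := exists_vanDerCorput n hn Γ hΓ
  refine ⟨(2 * n + 1) * (Cv * (640 * (64 * Real.exp 6) ^ 2) * n.factorial), by positivity, ?_⟩
  intro p hp e γ Λ a σ lo hi he he1 hγ hγΓ hΛ hσ hlo hlohi hhi x2 x2' M z hM hX hX'
  have hσ2 : σ ^ 2 = 1 := by rw [← sq_abs, hσ]; norm_num
  have hn1 : (1 : ℝ) ≤ n := by exact_mod_cast hn
  have hM0 : 0 ≤ M := by
    rw [hM]; exact add_nonneg (abs_nonneg _) (nu_nonneg _)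
  set ρ := √Λ / (1 + M) with hρ
  have hρ0 : 0 < ρ := by
    have : 0 < √Λ := Real.sqrt_pos.2 (by linarith)
    positivity
  set c1 := 64 * Real.exp 6 with hc1
  set m := c1 * (|x2 - z| * (ρ + |x2 - z|)⁻¹) with hm
  set m' := c1 * (|x2' - z| * (ρ + |x2' - z|)⁻¹) with hm'
  have hm0 : 0 ≤ m := by positivity
  have hm0' : 0 ≤ m' := by positivity
  set Q := phaseQ p a σ (x2 + x2') with hQ
  set D := coeffSum n Q.derivative with hD
  have hD0 : 0 ≤ D := coeffSum_nonneg _ _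
  have hMD : M ≤ n.factorial * D := by rw [hM]; exact coeffSum_phaseQ_ge hn hp hσ _
  set W := (1 + |x2 - x2'| * M) ^ (-(1 / (16 * n) : ℝ)) with hW
  have hW0 : 0 ≤ W := by positivity
  have hfac : (1 : ℝ) ≤ n.factorial := by exact_mod_cast Nat.one_le_iff_ne_zero.2 n.factorial_ne_zero
  have hDW : (1 + |-(x2 - x2')| * D) ^ (-(1 / (16 * n) : ℝ)) ≤ n.factorial * W := by
    have h1 : (1 + |x2 - x2'| * M) / n.factorial ≤ 1 + |-(x2 - x2')| * D := by
      rw [abs_neg, div_le_iff₀ (by positivity)]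
      nlinarith [mul_le_mul_of_nonneg_left hMD (abs_nonneg (x2 - x2'))]
    calc _ ≤ ((1 + |x2 - x2'| * M) / n.factorial) ^ (-(1 / (16 * n) : ℝ)) :=
          Real.rpow_le_rpow_of_nonpos (by positivity) h1 (by
            rw [neg_nonpos]; positivity)
      _ = (n.factorial : ℝ) ^ (1 / (16 * n) : ℝ) * W := by
          rw [Real.div_rpow (by positivity) (by positivity), div_eq_inv_mul,
            ← Real.rpow_neg (by positivity), neg_neg]
      _ ≤ (n.factorial : ℝ) ^ (1 : ℝ) * W := by
          refine mul_le_mul_of_nonneg_right ?_ hW0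
          refine Real.rpow_le_rpow_of_exponent_le hfac ?_
          rw [div_le_one (by positivity)]; linarith
      _ = _ := by rw [Real.rpow_one]
  have hmin : ∀ {y t : ℝ}, |y + dd p 1 (2 * a) / 2| + nu n p (2 * a) ≤ M → t ∈ Set.Icc lo hi →
      min 1 ((y - z) ^ 2 * nn n p (2 * a - σ * t) (y + z) / Λ ^ 2)
        ≤ c1 * (|y - z| * (ρ + |y - z|)⁻¹) := fun {y t} hy ht => by
    obtain ⟨ht0, ht2, -, -⟩ := window_bounds he he1 (t := t) (by linarith [ht.1])
      (by linarith [ht.2])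
    refine min_one_le hp hΛ (a := a) ?_ (by linarith)
    rw [sub_sub_cancel, abs_mul, hσ, one_mul, abs_of_nonneg ht0]
    exact ht2
  have hb : ∀ t ∈ Set.Icc lo hi, |ampl n Λ p e a σ x2 x2' z t| ≤ 640 * (m * m') ∧
      |ampl1 n Λ p e a σ x2 x2' z t| ≤ 640 * (m * m') := fun t ht =>
    ampl_bounds hp he he1 hσ (by linarith [ht.1]) (by linarith [ht.2]) (hmin hX ht) (hmin hX' ht)
  set P := signP p a σ (x2 + z) * signP p a σ (x2' + z) with hP
  set F : ℝ → ℂ := fun t => Complex.exp (Complex.I * ((-(x2 - x2') * (γ * Q.eval t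
    + bet e t * Q.derivative.eval t) : ℝ) : ℂ)) * ((ampl n Λ p e a σ x2 x2' z t : ℝ) : ℂ) with hF
  have hFc : Continuous F := by
    have h1 : Continuous (ampl n Λ p e a σ x2 x2' z) :=
      continuous_iff_continuousAt.2 fun t => (hasDerivAt_ampl he x2 x2' z t).continuousAt
    have h2 := continuous_bet (e := e)
    have h3 := Q.continuous
    have h4 := Q.derivative.continuous
    fun_prop
  have hPd : P.roots.toFinset.card ≤ 2 * n := by
    refine (Multiset.toFinset_card_le _).trans ((card_roots' P).trans ?_)
    refine natDegree_mul_le.trans ?_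
    have e1 := signP_natDegree hp (a := a) (σ := σ) (x2 + z)
    have e2 := signP_natDegree hp (a := a) (σ := σ) (x2' + z)
    omega
  have hsub := norm_integral_sign_mul_le P hFc (B := Cv * (640 * (m * m')) * (n.factorial * W))
    (2 * n) lo hi hlohi ((Finset.card_filter_le _ _).trans hPd) (fun a' b' ha' hab' hb' => by
      refine (hvdc Q (phaseQ_natDegree hn hp _) e γ (-(x2 - x2')) he he1 hγ hγΓ a' b' hab'
        (by linarith) (by linarith) _ _ (640 * (m * m')) (hasDerivAt_ampl he x2 x2' z)
        (continuous_ampl1 he x2 x2' z) (fun t ht => (hb t ⟨by linarith [ht.1], by linarith [ht.2]⟩).1)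
        (fun t ht => (hb t ⟨by linarith [ht.1], by linarith [ht.2]⟩).2)).trans ?_
      exact mul_le_mul_of_nonneg_left hDW (by positivity))
  have e1 : ∫ t in Set.Ioc lo hi, rowK n Λ p e γ a σ x2 (t, z) *
      conj (rowK n Λ p e γ a σ x2' (t, z)) = (((x2 - z)⁻¹ * (x2' - z)⁻¹ : ℝ) : ℂ) *
      ∫ t in lo..hi, ((SignType.sign (P.eval t) : ℝ) : ℂ) * F t := by
    rw [intervalIntegral.integral_of_le hlohi, ← integral_const_mul]
    exact integral_congr_ae (.of_forall fun t => rowK_mul_conj hσ2 x2 x2' z t)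
  rw [e1, norm_mul, Complex.norm_real, Real.norm_eq_abs, abs_mul, abs_inv, abs_inv]
  have hinv : ∀ x : ℝ, 0 ≤ x → x⁻¹ * (c1 * (x * (ρ + x)⁻¹)) ≤ c1 * (ρ + x)⁻¹ := fun x hx => by
    rcases hx.eq_or_lt with rfl | hx
    · rw [inv_zero, zero_mul]; positivity
    · rw [show x⁻¹ * (c1 * (x * (ρ + x)⁻¹)) = (x⁻¹ * x) * (c1 * (ρ + x)⁻¹) by ring,
        inv_mul_cancel₀ hx.ne', one_mul]
  calc |x2 - z|⁻¹ * |x2' - z|⁻¹ * ‖∫ t in lo..hi, ((SignType.sign (P.eval t) : ℝ) : ℂ) * F t‖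
      ≤ |x2 - z|⁻¹ * |x2' - z|⁻¹ *
        (((2 * n : ℕ) + 1) * (Cv * (640 * (m * m')) * (n.factorial * W))) := by gcongr
    _ = (2 * n + 1) * (Cv * 640 * n.factorial) * W * ((|x2 - z|⁻¹ * m) * (|x2' - z|⁻¹ * m')) := by
        push_cast; ring
    _ ≤ (2 * n + 1) * (Cv * 640 * n.factorial) * W * ((c1 * (ρ + |x2 - z|)⁻¹) *
        (c1 * (ρ + |x2' - z|)⁻¹)) := by
        refine mul_le_mul_of_nonneg_left ?_ (by positivity)
        exact mul_le_mul (hinv _ (abs_nonneg _)) (hinv _ (abs_nonneg _)) (by positivity)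
          (by positivity)
    _ = _ := by ring

lemma exists_row_kernel_bound (n : ℕ) (hn : 1 ≤ n) (Γ : ℝ) (hΓ : 1 / 2 < Γ) :
    ∃ C : ℝ, 0 < C ∧ ∀ p : ℝ[X], p.natDegree ≤ n → ∀ e γ Λ a σ lo hi M2 : ℝ, 0 < e → e ≤ 1 →
    1 / 2 ≤ γ → γ ≤ Γ → 1 ≤ Λ → |σ| = 1 → 1 - e ^ 2 ≤ lo → lo ≤ hi → hi ≤ 2 - e ^ 2 / 2 →
    ∀ x2 x2' : ℝ, x2 ≠ x2' →
    0 ≤ (x2 + dd p 1 (2 * a) / 2) * (x2' + dd p 1 (2 * a) / 2) →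
    ‖∫ y, rowK n Λ p e γ a σ x2 y * conj (rowK n Λ p e γ a σ x2' y) ∂(rowμ lo hi M2)‖ₑ
      ≤ ENNReal.ofReal (C * √Λ ^ (-(1 / (32 * n) : ℝ)) *
        ((1 + |x2 + dd p 1 (2 * a) / 2| + nu n p (2 * a)) * profile (1 / (32 * n))
        ((1 + |x2 + dd p 1 (2 * a) / 2| + nu n p (2 * a)) * (x2' - x2)))) := by
  have hn1 : (1 : ℝ) ≤ n := by exact_mod_cast hn
  set h : ℝ := 1 / (32 * n) with hh
  have hh0 : 0 < h := by positivity
  have hh1 : h ≤ 1 := by rw [hh, div_le_one (by positivity)]; linarith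
  obtain ⟨C1, hC1, hin⟩ := exists_row_inner_bound n hn Γ hΓ
  obtain ⟨C2, hC2, hconv⟩ := lintegral_inv_mul_inv_le hh0 hh1
  refine ⟨C1 * C2 * 48, by positivity, ?_⟩
  intro p hp e γ Λ a σ lo hi M2 he he1 hγ hγΓ hΛ hσ hlo hlohi hhi x2 x2' hne hXX
  set X := x2 + dd p 1 (2 * a) / 2 with hX
  set X' := x2' + dd p 1 (2 * a) / 2 with hX'
  set ν := nu n p (2 * a) with hν
  have hν0 : 0 ≤ ν := nu_nonneg _
  have hsum : |X + X'| = |X| + |X'| := by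
    rcases (mul_nonneg_iff.1 hXX) with ⟨h1, h2⟩ | ⟨h1, h2⟩
    · rw [abs_of_nonneg h1, abs_of_nonneg h2, abs_of_nonneg (by linarith)]
    · rw [abs_of_nonpos h1, abs_of_nonpos h2, abs_of_nonpos (by linarith)]; ring
  have hV : x2 + x2' + dd p 1 (2 * a) = X + X' := by rw [hX, hX']; ring
  have hδ' : X - X' = x2 - x2' := by rw [hX, hX']; ring
  set δ := |x2 - x2'| with hδ
  have hδ0 : 0 < δ := abs_pos.2 (sub_ne_zero.2 hne)
  set M := |X| + |X'| + ν with hM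
  set N := 1 + |X| + ν with hN
  have hN1 : 1 ≤ N := by rw [hN]; linarith [abs_nonneg X]
  have hM0 : 0 ≤ M := by positivity
  have hXd : |X'| ≤ |X| + δ := by
    rw [hδ, ← hδ']
    have := abs_sub_abs_le_abs_sub X' X
    rw [abs_sub_comm] at this
    linarith
  have hdX : δ ≤ |X| + |X'| := by rw [hδ, ← hδ']; exact abs_sub _ _
  by_cases hint : Integrable (fun y => rowK n Λ p e γ a σ x2 y * conj (rowK n Λ p e γ a σ x2' y))
      (rowμ lo hi M2)
  swap
  · rw [integral_undef hint]; simp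
  have hsl : 0 < √Λ := Real.sqrt_pos.2 (by linarith)
  set ρ := √Λ / (1 + M) with hρ
  have hρ0 : 0 < ρ := by positivity
  set W := (1 + δ * M) ^ (-(1 / (16 * n) : ℝ)) with hW
  have hW0 : 0 ≤ W := by positivity
  rw [rowμ, integral_prod_symm _ hint]
  refine (enorm_integral_le_lintegral_enorm _).trans ?_
  calc _ ≤ ∫⁻ z in Set.Icc (-M2) M2, ENNReal.ofReal (C1 * W *
        ((ρ + |x2 - z|)⁻¹ * (ρ + |x2' - z|)⁻¹)) := by
        refine lintegral_mono fun z => ?_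
        rw [← ofReal_norm]
        refine ENNReal.ofReal_le_ofReal ?_
        exact hin p hp e γ Λ a σ lo hi he he1 hγ hγΓ hΛ hσ hlo hlohi hhi x2 x2' M z
          (by rw [hV, hsum]) (by rw [hM]; linarith [abs_nonneg X'])
          (by rw [hM]; linarith [abs_nonneg X])
    _ ≤ ∫⁻ z, ENNReal.ofReal (C1 * W * ((ρ + |x2 - z|)⁻¹ * (ρ + |x2' - z|)⁻¹)) :=
        lintegral_mono' Measure.restrict_le_self le_rfl
    _ = ENNReal.ofReal (C1 * W) * ∫⁻ z, ENNReal.ofReal ((ρ + |x2 - z|)⁻¹ * (ρ + |x2' - z|)⁻¹) := by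
        simp_rw [ENNReal.ofReal_mul (show 0 ≤ C1 * W by positivity)]
        rw [lintegral_const_mul' _ _ ENNReal.ofReal_ne_top]
    _ ≤ ENNReal.ofReal (C1 * W) * ENNReal.ofReal (C2 * δ ^ (h - 1) * ρ ^ (-h)) := by
        gcongr
        exact hconv ρ x2 x2' hρ0 hne
    _ ≤ _ := by
        rw [← ENNReal.ofReal_mul (by positivity)]
        refine ENNReal.ofReal_le_ofReal ?_
        have hprof := decay_le_profile (h := h) (δ := δ) (N := N) (M := M) hh0 hh1 hδ0 hN1
          (by rw [hN, hM]; linarith [abs_nonneg X']) (by rw [hN, hM]; linarith)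
          (by rw [hM]; linarith)
        have hWe : W = (1 + δ * M) ^ (-(2 * h)) := by
          rw [hW]; congr 1; rw [hh]; field_simp; norm_num
        have hρe : ρ ^ (-h) = √Λ ^ (-h) * (1 + M) ^ h := by
          rw [hρ, Real.div_rpow hsl.le (by positivity), div_eq_mul_inv,
            ← Real.rpow_neg (by positivity), neg_neg]
        have hpe : profile h (N * (x2' - x2)) = profile h (N * δ) := by
          unfold profile
          rw [abs_mul, abs_mul, hδ, abs_abs, abs_sub_comm x2' x2]
        rw [hpe, hWe, hρe]
        calc _ = C1 * C2 * √Λ ^ (-h) * (δ ^ (h - 1) * (1 + M) ^ h * (1 + δ * M) ^ (-(2 * h))) := by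
              ring
          _ ≤ C1 * C2 * √Λ ^ (-h) * (48 * (N * profile h (N * δ))) := by gcongr
          _ = _ := by ring

end RowBound

section RowOperator

variable {n : ℕ} {p : ℝ[X]} {Λ e γ a σ : ℝ}

@[fun_prop]
lemma measurable_bet : Measurable (bet e) := continuous_bet.measurable

@[fun_prop]
lemma measurable_dd (p : ℝ[X]) (m : ℕ) : Measurable (dd p m) := (continuous_dd p m).measurable

lemma measurable_psi : Measurable fun z : ℝ × ℝ × ℝ => psi n Λ p z.1 z.2.1 z.2.2 :=
  (continuous_psi (n := n) (Λ := Λ) (p := p)).measurable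

lemma measurable_psi_comp {Y : Type*} [MeasurableSpace Y] {s u v : Y → ℝ} (hs : Measurable s)
    (hu : Measurable u) (hv : Measurable v) : Measurable fun x => psi n Λ p (s x) (u x) (v x) :=
  measurable_psi.comp (f := fun x => (s x, u x, v x)) (hs.prodMk (hu.prodMk hv))

lemma measurable_nn_comp {Y : Type*} [MeasurableSpace Y] {s v : Y → ℝ} (hs : Measurable s)
    (hv : Measurable v) : Measurable fun x => nn n p (s x) (v x) :=
  continuous_nn.measurable.comp (hs.prodMk hv)

lemma measurable_rowK_comp {Y : Type*} [MeasurableSpace Y] {fa fx ft fz : Y → ℝ}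
    (ha : Measurable fa) (hx : Measurable fx) (ht : Measurable ft) (hz : Measurable fz) :
    Measurable fun q => rowK n Λ p e γ (fa q) σ (fx q) (ft q, fz q) := by
  unfold rowK
  have h := measurable_psi_comp (n := n) (p := p) (Λ := Λ)
    (s := fun q => 2 * fa q - σ * ft q) (u := fun q => fx q - fz q)
    (v := fun q => fx q + fz q) (by fun_prop) (by fun_prop) (by fun_prop)
  simp only
  fun_prop

lemma exists_nn_bound (n : ℕ) (p : ℝ[X]) (A B : ℝ) : ∃ C : ℝ, 1 ≤ C ∧ ∀ s v, |s| ≤ A → |v| ≤ B →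
    nn n p s v ≤ C := by
  obtain ⟨C, hC⟩ := ((isCompact_Icc (a := -A) (b := A)).prod
    (isCompact_Icc (a := -B) (b := B))).exists_bound_of_continuousOn
    (continuous_nn (n := n) (p := p)).continuousOn
  refine ⟨max C 1, le_max_right _ _, fun s v hs hv => ?_⟩
  have := hC (s, v) ⟨abs_le.1 hs, abs_le.1 hv⟩
  exact (le_abs_self _).trans (this.trans (le_max_left _ _))

lemma norm_rowK_le (he : 0 < e) (he1 : e ≤ 1) (hΛ : 1 ≤ Λ) (hσ : |σ| = 1) {x2 t z : ℝ}
    (ht : 1 - e ^ 2 ≤ t) :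
    ‖rowK n Λ p e γ a σ x2 (t, z)‖ ≤ 8 * nn n p (2 * a - σ * t) (x2 + z) := by
  have hb := half_le_bet he he1 ht
  have h1 := psi_le_one (n := n) (Λ := Λ) (p := p) (2 * a - σ * t) (x2 - z) (x2 + z)
  have h2 := one_sub_psi_le (n := n) (Λ := Λ) (p := p) (2 * a - σ * t) (x2 - z) (x2 + z)
  have hN := one_le_nn (n := n) (p := p) (2 * a - σ * t) (x2 + z)
  unfold rowK
  simp only
  rw [norm_mul, mul_comm Complex.I, Complex.norm_exp_ofReal_mul_I, mul_one, Complex.norm_real,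
    Real.norm_eq_abs, abs_div, abs_mul, abs_mul, hσ, one_mul, abs_of_nonneg (sub_nonneg.2 h1),
    abs_mul, abs_mul, abs_two, abs_of_pos (bet_pos he t)]
  set N := nn n p (2 * a - σ * t) (x2 + z)
  have h3 : 1 - psi n Λ p (2 * a - σ * t) (x2 - z) (x2 + z) ≤ 8 * (|x2 - z| * N) := by
    refine h2.trans (mul_le_mul_of_nonneg_left ?_ (by norm_num))
    rcases le_total 1 |x2 - z| with h | h
    · exact (min_le_left _ _).trans (by nlinarith)
    · refine (min_le_right _ _).trans ?_
      rw [div_le_iff₀ (by positivity), ← sq_abs]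
      have hΛ2 : 1 ≤ Λ ^ 2 := one_le_pow₀ hΛ
      have h4 : |x2 - z| ^ 2 * N ≤ |x2 - z| * N := by
        have := abs_nonneg (x2 - z)
        have : |x2 - z| ^ 2 ≤ |x2 - z| := by nlinarith
        gcongr
      have h5 : 0 ≤ |x2 - z| * N := by positivity
      nlinarith
  refine div_le_of_le_mul₀ (by have := bet_pos he t; positivity) (by positivity) ?_
  calc _ ≤ 1 * (8 * (|x2 - z| * N)) :=
        mul_le_mul (abs_sgn_le _) h3 (by linarith) zero_le_one
    _ ≤ 8 * N * (2 * bet e t * |x2 - z|) := by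
        have h6 : 0 ≤ 8 * N * |x2 - z| := by positivity
        nlinarith

lemma rowμ_eq (lo hi M : ℝ) :
    rowμ lo hi M = (volume : Measure (ℝ × ℝ)).restrict (Set.Ioc lo hi ×ˢ Set.Icc (-M) M) := by
  rw [rowμ, Measure.prod_restrict]; rfl

instance (lo hi M : ℝ) : IsFiniteMeasure (rowμ lo hi M) := by unfold rowμ; infer_instance

lemma measurable_profile (h : ℝ) : Measurable (profile h) := by unfold profile; fun_prop

lemma exists_row_bound (n : ℕ) (hn : 1 ≤ n) (Γ : ℝ) (hΓ : 1 / 2 < Γ) :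
    ∃ C : ℝ, 0 < C ∧ ∀ p : ℝ[X], p.natDegree ≤ n → ∀ e γ Λ a σ lo hi M2 : ℝ, 0 < e → e ≤ 1 →
    1 / 2 ≤ γ → γ ≤ Γ → 1 ≤ Λ → |σ| = 1 → 1 - e ^ 2 ≤ lo → lo ≤ hi → hi ≤ 2 - e ^ 2 / 2 →
    ∀ f : ℝ × ℝ → ℂ, MemLp f 2 (rowμ lo hi M2) →
    sqn (volume.restrict (Set.Icc (-M2) M2)) (op (rowμ lo hi M2) (rowK n Λ p e γ a σ) f)
      ≤ ENNReal.ofReal (C * √Λ ^ (-(1 / (32 * n) : ℝ))) * sqn (rowμ lo hi M2) f := by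
  obtain ⟨C, hC, hker⟩ := exists_row_kernel_bound n hn Γ hΓ
  have hh0 : (0 : ℝ) < 1 / (32 * n) := by have : (1 : ℝ) ≤ n := by exact_mod_cast hn
                                          positivity
  set h : ℝ := 1 / (32 * n) with hh
  set I := ∫ x, profile h x with hI
  have hI0 : 0 ≤ I := integral_nonneg fun x => profile_nonneg h x
  refine ⟨2 * (C * I) + 1, by positivity, ?_⟩
  intro p hp e γ Λ a σ lo hi M2 he he1 hγ hγΓ hΛ hσ hlo hlohi hhi f hf
  set L := √Λ ^ (-h) with hL
  have hL0 : 0 ≤ L := by positivity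
  set N : ℝ → ℝ := fun x2 => 1 + |x2 + dd p 1 (2 * a) / 2| + nu n p (2 * a) with hN
  have hN0 : ∀ x, 0 < N x := fun x => by
    have := nu_nonneg (n := n) (p := p) (2 * a)
    rw [hN]; positivity
  have hK : Measurable (Function.uncurry (rowK n Λ p e γ a σ)) :=
    measurable_rowK_comp (fa := fun _ => a) (fx := fun q : ℝ × (ℝ × ℝ) => q.1)
      (ft := fun q => q.2.1) (fz := fun q => q.2.2) (by fun_prop) (by fun_prop) (by fun_prop)
      (by fun_prop)
  obtain ⟨B, hB1, hB⟩ := exists_nn_bound n p (2 * |a| + 2) (2 * |M2|)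
  set k1 : ℝ → ℝ → ℝ≥0∞ := fun x x' => ENNReal.ofReal (C * L * (N x * profile h (N x * (x' - x))))
    with hk1
  have hk1m : Measurable (Function.uncurry k1) := by
    have := measurable_profile h
    have hNm : Measurable N := by rw [hN]; fun_prop
    rw [hk1]
    unfold Function.uncurry
    fun_prop
  have hk1r : ∀ x, ∫⁻ x', k1 x x' ≤ ENNReal.ofReal (C * L * I) := fun x => by
    rw [hk1]
    simp only
    rw [lintegral_sub_right_eq_self (fun x' => ENNReal.ofReal (C * L * (N x *
      profile h (N x * x')))) x]
    simp_rw [ENNReal.ofReal_mul (show 0 ≤ C * L by positivity)]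
    rw [lintegral_const_mul' _ _ ENNReal.ofReal_ne_top, lintegral_profile_scaled hh0 (hN0 x)]
  have half : ∀ S : Set ℝ, MeasurableSet S → S ⊆ Set.Icc (-M2) M2 →
      (∀ x ∈ S, ∀ x' ∈ S, 0 ≤ (x + dd p 1 (2 * a) / 2) * (x' + dd p 1 (2 * a) / 2)) →
      sqn (volume.restrict S) (op (rowμ lo hi M2) (rowK n Λ p e γ a σ) f)
        ≤ ENNReal.ofReal (C * L * I) * sqn (rowμ lo hi M2) f := by
    intro S hS hSM hSs
    have : IsFiniteMeasure (volume.restrict S) :=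
      ⟨by rw [Measure.restrict_apply_univ]
          exact (measure_mono hSM).trans_lt measure_Icc_lt_top⟩
    have : IsFiniteMeasure ((volume : Measure (ℝ × ℝ)).restrict
      (Set.Ioc lo hi ×ˢ Set.Icc (-M2) M2)) := by rw [← rowμ_eq]; infer_instance
    rw [rowμ_eq] at hf ⊢
    refine sqn_op_le_of_ttstar_restrict hS (measurableSet_Ioc.prod measurableSet_Icc) hK
      (C := 8 * B) (by positivity) ?_ ?_ hf
    · rintro x hx ⟨t, z⟩ ⟨ht, hz⟩
      obtain ⟨ht0, ht2, -, -⟩ := window_bounds he he1 (t := t) (by linarith [ht.1])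
        (by linarith [ht.2])
      refine (norm_rowK_le he he1 hΛ hσ (by linarith [ht.1])).trans ?_
      refine mul_le_mul_of_nonneg_left (hB _ _ ?_ ?_) (by norm_num)
      · refine (abs_sub _ _).trans ?_
        rw [abs_mul, abs_mul, hσ, abs_two, abs_of_nonneg ht0]
        linarith
      · refine (abs_add_le _ _).trans ?_
        have h1 : |x| ≤ |M2| := by
          have := hSM hx
          exact (abs_le.2 this).trans (le_abs_self _)
        have h2 : |z| ≤ |M2| := (abs_le.2 hz).trans (le_abs_self _)
        linarith
    · intro F hF
      refine le_trans ?_ (schur_form (μ := volume.restrict S)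
        (k := fun x x' => min (k1 x x') (k1 x' x)) (A := ENNReal.ofReal (C * L * I))
        (B := ENNReal.ofReal (C * L * I)) (S := ENNReal.ofReal (C * L * I))
        (hk1m.min (hk1m.comp measurable_swap))
        (.of_forall fun x => ?_) (.of_forall fun x => ?_) (le_of_eq (sq _).symm) hF)
      · refine lintegral_mono_ae ((ae_restrict_iff' hS).2 (.of_forall fun x hx => ?_))
        refine lintegral_mono_ae ?_
        have hne : ∀ᵐ x' ∂(volume.restrict S), x' ≠ x :=
          ae_restrict_of_ae (Measure.ae_ne volume x)
        filter_upwards [hne, ae_restrict_mem hS] with x' hx' hx'S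
        rw [← rowμ_eq]
        refine mul_le_mul_right (le_min ?_ ?_) _
        · exact hker p hp e γ Λ a σ lo hi M2 he he1 hγ hγΓ hΛ hσ hlo hlohi hhi x x' hx'.symm
            (hSs x hx x' hx'S)
        · have h1 := hker p hp e γ Λ a σ lo hi M2 he he1 hγ hγΓ hΛ hσ hlo hlohi hhi x' x hx'
            (hSs x' hx'S x hx)
          refine le_trans (le_of_eq ?_) h1
          rw [← ofReal_norm, ← ofReal_norm, ← RCLike.norm_conj, ← integral_conj]
          congr 3
          funext y
          rw [map_mul, Complex.conj_conj, mul_comm]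
      · exact (lintegral_mono' Measure.restrict_le_self fun x' => min_le_left _ _).trans (hk1r x)
      · exact (lintegral_mono' Measure.restrict_le_self fun x' => min_le_right _ _).trans (hk1r x)
  set S1 : Set ℝ := {x | 0 ≤ x + dd p 1 (2 * a) / 2} with hS1
  have hS1m : MeasurableSet S1 := measurableSet_le measurable_const (by fun_prop)
  have h1 := half (Set.Icc (-M2) M2 ∩ S1) (measurableSet_Icc.inter hS1m) Set.inter_subset_left
    (fun x hx x' hx' => mul_nonneg hx.2 hx'.2)
  have h2 := half (Set.Icc (-M2) M2 \ S1) (measurableSet_Icc.diff hS1m) Set.sdiff_subset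
    (fun x hx x' hx' => mul_nonneg_of_nonpos_of_nonpos (le_of_lt (not_le.1 hx.2))
      (le_of_lt (not_le.1 hx'.2)))
  unfold sqn at h1 h2 ⊢
  rw [← lintegral_inter_add_sdiff _ (Set.Icc (-M2) M2) hS1m]
  refine (add_le_add h1 h2).trans ?_
  rw [← add_mul, ← ENNReal.ofReal_add (by positivity) (by positivity)]
  gcongr
  nlinarith

end RowOperator

section HighFrequency

variable {n : ℕ} {p : ℝ[X]} {Λ e γ a σ : ℝ}

/-- The high-frequency half kernel, with `σ = ±1` the sign of `x₁ - y₁`. -/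
def highK (n : ℕ) (Λ : ℝ) (p : ℝ[X]) (e γ lo hi σ : ℝ) (x y : ℝ × ℝ) : ℂ :=
  (Set.Ioc lo hi).indicator (fun t => rowK n Λ p e γ x.1 σ x.2 (t, y.2)) (σ * (x.1 - y.1))

/-- The box `[-M₁, M₁) × [-M₂, M₂]`. -/
def box (M1 M2 : ℝ) : Set (ℝ × ℝ) := Set.Ico (-M1) M1 ×ˢ Set.Icc (-M2) M2

lemma measurableSet_box (M1 M2 : ℝ) : MeasurableSet (box M1 M2) :=
  measurableSet_Ico.prod measurableSet_Icc

instance (M1 M2 : ℝ) : IsFiniteMeasure ((volume : Measure (ℝ × ℝ)).restrict (box M1 M2)) :=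
  ⟨by rw [Measure.restrict_apply_univ, box, Measure.volume_eq_prod, Measure.prod_prod]
      exact ENNReal.mul_lt_top measure_Ico_lt_top measure_Icc_lt_top⟩

lemma measurePreserving_row (a : ℝ) (hσ : σ = 1 ∨ σ = -1) :
    MeasurePreserving (fun w : ℝ × ℝ => (a - σ * w.1, w.2)) volume volume := by
  have h1 : MeasurePreserving (fun t : ℝ => a - σ * t) volume volume := by
    rcases hσ with rfl | rfl
    · simpa using Measure.measurePreserving_sub_left (volume : Measure ℝ) a
    · simpa using measurePreserving_add_left (volume : Measure ℝ) a
  exact h1.prod (MeasurePreserving.id _)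

lemma measurableEmbedding_row (a : ℝ) (hσ : σ = 1 ∨ σ = -1) :
    MeasurableEmbedding (fun w : ℝ × ℝ => (a - σ * w.1, w.2)) := by
  have h1 : MeasurableEmbedding (fun t : ℝ => a - σ * t) := by
    rcases hσ with rfl | rfl
    · simpa using (Homeomorph.subLeft a).measurableEmbedding
    · simpa using (Homeomorph.addLeft a).measurableEmbedding
  exact h1.prodMap MeasurableEmbedding.id

lemma exists_high_bound (n : ℕ) (hn : 1 ≤ n) (Γ : ℝ) (hΓ : 1 / 2 < Γ) :
    ∃ C : ℝ, 0 < C ∧ ∀ p : ℝ[X], p.natDegree ≤ n → ∀ e γ Λ σ lo hi M1 M2 : ℝ, 0 < e → e ≤ 1 →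
    1 / 2 ≤ γ → γ ≤ Γ → 1 ≤ Λ → (σ = 1 ∨ σ = -1) → 1 - e ^ 2 ≤ lo → lo ≤ hi → hi ≤ 2 - e ^ 2 / 2 →
    ∀ f : ℝ × ℝ → ℂ, MemLp f 2 (volume.restrict (box M1 M2)) →
    sqn (volume.restrict (box M1 M2))
      (op (volume.restrict (box M1 M2)) (highK n Λ p e γ lo hi σ) f)
      ≤ ENNReal.ofReal (C * √Λ ^ (-(1 / (32 * n) : ℝ))) * sqn (volume.restrict (box M1 M2)) f := by
  obtain ⟨C, hC, hrow⟩ := exists_row_bound n hn Γ hΓ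
  refine ⟨2 * C, by positivity, ?_⟩
  intro p hp e γ Λ σ lo hi M1 M2 he he1 hγ hγΓ hΛ hσ hlo hlohi hhi f hf
  have hσa : |σ| = 1 := by rcases hσ with rfl | rfl <;> simp
  have hσ2 : ∀ x, σ * (σ * x) = x := fun x => by rcases hσ with rfl | rfl <;> ring
  set D := box M1 M2 with hD
  have hDm : MeasurableSet D := measurableSet_box M1 M2
  set g := D.indicator f with hg
  have hgL : MemLp g 2 volume := (memLp_indicator_iff_restrict hDm).2 hf
  have hgs : sqn volume g = sqn (volume.restrict D) f := by
    unfold sqn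
    rw [← lintegral_indicator hDm]
    refine lintegral_congr fun x => ?_
    by_cases hx : x ∈ D <;> simp [hg, hx]
  set Φ : ℝ → ℝ × ℝ → ℝ × ℝ := fun a w => (a - σ * w.1, w.2) with hΦ
  have hgΦ : ∀ a, MemLp (g ∘ Φ a) 2 volume := fun a =>
    hgL.comp_measurePreserving (measurePreserving_row a hσ)
  have hop : ∀ a x2, op (volume.restrict D) (highK n Λ p e γ lo hi σ) f (a, x2)
      = op (rowμ lo hi M2) (rowK n Λ p e γ a σ) (g ∘ Φ a) x2 := fun a x2 => by
    unfold op
    rw [rowμ_eq, ← integral_indicator hDm, ← integral_indicator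
      (measurableSet_Ioc.prod measurableSet_Icc),
      ← (measurePreserving_row a hσ).integral_comp (measurableEmbedding_row a hσ)]
    refine integral_congr_ae (.of_forall fun w => ?_)
    simp only [Function.comp, hΦ, hg, highK]
    have e1 : σ * (a - (a - σ * w.1)) = w.1 := by rw [sub_sub_cancel]; exact hσ2 _
    by_cases hw : (a - σ * w.1, w.2) ∈ D
    · rw [Set.indicator_of_mem hw, e1]
      by_cases hw1 : w.1 ∈ Set.Ioc lo hi
      · rw [Set.indicator_of_mem hw1, Set.indicator_of_mem (s := Set.Ioc lo hi ×ˢ _) ⟨hw1, hw.2⟩,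
          Set.indicator_of_mem hw]
      · rw [Set.indicator_of_notMem hw1, Set.indicator_of_notMem (s := Set.Ioc lo hi ×ˢ _)
          (fun h => hw1 h.1), zero_mul]
    · rw [Set.indicator_of_notMem hw]
      symm
      refine Set.indicator_apply_eq_zero.2 fun _ => ?_
      rw [Set.indicator_of_notMem hw, mul_zero]
  set c := ENNReal.ofReal (C * √Λ ^ (-(1 / (32 * n) : ℝ))) with hc
  have hrow' : ∀ a, ∫⁻ x2 in Set.Icc (-M2) M2, ‖op (volume.restrict D)
      (highK n Λ p e γ lo hi σ) f (a, x2)‖ₑ ^ 2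
      ≤ c * ∫⁻ t in Set.Ioc lo hi, ∫⁻ z, ‖g (a - σ * t, z)‖ₑ ^ 2 := fun a => by
    simp_rw [hop]
    refine (hrow p hp e γ Λ a σ lo hi M2 he he1 hγ hγΓ hΛ hσa hlo hlohi hhi _
      ((hgΦ a).mono_measure (by rw [rowμ_eq]; exact Measure.restrict_le_self))).trans ?_
    gcongr
    unfold sqn
    rw [rowμ, lintegral_prod]
    · exact lintegral_mono fun t => lintegral_mono' Measure.restrict_le_self le_rfl
    · change AEMeasurable _ (rowμ lo hi M2)
      rw [rowμ_eq]
      exact ((hgΦ a).1.enorm.pow_const 2).mono_measure Measure.restrict_le_self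
  have hgm : AEMeasurable (fun w : ℝ × ℝ => ‖g w‖ₑ ^ 2) (volume.prod volume) :=
    hgL.1.enorm.pow_const 2
  have hin : AEMeasurable (fun y1 => ∫⁻ z, ‖g (y1, z)‖ₑ ^ 2) volume := hgm.lintegral_prod_right'
  have hmp : ∀ t : ℝ, ∫⁻ a, ∫⁻ z, ‖g (a - σ * t, z)‖ₑ ^ 2 = sqn (volume.restrict D) f := fun t => by
    rw [lintegral_sub_right_eq_self (fun y1 => ∫⁻ z, ‖g (y1, z)‖ₑ ^ 2), ← hgs, sqn,
      Measure.volume_eq_prod, lintegral_prod _ hgm]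
  have hmeas : AEMeasurable (Function.uncurry fun a t => ∫⁻ z, ‖g (a - σ * t, z)‖ₑ ^ 2)
      (volume.prod (volume.restrict (Set.Ioc lo hi))) := by
    have hq : Measure.QuasiMeasurePreserving (fun w : ℝ × ℝ => w.1 - σ * w.2)
        (volume.prod (volume.restrict (Set.Ioc lo hi))) volume := by
      have hq0 : Measure.QuasiMeasurePreserving (fun w : ℝ × ℝ => w.1 - σ * w.2)
          (volume.prod volume) volume := by
        rcases hσ with rfl | rfl
        · simpa using quasiMeasurePreserving_sub (volume : Measure ℝ) volume
        · simpa using quasiMeasurePreserving_add (volume : Measure ℝ) volume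
      exact hq0.mono_left ((Measure.prod_mono le_rfl Measure.restrict_le_self).absolutelyContinuous)
    exact hin.comp_quasiMeasurePreserving hq
  calc sqn (volume.restrict D) (op (volume.restrict D) (highK n Λ p e γ lo hi σ) f)
      ≤ ∫⁻ a in Set.Ico (-M1) M1, ∫⁻ x2 in Set.Icc (-M2) M2, ‖op (volume.restrict D)
        (highK n Λ p e γ lo hi σ) f (a, x2)‖ₑ ^ 2 := by
        unfold sqn
        nth_rewrite 1 [hD]
        rw [box, Measure.volume_eq_prod, ← Measure.prod_restrict]
        exact lintegral_prod_le _
    _ ≤ ∫⁻ a, c * ∫⁻ t in Set.Ioc lo hi, ∫⁻ z, ‖g (a - σ * t, z)‖ₑ ^ 2 :=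
        lintegral_mono' Measure.restrict_le_self hrow'
    _ = c * ∫⁻ t in Set.Ioc lo hi, ∫⁻ a, ∫⁻ z, ‖g (a - σ * t, z)‖ₑ ^ 2 := by
        rw [lintegral_const_mul' _ _ ENNReal.ofReal_ne_top, lintegral_lintegral_swap hmeas]
    _ = c * (sqn (volume.restrict D) f * ENNReal.ofReal (hi - lo)) := by
        simp_rw [hmp]
        rw [lintegral_const, Measure.restrict_apply_univ, Real.volume_Ioc]
    _ ≤ c * (sqn (volume.restrict D) f * ENNReal.ofReal 2) := by
        gcongr
        nlinarith
    _ = _ := by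
        rw [hc, mul_comm (sqn _ _), ← mul_assoc, ← ENNReal.ofReal_mul (by positivity)]
        congr 2
        ring

end HighFrequency

section BoundedKernels

variable {X : Type*} [MeasurableSpace X] {μ : Measure X} {D : Set X}

/-- Boundedness of a kernel on `D × D`. -/
def BddOn (D : Set X) (K : X → X → ℂ) : Prop := ∃ C : ℝ, 0 ≤ C ∧ ∀ x ∈ D, ∀ y ∈ D, ‖K x y‖ ≤ C

omit [MeasurableSpace X] in
lemma BddOn.add {K1 K2 : X → X → ℂ} (h1 : BddOn D K1) (h2 : BddOn D K2) :
    BddOn D fun x y => K1 x y + K2 x y := by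
  obtain ⟨C1, h10, h1⟩ := h1
  obtain ⟨C2, h20, h2⟩ := h2
  exact ⟨C1 + C2, by positivity, fun x hx y hy =>
    (norm_add_le _ _).trans (add_le_add (h1 x hx y hy) (h2 x hx y hy))⟩

lemma integrable_kernel_mul_of_bddOn [IsFiniteMeasure (μ.restrict D)] (hD : MeasurableSet D)
    {K : X → X → ℂ} (hK : Measurable (Function.uncurry K)) (hb : BddOn D K) {f : X → ℂ}
    (hf : MemLp f 2 (μ.restrict D)) {x : X} (hx : x ∈ D) :
    Integrable (fun y => K x y * f y) (μ.restrict D) := by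
  obtain ⟨C, -, hC⟩ := hb
  refine (hf.integrable (by norm_num)).bdd_mul (c := C)
    (hK.comp measurable_prodMk_left).aestronglyMeasurable ?_
  filter_upwards [ae_restrict_mem hD] with y hy using hC x hx y hy

lemma sqn_op_add_le [IsFiniteMeasure (μ.restrict D)] (hD : MeasurableSet D) {K1 K2 : X → X → ℂ}
    (hK1 : Measurable (Function.uncurry K1)) (hK2 : Measurable (Function.uncurry K2))
    (hb1 : BddOn D K1) (hb2 : BddOn D K2) {f : X → ℂ} (hf : MemLp f 2 (μ.restrict D)) :
    sqn (μ.restrict D) (op (μ.restrict D) (fun x y => K1 x y + K2 x y) f)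
      ≤ 2 * sqn (μ.restrict D) (op (μ.restrict D) K1 f)
        + 2 * sqn (μ.restrict D) (op (μ.restrict D) K2 f) := by
  refine le_trans (le_of_eq ?_) (sqn_add_le (op_stronglyMeasurable hK1 hf.1).aestronglyMeasurable)
  refine sqn_restrict_congr hD fun x hx => ?_
  unfold op
  rw [← integral_add (integrable_kernel_mul_of_bddOn hD hK1 hb1 hf hx)
    (integrable_kernel_mul_of_bddOn hD hK2 hb2 hf hx)]
  simp_rw [add_mul]

lemma sqn_op_const_mul {ν : Measure X} (c : ℂ) (K : X → X → ℂ) (f : X → ℂ) :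
    sqn μ (op ν (fun x y => c * K x y) f) = ‖c‖ₑ ^ 2 * sqn μ (op ν K f) := by
  unfold sqn op
  rw [← lintegral_const_mul' _ _ (by simp)]
  refine lintegral_congr fun x => ?_
  rw [← mul_pow, ← enorm_mul, ← integral_const_mul]
  simp_rw [mul_assoc]

/-- Schur's test with separate majorants for rows and columns. -/
lemma sqn_op_le_of_enorm_le_both [SFinite μ] {S T : Set X} {K : X → X → ℂ} {k1 k2 : X → X → ℝ≥0∞}
    (hk1 : Measurable fun q : X × X => k1 q.1 q.2) (hk2 : Measurable fun q : X × X => k2 q.1 q.2)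
    {A : ℝ≥0∞} (h1 : ∀ x y, ‖K x y‖ₑ ≤ k1 x y) (h2 : ∀ x y, ‖K x y‖ₑ ≤ k2 x y)
    (hA : ∀ x, ∫⁻ y, k1 x y ∂μ ≤ A) (hB : ∀ y, ∫⁻ x, k2 x y ∂μ ≤ A)
    {f : X → ℂ} (hf : AEStronglyMeasurable f (μ.restrict T)) :
    sqn (μ.restrict S) (op (μ.restrict T) K f) ≤ A ^ 2 * sqn (μ.restrict T) f := by
  rw [sq]
  refine sqn_op_le_of_enorm_le (k := fun x y => min (k1 x y) (k2 x y)) (hk1.min hk2)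
    (.of_forall fun x => .of_forall fun y => le_min (h1 x y) (h2 x y))
    (.of_forall fun x => ?_) (.of_forall fun y => ?_) hf
  · exact (lintegral_mono' Measure.restrict_le_self fun y => min_le_left _ _).trans (hA x)
  · exact (lintegral_mono' Measure.restrict_le_self fun x => min_le_right _ _).trans (hB y)

end BoundedKernels

section LowFrequency

variable {n : ℕ} {p : ℝ[X]} {Λ e γ a σ lo hi : ℝ}

/-- The rescaled kernel, conjugated to be Hermitian, without the window. -/
def coreK (p : ℝ[X]) (e γ : ℝ) (x y : ℝ × ℝ) : ℂ :=
  Complex.exp (Complex.I * ((-(γ * ((x.2 - y.2) * ((x.1 + y.1) * (x.2 + y.2)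
    + dd p 0 (x.1 + y.1)))) : ℝ) : ℂ)) *
  ((Real.sin (bet e (x.1 - y.1) * |x.2 + y.2 + dd p 1 (x.1 + y.1)| * (x.2 - y.2)) /
    (bet e (x.1 - y.1) * (x.2 - y.2)) : ℝ) : ℂ)

/-- The window `lo < |t| ≤ hi`. -/
def win (lo hi : ℝ) : Set ℝ := (fun t => |t|) ⁻¹' Set.Ioc lo hi

lemma mem_win {t : ℝ} : t ∈ win lo hi ↔ |t| ∈ Set.Ioc lo hi := Iff.rfl

lemma neg_mem_win {t : ℝ} : -t ∈ win lo hi ↔ t ∈ win lo hi := by rw [mem_win, mem_win, abs_neg]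

/-- The kernel restricted to a window. -/
def fullK (p : ℝ[X]) (e γ lo hi : ℝ) (x y : ℝ × ℝ) : ℂ :=
  (win lo hi).indicator (fun _ => coreK p e γ x y) (x.1 - y.1)

/-- The low-frequency part of the kernel. -/
def lowK (n : ℕ) (Λ : ℝ) (p : ℝ[X]) (e γ lo hi : ℝ) (x y : ℝ × ℝ) : ℂ :=
  (win lo hi).indicator (fun _ => ((psi n Λ p (x.1 + y.1) (x.2 - y.2) (x.2 + y.2) : ℝ) : ℂ) *
    coreK p e γ x y) (x.1 - y.1)

lemma conj_exp_I_mul (θ : ℝ) : conj (Complex.exp (Complex.I * (θ : ℂ)))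
      = Complex.exp (Complex.I * ((-θ : ℝ) : ℂ)) := by
  rw [← Complex.exp_conj, map_mul, Complex.conj_I, Complex.conj_ofReal]
  push_cast; ring_nf

lemma fullK_conj (x y : ℝ × ℝ) : conj (fullK p e γ lo hi y x) = fullK p e γ lo hi x y := by
  unfold fullK
  have hw : x.1 - y.1 = -(y.1 - x.1) := by ring
  by_cases h : y.1 - x.1 ∈ win lo hi
  · have h' : x.1 - y.1 ∈ win lo hi := by rwa [hw, neg_mem_win]
    rw [Set.indicator_of_mem h, Set.indicator_of_mem h']
    unfold coreK
    rw [map_mul, Complex.conj_ofReal, conj_exp_I_mul, hw, bet_neg, add_comm y.1, add_comm y.2,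
      show x.2 - y.2 = -(y.2 - x.2) by ring, mul_neg, mul_neg, Real.sin_neg, neg_div_neg_eq]
    congr 4
    ring
  · have h' : x.1 - y.1 ∉ win lo hi := by rwa [hw, neg_mem_win]
    rw [Set.indicator_of_notMem h, Set.indicator_of_notMem h', map_zero]

lemma sgn_mul_sin (w c : ℝ) : sgn w * Real.sin (w * c) = Real.sin (|w| * c) := by
  rcases lt_trichotomy w 0 with h | h | h
  · rw [sgn_of_neg h, abs_of_neg h, neg_mul w c, Real.sin_neg]; ring
  · simp [h]
  · rw [sgn_of_pos h, abs_of_pos h, one_mul]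

lemma exp_sub_exp_conj (A θ φ : ℝ) : -Complex.I * ((A : ℂ) * Complex.exp (Complex.I * ((θ + φ : ℝ) : ℂ)))
    + conj (-Complex.I * ((A : ℂ) * Complex.exp (Complex.I * ((-θ + φ : ℝ) : ℂ))))
    = Complex.exp (Complex.I * (θ : ℂ)) * ((2 * A * Real.sin φ : ℝ) : ℂ) := by
  rw [map_mul, map_mul, map_neg, Complex.conj_I, Complex.conj_ofReal, conj_exp_I_mul]
  push_cast
  rw [Complex.sin, show Complex.I * (θ + φ : ℂ) = Complex.I * θ + φ * Complex.I by ring,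
    show Complex.I * (-(-θ + φ) : ℂ) = Complex.I * θ + -φ * Complex.I by ring, Complex.exp_add,
    Complex.exp_add]
  ring

lemma tail_of_mem (hlo : 0 ≤ lo) (hσ : σ = 1 ∨ σ = -1) {x y : ℝ × ℝ}
    (h : σ * (x.1 - y.1) ∈ Set.Ioc lo hi) :
    fullK p e γ lo hi x y = lowK n Λ p e γ lo hi x y + (-Complex.I * highK n Λ p e γ lo hi σ x y
      + conj (-Complex.I * highK n Λ p e γ lo hi (-σ) y x)) := by
  have hpos : 0 < σ * (x.1 - y.1) := hlo.trans_lt h.1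
  have habs : |x.1 - y.1| = σ * (x.1 - y.1) := by
    rcases hσ with rfl | rfl
    · rw [one_mul] at hpos ⊢; exact abs_of_pos hpos
    · rw [neg_one_mul] at hpos ⊢; exact abs_of_neg (by linarith)
  have hmem : x.1 - y.1 ∈ win lo hi := by rw [mem_win, habs]; exact h
  have h2 : -σ * (y.1 - x.1) = σ * (x.1 - y.1) := by ring
  have hσσ : ∀ c, σ * (σ * c) = c := fun c => by rcases hσ with rfl | rfl <;> ring
  have hb : bet e (σ * (x.1 - y.1)) = bet e (x.1 - y.1) := by
    rcases hσ with rfl | rfl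
    · rw [one_mul]
    · rw [neg_one_mul, bet_neg]
  have hs1 : 2 * x.1 - σ * (σ * (x.1 - y.1)) = x.1 + y.1 := by rw [hσσ]; ring
  have hs2 : 2 * y.1 - -σ * (σ * (x.1 - y.1)) = x.1 + y.1 := by rw [neg_mul, hσσ]; ring
  unfold fullK lowK highK
  rw [Set.indicator_of_mem hmem, Set.indicator_of_mem hmem, Set.indicator_of_mem h, h2,
    Set.indicator_of_mem h]
  unfold rowK
  simp only
  rw [hs1, hs2, hb]
  set s := x.1 + y.1
  set u := x.2 - y.2 with hu
  set β := bet e (x.1 - y.1) with hβ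
  have hv : y.2 + x.2 = x.2 + y.2 := add_comm _ _
  have hu' : y.2 - x.2 = -u := by rw [hu]; ring
  rw [hv, hu']
  set v := x.2 + y.2
  set w := v + dd p 1 s with hw
  have hpsi : psi n Λ p s (-u) v = psi n Λ p s u v := by unfold psi; rw [neg_sq]
  rw [hpsi]
  have hA : -σ * sgn w * (1 - psi n Λ p s u v) / (2 * β * -u)
      = σ * sgn w * (1 - psi n Λ p s u v) / (2 * β * u) := by
    rw [mul_neg, show -σ * sgn w * (1 - psi n Λ p s u v)
      = -(σ * sgn w * (1 - psi n Λ p s u v)) by ring, neg_div_neg_eq]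
  rw [hA]
  have e1 : -(u * (γ * (s * v + dd p 0 s) - σ * β * w))
      = -(γ * (u * (s * v + dd p 0 s))) + σ * (w * (β * u)) := by ring
  have e2 : -(-u * (γ * (s * v + dd p 0 s) - -σ * β * w))
      = -(-(γ * (u * (s * v + dd p 0 s)))) + σ * (w * (β * u)) := by ring
  rw [e1, e2, exp_sub_exp_conj]
  have hsin : 2 * (σ * sgn w * (1 - psi n Λ p s u v) / (2 * β * u)) *
      Real.sin (σ * (w * (β * u)))
      = (1 - psi n Λ p s u v) * (Real.sin (β * |w| * u) / (β * u)) := by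
    have h3 : σ * Real.sin (σ * (w * (β * u))) = Real.sin (w * (β * u)) := by
      rcases hσ with rfl | rfl
      · rw [one_mul, one_mul]
      · rw [neg_one_mul, neg_one_mul, Real.sin_neg, neg_neg]
    calc _ = sgn w * (σ * Real.sin (σ * (w * (β * u)))) * (1 - psi n Λ p s u v) / (β * u) := by
          simp only [div_eq_mul_inv, mul_inv]; ring
      _ = _ := by
          rw [h3, sgn_mul_sin, show |w| * (β * u) = β * |w| * u by ring]
          ring
  rw [hsin]
  have hcore : coreK p e γ x y = Complex.exp (Complex.I * ((-(γ * (u * (s * v + dd p 0 s))) : ℝ) : ℂ)) *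
      ((Real.sin (β * |w| * u) / (β * u) : ℝ) : ℂ) := rfl
  rw [hcore]
  push_cast
  ring

lemma fullK_eq (hlo : 0 ≤ lo) (x y : ℝ × ℝ) :
    fullK p e γ lo hi x y = lowK n Λ p e γ lo hi x y +
      ((-Complex.I * highK n Λ p e γ lo hi 1 x y
        + conj (-Complex.I * highK n Λ p e γ lo hi 1 y x))
      + (-Complex.I * highK n Λ p e γ lo hi (-1) x y
        + conj (-Complex.I * highK n Λ p e γ lo hi (-1) y x))) := by
  have hz : ∀ {σ : ℝ} {x y : ℝ × ℝ}, σ * (x.1 - y.1) ∉ Set.Ioc lo hi →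
      highK n Λ p e γ lo hi σ x y = 0 := fun h => by
    unfold highK; rw [Set.indicator_of_notMem h]
  by_cases h1 : (1 : ℝ) * (x.1 - y.1) ∈ Set.Ioc lo hi
  · have h2 : (-1 : ℝ) * (x.1 - y.1) ∉ Set.Ioc lo hi := fun h => by linarith [h.1, h1.1]
    have h3 : (1 : ℝ) * (y.1 - x.1) ∉ Set.Ioc lo hi := fun h => by linarith [h.1, h1.1]
    rw [tail_of_mem (n := n) (Λ := Λ) hlo (Or.inl rfl) h1, hz h2, hz h3]
    simp
  · by_cases h2 : (-1 : ℝ) * (x.1 - y.1) ∈ Set.Ioc lo hi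
    · have h3 : (-1 : ℝ) * (y.1 - x.1) ∉ Set.Ioc lo hi := fun h => by linarith [h.1, h2.1]
      rw [tail_of_mem (n := n) (Λ := Λ) hlo (Or.inr rfl) h2, hz h1, hz h3, neg_neg]
      simp
      ring
    · have h3 : (-1 : ℝ) * (y.1 - x.1) ∉ Set.Ioc lo hi := fun h => h1 (by
        rwa [neg_one_mul, neg_sub, ← one_mul (x.1 - y.1)] at h)
      have h4 : (1 : ℝ) * (y.1 - x.1) ∉ Set.Ioc lo hi := fun h => h2 (by
        rwa [one_mul, ← neg_sub, ← neg_one_mul] at h)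
      have h0 : x.1 - y.1 ∉ win lo hi := fun h => by
        rw [mem_win] at h
        rcases abs_choice (x.1 - y.1) with h5 | h5
        · rw [h5] at h; exact h1 (by rwa [one_mul])
        · rw [h5] at h; exact h2 (by rwa [neg_one_mul])
      rw [hz h1, hz h2, hz h3, hz h4]
      unfold fullK lowK
      rw [Set.indicator_of_notMem h0, Set.indicator_of_notMem h0]
      simp

lemma measurableSet_win (lo hi : ℝ) : MeasurableSet (win lo hi) :=
  measurableSet_preimage (f := fun t : ℝ => |t|) (by fun_prop) measurableSet_Ioc

lemma measurable_coreK_comp {Y : Type*} [MeasurableSpace Y] {x1 x2 y1 y2 : Y → ℝ}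
    (hx1 : Measurable x1) (hx2 : Measurable x2) (hy1 : Measurable y1) (hy2 : Measurable y2) :
    Measurable fun q => coreK p e γ (x1 q, x2 q) (y1 q, y2 q) := by
  unfold coreK
  simp only
  fun_prop

lemma measurable_lowK_comp {Y : Type*} [MeasurableSpace Y] {x1 x2 y1 y2 : Y → ℝ}
    (hx1 : Measurable x1) (hx2 : Measurable x2) (hy1 : Measurable y1) (hy2 : Measurable y2) :
    Measurable fun q => lowK n Λ p e γ lo hi (x1 q, x2 q) (y1 q, y2 q) := by
  have h1 := measurable_coreK_comp (p := p) (e := e) (γ := γ) hx1 hx2 hy1 hy2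
  have h2 := measurable_psi_comp (n := n) (p := p) (Λ := Λ) (s := fun q => x1 q + y1 q)
    (u := fun q => x2 q - y2 q) (v := fun q => x2 q + y2 q) (by fun_prop) (by fun_prop)
    (by fun_prop)
  unfold lowK
  simp only
  have h3 : MeasurableSet {q | x1 q - y1 q ∈ win lo hi} :=
    (hx1.sub hy1) (measurableSet_win lo hi)
  exact Measurable.indicator (s := {q | x1 q - y1 q ∈ win lo hi})
    ((Complex.measurable_ofReal.comp h2).mul h1) h3

lemma measurable_lowK : Measurable (Function.uncurry (lowK n Λ p e γ lo hi)) :=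
  measurable_lowK_comp (x1 := fun q : (ℝ × ℝ) × (ℝ × ℝ) => q.1.1) (x2 := fun q => q.1.2)
    (y1 := fun q => q.2.1) (y2 := fun q => q.2.2) (by fun_prop) (by fun_prop) (by fun_prop)
    (by fun_prop)

lemma measurable_fullK : Measurable (Function.uncurry (fullK p e γ lo hi)) := by
  have h1 := measurable_coreK_comp (p := p) (e := e) (γ := γ)
    (x1 := fun q : (ℝ × ℝ) × (ℝ × ℝ) => q.1.1) (x2 := fun q => q.1.2)
    (y1 := fun q => q.2.1) (y2 := fun q => q.2.2) (by fun_prop) (by fun_prop) (by fun_prop)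
    (by fun_prop)
  have h3 : MeasurableSet {q : (ℝ × ℝ) × (ℝ × ℝ) | q.1.1 - q.2.1 ∈ win lo hi} :=
    (by fun_prop : Measurable fun q : (ℝ × ℝ) × (ℝ × ℝ) => q.1.1 - q.2.1) (measurableSet_win lo hi)
  exact Measurable.indicator (s := {q : (ℝ × ℝ) × (ℝ × ℝ) | q.1.1 - q.2.1 ∈ win lo hi}) h1 h3

lemma measurable_highK : Measurable (Function.uncurry (highK n Λ p e γ lo hi σ)) := by
  have h1 := measurable_rowK_comp (n := n) (Λ := Λ) (p := p) (e := e) (γ := γ) (σ := σ)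
    (fa := fun q : (ℝ × ℝ) × (ℝ × ℝ) => q.1.1) (fx := fun q => q.1.2)
    (ft := fun q => σ * (q.1.1 - q.2.1)) (fz := fun q => q.2.2) (by fun_prop) (by fun_prop)
    (by fun_prop) (by fun_prop)
  have h3 : MeasurableSet {q : (ℝ × ℝ) × (ℝ × ℝ) | σ * (q.1.1 - q.2.1) ∈ Set.Ioc lo hi} :=
    (by fun_prop : Measurable fun q : (ℝ × ℝ) × (ℝ × ℝ) => σ * (q.1.1 - q.2.1)) measurableSet_Ioc
  exact Measurable.indicator
    (s := {q : (ℝ × ℝ) × (ℝ × ℝ) | σ * (q.1.1 - q.2.1) ∈ Set.Ioc lo hi}) h1 h3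

lemma norm_coreK_le (x y : ℝ × ℝ) :
    ‖coreK p e γ x y‖ ≤ √(nn n p (x.1 + y.1) (x.2 + y.2)) := by
  unfold coreK
  rw [norm_mul, mul_comm Complex.I, Complex.norm_exp_ofReal_mul_I, one_mul, Complex.norm_real,
    Real.norm_eq_abs, abs_div]
  refine div_le_of_le_mul₀ (abs_nonneg _) (Real.sqrt_nonneg _) (Real.abs_sin_le_abs.trans ?_)
  rw [abs_mul, abs_mul, abs_mul, abs_abs]
  have := abs_w_le (n := n) (p := p) (x.1 + y.1) (x.2 + y.2)
  calc _ = |x.2 + y.2 + dd p 1 (x.1 + y.1)| * (|bet e (x.1 - y.1)| * |x.2 - y.2|) := by ring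
    _ ≤ _ := by gcongr

lemma norm_lowK_le (hΛ : 1 ≤ Λ) (x y : ℝ × ℝ) {v : ℝ}
    (hv : v = 2 * x.2 ∨ v = 2 * y.2) :
    ‖lowK n Λ p e γ lo hi x y‖ ≤ 4 * Λ ^ 16 * (((1 + (x.2 - y.2) ^ 2) ^ 5)⁻¹ *
      poi (nn n p (x.1 + y.1) v) (x.2 - y.2)) := by
  have h0 : 0 ≤ poi (nn n p (x.1 + y.1) v) (x.2 - y.2) := poi_nonneg (nn_pos _ _).le _
  unfold lowK
  refine (norm_indicator_le_norm_self _ _).trans ?_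
  rw [norm_mul, Complex.norm_real, Real.norm_of_nonneg (psi_pos _ _ _).le, mul_comm]
  refine (mul_le_mul_of_nonneg_right (norm_coreK_le (n := n) x y) (psi_pos _ _ _).le).trans ?_
  refine sqrt_nn_mul_psi_le hΛ _ _ _ _ ?_
  rcases hv with rfl | rfl <;> ring

lemma exists_nn_bound_box (n : ℕ) (p : ℝ[X]) (M1 M2 : ℝ) : ∃ C : ℝ, 1 ≤ C ∧
    ∀ x ∈ box M1 M2, ∀ y ∈ box M1 M2, nn n p (x.1 + y.1) (x.2 + y.2) ≤ C := by
  obtain ⟨C, hC1, hC⟩ := exists_nn_bound n p (2 * |M1|) (2 * |M2|)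
  refine ⟨C, hC1, fun x hx y hy => hC _ _ ?_ ?_⟩
  · refine (abs_add_le _ _).trans ?_
    have h1 : ∀ z ∈ box M1 M2, |z.1| ≤ |M1| := fun z hz =>
      (abs_le.2 ⟨hz.1.1, hz.1.2.le⟩).trans (le_abs_self _)
    linarith [h1 x hx, h1 y hy]
  · refine (abs_add_le _ _).trans ?_
    have h1 : ∀ z ∈ box M1 M2, |z.2| ≤ |M2| := fun z hz =>
      (abs_le.2 ⟨hz.2.1, hz.2.2⟩).trans (le_abs_self _)
    linarith [h1 x hx, h1 y hy]

lemma bddOn_fullK (M1 M2 : ℝ) : BddOn (box M1 M2) (fullK p e γ lo hi) := by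
  obtain ⟨C, hC1, hC⟩ := exists_nn_bound_box 0 p M1 M2
  refine ⟨√C, by positivity, fun x hx y hy => ?_⟩
  unfold fullK
  refine (norm_indicator_le_norm_self _ _).trans ((norm_coreK_le (n := 0) x y).trans ?_)
  exact Real.sqrt_le_sqrt (hC x hx y hy)

lemma bddOn_lowK (M1 M2 : ℝ) : BddOn (box M1 M2) (lowK n Λ p e γ lo hi) := by
  obtain ⟨C, hC1, hC⟩ := exists_nn_bound_box 0 p M1 M2
  refine ⟨√C, by positivity, fun x hx y hy => ?_⟩
  unfold lowK
  refine (norm_indicator_le_norm_self _ _).trans ?_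
  rw [norm_mul, Complex.norm_real, Real.norm_of_nonneg (psi_pos _ _ _).le]
  calc _ ≤ 1 * √C := mul_le_mul (psi_le_one _ _ _) ((norm_coreK_le (n := 0) x y).trans
        (Real.sqrt_le_sqrt (hC x hx y hy))) (norm_nonneg _) zero_le_one
    _ = _ := one_mul _

lemma bddOn_highK (he : 0 < e) (he1 : e ≤ 1) (hΛ : 1 ≤ Λ) (hσ : σ = 1 ∨ σ = -1)
    (hlo : 1 - e ^ 2 ≤ lo) (M1 M2 : ℝ) :
    BddOn (box M1 M2) (highK n Λ p e γ lo hi σ) := by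
  obtain ⟨C, hC1, hC⟩ := exists_nn_bound_box n p M1 M2
  have hσa : |σ| = 1 := by rcases hσ with rfl | rfl <;> simp
  refine ⟨8 * C, by positivity, fun x hx y hy => ?_⟩
  unfold highK
  by_cases h : σ * (x.1 - y.1) ∈ Set.Ioc lo hi
  · rw [Set.indicator_of_mem h]
    refine (norm_rowK_le he he1 hΛ hσa (by linarith [h.1])).trans ?_
    refine mul_le_mul_of_nonneg_left ?_ (by norm_num)
    have : 2 * x.1 - σ * (σ * (x.1 - y.1)) = x.1 + y.1 := by
      rcases hσ with rfl | rfl <;> ring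
    rw [this]
    exact hC x hx y hy
  · rw [Set.indicator_of_notMem h, norm_zero]; positivity

lemma measurable_poi_comp {Y : Type*} [MeasurableSpace Y] {s v u : Y → ℝ} (hs : Measurable s)
    (hv : Measurable v) (hu : Measurable u) : Measurable fun q => poi (nn n p (s q) (v q)) (u q) := by
  have := measurable_nn_comp (n := n) (p := p) hs hv
  unfold poi
  fun_prop

/-- The Poisson majorant with a weight in the first variable. -/
def poiMaj (n : ℕ) (p : ℝ[X]) (c : ℝ) (m : ℝ → ℝ≥0∞) (s t v u : ℝ) : ℝ≥0∞ :=
  ENNReal.ofReal (c * poi (nn n p s v) u) * m t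

lemma measurable_poiMaj {c : ℝ} {m : ℝ → ℝ≥0∞} (hm : Measurable m) {Y : Type*} [MeasurableSpace Y]
    {s t v u : Y → ℝ} (hs : Measurable s) (ht : Measurable t) (hv : Measurable v)
    (hu : Measurable u) : Measurable fun q => poiMaj n p c m (s q) (t q) (v q) (u q) :=
  ((measurable_poi_comp hs hv hu).const_mul c).ennreal_ofReal.mul (hm.comp ht)

lemma lintegral_poiMaj {c : ℝ} (hc : 0 ≤ c) (m : ℝ → ℝ≥0∞) (s t v : ℝ) :
    ∫⁻ u, poiMaj n p c m s t v u = ENNReal.ofReal (c * Real.pi) * m t := by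
  unfold poiMaj
  have h3 : Measurable fun u : ℝ => ENNReal.ofReal (c * poi (nn n p s v) u) :=
    ((measurable_poi_comp measurable_const measurable_const measurable_id).const_mul c).ennreal_ofReal
  rw [lintegral_mul_const _ h3]
  simp_rw [ENNReal.ofReal_mul hc]
  rw [lintegral_const_mul' _ _ ENNReal.ofReal_ne_top, lintegral_poi (nn_pos _ _)]

lemma lintegral_poiMaj_row {c : ℝ} (hc : 0 ≤ c) {m : ℝ → ℝ≥0∞} (hm : Measurable m) (x : ℝ × ℝ) :
    ∫⁻ y : ℝ × ℝ, poiMaj n p c m (x.1 + y.1) (x.1 - y.1) (2 * x.2) (x.2 - y.2)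
      = ENNReal.ofReal (c * Real.pi) * ∫⁻ t, m t := by
  have h : Measurable fun y : ℝ × ℝ => poiMaj n p c m (x.1 + y.1) (x.1 - y.1) (2 * x.2) (x.2 - y.2) :=
    measurable_poiMaj hm (by fun_prop) (by fun_prop) (by fun_prop) (by fun_prop)
  rw [Measure.volume_eq_prod, lintegral_prod _ h.aemeasurable]
  have hin : ∀ y1 : ℝ, ∫⁻ y2, poiMaj n p c m (x.1 + y1) (x.1 - y1) (2 * x.2) (x.2 - y2)
      = ENNReal.ofReal (c * Real.pi) * m (x.1 - y1) := fun y1 => by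
    rw [lintegral_sub_left_eq_self (fun u => poiMaj n p c m (x.1 + y1) (x.1 - y1) (2 * x.2) u) x.2,
      lintegral_poiMaj hc]
  simp_rw [hin]
  rw [lintegral_const_mul' _ _ ENNReal.ofReal_ne_top, lintegral_sub_left_eq_self]

lemma lintegral_poiMaj_col {c : ℝ} (hc : 0 ≤ c) {m : ℝ → ℝ≥0∞} (hm : Measurable m) (y : ℝ × ℝ) :
    ∫⁻ x : ℝ × ℝ, poiMaj n p c m (x.1 + y.1) (x.1 - y.1) (2 * y.2) (x.2 - y.2)
      = ENNReal.ofReal (c * Real.pi) * ∫⁻ t, m t := by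
  have h : Measurable fun x : ℝ × ℝ => poiMaj n p c m (x.1 + y.1) (x.1 - y.1) (2 * y.2) (x.2 - y.2) :=
    measurable_poiMaj hm (by fun_prop) (by fun_prop) (by fun_prop) (by fun_prop)
  rw [Measure.volume_eq_prod, lintegral_prod _ h.aemeasurable]
  have hin : ∀ x1 : ℝ, ∫⁻ x2, poiMaj n p c m (x1 + y.1) (x1 - y.1) (2 * y.2) (x2 - y.2)
      = ENNReal.ofReal (c * Real.pi) * m (x1 - y.1) := fun x1 => by
    rw [lintegral_sub_right_eq_self (fun u => poiMaj n p c m (x1 + y.1) (x1 - y.1) (2 * y.2) u) y.2,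
      lintegral_poiMaj hc]
  simp_rw [hin]
  rw [lintegral_const_mul' _ _ ENNReal.ofReal_ne_top, lintegral_sub_right_eq_self]

/-- Schur's test against the Poisson majorant. -/
lemma sqn_op_le_of_poi {S T : Set (ℝ × ℝ)} {K : ℝ × ℝ → ℝ × ℝ → ℂ} {c : ℝ} {m : ℝ → ℝ≥0∞}
    (hm : Measurable m) (hc : 0 ≤ c)
    (hK1 : ∀ x y, ‖K x y‖ₑ ≤ poiMaj n p c m (x.1 + y.1) (x.1 - y.1) (2 * x.2) (x.2 - y.2))
    (hK2 : ∀ x y, ‖K x y‖ₑ ≤ poiMaj n p c m (x.1 + y.1) (x.1 - y.1) (2 * y.2) (x.2 - y.2))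
    {f : ℝ × ℝ → ℂ} (hf : AEStronglyMeasurable f (volume.restrict T)) :
    sqn (volume.restrict S) (op (volume.restrict T) K f)
      ≤ (ENNReal.ofReal (c * Real.pi) * ∫⁻ t, m t) ^ 2 * sqn (volume.restrict T) f := by
  have h1 : Measurable fun q : (ℝ × ℝ) × (ℝ × ℝ) =>
      poiMaj n p c m (q.1.1 + q.2.1) (q.1.1 - q.2.1) (2 * q.1.2) (q.1.2 - q.2.2) :=
    measurable_poiMaj hm (by fun_prop) (by fun_prop) (by fun_prop) (by fun_prop)
  have h2 : Measurable fun q : (ℝ × ℝ) × (ℝ × ℝ) =>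
      poiMaj n p c m (q.1.1 + q.2.1) (q.1.1 - q.2.1) (2 * q.2.2) (q.1.2 - q.2.2) :=
    measurable_poiMaj hm (by fun_prop) (by fun_prop) (by fun_prop) (by fun_prop)
  have h3 := fun x => (lintegral_poiMaj_row (n := n) (p := p) hc hm x).le
  have h4 := fun x => (lintegral_poiMaj_col (n := n) (p := p) hc hm x).le
  generalize poiMaj n p c m = P at *
  exact sqn_op_le_of_enorm_le_both (μ := volume)
    (k1 := fun x y => P (x.1 + y.1) (x.1 - y.1) (2 * x.2) (x.2 - y.2))
    (k2 := fun x y => P (x.1 + y.1) (x.1 - y.1) (2 * y.2) (x.2 - y.2))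
    h1 h2 hK1 hK2 h3 h4 hf

end LowFrequency

section Tail

variable {n : ℕ} {p : ℝ[X]} {Λ e γ σ lo hi : ℝ}

lemma measurable_conj_comp {K : ℝ × ℝ → ℝ × ℝ → ℂ} (hK : Measurable (Function.uncurry K)) :
    Measurable (Function.uncurry fun x y => conj (K y x)) :=
  (RCLike.continuous_conj (K := ℂ)).measurable.comp (hK.comp measurable_swap)

lemma BddOn.conj_swap {D : Set (ℝ × ℝ)} {K : ℝ × ℝ → ℝ × ℝ → ℂ} (h : BddOn D K) :
    BddOn D fun x y => conj (K y x) := by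
  obtain ⟨C, h0, h⟩ := h
  exact ⟨C, h0, fun x hx y hy => by rw [RCLike.norm_conj]; exact h y hy x hx⟩

lemma BddOn.const_mul {D : Set (ℝ × ℝ)} {K : ℝ × ℝ → ℝ × ℝ → ℂ} (h : BddOn D K) (c : ℂ) :
    BddOn D fun x y => c * K x y := by
  obtain ⟨C, h0, h⟩ := h
  exact ⟨‖c‖ * C, by positivity, fun x hx y hy => by rw [norm_mul]; gcongr; exact h x hx y hy⟩

/-- The Hermitian high-frequency kernel attached to the sign `σ` of `x₁ - y₁`. -/
def hermK (n : ℕ) (Λ : ℝ) (p : ℝ[X]) (e γ lo hi σ : ℝ) (x y : ℝ × ℝ) : ℂ :=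
  -Complex.I * highK n Λ p e γ lo hi σ x y + conj (-Complex.I * highK n Λ p e γ lo hi σ y x)

/-- The part of the kernel not covered by `lowK`. -/
def tailK (n : ℕ) (Λ : ℝ) (p : ℝ[X]) (e γ lo hi : ℝ) (x y : ℝ × ℝ) : ℂ :=
  hermK n Λ p e γ lo hi 1 x y + hermK n Λ p e γ lo hi (-1) x y

lemma measurable_hermK : Measurable (Function.uncurry (hermK n Λ p e γ lo hi σ)) :=
  (measurable_highK.const_mul _).add
    (measurable_conj_comp (K := fun x y => -Complex.I * highK n Λ p e γ lo hi σ x y)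
      (measurable_highK.const_mul _))

lemma measurable_tailK : Measurable (Function.uncurry (tailK n Λ p e γ lo hi)) :=
  measurable_hermK.add measurable_hermK

lemma bddOn_hermK (he : 0 < e) (he1 : e ≤ 1) (hΛ : 1 ≤ Λ) (hσ : σ = 1 ∨ σ = -1)
    (hlo : 1 - e ^ 2 ≤ lo) (M1 M2 : ℝ) : BddOn (box M1 M2) (hermK n Λ p e γ lo hi σ) :=
  ((bddOn_highK he he1 hΛ hσ hlo M1 M2).const_mul _).add
    (((bddOn_highK he he1 hΛ hσ hlo M1 M2).const_mul
      (-Complex.I)).conj_swap)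

lemma bddOn_tailK (he : 0 < e) (he1 : e ≤ 1) (hΛ : 1 ≤ Λ)
    (hlo : 1 - e ^ 2 ≤ lo) (M1 M2 : ℝ) : BddOn (box M1 M2) (tailK n Λ p e γ lo hi) :=
  (bddOn_hermK he he1 hΛ (Or.inl rfl) hlo M1 M2).add (bddOn_hermK he he1 hΛ (Or.inr rfl) hlo M1 M2)

lemma fullK_eq_add (hlo : 0 ≤ lo) :
    fullK p e γ lo hi = fun x y => lowK n Λ p e γ lo hi x y + tailK n Λ p e γ lo hi x y := by
  funext x y
  rw [fullK_eq (n := n) (Λ := Λ) hlo]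
  rfl

lemma exists_herm_bound (n : ℕ) (hn : 1 ≤ n) (Γ : ℝ) (hΓ : 1 / 2 < Γ) :
    ∃ C : ℝ, 0 < C ∧ ∀ p : ℝ[X], p.natDegree ≤ n → ∀ e γ Λ σ lo hi M1 M2 : ℝ, 0 < e → e ≤ 1 →
    1 / 2 ≤ γ → γ ≤ Γ → 1 ≤ Λ → (σ = 1 ∨ σ = -1) → 1 - e ^ 2 ≤ lo → lo ≤ hi → hi ≤ 2 - e ^ 2 / 2 →
    ∀ f : ℝ × ℝ → ℂ, MemLp f 2 (volume.restrict (box M1 M2)) →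
    sqn (volume.restrict (box M1 M2))
      (op (volume.restrict (box M1 M2)) (hermK n Λ p e γ lo hi σ) f)
      ≤ ENNReal.ofReal (C * √Λ ^ (-(1 / (32 * n) : ℝ))) * sqn (volume.restrict (box M1 M2)) f := by
  obtain ⟨C, hC, h⟩ := exists_high_bound n hn Γ hΓ
  refine ⟨4 * C, by positivity, ?_⟩
  intro p hp e γ Λ σ lo hi M1 M2 he he1 hγ hγΓ hΛ hσ hlo hlohi hhi f hf
  have hm : ∀ σ, Measurable (Function.uncurry fun x y => -Complex.I * highK n Λ p e γ lo hi σ x y) :=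
    fun σ => measurable_highK.const_mul _
  have hb : ∀ σ, (σ = 1 ∨ σ = -1) → BddOn (box M1 M2)
      (fun x y => -Complex.I * highK n Λ p e γ lo hi σ x y) := fun σ hσ =>
    (bddOn_highK he he1 hΛ hσ hlo M1 M2).const_mul _
  have h1 : ∀ σ, (σ = 1 ∨ σ = -1) → ∀ f : ℝ × ℝ → ℂ, MemLp f 2 (volume.restrict (box M1 M2)) →
      sqn (volume.restrict (box M1 M2)) (op (volume.restrict (box M1 M2))
        (fun x y => -Complex.I * highK n Λ p e γ lo hi σ x y) f)
      ≤ ENNReal.ofReal (C * √Λ ^ (-(1 / (32 * n) : ℝ))) * sqn (volume.restrict (box M1 M2)) f :=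
    fun σ hσ f hf => by
      rw [sqn_op_const_mul, show ‖-Complex.I‖ₑ = 1 by rw [← ofReal_norm]; simp, one_pow, one_mul]
      exact h p hp e γ Λ σ lo hi M1 M2 he he1 hγ hγΓ hΛ hσ hlo hlohi hhi f hf
  obtain ⟨B, hB0, hB⟩ := (hb _ hσ).conj_swap
  have h2 := sqn_op_le_of_adjoint_restrict (measurableSet_box M1 M2) (measurableSet_box M1 M2)
    (measurable_conj_comp (hm σ)) hB0 hB (fun g hg => by
      simp_rw [Complex.conj_conj]
      exact h1 _ hσ g hg) hf
  refine (sqn_op_add_le (measurableSet_box M1 M2) (hm σ) (measurable_conj_comp (hm σ)) (hb _ hσ)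
    (hb _ hσ).conj_swap hf).trans ?_
  refine (add_le_add (mul_le_mul_right (h1 σ hσ f hf) _) (mul_le_mul_right h2 _)).trans (le_of_eq ?_)
  rw [mul_assoc 4, ENNReal.ofReal_mul (by norm_num) (p := 4), ENNReal.ofReal_ofNat]
  ring

/-- The tail is small for large `Λ`. -/
lemma exists_tail_bound (n : ℕ) (hn : 1 ≤ n) (Γ : ℝ) (hΓ : 1 / 2 < Γ) :
    ∃ C : ℝ, 0 < C ∧ ∀ p : ℝ[X], p.natDegree ≤ n → ∀ e γ Λ lo hi M1 M2 : ℝ, 0 < e → e ≤ 1 →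
    1 / 2 ≤ γ → γ ≤ Γ → 1 ≤ Λ → 1 - e ^ 2 ≤ lo → lo ≤ hi → hi ≤ 2 - e ^ 2 / 2 →
    ∀ f : ℝ × ℝ → ℂ, MemLp f 2 (volume.restrict (box M1 M2)) →
    sqn (volume.restrict (box M1 M2))
      (op (volume.restrict (box M1 M2)) (tailK n Λ p e γ lo hi) f)
      ≤ ENNReal.ofReal (C * √Λ ^ (-(1 / (32 * n) : ℝ))) * sqn (volume.restrict (box M1 M2)) f := by
  obtain ⟨C, hC, h⟩ := exists_herm_bound n hn Γ hΓ
  refine ⟨4 * C, by positivity, ?_⟩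
  intro p hp e γ Λ lo hi M1 M2 he he1 hγ hγΓ hΛ hlo hlohi hhi f hf
  refine (sqn_op_add_le (measurableSet_box M1 M2) measurable_hermK measurable_hermK
    (bddOn_hermK he he1 hΛ (Or.inl rfl) hlo M1 M2) (bddOn_hermK he he1 hΛ (Or.inr rfl) hlo M1 M2)
    hf).trans ?_
  refine (add_le_add (mul_le_mul_right
    (h p hp e γ Λ 1 lo hi M1 M2 he he1 hγ hγΓ hΛ (Or.inl rfl) hlo hlohi hhi f hf) _)
    (mul_le_mul_right
    (h p hp e γ Λ (-1) lo hi M1 M2 he he1 hγ hγΓ hΛ (Or.inr rfl) hlo hlohi hhi f hf) _)).trans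
    (le_of_eq ?_)
  rw [mul_assoc 4, ENNReal.ofReal_mul (by norm_num) (p := 4), ENNReal.ofReal_ofNat]
  ring

lemma enorm_lowK_le (hΛ : 1 ≤ Λ) (hhi : hi ≤ 2) (x y : ℝ × ℝ) {v : ℝ}
    (hv : v = 2 * x.2 ∨ v = 2 * y.2) :
    ‖lowK n Λ p e γ lo hi x y‖ₑ ≤ poiMaj n p (4 * Λ ^ 16)
      ((Set.Icc (-2) 2).indicator fun _ => 1) (x.1 + y.1) (x.1 - y.1) v (x.2 - y.2) := by
  unfold poiMaj
  by_cases h : x.1 - y.1 ∈ win lo hi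
  · have h2 : x.1 - y.1 ∈ Set.Icc (-2 : ℝ) 2 := abs_le.1 (h.2.trans hhi)
    rw [Set.indicator_of_mem h2, mul_one, ← ofReal_norm]
    refine ENNReal.ofReal_le_ofReal ((norm_lowK_le hΛ x y hv).trans ?_)
    have h3 := poi_nonneg (nn_pos (n := n) (p := p) (x.1 + y.1) v).le (x.2 - y.2)
    refine mul_le_mul_of_nonneg_left ?_ (by positivity)
    refine mul_le_of_le_one_left h3 (inv_le_one_of_one_le₀ (one_le_pow₀ ?_))
    linarith [sq_nonneg (x.2 - y.2)]
  · unfold lowK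
    rw [Set.indicator_of_notMem h]
    simp

/-- A single dyadic piece is bounded. -/
lemma exists_full_bound (n : ℕ) (hn : 1 ≤ n) (Γ : ℝ) (hΓ : 1 / 2 < Γ) :
    ∃ C : ℝ, 0 < C ∧ ∀ p : ℝ[X], p.natDegree ≤ n → ∀ e γ lo hi M1 M2 : ℝ, 0 < e → e ≤ 1 →
    1 / 2 ≤ γ → γ ≤ Γ → 1 - e ^ 2 ≤ lo → lo ≤ hi → hi ≤ 2 - e ^ 2 / 2 →
    ∀ f : ℝ × ℝ → ℂ, MemLp f 2 (volume.restrict (box M1 M2)) →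
    sqn (volume.restrict (box M1 M2))
      (op (volume.restrict (box M1 M2)) (fullK p e γ lo hi) f)
      ≤ ENNReal.ofReal C * sqn (volume.restrict (box M1 M2)) f := by
  obtain ⟨C, hC, h⟩ := exists_tail_bound n hn Γ hΓ
  refine ⟨2 * ((4 * Real.pi * 4) ^ 2 + C), by positivity, ?_⟩
  intro p hp e γ lo hi M1 M2 he he1 hγ hγΓ hlo hlohi hhi f hf
  have he2 : e ^ 2 ≤ 1 := pow_le_one₀ he.le he1
  have h1 := h p hp e γ 1 lo hi M1 M2 he he1 hγ hγΓ le_rfl hlo hlohi hhi f hf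
  rw [Real.sqrt_one, Real.one_rpow, mul_one] at h1
  have h2 := sqn_op_le_of_poi (n := n) (p := p) (S := box M1 M2) (T := box M1 M2)
    (K := lowK n 1 p e γ lo hi) (c := 4 * 1 ^ 16) (m := (Set.Icc (-2) 2).indicator fun _ => 1)
    (measurable_const.indicator measurableSet_Icc) (by norm_num)
    (fun x y => enorm_lowK_le le_rfl (by linarith [sq_nonneg e]) x y (Or.inl rfl))
    (fun x y => enorm_lowK_le le_rfl (by linarith [sq_nonneg e]) x y (Or.inr rfl)) hf.1
  rw [lintegral_indicator_const measurableSet_Icc, Real.volume_Icc, one_mul,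
    ← ENNReal.ofReal_mul (by positivity), ← ENNReal.ofReal_pow (by positivity)] at h2
  rw [fullK_eq_add (n := n) (Λ := 1) (by linarith)]
  refine (sqn_op_add_le (measurableSet_box M1 M2) measurable_lowK measurable_tailK
    (bddOn_lowK M1 M2) (bddOn_tailK he he1 le_rfl hlo M1 M2) hf).trans ?_
  refine (add_le_add (mul_le_mul_right h2 _) (mul_le_mul_right h1 _)).trans (le_of_eq ?_)
  rw [ENNReal.ofReal_mul (by norm_num), ENNReal.ofReal_add (by positivity) hC.le]
  norm_num
  ring

end Tail

section Continuity

variable {n : ℕ} {p : ℝ[X]} {Λ e γ lo hi : ℝ}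

lemma psi_le_exp (hp : p.natDegree ≤ n) (s s' u v : ℝ) :
    psi n Λ p s' u v ≤ Real.exp (24 * |s - s'|) * psi n Λ p s u v := by
  have h1 := nn_le_exp hp s' s v
  rw [abs_sub_comm s' s] at h1
  have h0 := nn_pos (n := n) (p := p) s v
  have h0' := nn_pos (n := n) (p := p) s' v
  have hE : 1 ≤ Real.exp (3 * |s - s'|) := Real.one_le_exp (by positivity)
  have h2 : 1 + u ^ 2 * nn n p s v / Λ ^ 2
      ≤ Real.exp (3 * |s - s'|) * (1 + u ^ 2 * nn n p s' v / Λ ^ 2) := by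
    rw [mul_add, mul_one]
    refine add_le_add hE ?_
    calc _ ≤ u ^ 2 * (Real.exp (3 * |s - s'|) * nn n p s' v) / Λ ^ 2 := by gcongr
      _ = _ := by ring
  have hr : 0 < 1 + u ^ 2 * nn n p s v / Λ ^ 2 := by positivity
  have hr' : 0 < 1 + u ^ 2 * nn n p s' v / Λ ^ 2 := by positivity
  have h3 := pow_le_pow_left₀ hr.le h2 8
  rw [mul_pow, ← Real.exp_nat_mul] at h3
  unfold psi
  rw [← div_eq_mul_inv, inv_le_iff_one_le_mul₀ (by positivity), div_mul_eq_mul_div,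
    le_div_iff₀ (by positivity), one_mul]
  refine h3.trans (le_of_eq ?_)
  push_cast
  ring_nf

lemma exp_sub_one_le (x : ℝ) : Real.exp x - 1 ≤ x * Real.exp x := by
  have h := Real.one_sub_le_exp_neg x
  have h2 := mul_le_mul_of_nonneg_right h (Real.exp_pos x).le
  rw [← Real.exp_add, neg_add_cancel, Real.exp_zero] at h2
  linarith

lemma abs_psi_sub_le (hp : p.natDegree ≤ n) {s s' : ℝ} (hs : |s - s'| ≤ 1) (u v : ℝ) :
    |psi n Λ p s u v - psi n Λ p s' u v| ≤ 24 * Real.exp 24 * |s - s'| * psi n Λ p s u v := by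
  have h1 := psi_le_exp (Λ := Λ) hp s s' u v
  have h2 := psi_le_exp (Λ := Λ) hp s' s u v
  rw [abs_sub_comm s' s] at h2
  have h0 := psi_pos (n := n) (Λ := Λ) (p := p) s u v
  have h0' := psi_pos (n := n) (Λ := Λ) (p := p) s' u v
  set d := |s - s'|
  have hd : 0 ≤ d := abs_nonneg _
  have hE : Real.exp (24 * d) - 1 ≤ 24 * Real.exp 24 * d :=
    calc _ ≤ 24 * d * Real.exp (24 * d) := exp_sub_one_le _
      _ ≤ 24 * d * Real.exp 24 := by gcongr; linarith
      _ = _ := by ring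
  set E := Real.exp (24 * d)
  have hE1 : 1 ≤ E := Real.one_le_exp (by positivity)
  set a := psi n Λ p s u v
  set b := psi n Λ p s' u v
  have h3 : (E - 1) * a ≤ 24 * Real.exp 24 * d * a := by gcongr
  rw [abs_le]
  constructor
  · linarith
  · rcases le_total a b with hab | hab
    · have : 0 ≤ 24 * Real.exp 24 * d * a := by positivity
      linarith
    · have : (E - 1) * b ≤ (E - 1) * a := mul_le_mul_of_nonneg_left hab (by linarith)
      linarith

lemma abs_sub_le_of_deriv_bound {f f1 : ℝ → ℝ} {M s s' : ℝ} (hf : ∀ x, HasDerivAt f (f1 x) x)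
    (hM : ∀ x, |s - x| ≤ |s - s'| → |f1 x| ≤ M) : |f s - f s'| ≤ M * |s - s'| := by
  have h := Convex.norm_image_sub_le_of_norm_hasDerivWithin_le (s := Set.uIcc s' s) (x := s')
    (y := s) (f := f) (f' := f1) (C := M) (fun x _ => (hf x).hasDerivWithinAt)
    (fun x hx => hM x ?_) (convex_uIcc s' s) Set.left_mem_uIcc Set.right_mem_uIcc
  · simpa using h
  · exact Set.abs_sub_le_of_uIcc_subset_uIcc (Set.uIcc_subset_uIcc hx Set.right_mem_uIcc)

lemma sqrt_nn_le (hp : p.natDegree ≤ n) {s s' : ℝ} (hs : |s - s'| ≤ 1) (v : ℝ) :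
    √(nn n p s' v) ≤ Real.exp 3 * √(nn n p s v) := by
  have h := nn_le_exp hp s s' v
  have h0 := nn_pos (n := n) (p := p) s v
  refine Real.sqrt_le_iff.2 ⟨by positivity, h.trans ?_⟩
  rw [mul_pow, Real.sq_sqrt h0.le, ← Real.exp_nat_mul]
  exact mul_le_mul_of_nonneg_right (Real.exp_le_exp.2 (by push_cast; linarith)) h0.le

lemma abs_phase_sub_le (hp : p.natDegree ≤ n) {s s' : ℝ} (hs : |s - s'| ≤ 1) (v : ℝ) :
    |(s * v + dd p 0 s) - (s' * v + dd p 0 s')| ≤ Real.exp 3 * √(nn n p s v) * |s - s'| := by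
  refine abs_sub_le_of_deriv_bound (f := fun s => s * v + dd p 0 s) (f1 := fun s => v + dd p 1 s)
    (fun x => ?_) fun x hx => (abs_w_le _ _).trans (sqrt_nn_le hp (hx.trans hs) v)
  exact (((hasDerivAt_id x).mul_const v).add (hasDerivAt_dd p 0 x)).congr_deriv (by simp)

lemma abs_dd_one_sub_le (hp : p.natDegree ≤ n) {s s' : ℝ} (hs : |s - s'| ≤ 1) (v : ℝ) :
    |dd p 1 s - dd p 1 s'| ≤ Real.exp 3 * √(nn n p s v) * |s - s'| :=
  abs_sub_le_of_deriv_bound (hasDerivAt_dd p 1) fun _ hx =>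
    (abs_dd_two_le hp _ _).trans (sqrt_nn_le hp (hx.trans hs) v)

lemma abs_bet_sub_le (t t' : ℝ) : |bet e t - bet e t'| ≤ |t - t'| := by
  have key : ∀ a b : ℝ, bet e a ≤ bet e b + |a - b| := fun a b => by
    unfold bet
    refine Real.sqrt_le_iff.2 ⟨by positivity, ?_⟩
    have h1 : 0 ≤ e ^ 2 + b ^ 2 / 4 := by positivity
    have h2 := Real.sq_sqrt h1
    have h3 : |b| / 2 ≤ √(e ^ 2 + b ^ 2 / 4) := Real.le_sqrt_of_sq_le (by
      rw [div_pow, sq_abs]; linarith [sq_nonneg e])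
    have h4 : a ^ 2 ≤ b ^ 2 + 2 * |b| * |a - b| + |a - b| ^ 2 := by
      have : |a| ≤ |b| + |a - b| := by linarith [abs_sub_abs_le_abs_sub a b]
      calc a ^ 2 = |a| ^ 2 := (sq_abs a).symm
        _ ≤ (|b| + |a - b|) ^ 2 := by gcongr
        _ = _ := by rw [add_sq, sq_abs b]
    have h5 := mul_le_mul_of_nonneg_right h3 (abs_nonneg (a - b))
    rw [add_sq, h2]
    linarith [sq_nonneg (|a - b|), mul_nonneg (abs_nonneg b) (abs_nonneg (a - b))]
  rw [abs_le]
  constructor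
  · have := key t' t
    rw [abs_sub_comm] at this
    linarith
  · linarith [key t t']

lemma norm_exp_I_sub_le (a b : ℝ) :
    ‖Complex.exp (Complex.I * (a : ℂ)) - Complex.exp (Complex.I * (b : ℂ))‖ ≤ |a - b| := by
  have h : Complex.exp (Complex.I * (a : ℂ)) - Complex.exp (Complex.I * (b : ℂ))
      = Complex.exp (Complex.I * (b : ℂ)) * (Complex.exp (Complex.I * ((a - b : ℝ) : ℂ)) - 1) := by
    rw [mul_sub, ← Complex.exp_add]
    push_cast
    ring_nf
  rw [h, norm_mul, mul_comm Complex.I (b : ℂ), Complex.norm_exp_ofReal_mul_I, one_mul]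
  exact (Real.norm_exp_I_mul_ofReal_sub_one_le).trans (by rw [Real.norm_eq_abs])

/-- The quotient `sin (βWu) / (βu)`. -/
def sinq (b W u : ℝ) : ℝ := Real.sin (b * W * u) / (b * u)

lemma abs_sinq_le (b W u : ℝ) : |sinq b W u| ≤ |W| := by
  unfold sinq
  rw [abs_div]
  refine div_le_of_le_mul₀ (abs_nonneg _) (abs_nonneg _) (Real.abs_sin_le_abs.trans (le_of_eq ?_))
  rw [abs_mul, abs_mul, abs_mul]
  ring

lemma abs_mul_abs_sinq_le {b W u : ℝ} (hb : 1 / 2 ≤ b) : |u| * |sinq b W u| ≤ 2 := by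
  have hb0 : 0 < b := by linarith
  by_cases hu : u = 0
  · simp [hu]
  have hu' : 0 < |u| := abs_pos.2 hu
  unfold sinq
  rw [abs_div, abs_mul, abs_of_pos hb0, ← mul_div_assoc, div_le_iff₀ (by positivity)]
  have := Real.abs_sin_le_one (b * W * u)
  nlinarith

lemma abs_sin_sub_sin_le (a b : ℝ) : |Real.sin a - Real.sin b| ≤ |a - b| := by
  have := abs_sub_le_of_deriv_bound (s := a) (s' := b) (M := 1) Real.hasDerivAt_sin
    fun x _ => Real.abs_cos_le_one x
  simpa using this

lemma abs_sinq_sub_le {b b' W W' u : ℝ} (hb : 1 / 2 ≤ b) (hb' : 1 / 2 ≤ b') :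
    |sinq b W u - sinq b' W' u| ≤ 4 * |W| * |b - b'| + |W - W'| := by
  have hb0 : 0 < b := by linarith
  have hb0' : 0 < b' := by linarith
  by_cases hu : u = 0
  · simp only [sinq, hu, mul_zero, Real.sin_zero, div_zero, sub_self, abs_zero]; positivity
  have hu' : 0 < |u| := abs_pos.2 hu
  have h1 : |sinq b' W u - sinq b' W' u| ≤ |W - W'| := by
    unfold sinq
    rw [← sub_div, abs_div, abs_mul, abs_of_pos hb0', div_le_iff₀ (by positivity)]
    refine (abs_sin_sub_sin_le _ _).trans (le_of_eq ?_)
    rw [← sub_mul, ← mul_sub, abs_mul, abs_mul, abs_of_pos hb0']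
    ring
  have h2 : |sinq b W u - sinq b' W u| ≤ 4 * |W| * |b - b'| := by
    have e1 : sinq b W u - sinq b' W u = (Real.sin (b * W * u) - Real.sin (b' * W * u)) / (b * u)
        + Real.sin (b' * W * u) * (b' - b) / (b * b' * u) := by
      unfold sinq; field_simp; ring
    rw [e1]
    refine (abs_add_le _ _).trans ?_
    have e2 : |(Real.sin (b * W * u) - Real.sin (b' * W * u)) / (b * u)| ≤ 2 * |W| * |b - b'| := by
      rw [abs_div, abs_mul, abs_of_pos hb0, div_le_iff₀ (by positivity)]
      refine (abs_sin_sub_sin_le _ _).trans ?_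
      rw [← sub_mul, ← sub_mul, abs_mul, abs_mul]
      have : 0 ≤ |b - b'| * |W| * |u| := by positivity
      nlinarith
    have e3 : |Real.sin (b' * W * u) * (b' - b) / (b * b' * u)| ≤ 2 * |W| * |b - b'| := by
      rw [abs_div, abs_mul, abs_mul, abs_mul, abs_of_pos hb0, abs_of_pos hb0',
        div_le_iff₀ (by positivity), abs_sub_comm b']
      have h3 : |Real.sin (b' * W * u)| ≤ b' * |W| * |u| :=
        Real.abs_sin_le_abs.trans (le_of_eq (by rw [abs_mul, abs_mul, abs_of_pos hb0']))
      calc _ ≤ b' * |W| * |u| * |b - b'| := by gcongr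
        _ = 1 * (b' * |W| * |u| * |b - b'|) := (one_mul _).symm
        _ ≤ 2 * b * (b' * |W| * |u| * |b - b'|) := by
          gcongr; linarith
        _ = _ := by ring
    linarith
  calc _ = |(sinq b W u - sinq b' W u) + (sinq b' W u - sinq b' W' u)| := by ring_nf
    _ ≤ _ := (abs_add_le _ _).trans (add_le_add h2 h1)

lemma coreK_eq (x y : ℝ × ℝ) : coreK p e γ x y =
    Complex.exp (Complex.I * ((-(γ * ((x.2 - y.2) * ((x.1 + y.1) * (x.2 + y.2)
    + dd p 0 (x.1 + y.1)))) : ℝ) : ℂ)) *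
    ((sinq (bet e (x.1 - y.1)) |x.2 + y.2 + dd p 1 (x.1 + y.1)| (x.2 - y.2) : ℝ) : ℂ) := rfl

/-- Lipschitz dependence of the cut-off kernel on the first variable. -/
lemma norm_psi_mul_coreK_sub_le (hp : p.natDegree ≤ n) {Γ : ℝ} (hγ : |γ| ≤ Γ) {a b x2 : ℝ} {y : ℝ × ℝ}
    (hab : |a - b| ≤ 1) (hba : 1 / 2 ≤ bet e (a - y.1)) (hbb : 1 / 2 ≤ bet e (b - y.1)) :
    ‖((psi n Λ p (a + y.1) (x2 - y.2) (x2 + y.2) : ℝ) : ℂ) * coreK p e γ (a, x2) y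
      - ((psi n Λ p (b + y.1) (x2 - y.2) (x2 + y.2) : ℝ) : ℂ) * coreK p e γ (b, x2) y‖
    ≤ (24 * Real.exp 24 + Real.exp 24 * (2 * Γ * Real.exp 3 + 4 + Real.exp 3)) * |a - b| *
      (√(nn n p (a + y.1) (x2 + y.2)) * psi n Λ p (a + y.1) (x2 - y.2) (x2 + y.2)) := by
  have hΓ : 0 ≤ Γ := (abs_nonneg γ).trans hγ
  rw [coreK_eq, coreK_eq]
  simp only
  have hss : (a + y.1) - (b + y.1) = a - b := by ring
  have hs : |(a + y.1) - (b + y.1)| ≤ 1 := by rwa [hss]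
  have hψ := abs_psi_sub_le (Λ := Λ) hp hs (x2 - y.2) (x2 + y.2)
  have hψ' := psi_le_exp (Λ := Λ) hp (a + y.1) (b + y.1) (x2 - y.2) (x2 + y.2)
  have hq := abs_phase_sub_le hp hs (x2 + y.2)
  have hd := abs_dd_one_sub_le hp hs (x2 + y.2)
  have hw := abs_w_le (n := n) (p := p) (a + y.1) (x2 + y.2)
  have hβ := abs_bet_sub_le (e := e) (a - y.1) (b - y.1)
  rw [show (a - y.1) - (b - y.1) = a - b by ring] at hβ
  rw [hss] at hψ hψ' hq hd
  have h24 : Real.exp (24 * |a - b|) ≤ Real.exp 24 := Real.exp_le_exp.2 (by linarith)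
  have h0 := psi_pos (n := n) (Λ := Λ) (p := p) (a + y.1) (x2 - y.2) (x2 + y.2)
  have h0' := psi_pos (n := n) (Λ := Λ) (p := p) (b + y.1) (x2 - y.2) (x2 + y.2)
  set ψ := psi n Λ p (a + y.1) (x2 - y.2) (x2 + y.2)
  set ψ' := psi n Λ p (b + y.1) (x2 - y.2) (x2 + y.2)
  set u := x2 - y.2
  set v := x2 + y.2
  set N := √(nn n p (a + y.1) v)
  have hN : 0 ≤ N := Real.sqrt_nonneg _
  set q := (a + y.1) * v + dd p 0 (a + y.1)
  set q' := (b + y.1) * v + dd p 0 (b + y.1)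
  set W := |v + dd p 1 (a + y.1)| with hW
  set W' := |v + dd p 1 (b + y.1)| with hW'
  have hWW : |W - W'| ≤ Real.exp 3 * N * |a - b| := by
    refine (abs_abs_sub_abs_le _ _).trans (le_trans (le_of_eq ?_) hd)
    ring_nf
  set β := bet e (a - y.1)
  set β' := bet e (b - y.1)
  have hS1 : |sinq β W u| ≤ N := (abs_sinq_le _ _ _).trans (by rw [hW, abs_abs]; exact hw)
  have hS2 := abs_mul_abs_sinq_le (W := W) (u := u) hba
  have hS3 := abs_sinq_sub_le (W := W) (W' := W') (u := u) hba hbb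
  have hS4 : |sinq β W u - sinq β' W' u| ≤ (4 + Real.exp 3) * N * |a - b| := by
    refine hS3.trans ?_
    have : 4 * |W| * |β - β'| ≤ 4 * N * |a - b| := by
      gcongr
      rw [hW, abs_abs]; exact hw
    linarith
  have hE := norm_exp_I_sub_le (-(γ * (u * q))) (-(γ * (u * q')))
  rw [show -(γ * (u * q)) - -(γ * (u * q')) = -(γ * u * (q - q')) by ring, abs_neg, abs_mul,
    abs_mul] at hE
  have hE1 : ∀ c : ℝ, ‖Complex.exp (Complex.I * (c : ℂ))‖ = 1 := fun c => by
    rw [mul_comm, Complex.norm_exp_ofReal_mul_I]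
  set E := Complex.exp (Complex.I * ((-(γ * (u * q)) : ℝ) : ℂ))
  set E' := Complex.exp (Complex.I * ((-(γ * (u * q')) : ℝ) : ℂ)) with hE'
  have hE'1 : ‖E'‖ = 1 := hE1 _
  have hE0 : ‖E‖ = 1 := hE1 _
  set S := sinq β W u
  set S' := sinq β' W' u
  have hdec : (ψ : ℂ) * (E * (S : ℂ)) - (ψ' : ℂ) * (E' * (S' : ℂ))
      = ((ψ - ψ' : ℝ) : ℂ) * (E * (S : ℂ)) + (ψ' : ℂ) * ((E - E') * (S : ℂ))
        + (ψ' : ℂ) * (E' * ((S - S' : ℝ) : ℂ)) := by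
    push_cast; ring
  rw [hdec]
  have t1 : ‖((ψ - ψ' : ℝ) : ℂ) * (E * (S : ℂ))‖ ≤ 24 * Real.exp 24 * |a - b| * ψ * N := by
    rw [norm_mul, norm_mul, hE0, one_mul, Complex.norm_real, Complex.norm_real, Real.norm_eq_abs,
      Real.norm_eq_abs]
    gcongr
  have t2 : ‖(ψ' : ℂ) * ((E - E') * (S : ℂ))‖
      ≤ (Real.exp 24 * ψ) * (2 * Γ * Real.exp 3 * N * |a - b|) := by
    rw [norm_mul, norm_mul, Complex.norm_real, Complex.norm_real, Real.norm_of_nonneg h0'.le,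
      Real.norm_eq_abs]
    refine mul_le_mul (hψ'.trans (by gcongr)) ?_ (by positivity) (by positivity)
    calc ‖E - E'‖ * |S| ≤ (|γ| * |u| * |q - q'|) * |S| := by gcongr
      _ = |γ| * |q - q'| * (|u| * |S|) := by ring
      _ ≤ Γ * (Real.exp 3 * N * |a - b|) * 2 := by gcongr
      _ = _ := by ring
  have t3 : ‖(ψ' : ℂ) * (E' * ((S - S' : ℝ) : ℂ))‖
      ≤ (Real.exp 24 * ψ) * ((4 + Real.exp 3) * N * |a - b|) := by
    rw [norm_mul, norm_mul, hE'1, one_mul, Complex.norm_real, Complex.norm_real,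
      Real.norm_of_nonneg h0'.le, Real.norm_eq_abs]
    exact mul_le_mul (hψ'.trans (by gcongr)) hS4 (abs_nonneg _) (by positivity)
  refine (norm_add₃_le).trans ((add_le_add (add_le_add t1 t2) t3).trans (le_of_eq ?_))
  ring

/-- The left end point of the cell of length `ℓ` containing `x`. -/
def cell (ℓ x : ℝ) : ℝ := ℓ * ⌊x / ℓ⌋

lemma abs_sub_cell_le {ℓ : ℝ} (hℓ : 0 < ℓ) (x : ℝ) : |x - cell ℓ x| ≤ ℓ := by
  unfold cell
  have h1 := Int.floor_le (x / ℓ)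
  have h2 := Int.lt_floor_add_one (x / ℓ)
  rw [le_div_iff₀ hℓ] at h1
  rw [div_lt_iff₀ hℓ] at h2
  rw [abs_le]
  constructor <;> linarith

lemma measurable_cell (ℓ : ℝ) : Measurable (cell ℓ) := by
  have h : Measurable fun x : ℝ => ⌊x / ℓ⌋ := Int.measurable_floor.comp (by fun_prop)
  have h2 : Measurable fun k : ℤ => (k : ℝ) := measurable_from_top
  exact (h2.comp h).const_mul ℓ

/-- The difference between `lowK` and its sample at the left end point of a cell. -/
def diffK (n : ℕ) (Λ : ℝ) (p : ℝ[X]) (e γ lo hi ℓ : ℝ) (x y : ℝ × ℝ) : ℂ :=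
  lowK n Λ p e γ lo hi x y - lowK n Λ p e γ lo hi (cell ℓ x.1, x.2) y

/-- The weight in `x₁ - y₁` for the Schur bound of `diffK`. -/
def edge (lo hi ℓ t : ℝ) : ℝ≥0∞ :=
  ENNReal.ofReal ℓ * (Set.Icc (-3) 3).indicator (fun _ => 1) t +
  ((Metric.closedBall lo ℓ).indicator (fun _ => 1) t +
  (Metric.closedBall (-lo) ℓ).indicator (fun _ => 1) t +
  ((Metric.closedBall hi ℓ).indicator (fun _ => 1) t +
  (Metric.closedBall (-hi) ℓ).indicator (fun _ => 1) t))

lemma measurable_edge (lo hi ℓ : ℝ) : Measurable (edge lo hi ℓ) := by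
  have h : ∀ c, Measurable ((Metric.closedBall c ℓ).indicator (fun _ : ℝ => (1 : ℝ≥0∞))) := fun c =>
    measurable_const.indicator Metric.isClosed_closedBall.measurableSet
  exact ((measurable_const.indicator measurableSet_Icc).const_mul _).add
    (((h _).add (h _)).add ((h _).add (h _)))

lemma lintegral_edge (lo hi : ℝ) {ℓ : ℝ} (hℓ : 0 ≤ ℓ) :
    ∫⁻ t, edge lo hi ℓ t = ENNReal.ofReal (14 * ℓ) := by
  have hm : ∀ c, Measurable ((Metric.closedBall c ℓ).indicator (fun _ : ℝ => (1 : ℝ≥0∞))) := fun c =>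
    measurable_const.indicator Metric.isClosed_closedBall.measurableSet
  have hi' : ∀ c, ∫⁻ t, (Metric.closedBall c ℓ).indicator (fun _ : ℝ => (1 : ℝ≥0∞)) t
      = ENNReal.ofReal (2 * ℓ) := fun c => by
    rw [lintegral_indicator_const Metric.isClosed_closedBall.measurableSet, Real.volume_closedBall,
      one_mul]
  have hm2 : ∀ c, Measurable fun t : ℝ => (Metric.closedBall c ℓ).indicator (fun _ => (1 : ℝ≥0∞)) t +
      (Metric.closedBall (-c) ℓ).indicator (fun _ => (1 : ℝ≥0∞)) t := fun c => (hm _).add (hm _)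
  unfold edge
  rw [lintegral_add_left ((measurable_const.indicator measurableSet_Icc).const_mul _),
    lintegral_add_left (hm2 lo), lintegral_add_left (hm _), lintegral_add_left (hm _),
    hi', hi', hi', hi', lintegral_const_mul _ (measurable_const.indicator measurableSet_Icc),
    lintegral_indicator_const measurableSet_Icc, Real.volume_Icc, one_mul,
    ← ENNReal.ofReal_mul hℓ, ← ENNReal.ofReal_add (by positivity) (by positivity),
    ← ENNReal.ofReal_add (by positivity) (by positivity),
    ← ENNReal.ofReal_add (by nlinarith) (by positivity)]
  congr 1
  ring

lemma one_le_edge_of_mem {ℓ a b : ℝ} (hab : |a - b| ≤ ℓ) (ha : a ∈ win lo hi)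
    (hb : b ∉ win lo hi) : 1 ≤ edge lo hi ℓ a ∧ 1 ≤ edge lo hi ℓ b := by
  have hab2 : |(|a| - |b|)| ≤ ℓ := (abs_abs_sub_abs_le _ _).trans hab
  rw [abs_le] at hab2
  have key : ∀ t, ((|(|t| - lo)| ≤ ℓ) ∨ (|(|t| - hi)| ≤ ℓ)) → 1 ≤ edge lo hi ℓ t := by
    intro t ht
    have hle : ∀ c, t ∈ Metric.closedBall c ℓ →
        1 ≤ (Metric.closedBall c ℓ).indicator (fun _ : ℝ => (1 : ℝ≥0∞)) t := fun c h => by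
      rw [Set.indicator_of_mem h]
    have hmem : ∀ c, |(|t| - c)| ≤ ℓ → t ∈ Metric.closedBall c ℓ ∨ t ∈ Metric.closedBall (-c) ℓ := by
      intro c hc
      rw [Metric.mem_closedBall, Metric.mem_closedBall, Real.dist_eq, Real.dist_eq]
      rcases abs_choice t with h | h
      · left; rwa [h] at hc
      · right; rw [h] at hc; rw [← abs_neg]; convert hc using 2; ring
    unfold edge
    refine le_add_left ?_
    rcases ht with h | h
    · rcases hmem _ h with h | h
      · exact le_add_right (le_add_right (hle _ h))
      · exact le_add_right (le_add_left (hle _ h))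
    · rcases hmem _ h with h | h
      · exact le_add_left (le_add_right (hle _ h))
      · exact le_add_left (le_add_left (hle _ h))
  rw [mem_win] at ha hb
  have hb' : |b| ≤ lo ∨ hi < |b| := by
    by_contra! h
    exact hb ⟨h.1, h.2⟩
  constructor
  · refine key a ?_
    rcases hb' with h | h
    · left; rw [abs_le]; constructor <;> linarith [ha.1]
    · right; rw [abs_le]; constructor <;> linarith [ha.2]
  · refine key b ?_
    rcases hb' with h | h
    · left; rw [abs_le]; constructor <;> linarith [ha.1]
    · right; rw [abs_le]; constructor <;> linarith [ha.2]

lemma norm_lowK_le_of_sqrt (x y : ℝ × ℝ) : ‖lowK n Λ p e γ lo hi x y‖ ≤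
    √(nn n p (x.1 + y.1) (x.2 + y.2)) * psi n Λ p (x.1 + y.1) (x.2 - y.2) (x.2 + y.2) := by
  unfold lowK
  refine (norm_indicator_le_norm_self _ _).trans ?_
  rw [norm_mul, Complex.norm_real, Real.norm_of_nonneg (psi_pos _ _ _).le, mul_comm]
  exact mul_le_mul_of_nonneg_right (norm_coreK_le (n := n) x y) (psi_pos _ _ _).le

/-- The Lipschitz constant in the first variable. -/
def lipC (Γ : ℝ) : ℝ :=
  24 * Real.exp 24 + Real.exp 24 * (2 * Γ * Real.exp 3 + 4 + Real.exp 3) + Real.exp 24 * Real.exp 3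

lemma half_le_bet_of_mem_win (he : 0 < e) (he1 : e ≤ 1) (hlo : 1 - e ^ 2 ≤ lo) {t : ℝ}
    (ht : t ∈ win lo hi) : 1 / 2 ≤ bet e t := by
  have h := half_le_bet he he1 (t := |t|) (hlo.trans ht.1.le)
  rcases abs_choice t with h1 | h1 <;> rw [h1] at h
  · exact h
  · rwa [bet_neg] at h

lemma enorm_diffK_le (hp : p.natDegree ≤ n) {Γ ℓ : ℝ} (hγ : |γ| ≤ Γ) (he : 0 < e) (he1 : e ≤ 1)
    (hΛ : 1 ≤ Λ) (hlo : 1 - e ^ 2 ≤ lo) (hhi : hi ≤ 2) (hℓ : 0 < ℓ) (hℓ1 : ℓ ≤ 1) (x y : ℝ × ℝ) {v : ℝ}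
    (hv : v = 2 * x.2 ∨ v = 2 * y.2) :
    ‖diffK n Λ p e γ lo hi ℓ x y‖ₑ ≤ poiMaj n p (4 * Λ ^ 16 * lipC Γ)
      (edge lo hi ℓ) (x.1 + y.1) (x.1 - y.1) v (x.2 - y.2) := by
  have hΓ : 0 ≤ Γ := (abs_nonneg γ).trans hγ
  have h3 := poi_nonneg (nn_pos (n := n) (p := p) (x.1 + y.1) v).le (x.2 - y.2)
  have hD : √(nn n p (x.1 + y.1) (x.2 + y.2)) * psi n Λ p (x.1 + y.1) (x.2 - y.2) (x.2 + y.2)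
      ≤ 4 * Λ ^ 16 * poi (nn n p (x.1 + y.1) v) (x.2 - y.2) := by
    refine (sqrt_nn_mul_psi_le hΛ _ _ _ v (by rcases hv with rfl | rfl <;> ring)).trans ?_
    refine mul_le_mul_of_nonneg_left ?_ (by positivity)
    refine mul_le_of_le_one_left h3 (inv_le_one_of_one_le₀ (one_le_pow₀ ?_))
    linarith [sq_nonneg (x.2 - y.2)]
  have hx := abs_sub_cell_le hℓ x.1
  set b := cell ℓ x.1 with hb
  have hx1 : |x.1 - b| ≤ 1 := hx.trans hℓ1
  have hss : |(x.1 + y.1) - (b + y.1)| ≤ 1 := by rwa [add_sub_add_right_eq_sub]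
  have hst : |(x.1 - y.1) - (b - y.1)| ≤ ℓ := by rwa [sub_sub_sub_cancel_right]
  have hψ' := psi_le_exp (Λ := Λ) hp (x.1 + y.1) (b + y.1) (x.2 - y.2) (x.2 + y.2)
  have hN' := sqrt_nn_le hp hss (x.2 + y.2)
  have h24 : Real.exp (24 * |(x.1 + y.1) - (b + y.1)|) ≤ Real.exp 24 :=
    Real.exp_le_exp.2 (by linarith)
  have h1 := norm_lowK_le_of_sqrt (n := n) (Λ := Λ) (p := p) (e := e) (γ := γ) (lo := lo) (hi := hi) x y
  have h2 := norm_lowK_le_of_sqrt (n := n) (Λ := Λ) (p := p) (e := e) (γ := γ) (lo := lo) (hi := hi)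
    (b, x.2) y
  have hboth := fun h h' => norm_psi_mul_coreK_sub_le (Λ := Λ) (e := e) (x2 := x.2) (y := y) hp hγ hx1 h h'
  simp only at h2 hboth
  have hψ0 := psi_pos (n := n) (Λ := Λ) (p := p) (x.1 + y.1) (x.2 - y.2) (x.2 + y.2)
  have hψ0' := psi_pos (n := n) (Λ := Λ) (p := p) (b + y.1) (x.2 - y.2) (x.2 + y.2)
  have h2' : ‖lowK n Λ p e γ lo hi (b, x.2) y‖ ≤ Real.exp 24 * Real.exp 3 *
      (√(nn n p (x.1 + y.1) (x.2 + y.2)) * psi n Λ p (x.1 + y.1) (x.2 - y.2) (x.2 + y.2)) := by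
    refine h2.trans ?_
    calc _ ≤ (Real.exp 3 * √(nn n p (x.1 + y.1) (x.2 + y.2))) *
          (Real.exp 24 * psi n Λ p (x.1 + y.1) (x.2 - y.2) (x.2 + y.2)) := by
          refine mul_le_mul hN' (hψ'.trans ?_) hψ0'.le (by positivity)
          gcongr
      _ = _ := by ring
  set D := √(nn n p (x.1 + y.1) (x.2 + y.2)) * psi n Λ p (x.1 + y.1) (x.2 - y.2) (x.2 + y.2) with hDdef
  have hD0 : 0 ≤ D := by positivity
  have e24 : 1 ≤ Real.exp 24 := Real.one_le_exp (by norm_num)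
  have e3 : 1 ≤ Real.exp 3 := Real.one_le_exp (by norm_num)
  have eC1 : 1 ≤ lipC Γ := by
    unfold lipC
    have : 0 ≤ Real.exp 24 * (2 * Γ * Real.exp 3 + 4 + Real.exp 3) := by positivity
    have : 0 ≤ Real.exp 24 * Real.exp 3 := by positivity
    linarith
  have eC2 : Real.exp 24 * Real.exp 3 ≤ lipC Γ := by
    unfold lipC
    have : 0 ≤ Real.exp 24 * (2 * Γ * Real.exp 3 + 4 + Real.exp 3) := by positivity
    linarith
  have eC3 : 24 * Real.exp 24 + Real.exp 24 * (2 * Γ * Real.exp 3 + 4 + Real.exp 3) ≤ lipC Γ := by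
    unfold lipC
    have : 0 ≤ Real.exp 24 * Real.exp 3 := by positivity
    linarith
  have hfin : ENNReal.ofReal (lipC Γ * D)
      ≤ ENNReal.ofReal (4 * Λ ^ 16 * lipC Γ * poi (nn n p (x.1 + y.1) v) (x.2 - y.2)) := by
    refine ENNReal.ofReal_le_ofReal ?_
    calc lipC Γ * D ≤ lipC Γ * (4 * Λ ^ 16 * poi (nn n p (x.1 + y.1) v) (x.2 - y.2)) := by gcongr
      _ = _ := by ring
  unfold poiMaj
  refine le_trans ?_ (mul_le_mul_left hfin _)
  rw [← ofReal_norm]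
  have hlarge : ‖diffK n Λ p e γ lo hi ℓ x y‖ ≤ lipC Γ * D → 1 ≤ edge lo hi ℓ (x.1 - y.1) →
      ENNReal.ofReal ‖diffK n Λ p e γ lo hi ℓ x y‖ ≤
        ENNReal.ofReal (lipC Γ * D) * edge lo hi ℓ (x.1 - y.1) := fun h h' =>
    (ENNReal.ofReal_le_ofReal h).trans (le_mul_of_one_le_right' h')
  by_cases hxw : x.1 - y.1 ∈ win lo hi
  · by_cases hbw : b - y.1 ∈ win lo hi
    · have h4 := hboth (half_le_bet_of_mem_win he he1 hlo hxw) (half_le_bet_of_mem_win he he1 hlo hbw)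
      have h5 : ‖diffK n Λ p e γ lo hi ℓ x y‖ ≤ (lipC Γ * D) * ℓ := by
        unfold diffK lowK
        rw [← hb, Set.indicator_of_mem hxw, Set.indicator_of_mem hbw]
        refine h4.trans ?_
        calc _ ≤ lipC Γ * ℓ * D := by gcongr
          _ = _ := by ring
      refine (ENNReal.ofReal_le_ofReal h5).trans ?_
      rw [ENNReal.ofReal_mul (by positivity)]
      gcongr
      unfold edge
      have h6 : x.1 - y.1 ∈ Set.Icc (-3 : ℝ) 3 := by
        have := abs_le.1 (hxw.2.trans hhi)
        exact ⟨by linarith [this.1], by linarith [this.2]⟩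
      rw [Set.indicator_of_mem h6, mul_one]
      exact le_self_add
    · refine hlarge ?_ (one_le_edge_of_mem hst hxw hbw).1
      have : lowK n Λ p e γ lo hi (b, x.2) y = 0 := by
        unfold lowK; rw [Set.indicator_of_notMem hbw]
      unfold diffK
      rw [← hb, this, sub_zero]
      exact h1.trans (le_mul_of_one_le_left hD0 eC1)
  · by_cases hbw : b - y.1 ∈ win lo hi
    · refine hlarge ?_ (one_le_edge_of_mem (by rwa [abs_sub_comm]) hbw hxw).2
      have : lowK n Λ p e γ lo hi x y = 0 := by
        unfold lowK; rw [Set.indicator_of_notMem hxw]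
      unfold diffK
      rw [← hb, this, zero_sub, norm_neg]
      exact h2'.trans (mul_le_mul_of_nonneg_right eC2 hD0)
    · have : diffK n Λ p e γ lo hi ℓ x y = 0 := by
        unfold diffK lowK
        rw [← hb, Set.indicator_of_notMem hxw, Set.indicator_of_notMem hbw, sub_zero]
      rw [this]
      simp

lemma integrable_lowK_mul {M1 M2 : ℝ} {f : ℝ × ℝ → ℂ} (hf : MemLp f 2 (volume.restrict (box M1 M2)))
    (x : ℝ × ℝ) : Integrable (fun y => lowK n Λ p e γ lo hi x y * f y) (volume.restrict (box M1 M2)) := by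
  obtain ⟨C, -, hC⟩ := bddOn_lowK (n := n) (Λ := Λ) (p := p) (e := e) (γ := γ) (lo := lo) (hi := hi)
    (|x.1| + |M1| + 1) (|x.2| + |M2|)
  have a1 := abs_nonneg x.1
  have a2 := abs_nonneg x.2
  have a3 := abs_nonneg M1
  have a4 := abs_nonneg M2
  refine (hf.integrable (by norm_num)).bdd_mul (c := C)
    (measurable_lowK.comp measurable_prodMk_left).aestronglyMeasurable ?_
  filter_upwards [ae_restrict_mem (measurableSet_box M1 M2)] with y hy
  refine hC x ⟨⟨?_, ?_⟩, ?_, ?_⟩ y ⟨⟨?_, ?_⟩, ?_, ?_⟩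
  · linarith [neg_abs_le x.1]
  · linarith [le_abs_self x.1]
  · linarith [neg_abs_le x.2]
  · linarith [le_abs_self x.2]
  · linarith [hy.1.1, le_abs_self M1]
  · linarith [hy.1.2, le_abs_self M1]
  · linarith [hy.2.1, le_abs_self M2]
  · linarith [hy.2.2, le_abs_self M2]

/-- The function `op lowK f` sampled at left end points of cells. -/
def sample (n : ℕ) (Λ : ℝ) (p : ℝ[X]) (e γ lo hi ℓ M1 M2 : ℝ) (f : ℝ × ℝ → ℂ) (x : ℝ × ℝ) : ℂ :=
  op (volume.restrict (box M1 M2)) (lowK n Λ p e γ lo hi) f (cell ℓ x.1, x.2)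

lemma stronglyMeasurable_sample {ℓ M1 M2 : ℝ} {f : ℝ × ℝ → ℂ}
    (hf : MemLp f 2 (volume.restrict (box M1 M2))) :
    StronglyMeasurable (sample n Λ p e γ lo hi ℓ M1 M2 f) :=
  (op_stronglyMeasurable measurable_lowK hf.1).comp_measurable
    (((measurable_cell ℓ).comp measurable_fst).prodMk measurable_snd)

/-- A single dyadic piece maps to functions that are nearly constant on short cells. -/
lemma exists_sample_bound (n : ℕ) (hn : 1 ≤ n) (Γ : ℝ) (hΓ : 1 / 2 < Γ) :
    ∃ C : ℝ, 0 < C ∧ ∀ p : ℝ[X], p.natDegree ≤ n → ∀ e γ Λ lo hi ℓ M1 M2 : ℝ, 0 < e → e ≤ 1 →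
    1 / 2 ≤ γ → γ ≤ Γ → 1 ≤ Λ → 1 - e ^ 2 ≤ lo → lo ≤ hi → hi ≤ 2 - e ^ 2 / 2 → 0 < ℓ → ℓ ≤ 1 →
    ∀ f : ℝ × ℝ → ℂ, MemLp f 2 (volume.restrict (box M1 M2)) →
    sqn (volume.restrict (box M1 M2))
      (fun x => op (volume.restrict (box M1 M2)) (fullK p e γ lo hi) f x
        - sample n Λ p e γ lo hi ℓ M1 M2 f x)
      ≤ ENNReal.ofReal (C * (Λ ^ 32 * ℓ ^ 2 + √Λ ^ (-(1 / (32 * n) : ℝ))))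
        * sqn (volume.restrict (box M1 M2)) f := by
  obtain ⟨C, hC, h⟩ := exists_tail_bound n hn Γ hΓ
  refine ⟨2 * (4 * lipC Γ * Real.pi * 14) ^ 2 + 2 * C, by positivity, ?_⟩
  intro p hp e γ Λ lo hi ℓ M1 M2 he he1 hγ hγΓ hΛ hlo hlohi hhi hℓ hℓ1 f hf
  have he2 : e ^ 2 ≤ 1 := pow_le_one₀ he.le he1
  have hlip : 0 ≤ lipC Γ := by unfold lipC; positivity
  have h1 := h p hp e γ Λ lo hi M1 M2 he he1 hγ hγΓ hΛ hlo hlohi hhi f hf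
  have hγa : |γ| ≤ Γ := by rwa [abs_of_pos (by linarith)]
  have h2 := sqn_op_le_of_poi (n := n) (p := p) (S := box M1 M2) (T := box M1 M2)
    (K := diffK n Λ p e γ lo hi ℓ) (measurable_edge lo hi ℓ) (by positivity)
    (fun x y => enorm_diffK_le hp hγa he he1 hΛ hlo (by linarith [sq_nonneg e]) hℓ hℓ1 x y (Or.inl rfl))
    (fun x y => enorm_diffK_le hp hγa he he1 hΛ hlo (by linarith [sq_nonneg e]) hℓ hℓ1 x y (Or.inr rfl))
    hf.1
  rw [lintegral_edge _ _ hℓ.le, ← ENNReal.ofReal_mul (by positivity),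
    ← ENNReal.ofReal_pow (by positivity)] at h2
  have e1 : ∀ x ∈ box M1 M2, op (volume.restrict (box M1 M2)) (fullK p e γ lo hi) f x
        - sample n Λ p e γ lo hi ℓ M1 M2 f x
      = op (volume.restrict (box M1 M2)) (tailK n Λ p e γ lo hi) f x
        + op (volume.restrict (box M1 M2)) (diffK n Λ p e γ lo hi ℓ) f x := fun x hx => by
    rw [fullK_eq_add (n := n) (Λ := Λ) (by linarith)]
    unfold sample op diffK
    simp_rw [add_mul, sub_mul]
    rw [integral_add (integrable_lowK_mul hf x) (integrable_kernel_mul_of_bddOn (measurableSet_box M1 M2)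
      measurable_tailK (bddOn_tailK he he1 hΛ hlo M1 M2) hf hx),
      integral_sub (integrable_lowK_mul hf x) (integrable_lowK_mul hf _)]
    ring
  rw [sqn_restrict_congr (measurableSet_box M1 M2) e1]
  refine (sqn_add_le (op_stronglyMeasurable measurable_tailK hf.1).aestronglyMeasurable).trans ?_
  refine (add_le_add (mul_le_mul_right h1 _) (mul_le_mul_right h2 _)).trans ?_
  rw [← mul_assoc, ← mul_assoc, ← add_mul, ← ENNReal.ofReal_ofNat, ← ENNReal.ofReal_mul (by norm_num),
    ← ENNReal.ofReal_mul (by norm_num), ← ENNReal.ofReal_add (by positivity) (by positivity)]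
  gcongr
  have hη : 0 ≤ √Λ ^ (-(1 / (32 * n) : ℝ)) := by positivity
  have hA : 0 ≤ (4 * lipC Γ * Real.pi * 14) ^ 2 * √Λ ^ (-(1 / (32 * n) : ℝ)) := by positivity
  have hB : 0 ≤ C * (Λ ^ 32 * ℓ ^ 2) := by positivity
  have e2 : (4 * Λ ^ 16 * lipC Γ * Real.pi * (14 * ℓ)) ^ 2
      = (4 * lipC Γ * Real.pi * 14) ^ 2 * (Λ ^ 32 * ℓ ^ 2) := by ring
  rw [e2]
  linarith

end Continuity

section LogDerivative

/-- Away from the real parts of the complex roots the logarithmic derivative is small. -/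
lemma exists_logDeriv_centers (P : ℝ[X]) : ∃ R : Finset ℝ, R.card ≤ P.natDegree ∧
    ∀ κ s : ℝ, 0 < κ → (∀ r ∈ R, κ ≤ |s - r|) →
      |P.derivative.eval s| ≤ P.natDegree / κ * |P.eval s| := by
  classical
  by_cases hP : P = 0
  · exact ⟨∅, by simp, by simp [hP]⟩
  set Q := P.map (algebraMap ℝ ℂ) with hQ
  have hsplit : Q.Splits := IsAlgClosed.splits Q
  have hQ0 : Q ≠ 0 := (Polynomial.map_ne_zero_iff (algebraMap ℝ ℂ).injective).2 hP
  have hcard : Q.roots.card = P.natDegree := by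
    rw [← natDegree_map (p := P) (algebraMap ℝ ℂ)]; exact hsplit.natDegree_eq_card_roots.symm
  have hev : ∀ (T : ℝ[X]) (x : ℝ), (T.map (algebraMap ℝ ℂ)).eval (x : ℂ) = ((T.eval x : ℝ) : ℂ) := by
    intro T x
    rw [eval_map_algebraMap, ← Complex.coe_algebraMap, aeval_algebraMap_apply]
    simp
  have hn : ∀ (T : ℝ[X]) (x : ℝ), |T.eval x| = ‖(T.map (algebraMap ℝ ℂ)).eval (x : ℂ)‖ :=
    fun T x => by rw [hev, Complex.norm_real, Real.norm_eq_abs]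
  refine ⟨(Q.roots.map Complex.re).toFinset, (Multiset.toFinset_card_le _).trans
    (by rw [Multiset.card_map, hcard]), fun κ s hκ hr => ?_⟩
  have hr' : ∀ r ∈ Q.roots, κ ≤ ‖(s : ℂ) - r‖ := fun r h => by
    refine (hr r.re (Multiset.mem_toFinset.2 (Multiset.mem_map_of_mem _ h))).trans ?_
    simpa using Complex.abs_re_le_norm ((s : ℂ) - r)
  have hs0 : Q.eval (s : ℂ) ≠ 0 := fun h => by
    have := hr' s ((mem_roots hQ0).2 h)
    rw [sub_self, norm_zero] at this
    linarith
  have hdiv := hsplit.eval_derivative_div_eval_of_ne_zero hs0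
  have hbound : ∀ M : Multiset ℂ, (∀ r ∈ M, κ ≤ ‖(s : ℂ) - r‖) →
      ‖(M.map fun z => 1 / ((s : ℂ) - z)).sum‖ ≤ M.card / κ := by
    intro M
    induction M using Multiset.induction_on with
    | empty => simp
    | cons a M ih =>
      intro h
      rw [Multiset.map_cons, Multiset.sum_cons, Multiset.card_cons, Nat.cast_add, Nat.cast_one,
        add_div, add_comm]
      refine (norm_add_le _ _).trans (add_le_add (ih fun r hr => h r (Multiset.mem_cons_of_mem hr)) ?_)
      rw [norm_div, norm_one]
      exact one_div_le_one_div_of_le hκ (h a (Multiset.mem_cons_self a M))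
  have h2 := hbound Q.roots hr'
  rw [← hdiv, hcard, norm_div, div_le_iff₀ (norm_pos_iff.2 hs0), hQ, derivative_map] at h2
  rw [hn, hn]
  exact h2

variable {n : ℕ} {p : ℝ[X]}

/-- Points where all derivatives are controlled by the lower ones at scale `κ`. -/
def GoodAt (n : ℕ) (p : ℝ[X]) (κ z s : ℝ) : Prop :=
  |dd p 2 s| ≤ n / κ * |2 * z + dd p 1 s| ∧ ∀ m, |dd p (m + 3) s| ≤ n / κ * |dd p (m + 2) s|

lemma exists_goodAt_centers (hp : p.natDegree ≤ n) (z : ℝ) : ∃ R : Finset ℝ, R.card ≤ n * (n + 1) ∧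
    ∀ κ s : ℝ, 0 < κ → (∀ r ∈ R, κ ≤ |s - r|) → GoodAt n p κ z s := by
  classical
  obtain ⟨R0, hR0, h0⟩ := exists_logDeriv_centers (C (2 * z) + derivative p)
  choose R hR h using fun m => exists_logDeriv_centers (derivative^[m + 2] p)
  have hd0 : (C (2 * z) + derivative p).natDegree ≤ n :=
    (natDegree_add_le _ _).trans (max_le (by rw [natDegree_C]; omega) ((natDegree_derivative_le p).trans (by omega)))
  have hd : ∀ m, (derivative^[m + 2] p).natDegree ≤ n := fun m =>
    (natDegree_iterate_derivative p _).trans (by omega)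
  refine ⟨R0 ∪ (Finset.range n).biUnion R, ?_, fun κ s hκ hr => ⟨?_, fun m => ?_⟩⟩
  · refine (Finset.card_union_le _ _).trans ?_
    have := Finset.card_biUnion_le_card_mul (Finset.range n) R n fun m _ => (hR m).trans (hd m)
    rw [Finset.card_range] at this
    have := hR0.trans hd0
    nlinarith
  · have h1 := h0 κ s hκ fun r hrm => hr r (Finset.mem_union_left _ hrm)
    have e1 : (derivative (C (2 * z) + derivative p)).eval s = dd p 2 s := by simp [dd]
    have e2 : (C (2 * z) + derivative p).eval s = 2 * z + dd p 1 s := by simp [dd]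
    rw [e1, e2] at h1
    refine h1.trans ?_
    gcongr
  · by_cases hm : n < m + 3
    · rw [dd_eq_zero hp hm, abs_zero]; positivity
    · have h1 := h m κ s hκ fun r hrm => hr r (Finset.mem_union_right _
        (Finset.mem_biUnion.2 ⟨m, Finset.mem_range.2 (by omega), hrm⟩))
      rw [← Function.iterate_succ_apply' derivative] at h1
      refine h1.trans ?_
      unfold dd
      gcongr
      exact hd m

/-- Comparison constant of `nn` with its first term at good points. -/
def goodC (n : ℕ) : ℝ := 1 + ∑ m ∈ Finset.range n, ((n : ℝ) ^ (m + 1)) ^ 2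

lemma one_le_goodC (n : ℕ) : 1 ≤ goodC n := by
  unfold goodC
  have : 0 ≤ ∑ m ∈ Finset.range n, ((n : ℝ) ^ (m + 1)) ^ 2 := Finset.sum_nonneg fun _ _ => by positivity
  linarith

lemma nn_le_of_goodAt {κ z s : ℝ} (hκ : 1 ≤ κ) (h : GoodAt n p κ z s) :
    nn n p s (2 * z) ≤ goodC n * (1 + (2 * z + dd p 1 s) ^ 2) := by
  have hn : (n : ℝ) / κ ≤ n := div_le_self (by positivity) hκ
  have key : ∀ m, |dd p (m + 2) s| ≤ (n : ℝ) ^ (m + 1) * |2 * z + dd p 1 s| := by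
    intro m
    induction m with
    | zero => simpa using h.1.trans (mul_le_mul_of_nonneg_right hn (abs_nonneg _))
    | succ m ih =>
      calc |dd p (m + 1 + 2) s| ≤ n / κ * |dd p (m + 2) s| := h.2 m
        _ ≤ n * ((n : ℝ) ^ (m + 1) * |2 * z + dd p 1 s|) := by gcongr
        _ = _ := by ring
  have h1 : ∑ m ∈ Finset.range n, dd p (m + 2) s ^ 2
      ≤ (∑ m ∈ Finset.range n, ((n : ℝ) ^ (m + 1)) ^ 2) * (2 * z + dd p 1 s) ^ 2 := by
    rw [Finset.sum_mul]
    refine Finset.sum_le_sum fun m _ => ?_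
    rw [← sq_abs (dd p (m + 2) s), ← sq_abs (2 * z + dd p 1 s), ← mul_pow]
    exact pow_le_pow_left₀ (abs_nonneg _) (key m) 2
  have h0 : 0 ≤ ∑ m ∈ Finset.range n, ((n : ℝ) ^ (m + 1)) ^ 2 := Finset.sum_nonneg fun _ _ => by positivity
  unfold nn goodC
  linarith

lemma abs_nn1_le_of_goodAt {κ z s : ℝ} (hκ : 0 < κ) (h : GoodAt n p κ z s) (v : ℝ) :
    |nn1 n p s v| ≤ 2 * n / κ * (√(nn n p s v) * √(nn n p s (2 * z)) + nn n p s v) := by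
  have hn : 0 ≤ (n : ℝ) / κ := by positivity
  have h1 : |2 * (v + dd p 1 s) * dd p 2 s| ≤ 2 * n / κ * (√(nn n p s v) * √(nn n p s (2 * z))) := by
    rw [abs_mul, abs_mul, abs_of_pos (by norm_num : (0 : ℝ) < 2)]
    have a1 := abs_w_le (n := n) (p := p) s v
    have a2 := h.1.trans (mul_le_mul_of_nonneg_left (abs_w_le (n := n) (p := p) s (2 * z)) hn)
    calc _ ≤ 2 * √(nn n p s v) * (n / κ * √(nn n p s (2 * z))) := by gcongr
      _ = _ := by ring
  have h2 : |∑ m ∈ Finset.range n, 2 * dd p (m + 2) s * dd p (m + 3) s| ≤ 2 * n / κ * nn n p s v := by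
    calc _ ≤ ∑ m ∈ Finset.range n, |2 * dd p (m + 2) s * dd p (m + 3) s| :=
          Finset.abs_sum_le_sum_abs _ _
      _ ≤ ∑ m ∈ Finset.range n, 2 * n / κ * dd p (m + 2) s ^ 2 := by
          refine Finset.sum_le_sum fun m _ => ?_
          rw [abs_mul, abs_mul, abs_of_pos (by norm_num : (0 : ℝ) < 2), ← sq_abs (dd p (m + 2) s)]
          calc _ ≤ 2 * |dd p (m + 2) s| * (n / κ * |dd p (m + 2) s|) := by
                gcongr; exact h.2 m
            _ = _ := by ring
      _ = 2 * n / κ * ∑ m ∈ Finset.range n, dd p (m + 2) s ^ 2 := by rw [Finset.mul_sum]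
      _ ≤ _ := by
          refine mul_le_mul_of_nonneg_left ?_ (by positivity)
          unfold nn
          linarith [sq_nonneg (v + dd p 1 s)]
  unfold nn1
  refine (abs_add_le _ _).trans ((add_le_add h1 h2).trans (le_of_eq ?_))
  ring

lemma abs_psi1_le_mul {Λ : ℝ} (s u v : ℝ) :
    |psi1 n Λ p s u v| ≤ 8 * (|nn1 n p s v| / nn n p s v) * psi n Λ p s u v := by
  have h0 := nn_pos (n := n) (p := p) s v
  unfold psi1 psi
  have hr : 0 ≤ u ^ 2 / Λ ^ 2 := by positivity
  rw [abs_neg, abs_div, abs_mul, abs_div, abs_mul, abs_of_nonneg (sq_nonneg u),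
    abs_of_nonneg (sq_nonneg Λ), abs_of_pos (by norm_num : (0 : ℝ) < 8)]
  have e1 : u ^ 2 * nn n p s v / Λ ^ 2 = u ^ 2 / Λ ^ 2 * nn n p s v := by ring
  have e2 : u ^ 2 * |nn1 n p s v| / Λ ^ 2 = u ^ 2 / Λ ^ 2 * |nn1 n p s v| := by ring
  rw [e1, e2]
  set r := u ^ 2 / Λ ^ 2
  have hp1 : 0 < 1 + r * nn n p s v := by positivity
  rw [abs_of_pos (pow_pos hp1 9), div_le_iff₀ (by positivity)]
  have e3 : 8 * (|nn1 n p s v| / nn n p s v) * ((1 + r * nn n p s v) ^ 8)⁻¹ * (1 + r * nn n p s v) ^ 9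
      = 8 * |nn1 n p s v| * (1 / nn n p s v + r) := by
    field_simp
  rw [e3]
  have : 0 ≤ |nn1 n p s v| * (1 / nn n p s v) := by positivity
  nlinarith

end LogDerivative

section StripAmplitude

variable {n : ℕ} {p : ℝ[X]} {Λ b κ : ℝ}

/-- The real amplitude of the cut-off kernel as a function of `s = x₁ + y₁`. -/
def stripG (n : ℕ) (Λ : ℝ) (p : ℝ[X]) (b s x2 z : ℝ) : ℝ :=
  psi n Λ p s (x2 - z) (x2 + z) * sinq b |x2 + z + dd p 1 s| (x2 - z)

/-- The `s`-derivative of `stripG`. -/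
def stripG1 (n : ℕ) (Λ : ℝ) (p : ℝ[X]) (b s x2 z : ℝ) : ℝ :=
  psi1 n Λ p s (x2 - z) (x2 + z) * sinq b |x2 + z + dd p 1 s| (x2 - z) +
  psi n Λ p s (x2 - z) (x2 + z) * (Real.cos (b * |x2 + z + dd p 1 s| * (x2 - z)) *
    (b * (x2 - z) / (b * (x2 - z))) * dd p 2 s) * sgn (x2 + z + dd p 1 s)

lemma hasDerivAt_stripG {s x2 z : ℝ}
    (h : x2 + z + dd p 1 s ≠ 0 ∨ ∀ s, x2 + z + dd p 1 s = 0) :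
    HasDerivAt (fun s => stripG n Λ p b s x2 z) (stripG1 n Λ p b s x2 z) s := by
  unfold stripG stripG1
  rcases h with h | h
  · have h1 : HasDerivAt (fun s => x2 + z + dd p 1 s) (dd p 2 s) s :=
      (hasDerivAt_dd p 1 s).const_add _
    have h2 : HasDerivAt (fun s => |x2 + z + dd p 1 s|) (sgn (x2 + z + dd p 1 s) * dd p 2 s) s :=
      HasDerivAt.comp s (h₂ := fun x => |x|) (hasDerivAt_abs h) h1
    have h3 : HasDerivAt (fun s => sinq b |x2 + z + dd p 1 s| (x2 - z))
        (Real.cos (b * |x2 + z + dd p 1 s| * (x2 - z)) *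
          (b * (sgn (x2 + z + dd p 1 s) * dd p 2 s) * (x2 - z)) / (b * (x2 - z))) s := by
      unfold sinq
      exact (((h2.const_mul b).mul_const (x2 - z)).sin).div_const _
    refine ((hasDerivAt_psi s (x2 - z) (x2 + z)).mul h3).congr_deriv ?_
    ring
  · have e : (fun s => psi n Λ p s (x2 - z) (x2 + z) * sinq b |x2 + z + dd p 1 s| (x2 - z))
        = fun _ => 0 := by
      funext s; rw [h s]; simp [sinq]
    rw [e, h s]
    simpa [sinq, sgn] using hasDerivAt_const s (0 : ℝ)

lemma abs_stripG_le (s x2 z : ℝ) :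
    |stripG n Λ p b s x2 z| ≤ √(nn n p s (x2 + z)) * psi n Λ p s (x2 - z) (x2 + z) := by
  unfold stripG
  rw [abs_mul, abs_of_pos (psi_pos _ _ _), mul_comm]
  refine mul_le_mul_of_nonneg_right ?_ (psi_pos _ _ _).le
  refine (abs_sinq_le _ _ _).trans ?_
  rw [abs_abs]
  exact abs_w_le _ _

lemma abs_mul_abs_stripG_le (hb : 1 / 2 ≤ b) (s x2 z : ℝ) :
    |x2 - z| * |stripG n Λ p b s x2 z| ≤ 2 * psi n Λ p s (x2 - z) (x2 + z) := by
  unfold stripG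
  rw [abs_mul, abs_of_pos (psi_pos _ _ _), mul_left_comm, mul_comm]
  exact mul_le_mul_of_nonneg_right (abs_mul_abs_sinq_le hb) (psi_pos _ _ _).le

lemma abs_stripG1_le {z0 s x2 z Q : ℝ} (hκ : 0 < κ) (h : GoodAt n p κ z0 s) (hQ : 1 ≤ Q)
    (hQ0 : √(nn n p s (2 * z0)) ≤ 16 * Q * √(nn n p s (x2 + z))) :
    |stripG1 n Λ p b s x2 z| ≤ 288 * n / κ * Q *
      (√(nn n p s (x2 + z)) * psi n Λ p s (x2 - z) (x2 + z)) := by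
  have hn : 0 ≤ (n : ℝ) / κ := by positivity
  have h0 := nn_pos (n := n) (p := p) s (x2 + z)
  have hψ := psi_pos (n := n) (Λ := Λ) (p := p) s (x2 - z) (x2 + z)
  have h1 := abs_nn1_le_of_goodAt hκ h (x2 + z)
  have hψ1 := abs_psi1_le_mul (n := n) (p := p) (Λ := Λ) s (x2 - z) (x2 + z)
  have hp2 := h.1.trans (mul_le_mul_of_nonneg_left (abs_w_le (n := n) (p := p) s (2 * z0)) hn)
  have hS : |sinq b |x2 + z + dd p 1 s| (x2 - z)| ≤ √(nn n p s (x2 + z)) := by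
    refine (abs_sinq_le _ _ _).trans ?_
    rw [abs_abs]
    exact abs_w_le _ _
  have hsq := Real.sq_sqrt h0.le
  have hNN : 0 ≤ √(nn n p s (x2 + z)) := Real.sqrt_nonneg _
  have hu : |b * (x2 - z) / (b * (x2 - z))| ≤ 1 := by
    by_cases hz : b * (x2 - z) = 0
    · simp [hz]
    · rw [div_self hz, abs_one]
  unfold stripG1
  set N := nn n p s (x2 + z)
  set ψ := psi n Λ p s (x2 - z) (x2 + z)
  set A := √(nn n p s (2 * z0))
  set c := (n : ℝ) / κ with hc
  have h1' : |nn1 n p s (x2 + z)| ≤ 34 * c * Q * N := by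
    have e : √N * A ≤ 16 * Q * N := by
      calc √N * A ≤ √N * (16 * Q * √N) := by gcongr
        _ = 16 * Q * √N ^ 2 := by ring
        _ = _ := by rw [hsq]
    calc _ ≤ 2 * n / κ * (16 * Q * N + Q * N) := by
          refine h1.trans ?_
          gcongr
          exact le_mul_of_one_le_left h0.le hQ
      _ = _ := by rw [hc]; ring
  have h2 : |nn1 n p s (x2 + z)| / N ≤ 34 * c * Q := by rw [div_le_iff₀ h0]; exact h1'
  have t1 : |psi1 n Λ p s (x2 - z) (x2 + z) * sinq b |x2 + z + dd p 1 s| (x2 - z)|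
      ≤ 8 * (34 * c * Q) * ψ * √N := by
    rw [abs_mul]
    refine mul_le_mul (hψ1.trans ?_) hS (abs_nonneg _) (by positivity)
    gcongr
  have t2 : |ψ * (Real.cos (b * |x2 + z + dd p 1 s| * (x2 - z)) *
    (b * (x2 - z) / (b * (x2 - z))) * dd p 2 s) * sgn (x2 + z + dd p 1 s)| ≤ ψ * (c * (16 * Q * √N)) := by
    rw [abs_mul, abs_mul, abs_mul, abs_mul, abs_of_pos hψ]
    have hcos := Real.abs_cos_le_one (b * |x2 + z + dd p 1 s| * (x2 - z))
    have hsg := abs_sgn_le (x2 + z + dd p 1 s)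
    calc _ ≤ ψ * (1 * 1 * (c * (16 * Q * √N))) * 1 := by
          gcongr
          exact hp2.trans (by gcongr)
      _ = _ := by ring
  refine (abs_add_le _ _).trans ((add_le_add t1 t2).trans (le_of_eq ?_))
  rw [hc]
  ring

/-- The Schur majorant for the product of two strip kernels. -/
def stripMaj (n : ℕ) (p : ℝ[X]) (z s z' x2 : ℝ) : ℝ :=
  poi (nn n p s (2 * z)) (x2 - z) * poi (nn n p s (2 * x2)) (x2 - z')

/-- The loss factor. -/
def lossQ (z z' x2 : ℝ) : ℝ := (1 + (x2 - z) ^ 2) * (1 + (x2 - z') ^ 2)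

lemma one_le_lossQ (z z' x2 : ℝ) : 1 ≤ lossQ z z' x2 := by
  unfold lossQ
  nlinarith [sq_nonneg (x2 - z), sq_nonneg (x2 - z'), mul_nonneg (sq_nonneg (x2 - z)) (sq_nonneg (x2 - z'))]

lemma sqrt_nn_le_lossQ (z s z' x2 : ℝ) :
    √(nn n p s (2 * z)) ≤ 16 * lossQ z z' x2 * √(nn n p s (x2 + z)) ∧
    √(nn n p s (2 * z)) ≤ 16 * lossQ z z' x2 * √(nn n p s (x2 + z')) := by
  have hu := sq_nonneg (x2 - z)
  have hu' := sq_nonneg (x2 - z')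
  have hm := mul_nonneg hu hu'
  constructor
  · refine (sqrt_nn_mul_le s (x2 - z) (2 * z) (x2 + z) (by ring)).trans ?_
    rw [mul_right_comm]
    refine mul_le_mul_of_nonneg_right ?_ (Real.sqrt_nonneg _)
    unfold lossQ
    nlinarith
  · refine (sqrt_nn_mul_le s (2 * (x2 - z) - (x2 - z')) (2 * z) (x2 + z') (by ring)).trans ?_
    rw [mul_right_comm]
    refine mul_le_mul_of_nonneg_right ?_ (Real.sqrt_nonneg _)
    unfold lossQ
    nlinarith [sq_nonneg (2 * (x2 - z) + (x2 - z'))]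

/-- The product of the two Schur factors. -/
def stripX (n : ℕ) (Λ : ℝ) (p : ℝ[X]) (z s z' x2 : ℝ) : ℝ :=
  (√(nn n p s (x2 + z)) * psi n Λ p s (x2 - z) (x2 + z)) *
    (√(nn n p s (x2 + z')) * psi n Λ p s (x2 - z') (x2 + z'))

lemma lossQ_mul_stripX_le (hΛ : 1 ≤ Λ) (z s z' x2 : ℝ) :
    lossQ z z' x2 * stripX n Λ p z s z' x2 ≤ 16 * Λ ^ 32 * stripMaj n p z s z' x2 := by
  have f1 := sqrt_nn_mul_psi_le (n := n) (p := p) hΛ s (x2 - z) (x2 + z) (2 * z) (by ring)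
  have f2 := sqrt_nn_mul_psi_le (n := n) (p := p) hΛ s (x2 - z') (x2 + z') (2 * x2) (by ring)
  have q1 := poi_nonneg (nn_pos (n := n) (p := p) s (2 * z)).le (x2 - z)
  have q2 := poi_nonneg (nn_pos (n := n) (p := p) s (2 * x2)).le (x2 - z')
  have g : ∀ u q : ℝ, 0 ≤ q → (1 + u ^ 2) * (((1 + u ^ 2) ^ 5)⁻¹ * q) ≤ q := fun u q hq => by
    rw [← mul_assoc]
    refine mul_le_of_le_one_left hq ?_
    rw [← div_eq_mul_inv, div_le_one (by positivity)]
    exact le_self_pow₀ (by linarith [sq_nonneg u]) (by norm_num)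
  have hψ := psi_pos (n := n) (Λ := Λ) (p := p) s (x2 - z) (x2 + z)
  have hψ' := psi_pos (n := n) (Λ := Λ) (p := p) s (x2 - z') (x2 + z')
  unfold lossQ stripX stripMaj
  calc _ = ((1 + (x2 - z) ^ 2) * (√(nn n p s (x2 + z)) * psi n Λ p s (x2 - z) (x2 + z))) *
        ((1 + (x2 - z') ^ 2) * (√(nn n p s (x2 + z')) * psi n Λ p s (x2 - z') (x2 + z'))) := by ring
    _ ≤ ((1 + (x2 - z) ^ 2) * (4 * Λ ^ 16 * (((1 + (x2 - z) ^ 2) ^ 5)⁻¹ *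
        poi (nn n p s (2 * z)) (x2 - z)))) * ((1 + (x2 - z') ^ 2) * (4 * Λ ^ 16 *
        (((1 + (x2 - z') ^ 2) ^ 5)⁻¹ * poi (nn n p s (2 * x2)) (x2 - z')))) := by gcongr
    _ = 16 * Λ ^ 32 * (((1 + (x2 - z) ^ 2) * (((1 + (x2 - z) ^ 2) ^ 5)⁻¹ *
        poi (nn n p s (2 * z)) (x2 - z))) * ((1 + (x2 - z') ^ 2) *
        (((1 + (x2 - z') ^ 2) ^ 5)⁻¹ * poi (nn n p s (2 * x2)) (x2 - z')))) := by ring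
    _ ≤ _ := by
        gcongr
        · exact g _ _ q1
        · exact g _ _ q2

lemma stripX_nonneg (z s z' x2 : ℝ) : 0 ≤ stripX n Λ p z s z' x2 := by
  have hψ := psi_pos (n := n) (Λ := Λ) (p := p) s (x2 - z) (x2 + z)
  have hψ' := psi_pos (n := n) (Λ := Λ) (p := p) s (x2 - z') (x2 + z')
  unfold stripX; positivity

lemma stripX_le (hΛ : 1 ≤ Λ) (z s z' x2 : ℝ) :
    stripX n Λ p z s z' x2 ≤ 16 * Λ ^ 32 * stripMaj n p z s z' x2 :=
  (le_mul_of_one_le_left (stripX_nonneg z s z' x2) (one_le_lossQ z z' x2)).trans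
    (lossQ_mul_stripX_le hΛ z s z' x2)

lemma poi_le_sqrt {a : ℝ} (ha : 0 ≤ a) (u : ℝ) : poi a u ≤ √a := by
  unfold poi
  refine div_le_self (Real.sqrt_nonneg a) ?_
  have : 0 ≤ u ^ 2 * a := by positivity
  linarith

lemma stripX_le_of_goodAt (hΛ : 1 ≤ Λ) (hκ : 1 ≤ κ) {z s : ℝ} (h : GoodAt n p κ z s) (z' x2 : ℝ) :
    stripX n Λ p z s z' x2 ≤ 128 * goodC n * Λ ^ 32 * (poi (nn n p s (2 * z)) (x2 - z) *
      √(1 + (2 * z + dd p 1 s) ^ 2)) := by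
  have f1 := sqrt_nn_mul_psi_le (n := n) (p := p) hΛ s (x2 - z) (x2 + z) (2 * z) (by ring)
  have f2 := sqrt_nn_mul_psi_le (n := n) (p := p) hΛ s (x2 - z') (x2 + z') (2 * x2) (by ring)
  have q1 := poi_nonneg (nn_pos (n := n) (p := p) s (2 * z)).le (x2 - z)
  have q2 := poi_nonneg (nn_pos (n := n) (p := p) s (2 * x2)).le (x2 - z')
  have q3 := poi_le_sqrt (nn_pos (n := n) (p := p) s (2 * x2)).le (x2 - z')
  have q4 := sqrt_nn_mul_le (n := n) (p := p) s (2 * (x2 - z)) (2 * x2) (2 * z) (by ring)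
  have q5 : √(nn n p s (2 * z)) ≤ goodC n * √(1 + (2 * z + dd p 1 s) ^ 2) := by
    have h1 := one_le_goodC n
    refine Real.sqrt_le_iff.2 ⟨by positivity, (nn_le_of_goodAt hκ h).trans ?_⟩
    rw [mul_pow, Real.sq_sqrt (by positivity)]
    gcongr
    exact le_self_pow₀ h1 (by norm_num)
  have hψ := psi_pos (n := n) (Λ := Λ) (p := p) s (x2 - z) (x2 + z)
  have hψ' := psi_pos (n := n) (Λ := Λ) (p := p) s (x2 - z') (x2 + z')
  have q6 : ((1 + (x2 - z') ^ 2) ^ 5)⁻¹ ≤ 1 :=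
    inv_le_one_of_one_le₀ (one_le_pow₀ (by linarith [sq_nonneg (x2 - z')]))
  have q7 : ((1 + (x2 - z) ^ 2) ^ 5)⁻¹ * (1 + (2 * (x2 - z)) ^ 2) ≤ 4 := by
    rw [inv_mul_le_iff₀ (by positivity)]
    have : 1 + (x2 - z) ^ 2 ≤ (1 + (x2 - z) ^ 2) ^ 5 :=
      le_self_pow₀ (by linarith [sq_nonneg (x2 - z)]) (by norm_num)
    nlinarith
  have q8 : 0 ≤ ((1 + (x2 - z) ^ 2) ^ 5)⁻¹ := by positivity
  unfold stripX
  set w := √(1 + (2 * z + dd p 1 s) ^ 2)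
  have hw : 0 ≤ w := Real.sqrt_nonneg _
  have hg := one_le_goodC n
  calc _ ≤ (4 * Λ ^ 16 * (((1 + (x2 - z) ^ 2) ^ 5)⁻¹ * poi (nn n p s (2 * z)) (x2 - z))) *
        (4 * Λ ^ 16 * (1 * (2 * (goodC n * w) * (1 + (2 * (x2 - z)) ^ 2)))) := by
        refine mul_le_mul f1 (f2.trans ?_) (by positivity) (by positivity)
        gcongr
        exact q3.trans (q4.trans (by gcongr))
    _ = 32 * goodC n * Λ ^ 32 * (poi (nn n p s (2 * z)) (x2 - z) * w) *
        (((1 + (x2 - z) ^ 2) ^ 5)⁻¹ * (1 + (2 * (x2 - z)) ^ 2)) := by ring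
    _ ≤ 32 * goodC n * Λ ^ 32 * (poi (nn n p s (2 * z)) (x2 - z) * w) * 4 := by gcongr
    _ = _ := by ring

end StripAmplitude

section StripPhase

variable {n : ℕ} {p : ℝ[X]} {Λ b κ γ θ : ℝ}

/-- The phase of the kernel of `A* A`, as a function of `s`. -/
def stripΦ (p : ℝ[X]) (γ z z' s : ℝ) : ℝ := γ * ((z' - z) * (s * (z + z') + dd p 0 s))

/-- The derivative of `stripΦ`. -/
def stripΦ1 (p : ℝ[X]) (γ z z' s : ℝ) : ℝ := γ * ((z' - z) * (z + z' + dd p 1 s))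

lemma hasDerivAt_stripΦ (z z' s : ℝ) : HasDerivAt (stripΦ p γ z z') (stripΦ1 p γ z z' s) s := by
  unfold stripΦ stripΦ1
  refine (((((hasDerivAt_id s).mul_const (z + z')).add (hasDerivAt_dd p 0 s)).const_mul
    (z' - z)).const_mul γ).congr_deriv ?_
  simp

lemma hasDerivAt_stripΦ1 (z z' s : ℝ) :
    HasDerivAt (stripΦ1 p γ z z') (γ * ((z' - z) * dd p 2 s)) s := by
  unfold stripΦ1
  exact ((((hasDerivAt_dd p 1 s).const_add (z + z')).const_mul (z' - z)).const_mul γ)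

lemma continuous_stripΦ1 (z z' : ℝ) : Continuous (stripΦ1 p γ z z') :=
  continuous_iff_continuousAt.2 fun s => (hasDerivAt_stripΦ1 z z' s).continuousAt

lemma continuous_psi_fst (u v : ℝ) : Continuous fun s => psi n Λ p s u v :=
  continuous_iff_continuousAt.2 fun s => (hasDerivAt_psi s u v).continuousAt

lemma continuous_stripG (x2 z : ℝ) : Continuous fun s => stripG n Λ p b s x2 z := by
  have h := continuous_psi_fst (n := n) (Λ := Λ) (p := p) (x2 - z) (x2 + z)
  unfold stripG sinq
  fun_prop

lemma intervalIntegrable_sgn (v c d : ℝ) :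
    IntervalIntegrable (fun s => sgn (v + dd p 1 s)) volume c d := by
  refine (intervalIntegrable_const (c := (1 : ℝ))).mono_fun ?_ (.of_forall fun s => ?_)
  · have := measurable_dd p 1
    exact Measurable.aestronglyMeasurable (by fun_prop)
  · simpa using abs_sgn_le (v + dd p 1 s)

lemma intervalIntegrable_stripG1 (x2 z c d : ℝ) :
    IntervalIntegrable (fun s => stripG1 n Λ p b s x2 z) volume c d := by
  have h := continuous_psi_fst (n := n) (Λ := Λ) (p := p) (x2 - z) (x2 + z)
  have h1 := continuous_psi1 (n := n) (Λ := Λ) (p := p) (x2 - z) (x2 + z)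
  unfold stripG1
  refine IntervalIntegrable.add ?_ (IntervalIntegrable.continuousOn_mul (intervalIntegrable_sgn _ _ _) ?_)
  · refine Continuous.intervalIntegrable ?_ _ _
    unfold sinq
    fun_prop
  · refine Continuous.continuousOn ?_
    fun_prop

lemma countable_zeros (v : ℝ) :
    {s : ℝ | ¬(v + dd p 1 s ≠ 0 ∨ ∀ s, v + dd p 1 s = 0)}.Countable := by
  by_cases hP : C v + derivative p = 0
  · have h : ∀ s, v + dd p 1 s = 0 := fun s => by
      have := congrArg (eval s) hP
      simpa [dd] using this
    convert Set.countable_empty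
    ext s
    simp [h]
  · refine ((C v + derivative p).roots.toFinset.finite_toSet.countable).mono fun s hs => ?_
    have hs' : v + dd p 1 s = 0 := by
      by_contra h
      exact hs (Or.inl h)
    rw [Finset.mem_coe, Multiset.mem_toFinset, mem_roots hP, IsRoot.def]
    simpa [dd] using hs'

lemma stripΦ1_eq (z z' s : ℝ) :
    stripΦ1 p γ z z' s = γ * ((z' - z) * ((2 * z + dd p 1 s) + (z' - z))) := by
  unfold stripΦ1; ring

lemma abs_stripAmp_le (z s z' x2 : ℝ) :
    |stripG n Λ p b s x2 z * stripG n Λ p b s x2 z'| ≤ stripX n Λ p z s z' x2 := by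
  rw [abs_mul]
  exact mul_le_mul (abs_stripG_le _ _ _) (abs_stripG_le _ _ _) (abs_nonneg _)
    (mul_nonneg (Real.sqrt_nonneg _) (psi_pos _ _ _).le)

/-- The derivative of the amplitude. -/
def stripA1 (n : ℕ) (Λ : ℝ) (p : ℝ[X]) (b z z' x2 s : ℝ) : ℝ :=
  stripG1 n Λ p b s x2 z * stripG n Λ p b s x2 z' + stripG n Λ p b s x2 z * stripG1 n Λ p b s x2 z'

lemma abs_stripA1_le {z s : ℝ} (hκ : 0 < κ) (h : GoodAt n p κ z s) (z' x2 : ℝ) :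
    |stripA1 n Λ p b z z' x2 s| ≤ 576 * n / κ * (lossQ z z' x2 * stripX n Λ p z s z' x2) := by
  have hQ := one_le_lossQ z z' x2
  obtain ⟨q1, q2⟩ := sqrt_nn_le_lossQ (n := n) (p := p) z s z' x2
  have h1 := abs_stripG1_le (Λ := Λ) (b := b) (x2 := x2) hκ h hQ q1
  have h2 := abs_stripG1_le (Λ := Λ) (b := b) (x2 := x2) (z := z') hκ h hQ q2
  have g1 := abs_stripG_le (n := n) (Λ := Λ) (p := p) (b := b) s x2 z
  have g2 := abs_stripG_le (n := n) (Λ := Λ) (p := p) (b := b) s x2 z'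
  have hψ := psi_pos (n := n) (Λ := Λ) (p := p) s (x2 - z) (x2 + z)
  have hψ' := psi_pos (n := n) (Λ := Λ) (p := p) s (x2 - z') (x2 + z')
  unfold stripA1 stripX
  refine (abs_add_le _ _).trans ?_
  rw [abs_mul, abs_mul]
  calc _ ≤ _ := add_le_add (mul_le_mul h1 g2 (abs_nonneg _) (by positivity))
        (mul_le_mul g1 h2 (abs_nonneg _) (by positivity))
    _ = _ := by ring

lemma abs_stripΦ2_mul_le {Γ z s : ℝ} (hγ : |γ| ≤ Γ) (hb : 1 / 2 ≤ b) (hκ : 0 < κ)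
    (h : GoodAt n p κ z s) (z' x2 : ℝ) :
    |γ * ((z' - z) * dd p 2 s)| * |stripG n Λ p b s x2 z * stripG n Λ p b s x2 z'|
      ≤ 64 * Γ * n / κ * (lossQ z z' x2 * stripX n Λ p z s z' x2) := by
  have hΓ : 0 ≤ Γ := (abs_nonneg γ).trans hγ
  have hQ := one_le_lossQ z z' x2
  obtain ⟨q1, q2⟩ := sqrt_nn_le_lossQ (n := n) (p := p) z s z' x2
  have g1 := abs_stripG_le (n := n) (Λ := Λ) (p := p) (b := b) s x2 z
  have g2 := abs_stripG_le (n := n) (Λ := Λ) (p := p) (b := b) s x2 z'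
  have d1 := abs_mul_abs_stripG_le (n := n) (Λ := Λ) (p := p) hb s x2 z
  have d2 := abs_mul_abs_stripG_le (n := n) (Λ := Λ) (p := p) hb s x2 z'
  have hψ := psi_pos (n := n) (Λ := Λ) (p := p) s (x2 - z) (x2 + z)
  have hψ' := psi_pos (n := n) (Λ := Λ) (p := p) s (x2 - z') (x2 + z')
  have hn : 0 ≤ (n : ℝ) / κ := by positivity
  have hp2 := h.1.trans (mul_le_mul_of_nonneg_left (abs_w_le (n := n) (p := p) s (2 * z)) hn)
  have hδ : |z' - z| ≤ |x2 - z| + |x2 - z'| := by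
    calc |z' - z| = |(x2 - z) - (x2 - z')| := by ring_nf
      _ ≤ _ := abs_sub _ _
  unfold stripX
  rw [abs_mul, abs_mul, abs_mul]
  set A := √(nn n p s (2 * z))
  set N := √(nn n p s (x2 + z))
  set N' := √(nn n p s (x2 + z'))
  set G := |stripG n Λ p b s x2 z|
  set G' := |stripG n Λ p b s x2 z'|
  set ψ := psi n Λ p s (x2 - z) (x2 + z)
  set ψ' := psi n Λ p s (x2 - z') (x2 + z')
  set Q := lossQ z z' x2
  have hG : 0 ≤ G := abs_nonneg _
  have hG' : 0 ≤ G' := abs_nonneg _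
  have hA : 0 ≤ A := Real.sqrt_nonneg _
  have hN : 0 ≤ N := Real.sqrt_nonneg _
  have hN' : 0 ≤ N' := Real.sqrt_nonneg _
  have t1 : A * (|x2 - z| * G) * G' ≤ 32 * Q * N * ψ * (N' * ψ') := by
    calc _ ≤ (16 * Q * N) * (2 * ψ) * (N' * ψ') := by gcongr
      _ = _ := by ring
  have t2 : A * (|x2 - z'| * G') * G ≤ 32 * Q * N' * ψ' * (N * ψ) := by
    calc _ ≤ (16 * Q * N') * (2 * ψ') * (N * ψ) := by gcongr
      _ = _ := by ring
  calc |γ| * (|z' - z| * |dd p 2 s|) * (G * G')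
      ≤ Γ * ((|x2 - z| + |x2 - z'|) * (n / κ * A)) * (G * G') := by gcongr
    _ = Γ * (n / κ) * (A * (|x2 - z| * G) * G' + A * (|x2 - z'| * G') * G) := by ring
    _ ≤ Γ * (n / κ) * (32 * Q * N * ψ * (N' * ψ') + 32 * Q * N' * ψ' * (N * ψ)) := by gcongr
    _ = _ := by ring

end StripPhase

section StripCells

variable {n : ℕ} {p : ℝ[X]} {Λ b κ γ θ Γ : ℝ}

lemma enorm_intervalIntegral_le {f : ℝ → ℂ} {c d : ℝ} (hcd : c ≤ d) {W : ℝ → ℝ≥0∞}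
    (h : ∀ s ∈ Set.Icc c d, ‖f s‖ₑ ≤ W s) :
    ‖∫ s in c..d, f s‖ₑ ≤ ∫⁻ s in Set.Ioc c d, W s := by
  rw [intervalIntegral.integral_of_le hcd]
  refine (enorm_integral_le_lintegral_enorm _).trans (setLIntegral_mono' measurableSet_Ioc ?_)
  exact fun s hs => h s (Set.Ioc_subset_Icc_self hs)

lemma ofReal_intervalIntegral_le {f W : ℝ → ℝ} {c d : ℝ} (hcd : c ≤ d) (hf : ∀ s, 0 ≤ f s)
    (h : ∀ s ∈ Set.Icc c d, f s ≤ W s) :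
    ENNReal.ofReal (∫ s in c..d, f s) ≤ ∫⁻ s in Set.Ioc c d, ENNReal.ofReal (W s) := by
  rw [intervalIntegral.integral_of_le hcd, ← Real.enorm_of_nonneg (integral_nonneg hf)]
  refine (enorm_integral_le_lintegral_enorm _).trans (setLIntegral_mono' measurableSet_Ioc ?_)
  exact fun s hs => by
    rw [Real.enorm_of_nonneg (hf s)]
    exact ENNReal.ofReal_le_ofReal (h s (Set.Ioc_subset_Icc_self hs))

/-- The oscillatory integrand in `s` of the kernel of `A* A`. -/
def stripF (n : ℕ) (Λ : ℝ) (p : ℝ[X]) (b γ z z' x2 s : ℝ) : ℂ :=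
  Complex.exp (Complex.I * (stripΦ p γ z z' s : ℂ)) *
    ((stripG n Λ p b s x2 z * stripG n Λ p b s x2 z' : ℝ) : ℂ)

lemma norm_stripF_le (hΛ : 1 ≤ Λ) (z z' x2 s : ℝ) :
    ‖stripF n Λ p b γ z z' x2 s‖ ≤ 16 * Λ ^ 32 * stripMaj n p z s z' x2 := by
  unfold stripF
  rw [norm_mul, mul_comm Complex.I, Complex.norm_exp_ofReal_mul_I, one_mul, Complex.norm_real]
  exact (abs_stripAmp_le _ _ _ _).trans (stripX_le hΛ _ _ _ _)

/-- The main weight. -/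
def stripMain (n : ℕ) (Λ : ℝ) (p : ℝ[X]) (γ θ z z' x2 s : ℝ) : ℝ :=
  128 * goodC n * Λ ^ 32 * (poi (nn n p s (2 * z)) (x2 - z) *
    (√(1 + (2 * z + dd p 1 s) ^ 2) * (θ ^ 2 / (stripΦ1 p γ z z' s ^ 2 + θ ^ 2))))

/-- The constant of the remainder terms. -/
def stripRest (n : ℕ) (Γ κ θ : ℝ) : ℝ := (64 * Γ + 576) * n / κ / θ ^ 2

lemma cell_good (hΛ : 1 ≤ Λ) (hγ : |γ| ≤ Γ) (hb : 1 / 2 ≤ b) (hκ : 1 ≤ κ) (hθ : 0 < θ) (hθ1 : θ ≤ 1)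
    {c d z : ℝ} (hcd : c ≤ d) (hg : ∀ s ∈ Set.Icc c d, GoodAt n p κ z s) (z' x2 : ℝ) :
    ‖∫ s in c..d, stripF n Λ p b γ z z' x2 s‖ₑ ≤
      (∫⁻ s in Set.Ioc c d, ENNReal.ofReal (stripMain n Λ p γ θ z z' x2 s)) +
      ((ENNReal.ofReal (16 * Λ ^ 32 * stripMaj n p z c z' x2 / θ) +
        ENNReal.ofReal (16 * Λ ^ 32 * stripMaj n p z d z' x2 / θ)) +
      ∫⁻ s in Set.Ioc c d,
        ENNReal.ofReal (stripRest n Γ κ θ * (16 * Λ ^ 32 * stripMaj n p z s z' x2))) := by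
  have hκ0 : 0 < κ := by linarith
  have hΓ : 0 ≤ Γ := (abs_nonneg γ).trans hγ
  set A : ℝ → ℝ := fun s => stripG n Λ p b s x2 z * stripG n Λ p b s x2 z' with hA
  set f1 := stripΦ1 p γ z z' with hf1
  have hAc : Continuous A := (continuous_stripG x2 z).mul (continuous_stripG x2 z')
  have hpos : ∀ s, 0 < f1 s ^ 2 + θ ^ 2 := fun s => by positivity
  set P1 : ℝ → ℝ := fun s => (γ * ((z' - z) * dd p 2 s)) * ((θ ^ 2 - f1 s ^ 2) / (f1 s ^ 2 + θ ^ 2) ^ 2)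
    * A s + f1 s / (f1 s ^ 2 + θ ^ 2) * stripA1 n Λ p b z z' x2 s with hP1
  have hf1c : Continuous f1 := continuous_stripΦ1 z z'
  have hmain := norm_integral_exp_mul_le hcd (f := stripΦ p γ z z') (f1 := f1) (A := A)
    (B := fun _ => θ ^ 2) (P1 := P1)
    (s := {s : ℝ | ¬(x2 + z + dd p 1 s ≠ 0 ∨ ∀ s, x2 + z + dd p 1 s = 0)} ∪
      {s : ℝ | ¬(x2 + z' + dd p 1 s ≠ 0 ∨ ∀ s, x2 + z' + dd p 1 s = 0)})
    ((countable_zeros _).union (countable_zeros _)) (fun t => hasDerivAt_stripΦ z z' t)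
    hf1c hAc.continuousOn continuous_const (fun _ => by positivity)
    (fun t ht => by
      have h1 : x2 + z + dd p 1 t ≠ 0 ∨ ∀ s, x2 + z + dd p 1 s = 0 := by
        by_contra h; exact ht.2 (Or.inl h)
      have h2 : x2 + z' + dd p 1 t ≠ 0 ∨ ∀ s, x2 + z' + dd p 1 s = 0 := by
        by_contra h; exact ht.2 (Or.inr h)
      have hA' : HasDerivAt A (stripA1 n Λ p b z z' x2 t) t :=
        (hasDerivAt_stripG h1).mul (hasDerivAt_stripG h2)
      have hd := hasDerivAt_stripΦ1 (p := p) (γ := γ) z z' t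
      refine ((hd.fun_div ((hd.fun_pow 2).add_const (θ ^ 2)) (hpos t).ne').mul hA').congr_deriv ?_
      rw [hP1]
      have := (hpos t).ne'
      simp only [← hf1]
      field_simp
      ring)
    (by
      refine IntervalIntegrable.add (Continuous.intervalIntegrable ?_ _ _)
        (IntervalIntegrable.continuousOn_mul ?_ ?_)
      · have hd := continuous_dd p 2
        exact (Continuous.mul (by fun_prop) (Continuous.div (by fun_prop) (by fun_prop)
          fun s => (pow_pos (hpos s) 2).ne')).mul hAc
      · exact ((intervalIntegrable_stripG1 x2 z c d).mul_continuousOn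
          (continuous_stripG x2 z').continuousOn).add
          ((intervalIntegrable_stripG1 x2 z' c d).continuousOn_mul (continuous_stripG x2 z).continuousOn)
      · exact (Continuous.div hf1c (by fun_prop) fun s => (hpos s).ne').continuousOn)
  have hbd : ∀ s, |f1 s / (f1 s ^ 2 + θ ^ 2) * A s| ≤ 16 * Λ ^ 32 * stripMaj n p z s z' x2 / θ := by
    intro s
    rw [abs_mul]
    calc _ ≤ 1 / θ * (16 * Λ ^ 32 * stripMaj n p z s z' x2) :=
          mul_le_mul (abs_div_sq_add_le hθ) ((abs_stripAmp_le _ _ _ _).trans (stripX_le hΛ _ _ _ _))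
            (abs_nonneg _) (by positivity)
      _ = _ := by ring
  have i1 : ENNReal.ofReal (∫ s in c..d, |A s| * (θ ^ 2 / (f1 s ^ 2 + θ ^ 2))) ≤
      ∫⁻ s in Set.Ioc c d, ENNReal.ofReal (stripMain n Λ p γ θ z z' x2 s) := by
    refine ofReal_intervalIntegral_le hcd (fun s => by have := hpos s; positivity) fun s hs => ?_
    have h1 := (abs_stripAmp_le (b := b) _ _ _ _).trans
      (stripX_le_of_goodAt (n := n) (p := p) hΛ hκ (hg s hs) z' x2)
    have := hpos s
    unfold stripMain
    calc _ ≤ 128 * goodC n * Λ ^ 32 * (poi (nn n p s (2 * z)) (x2 - z) *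
      √(1 + (2 * z + dd p 1 s) ^ 2)) * (θ ^ 2 / (f1 s ^ 2 + θ ^ 2)) := by gcongr
      _ = _ := by ring
  have i2 : ENNReal.ofReal (∫ s in c..d, |P1 s|) ≤ ∫⁻ s in Set.Ioc c d,
      ENNReal.ofReal (stripRest n Γ κ θ * (16 * Λ ^ 32 * stripMaj n p z s z' x2)) := by
    refine ofReal_intervalIntegral_le hcd (fun s => abs_nonneg _) fun s hs => ?_
    have h1 := abs_stripΦ2_mul_le (Λ := Λ) hγ hb hκ0 (hg s hs) z' x2
    have h2 := abs_stripA1_le (Λ := Λ) (b := b) hκ0 (hg s hs) z' x2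
    have h3 := lossQ_mul_stripX_le (n := n) (p := p) hΛ z s z' x2
    have h4 : 0 ≤ lossQ z z' x2 * stripX n Λ p z s z' x2 :=
      mul_nonneg (zero_le_one.trans (one_le_lossQ z z' x2)) (stripX_nonneg z s z' x2)
    have h5 : 1 / θ ≤ 1 / θ ^ 2 := by
      gcongr
      exact pow_le_of_le_one hθ.le hθ1 (by norm_num)
    set Y := lossQ z z' x2 * stripX n Λ p z s z' x2
    rw [hP1]
    refine (abs_add_le _ _).trans ?_
    rw [abs_mul, abs_mul, abs_mul (f1 s / _), mul_right_comm]
    calc _ ≤ (64 * Γ * n / κ * Y) * (1 / θ ^ 2) + 1 / θ * (576 * n / κ * Y) :=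
          add_le_add (mul_le_mul h1 (abs_sub_div_sq_add_le hθ) (abs_nonneg _) (by positivity))
            (mul_le_mul (abs_div_sq_add_le hθ) h2 (abs_nonneg _) (by positivity))
      _ ≤ (64 * Γ * n / κ * Y) * (1 / θ ^ 2) + 1 / θ ^ 2 * (576 * n / κ * Y) := by gcongr
      _ = stripRest n Γ κ θ * Y := by unfold stripRest; ring
      _ ≤ _ := by
          refine mul_le_mul_of_nonneg_left h3 ?_
          unfold stripRest; positivity
  have hfin := ENNReal.ofReal_le_ofReal hmain
  rw [ofReal_norm] at hfin
  refine hfin.trans ?_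
  refine ENNReal.ofReal_add_le.trans (add_le_add i1 (ENNReal.ofReal_add_le.trans (add_le_add ?_ i2)))
  exact ENNReal.ofReal_add_le.trans (add_le_add (ENNReal.ofReal_le_ofReal (hbd c))
    (ENNReal.ofReal_le_ofReal (hbd d)))

/-- The weight controlling the integral over a cell. -/
def stripW (n : ℕ) (Λ : ℝ) (p : ℝ[X]) (γ Γ κ θ : ℝ) (R : Finset ℝ) (z : ℝ) (s : ℝ) (q : ℝ × ℝ) : ℝ≥0∞ :=
  ENNReal.ofReal (stripMain n Λ p γ θ z q.1 q.2 s) +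
    (ENNReal.ofReal (stripRest n Γ κ θ) + ∑ r ∈ R, (Metric.closedBall r (2 * κ)).indicator 1 s) *
      ENNReal.ofReal (16 * Λ ^ 32 * stripMaj n p z s q.1 q.2)

/-- The boundary term at the end point of a cell. -/
def stripD (n : ℕ) (Λ : ℝ) (p : ℝ[X]) (θ z c : ℝ) (q : ℝ × ℝ) : ℝ≥0∞ :=
  ENNReal.ofReal (16 * Λ ^ 32 * stripMaj n p z c q.1 q.2 / θ)

lemma cell_bound (hΛ : 1 ≤ Λ) (hγ : |γ| ≤ Γ) (hb : 1 / 2 ≤ b) (hκ : 1 ≤ κ) (hθ : 0 < θ) (hθ1 : θ ≤ 1)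
    {z : ℝ} {R : Finset ℝ} (hR : ∀ s : ℝ, (∀ r ∈ R, κ ≤ |s - r|) → GoodAt n p κ z s)
    (c : ℝ) (q : ℝ × ℝ) :
    ‖∫ s in c..(c + κ), stripF n Λ p b γ z q.1 q.2 s‖ₑ ≤
      (∫⁻ s in Set.Ioc c (c + κ), stripW n Λ p γ Γ κ θ R z s q) +
        (stripD n Λ p θ z c q + stripD n Λ p θ z (c + κ) q) := by
  have hκ0 : 0 < κ := by linarith
  have hΓ : 0 ≤ Γ := (abs_nonneg γ).trans hγ
  have hcd : c ≤ c + κ := by linarith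
  by_cases hg : ∀ s ∈ Set.Icc c (c + κ), ∀ r ∈ R, κ ≤ |s - r|
  · refine (cell_good hΛ hγ hb hκ hθ hθ1 hcd (fun s hs => hR s (hg s hs)) q.1 q.2).trans ?_
    rw [add_comm (ENNReal.ofReal _ + ENNReal.ofReal _), ← add_assoc]
    refine add_le_add ?_ le_rfl
    refine (le_lintegral_add _ _).trans (lintegral_mono fun s => ?_)
    unfold stripW
    refine add_le_add le_rfl ?_
    rw [ENNReal.ofReal_mul (by unfold stripRest; positivity)]
    gcongr
    exact le_self_add
  · push Not at hg
    obtain ⟨s0, hs0, r, hr, hsr⟩ := hg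
    refine le_add_right (enorm_intervalIntegral_le hcd fun s hs => ?_)
    unfold stripW
    refine le_add_left ?_
    rw [← ofReal_norm]
    refine (ENNReal.ofReal_le_ofReal (norm_stripF_le hΛ _ _ _ _)).trans
      (le_mul_of_one_le_left' (le_add_left ?_))
    have hmem : s ∈ Metric.closedBall r (2 * κ) := by
      rw [Metric.mem_closedBall, Real.dist_eq]
      have h1 : |s - s0| ≤ κ := by
        rw [abs_le]; constructor <;> linarith [hs.1, hs.2, hs0.1, hs0.2]
      calc |s - r| = |(s - s0) + (s0 - r)| := by ring_nf
        _ ≤ _ := (abs_add_le _ _).trans (by linarith)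
    refine le_trans ?_ (Finset.single_le_sum
      (f := fun r => (Metric.closedBall r (2 * κ)).indicator (1 : ℝ → ℝ≥0∞) s) (fun _ _ => zero_le) hr)
    rw [Set.indicator_of_mem hmem]
    rfl

lemma continuous_stripF (z z' x2 : ℝ) : Continuous (stripF n Λ p b γ z z' x2) := by
  have h1 : Continuous (stripΦ p γ z z') :=
    continuous_iff_continuousAt.2 fun s => (hasDerivAt_stripΦ z z' s).continuousAt
  have h2 := (continuous_stripG (n := n) (Λ := Λ) (p := p) (b := b) x2 z)
  have h3 := (continuous_stripG (n := n) (Λ := Λ) (p := p) (b := b) x2 z')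
  unfold stripF
  fun_prop

lemma cells_bound (hΛ : 1 ≤ Λ) (hγ : |γ| ≤ Γ) (hb : 1 / 2 ≤ b) (hκ : 1 ≤ κ) (hθ : 0 < θ) (hθ1 : θ ≤ 1)
    {z : ℝ} {R : Finset ℝ} (hR : ∀ s : ℝ, (∀ r ∈ R, κ ≤ |s - r|) → GoodAt n p κ z s)
    (a : ℝ) (m : ℕ) (q : ℝ × ℝ) :
    ‖∫ s in a..(a + m * κ), stripF n Λ p b γ z q.1 q.2 s‖ₑ ≤
      (∫⁻ s in Set.Ioc a (a + m * κ), stripW n Λ p γ Γ κ θ R z s q) +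
        ∑ j ∈ Finset.range m, (stripD n Λ p θ z (a + j * κ) q + stripD n Λ p θ z (a + j * κ + κ) q) := by
  have hκ0 : 0 < κ := by linarith
  induction m with
  | zero => simp
  | succ m ih =>
    have hc := cell_bound (b := b) hΛ hγ hb hκ hθ hθ1 hR (a + m * κ) q
    have e1 : a + ((m + 1 : ℕ) : ℝ) * κ = a + m * κ + κ := by push_cast; ring
    have hii := fun c d => (continuous_stripF (n := n) (Λ := Λ) (p := p) (b := b) (γ := γ) z q.1
      q.2).intervalIntegrable (μ := volume) c d
    have hm : 0 ≤ (m : ℝ) * κ := by positivity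
    rw [e1, ← intervalIntegral.integral_add_adjacent_intervals (hii a (a + m * κ))
      (hii (a + m * κ) (a + m * κ + κ)), Finset.sum_range_succ,
      ← Set.Ioc_union_Ioc_eq_Ioc (show a ≤ a + m * κ by linarith)
        (show a + m * κ ≤ a + m * κ + κ by linarith),
      lintegral_union measurableSet_Ioc (Set.Ioc_disjoint_Ioc_of_le le_rfl)]
    refine (enorm_add_le _ _).trans ((add_le_add ih hc).trans (le_of_eq ?_))
    ring

end StripCells

section StripSchur

variable {n : ℕ} {p : ℝ[X]} {Λ b κ γ θ Γ : ℝ}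

lemma lintegral_inv_quartic {w : ℝ} (hθ : 0 < θ) (hθ1 : θ ≤ 1) : ∃ a : ℝ, 0 < a ∧ ∀ x : ℝ,
    √(1 + w ^ 2) * (θ ^ 2 / (x ^ 2 * (|x| + |w|) ^ 2 / 36 + θ ^ 2)) ≤ 12 * √θ * poi a x := by
  have hsθ : 0 < √θ := Real.sqrt_pos.2 hθ
  have hsq : √θ ^ 2 = θ := Real.sq_sqrt hθ.le
  rcases le_total |w| 1 with hw | hw
  · refine ⟨1 / θ, by positivity, fun x => ?_⟩
    have h1 : √(1 + w ^ 2) ≤ 2 := by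
      refine Real.sqrt_le_iff.2 ⟨by norm_num, ?_⟩
      have : w ^ 2 ≤ 1 := by rw [← sq_abs]; exact pow_le_one₀ (abs_nonneg _) hw
      linarith
    have h2 : θ ^ 2 / (x ^ 2 * (|x| + |w|) ^ 2 / 36 + θ ^ 2) ≤ 6 / (1 + x ^ 2 * (1 / θ)) := by
      rw [div_le_div_iff₀ (by positivity) (by positivity)]
      have e1 : x ^ 2 * x ^ 2 ≤ x ^ 2 * (|x| + |w|) ^ 2 := by
        refine mul_le_mul_of_nonneg_left ?_ (sq_nonneg x)
        rw [← sq_abs x]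
        gcongr
        linarith [abs_nonneg w]
      have e2 : θ ^ 2 * (1 + x ^ 2 * (1 / θ)) = θ ^ 2 + θ * x ^ 2 := by field_simp
      rw [e2]
      nlinarith [sq_nonneg (x ^ 2 - 6 * θ)]
    have h3 : √(1 / θ) = 1 / √θ := by rw [Real.sqrt_div zero_le_one, Real.sqrt_one]
    calc _ ≤ 2 * (6 / (1 + x ^ 2 * (1 / θ))) := by gcongr
      _ = _ := by unfold poi; rw [h3]; field_simp; ring
  · refine ⟨(|w| / (6 * θ)) ^ 2, by positivity, fun x => ?_⟩
    have hw0 : 0 < |w| := by linarith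
    have h1 : √(1 + w ^ 2) ≤ 2 * |w| := by
      refine Real.sqrt_le_iff.2 ⟨by positivity, ?_⟩
      rw [← sq_abs w]; nlinarith
    have h2 : θ ^ 2 / (x ^ 2 * (|x| + |w|) ^ 2 / 36 + θ ^ 2) ≤ 1 / (1 + x ^ 2 * (|w| / (6 * θ)) ^ 2) := by
      rw [div_le_div_iff₀ (by positivity) (by positivity)]
      have e1 : x ^ 2 * |w| ^ 2 ≤ x ^ 2 * (|x| + |w|) ^ 2 := by
        gcongr
        linarith [abs_nonneg x]
      have e2 : θ ^ 2 * (1 + x ^ 2 * (|w| / (6 * θ)) ^ 2) = θ ^ 2 + x ^ 2 * |w| ^ 2 / 36 := by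
        field_simp; ring
      rw [e2]
      linarith
    have hθs : θ ≤ √θ := Real.le_sqrt_of_sq_le (by nlinarith)
    have h0 : 0 ≤ poi ((|w| / (6 * θ)) ^ 2) x := poi_nonneg (by positivity) x
    calc _ ≤ 2 * |w| * (1 / (1 + x ^ 2 * (|w| / (6 * θ)) ^ 2)) := by gcongr
      _ = 12 * θ * poi ((|w| / (6 * θ)) ^ 2) x := by
          unfold poi
          rw [Real.sqrt_sq (by positivity)]
          field_simp
          ring
      _ ≤ _ := by gcongr

lemma main_le_sum (hγ : 1 / 2 ≤ |γ|) (hθ : 0 < θ) (w δ : ℝ) :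
    θ ^ 2 / ((γ * (δ * (w + δ))) ^ 2 + θ ^ 2) ≤
      θ ^ 2 / (δ ^ 2 * (|δ| + |w|) ^ 2 / 36 + θ ^ 2) +
      θ ^ 2 / ((w + δ) ^ 2 * (|w + δ| + |w|) ^ 2 / 36 + θ ^ 2) := by
  have hγ2 : 1 / 4 ≤ γ ^ 2 := by rw [← sq_abs]; nlinarith
  have key : ∀ x y : ℝ, |x| ≤ |y| → |w| ≤ |x| + |y| →
      θ ^ 2 / ((γ * (x * y)) ^ 2 + θ ^ 2) ≤ θ ^ 2 / (x ^ 2 * (|x| + |w|) ^ 2 / 36 + θ ^ 2) := by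
    intro x y hxy hw
    have h1 : (|x| + |w|) ^ 2 ≤ 9 * y ^ 2 := by
      rw [← sq_abs y]
      calc (|x| + |w|) ^ 2 ≤ (3 * |y|) ^ 2 := by gcongr; linarith
        _ = _ := by ring
    refine div_le_div_of_nonneg_left (by positivity) (by positivity) ?_
    have h2 : x ^ 2 * (|x| + |w|) ^ 2 / 36 ≤ x ^ 2 * (9 * y ^ 2) / 36 := by gcongr
    have h3 : 1 / 4 * (x ^ 2 * y ^ 2) ≤ γ ^ 2 * (x ^ 2 * y ^ 2) := by gcongr
    rw [mul_pow, mul_pow]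
    linarith
  have hw : |w| ≤ |δ| + |w + δ| := by
    calc |w| = |(w + δ) - δ| := by ring_nf
      _ ≤ _ := (abs_sub _ _).trans (by linarith)
  rcases le_total |δ| |w + δ| with h | h
  · exact (key δ (w + δ) h hw).trans (le_add_of_nonneg_right (by positivity))
  · have h1 := key (w + δ) δ h (by linarith)
    rw [mul_comm (w + δ) δ] at h1
    exact h1.trans (le_add_of_nonneg_left (by positivity))

lemma lintegral_main_le (hγ : 1 / 2 ≤ |γ|) (hθ : 0 < θ) (hθ1 : θ ≤ 1) (z s : ℝ) :
    ∫⁻ z', ENNReal.ofReal (√(1 + (2 * z + dd p 1 s) ^ 2) *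
      (θ ^ 2 / (stripΦ1 p γ z z' s ^ 2 + θ ^ 2))) ≤ ENNReal.ofReal (24 * √θ * Real.pi) := by
  set w := 2 * z + dd p 1 s with hw
  obtain ⟨a, ha, h⟩ := lintegral_inv_quartic (w := w) hθ hθ1
  have hp : ∀ z' : ℝ, ENNReal.ofReal (√(1 + w ^ 2) * (θ ^ 2 / (stripΦ1 p γ z z' s ^ 2 + θ ^ 2)))
      ≤ ENNReal.ofReal (12 * √θ) * ENNReal.ofReal (poi a (z' - z)) +
        ENNReal.ofReal (12 * √θ) * ENNReal.ofReal (poi a (z' - (z - w))) := by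
    intro z'
    rw [← ENNReal.ofReal_mul (by positivity), ← ENNReal.ofReal_mul (by positivity),
      ← ENNReal.ofReal_add (mul_nonneg (by positivity) (poi_nonneg ha.le _))
        (mul_nonneg (by positivity) (poi_nonneg ha.le _))]
    refine ENNReal.ofReal_le_ofReal ?_
    rw [stripΦ1_eq, ← hw]
    have h1 := main_le_sum hγ hθ w (z' - z)
    have h2 := h (z' - z)
    have h3 := h (w + (z' - z))
    rw [show z' - (z - w) = w + (z' - z) by ring]
    calc _ ≤ √(1 + w ^ 2) * _ := mul_le_mul_of_nonneg_left h1 (Real.sqrt_nonneg _)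
      _ ≤ _ := by rw [mul_add]; exact add_le_add h2 h3
  refine (lintegral_mono hp).trans ?_
  have hm2 : Measurable fun z' : ℝ => ENNReal.ofReal (12 * √θ) * ENNReal.ofReal (poi a (z' - z)) := by
    unfold poi; fun_prop
  rw [lintegral_add_left hm2,
    lintegral_const_mul' _ _ ENNReal.ofReal_ne_top, lintegral_const_mul' _ _ ENNReal.ofReal_ne_top,
    lintegral_sub_right_eq_self (fun u => ENNReal.ofReal (poi a u)),
    lintegral_sub_right_eq_self (fun u => ENNReal.ofReal (poi a u)), lintegral_poi ha,
    ← ENNReal.ofReal_mul (by positivity), ← ENNReal.ofReal_add (by positivity) (by positivity)]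
  refine ENNReal.ofReal_le_ofReal (le_of_eq ?_)
  ring

lemma measurable_stripMaj_comp {Y : Type*} [MeasurableSpace Y] {s z' x2 : Y → ℝ} (z : ℝ)
    (hs : Measurable s) (hz : Measurable z') (hx : Measurable x2) :
    Measurable fun q => stripMaj n p z (s q) (z' q) (x2 q) := by
  unfold stripMaj
  exact (measurable_poi_comp hs measurable_const (by fun_prop)).mul
    (measurable_poi_comp hs (by fun_prop) (by fun_prop))

lemma lintegral_stripMaj (z s : ℝ) :
    ∫⁻ q : ℝ × ℝ, ENNReal.ofReal (stripMaj n p z s q.1 q.2) = ENNReal.ofReal (Real.pi ^ 2) := by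
  have hm : Measurable fun q : ℝ × ℝ => ENNReal.ofReal (stripMaj n p z s q.1 q.2) :=
    (measurable_stripMaj_comp z measurable_const measurable_fst measurable_snd).ennreal_ofReal
  rw [Measure.volume_eq_prod, lintegral_prod_symm _ hm.aemeasurable]
  have h1 : ∀ x2 : ℝ, ∫⁻ z', ENNReal.ofReal (stripMaj n p z s z' x2)
      = ENNReal.ofReal (poi (nn n p s (2 * z)) (x2 - z)) * ENNReal.ofReal Real.pi := fun x2 => by
    unfold stripMaj
    simp_rw [ENNReal.ofReal_mul (poi_nonneg (nn_pos (n := n) (p := p) s (2 * z)).le (x2 - z))]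
    rw [lintegral_const_mul' _ _ ENNReal.ofReal_ne_top,
      lintegral_sub_left_eq_self (fun u => ENNReal.ofReal (poi (nn n p s (2 * x2)) u)),
      lintegral_poi (nn_pos _ _)]
  simp_rw [h1]
  rw [lintegral_mul_const' _ _ ENNReal.ofReal_ne_top,
    lintegral_sub_right_eq_self (fun u => ENNReal.ofReal (poi (nn n p s (2 * z)) u)),
    lintegral_poi (nn_pos _ _), ← ENNReal.ofReal_mul Real.pi_pos.le, sq]

lemma measurable_stripMain_comp {Y : Type*} [MeasurableSpace Y] {s z' x2 : Y → ℝ} (z : ℝ)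
    (hs : Measurable s) (hz : Measurable z') (hx : Measurable x2) :
    Measurable fun q => stripMain n Λ p γ θ z (z' q) (x2 q) (s q) := by
  have h1 := measurable_poi_comp (n := n) (p := p) hs (measurable_const (a := 2 * z))
    (by fun_prop : Measurable fun q => x2 q - z)
  have h2 : Measurable fun q => dd p 1 (s q) := (measurable_dd p 1).comp hs
  unfold stripMain stripΦ1
  fun_prop

lemma lintegral_stripMain_le (hΛ : 1 ≤ Λ) (hγ : 1 / 2 ≤ |γ|) (hθ : 0 < θ) (hθ1 : θ ≤ 1) (z s : ℝ) :
    ∫⁻ q : ℝ × ℝ, ENNReal.ofReal (stripMain n Λ p γ θ z q.1 q.2 s)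
      ≤ ENNReal.ofReal (128 * goodC n * Λ ^ 32 * (24 * √θ * Real.pi ^ 2)) := by
  have hg := one_le_goodC n
  have hm : Measurable fun q : ℝ × ℝ => ENNReal.ofReal (stripMain n Λ p γ θ z q.1 q.2 s) :=
    (measurable_stripMain_comp z measurable_const measurable_fst measurable_snd).ennreal_ofReal
  rw [Measure.volume_eq_prod, lintegral_prod_symm _ hm.aemeasurable]
  have h1 : ∀ x2 : ℝ, ∫⁻ z', ENNReal.ofReal (stripMain n Λ p γ θ z z' x2 s)
      ≤ ENNReal.ofReal (128 * goodC n * Λ ^ 32) * (ENNReal.ofReal (poi (nn n p s (2 * z)) (x2 - z)) *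
        ENNReal.ofReal (24 * √θ * Real.pi)) := fun x2 => by
    unfold stripMain
    have e0 : 0 ≤ 128 * goodC n * Λ ^ 32 := by positivity
    simp_rw [ENNReal.ofReal_mul e0,
      ENNReal.ofReal_mul (poi_nonneg (nn_pos (n := n) (p := p) s (2 * z)).le (x2 - z))]
    rw [lintegral_const_mul' _ _ ENNReal.ofReal_ne_top, lintegral_const_mul' _ _ ENNReal.ofReal_ne_top]
    gcongr
    exact lintegral_main_le hγ hθ hθ1 z s
  refine (lintegral_mono h1).trans ?_
  rw [lintegral_const_mul' _ _ ENNReal.ofReal_ne_top, lintegral_mul_const' _ _ ENNReal.ofReal_ne_top,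
    lintegral_sub_right_eq_self (fun u => ENNReal.ofReal (poi (nn n p s (2 * z)) u)),
    lintegral_poi (nn_pos _ _), ← ENNReal.ofReal_mul Real.pi_pos.le, ← ENNReal.ofReal_mul (by positivity)]
  refine ENNReal.ofReal_le_ofReal (le_of_eq ?_)
  ring

end StripSchur

section StripRow

variable {n : ℕ} {p : ℝ[X]} {Λ b κ γ θ Γ : ℝ}

lemma measurable_stripW (R : Finset ℝ) (z : ℝ) :
    Measurable fun w : (ℝ × ℝ) × ℝ => stripW n Λ p γ Γ κ θ R z w.2 w.1 := by
  unfold stripW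
  have h1 := measurable_stripMain_comp (n := n) (Λ := Λ) (p := p) (γ := γ) (θ := θ) z
    (s := fun w : (ℝ × ℝ) × ℝ => w.2) (z' := fun w => w.1.1) (x2 := fun w => w.1.2)
    (by fun_prop) (by fun_prop) (by fun_prop)
  have h2 := measurable_stripMaj_comp (n := n) (p := p) z
    (s := fun w : (ℝ × ℝ) × ℝ => w.2) (z' := fun w => w.1.1) (x2 := fun w => w.1.2)
    (by fun_prop) (by fun_prop) (by fun_prop)
  have h3 : Measurable fun w : (ℝ × ℝ) × ℝ =>
      ∑ r ∈ R, (Metric.closedBall r (2 * κ)).indicator (1 : ℝ → ℝ≥0∞) w.2 :=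
    Finset.measurable_sum _ fun r _ =>
      ((measurable_one.indicator Metric.isClosed_closedBall.measurableSet).comp measurable_snd)
  exact h1.ennreal_ofReal.add ((measurable_const.add h3).mul (h2.const_mul _).ennreal_ofReal)

lemma lintegral_stripW_le (hΛ : 1 ≤ Λ) (hγ : 1 / 2 ≤ |γ|) (hθ : 0 < θ) (hθ1 : θ ≤ 1)
    (R : Finset ℝ) (z s : ℝ) :
    ∫⁻ q : ℝ × ℝ, stripW n Λ p γ Γ κ θ R z s q ≤
      ENNReal.ofReal (128 * goodC n * Λ ^ 32 * (24 * √θ * Real.pi ^ 2)) +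
      (ENNReal.ofReal (stripRest n Γ κ θ) + ∑ r ∈ R, (Metric.closedBall r (2 * κ)).indicator 1 s) *
        ENNReal.ofReal (16 * Λ ^ 32 * Real.pi ^ 2) := by
  have hm : Measurable fun q : ℝ × ℝ => ENNReal.ofReal (stripMain n Λ p γ θ z q.1 q.2 s) :=
    (measurable_stripMain_comp z measurable_const measurable_fst measurable_snd).ennreal_ofReal
  have hΛ0 : 0 ≤ 16 * Λ ^ 32 := by positivity
  unfold stripW
  rw [lintegral_add_left hm]
  refine add_le_add (lintegral_stripMain_le hΛ hγ hθ hθ1 z s) ?_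
  simp_rw [ENNReal.ofReal_mul hΛ0]
  have hm2 : Measurable fun q : ℝ × ℝ => ENNReal.ofReal (stripMaj n p z s q.1 q.2) :=
    (measurable_stripMaj_comp z measurable_const measurable_fst measurable_snd).ennreal_ofReal
  rw [lintegral_const_mul _ (hm2.const_mul _), lintegral_const_mul _ hm2, lintegral_stripMaj]

lemma lintegral_stripD (hΛ : 1 ≤ Λ) (hθ : 0 < θ) (z c : ℝ) :
    ∫⁻ q : ℝ × ℝ, stripD n Λ p θ z c q = ENNReal.ofReal (16 * Λ ^ 32 * Real.pi ^ 2 / θ) := by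
  have hc : 0 ≤ 16 * Λ ^ 32 / θ := by positivity
  have hm2 : Measurable fun q : ℝ × ℝ => ENNReal.ofReal (stripMaj n p z c q.1 q.2) :=
    (measurable_stripMaj_comp z measurable_const measurable_fst measurable_snd).ennreal_ofReal
  have e : ∀ q : ℝ × ℝ, stripD n Λ p θ z c q
      = ENNReal.ofReal (16 * Λ ^ 32 / θ) * ENNReal.ofReal (stripMaj n p z c q.1 q.2) := fun q => by
    unfold stripD
    rw [← ENNReal.ofReal_mul hc]
    ring_nf
  simp_rw [e]
  rw [lintegral_const_mul _ hm2, lintegral_stripMaj, ← ENNReal.ofReal_mul hc]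
  ring_nf

lemma measurable_stripD (z c : ℝ) : Measurable fun q : ℝ × ℝ => stripD n Λ p θ z c q := by
  have hm2 : Measurable fun q : ℝ × ℝ => stripMaj n p z c q.1 q.2 :=
    measurable_stripMaj_comp z measurable_const measurable_fst measurable_snd
  unfold stripD
  fun_prop

lemma lintegral_row_le (hΛ : 1 ≤ Λ) (hγ : 1 / 2 ≤ |γ|) (hΓ : 0 ≤ Γ) (hκ : 0 < κ) (hθ : 0 < θ)
    (hθ1 : θ ≤ 1) (R : Finset ℝ) (z a : ℝ) (m : ℕ) :
    ∫⁻ q : ℝ × ℝ, ((∫⁻ s in Set.Ioc a (a + m * κ), stripW n Λ p γ Γ κ θ R z s q) +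
        ∑ j ∈ Finset.range m, (stripD n Λ p θ z (a + j * κ) q + stripD n Λ p θ z (a + j * κ + κ) q))
      ≤ ENNReal.ofReal (m * κ * (128 * goodC n * Λ ^ 32 * (24 * √θ * Real.pi ^ 2)) +
        (m * κ * stripRest n Γ κ θ + R.card * (4 * κ)) * (16 * Λ ^ 32 * Real.pi ^ 2) +
        m * (2 * (16 * Λ ^ 32 * Real.pi ^ 2 / θ))) := by
  have hg := one_le_goodC n
  have hrest : 0 ≤ stripRest n Γ κ θ := by unfold stripRest; positivity
  have hmD : Measurable fun q : ℝ × ℝ => ∑ j ∈ Finset.range m,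
      (stripD n Λ p θ z (a + j * κ) q + stripD n Λ p θ z (a + j * κ + κ) q) :=
    Finset.measurable_sum _ fun j _ => (measurable_stripD z _).add (measurable_stripD z _)
  rw [lintegral_add_right _ hmD, ENNReal.ofReal_add (by positivity) (by positivity)]
  refine add_le_add ?_ ?_
  · rw [lintegral_lintegral_swap (measurable_stripW R z).aemeasurable]
    refine (lintegral_mono fun s => lintegral_stripW_le hΛ hγ hθ hθ1 R z s).trans ?_
    have hms : Measurable fun s : ℝ =>
        ∑ r ∈ R, (Metric.closedBall r (2 * κ)).indicator (1 : ℝ → ℝ≥0∞) s :=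
      Finset.measurable_sum _ fun r _ =>
        measurable_one.indicator Metric.isClosed_closedBall.measurableSet
    have hvol : volume (Set.Ioc a (a + m * κ)) = ENNReal.ofReal (m * κ) := by
      rw [Real.volume_Ioc]; congr 1; ring
    have hsum : ∫⁻ s in Set.Ioc a (a + m * κ),
        ∑ r ∈ R, (Metric.closedBall r (2 * κ)).indicator (1 : ℝ → ℝ≥0∞) s
        ≤ ENNReal.ofReal (R.card * (4 * κ)) := by
      rw [lintegral_finsetSum _ fun r _ =>
        measurable_one.indicator Metric.isClosed_closedBall.measurableSet]
      refine (Finset.sum_le_card_nsmul R _ (ENNReal.ofReal (4 * κ)) fun r _ => ?_).trans (le_of_eq ?_)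
      · refine (setLIntegral_le_lintegral _ _).trans ?_
        rw [lintegral_indicator_one Metric.isClosed_closedBall.measurableSet, Real.volume_closedBall]
        exact ENNReal.ofReal_le_ofReal (by linarith)
      · rw [nsmul_eq_mul, ENNReal.ofReal_mul (Nat.cast_nonneg _), ENNReal.ofReal_natCast]
    have hms' : Measurable fun s : ℝ => ENNReal.ofReal (stripRest n Γ κ θ) +
        ∑ r ∈ R, (Metric.closedBall r (2 * κ)).indicator (1 : ℝ → ℝ≥0∞) s := measurable_const.add hms
    rw [lintegral_add_left measurable_const, lintegral_mul_const _ hms',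
      lintegral_add_left measurable_const, setLIntegral_const, setLIntegral_const, hvol,
      ENNReal.ofReal_add (by positivity) (by positivity)]
    refine add_le_add (le_of_eq ?_) ?_
    · rw [← ENNReal.ofReal_mul (by positivity)]
      ring_nf
    · rw [ENNReal.ofReal_mul (p := m * κ * stripRest n Γ κ θ + R.card * (4 * κ)) (by positivity),
        ENNReal.ofReal_add (by positivity) (by positivity)]
      refine mul_le_mul_left (add_le_add (le_of_eq ?_) hsum) _
      rw [← ENNReal.ofReal_mul hrest, mul_comm]
  · have hmj : ∀ j ∈ Finset.range m, Measurable fun q : ℝ × ℝ =>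
        stripD n Λ p θ z (a + j * κ) q + stripD n Λ p θ z (a + j * κ + κ) q := fun j _ =>
      (measurable_stripD z _).add (measurable_stripD z _)
    rw [lintegral_finsetSum _ hmj]
    refine (Finset.sum_le_card_nsmul _ _ (ENNReal.ofReal (2 * (16 * Λ ^ 32 * Real.pi ^ 2 / θ)))
      fun j _ => ?_).trans (le_of_eq ?_)
    · rw [lintegral_add_left (measurable_stripD z _), lintegral_stripD hΛ hθ, lintegral_stripD hΛ hθ,
        ← ENNReal.ofReal_add (by positivity) (by positivity), two_mul]
    · rw [nsmul_eq_mul, Finset.card_range, ENNReal.ofReal_mul (Nat.cast_nonneg _), ENNReal.ofReal_natCast]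

/-- The constant in the strip estimate. -/
def stripConst (n : ℕ) (Γ : ℝ) : ℝ :=
  Real.pi ^ 2 * (6144 * goodC n + 16 * (2 * ((64 * Γ + 576) * n) + n * (n + 1) * 4) + 64)

lemma stripConst_pos (n : ℕ) {Γ : ℝ} (hΓ : 0 ≤ Γ) : 0 < stripConst n Γ := by
  have := one_le_goodC n
  unfold stripConst
  positivity

lemma lintegral_row_le_pow (hΛ : 1 ≤ Λ) (hγ : 1 / 2 ≤ |γ|) (hΓ : 0 ≤ Γ) {r : ℝ} (hr : 1 ≤ r)
    {R : Finset ℝ} (hR : R.card ≤ n * (n + 1)) (z a : ℝ) {m : ℕ} (hm : (m : ℝ) ≤ 2 * r ^ 8) :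
    ∫⁻ q : ℝ × ℝ, ((∫⁻ s in Set.Ioc a (a + m * r ^ 8), stripW n Λ p γ Γ (r ^ 8) (r ^ 2)⁻¹ R z s q) +
        ∑ j ∈ Finset.range m, (stripD n Λ p (r ^ 2)⁻¹ z (a + j * r ^ 8) q
          + stripD n Λ p (r ^ 2)⁻¹ z (a + j * r ^ 8 + r ^ 8) q))
      ≤ ENNReal.ofReal (stripConst n Γ * Λ ^ 32 * r ^ 15) := by
  have hg := one_le_goodC n
  have hr0 : 0 < r := by linarith
  refine (lintegral_row_le hΛ hγ hΓ (by positivity) (by positivity)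
    (inv_le_one_of_one_le₀ (one_le_pow₀ hr)) R z a m).trans (ENNReal.ofReal_le_ofReal ?_)
  have hR' : (R.card : ℝ) ≤ n * (n + 1) := by exact_mod_cast hR
  have e1 : √(r ^ 2)⁻¹ = r⁻¹ := by rw [Real.sqrt_inv, Real.sqrt_sq hr0.le]
  rw [e1]
  have t1 : m * r ^ 8 * (128 * goodC n * Λ ^ 32 * (24 * r⁻¹ * Real.pi ^ 2))
      ≤ (6144 * goodC n * Λ ^ 32 * Real.pi ^ 2) * r ^ 15 := by
    calc _ ≤ 2 * r ^ 8 * r ^ 8 * (128 * goodC n * Λ ^ 32 * (24 * r⁻¹ * Real.pi ^ 2)) := by gcongr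
      _ = _ := by field_simp; ring
  have t2 : m * r ^ 8 * stripRest n Γ (r ^ 8) (r ^ 2)⁻¹ ≤ 2 * ((64 * Γ + 576) * n) * r ^ 15 := by
    unfold stripRest
    calc _ ≤ 2 * r ^ 8 * r ^ 8 * ((64 * Γ + 576) * n / r ^ 8 / (r ^ 2)⁻¹ ^ 2) := by gcongr
      _ = 2 * ((64 * Γ + 576) * n) * r ^ 12 := by field_simp
      _ ≤ _ := by gcongr; norm_num
  have t3 : R.card * (4 * r ^ 8) ≤ n * (n + 1) * 4 * r ^ 15 := by
    calc _ ≤ n * (n + 1) * (4 * r ^ 15) := by gcongr; norm_num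
      _ = _ := by ring
  have t4 : m * (2 * (16 * Λ ^ 32 * Real.pi ^ 2 / (r ^ 2)⁻¹)) ≤ 64 * Λ ^ 32 * Real.pi ^ 2 * r ^ 15 := by
    calc _ ≤ 2 * r ^ 8 * (2 * (16 * Λ ^ 32 * Real.pi ^ 2 / (r ^ 2)⁻¹)) := by gcongr
      _ = 64 * Λ ^ 32 * Real.pi ^ 2 * r ^ 10 := by field_simp; ring
      _ ≤ _ := by gcongr; norm_num
  calc _ ≤ (6144 * goodC n * Λ ^ 32 * Real.pi ^ 2) * r ^ 15 + (2 * ((64 * Γ + 576) * n) * r ^ 15 +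
        n * (n + 1) * 4 * r ^ 15) * (16 * Λ ^ 32 * Real.pi ^ 2) + 64 * Λ ^ 32 * Real.pi ^ 2 * r ^ 15 := by
        gcongr
    _ = _ := by unfold stripConst; ring

end StripRow

section StripOperator

variable {n : ℕ} {p : ℝ[X]} {Λ b κ γ θ Γ : ℝ}

/-- The kernel in the variables `(s, x₂)` and `z`, for frozen `x₁ - y₁`. -/
def stripK (n : ℕ) (Λ : ℝ) (p : ℝ[X]) (b γ : ℝ) (q : ℝ × ℝ) (z : ℝ) : ℂ :=
  Complex.exp (Complex.I * ((-(γ * ((q.2 - z) * (q.1 * (q.2 + z) + dd p 0 q.1))) : ℝ) : ℂ)) *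
    ((stripG n Λ p b q.1 q.2 z : ℝ) : ℂ)

lemma conj_stripK_mul (s x2 z z' : ℝ) :
    conj (stripK n Λ p b γ (s, x2) z) * stripK n Λ p b γ (s, x2) z' = stripF n Λ p b γ z z' x2 s := by
  unfold stripK stripF
  rw [map_mul, conj_exp_I_mul, Complex.conj_ofReal]
  rw [mul_mul_mul_comm, ← Complex.exp_add, ← mul_add, ← Complex.ofReal_add, ← Complex.ofReal_mul]
  congr 4
  unfold stripΦ
  ring

lemma measurable_stripK_comp {Y : Type*} [MeasurableSpace Y] {s x2 z : Y → ℝ} (hs : Measurable s)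
    (hx : Measurable x2) (hz : Measurable z) :
    Measurable fun q => stripK n Λ p b γ (s q, x2 q) (z q) := by
  have h1 := measurable_psi_comp (n := n) (Λ := Λ) (p := p) hs (hx.sub hz) (hx.add hz)
  have h2 : Measurable fun q => dd p 1 (s q) := (measurable_dd p 1).comp hs
  have h3 : Measurable fun q => dd p 0 (s q) := (measurable_dd p 0).comp hs
  simp only [Pi.sub_apply, Pi.add_apply] at h1
  unfold stripK stripG sinq
  simp only
  fun_prop

lemma norm_stripK_le (q : ℝ × ℝ) (z : ℝ) :
    ‖stripK n Λ p b γ q z‖ ≤ √(nn n p q.1 (q.2 + z)) := by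
  unfold stripK
  rw [norm_mul, mul_comm Complex.I, Complex.norm_exp_ofReal_mul_I, one_mul, Complex.norm_real]
  exact (abs_stripG_le _ _ _).trans (mul_le_of_le_one_right (Real.sqrt_nonneg _) (psi_le_one _ _ _))

instance (a c M : ℝ) : IsFiniteMeasure
    ((volume : Measure (ℝ × ℝ)).restrict (Set.Ioc a c ×ˢ Set.Icc (-M) M)) :=
  ⟨by rw [Measure.restrict_apply_univ, Measure.volume_eq_prod, Measure.prod_prod]
      exact ENNReal.mul_lt_top measure_Ioc_lt_top measure_Icc_lt_top⟩

lemma exists_norm_stripK_le (a c M : ℝ) : ∃ C : ℝ, 0 ≤ C ∧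
    ∀ q ∈ Set.Ioc a c ×ˢ Set.Icc (-M) M, ∀ z ∈ Set.Icc (-M) M, ‖stripK n Λ p b γ q z‖ ≤ C := by
  obtain ⟨C, hC1, hC⟩ := exists_nn_bound n p (|a| + |c|) (2 * M)
  refine ⟨√C, Real.sqrt_nonneg _, fun q hq z hz =>
    (norm_stripK_le q z).trans (Real.sqrt_le_sqrt (hC _ _ ?_ ?_))⟩
  · rw [abs_le]
    have h1 := hq.1.1
    have h2 := hq.1.2
    constructor
    · linarith [neg_abs_le a, abs_nonneg c]
    · linarith [le_abs_self c, abs_nonneg a]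
  · rw [abs_le]
    constructor <;> linarith [hq.2.1, hq.2.2, hz.1, hz.2]

lemma enorm_stripKK_le (hΛ : 1 ≤ Λ) (hγ : |γ| ≤ Γ) (hb : 1 / 2 ≤ b) (hκ : 1 ≤ κ)
    (hθ : 0 < θ) (hθ1 : θ ≤ 1) {z : ℝ} {R : Finset ℝ}
    (hR : ∀ s : ℝ, (∀ r ∈ R, κ ≤ |s - r|) → GoodAt n p κ z s) (a : ℝ) (m : ℕ) (M z' : ℝ)
    (hz : z ∈ Set.Icc (-M) M) (hz' : z' ∈ Set.Icc (-M) M) :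
    ‖∫ q in Set.Ioc a (a + m * κ) ×ˢ Set.Icc (-M) M,
      conj (stripK n Λ p b γ q z) * stripK n Λ p b γ q z'‖ₑ ≤
    ∫⁻ x2, ((∫⁻ s in Set.Ioc a (a + m * κ), stripW n Λ p γ Γ κ θ R z s (z', x2)) +
        ∑ j ∈ Finset.range m, (stripD n Λ p θ z (a + j * κ) (z', x2)
          + stripD n Λ p θ z (a + j * κ + κ) (z', x2))) := by
  have hκ0 : 0 < κ := by linarith
  have hm0 : a ≤ a + m * κ := by
    have : 0 ≤ (m : ℝ) * κ := by positivity
    linarith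
  obtain ⟨C, hC0, hC⟩ := exists_norm_stripK_le (n := n) (Λ := Λ) (p := p) (b := b) (γ := γ) a (a + m * κ) M
  have hme : ∀ z, Measurable fun q : ℝ × ℝ => stripK n Λ p b γ q z := fun z =>
    measurable_stripK_comp measurable_fst measurable_snd measurable_const
  have hint : Integrable (fun q : ℝ × ℝ => conj (stripK n Λ p b γ q z) * stripK n Λ p b γ q z')
      (volume.restrict (Set.Ioc a (a + m * κ) ×ˢ Set.Icc (-M) M)) := by
    refine Integrable.of_bound ?_ (C * C) ?_
    · exact (((RCLike.continuous_conj (K := ℂ)).measurable.comp (hme z)).mul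
        (hme z')).aestronglyMeasurable
    · filter_upwards [ae_restrict_mem (measurableSet_Ioc.prod measurableSet_Icc)] with q hq
      rw [norm_mul, RCLike.norm_conj]
      exact mul_le_mul (hC q hq z hz) (hC q hq z' hz') (norm_nonneg _) hC0
  rw [Measure.volume_eq_prod, ← Measure.prod_restrict] at hint ⊢
  rw [integral_prod_symm _ hint]
  refine (enorm_integral_le_lintegral_enorm _).trans
    ((setLIntegral_le_lintegral _ _).trans (lintegral_mono fun x2 => ?_))
  simp_rw [conj_stripK_mul]
  rw [← intervalIntegral.integral_of_le hm0]
  exact cells_bound hΛ hγ hb hκ hθ hθ1 hR a m (z', x2)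

lemma measurable_stripK_comp_pair {Y : Type*} [MeasurableSpace Y] {q : Y → ℝ × ℝ} {z : Y → ℝ}
    (hq : Measurable q) (hz : Measurable z) : Measurable fun w => stripK n Λ p b γ (q w) (z w) := by
  simpa only [Prod.mk.eta] using measurable_stripK_comp (n := n) (Λ := Λ) (p := p) (b := b) (γ := γ)
    hq.fst hq.snd hz

lemma measurable_stripK : Measurable (Function.uncurry (stripK n Λ p b γ)) :=
  measurable_stripK_comp_pair (q := fun w : (ℝ × ℝ) × ℝ => w.1) measurable_fst measurable_snd

lemma measurable_conj_stripK_comp {Y : Type*} [MeasurableSpace Y] {q : Y → ℝ × ℝ} {z : Y → ℝ}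
    (hq : Measurable q) (hz : Measurable z) :
    Measurable fun w => conj (stripK n Λ p b γ (q w) (z w)) :=
  Measurable.comp (g := fun c : ℂ => conj c) (RCLike.continuous_conj (K := ℂ)).measurable
    (measurable_stripK_comp_pair hq hz)

lemma measurable_conj_stripK :
    Measurable (Function.uncurry fun (z : ℝ) (q : ℝ × ℝ) => conj (stripK n Λ p b γ q z)) :=
  measurable_conj_stripK_comp (q := fun w : ℝ × (ℝ × ℝ) => w.2) measurable_snd measurable_fst

/-- The modulus of the kernel of `A* A`. -/
def stripKK (n : ℕ) (Λ : ℝ) (p : ℝ[X]) (b γ : ℝ) (S : Set (ℝ × ℝ)) (z z' : ℝ) : ℝ≥0∞ :=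
  ‖∫ q in S, conj (stripK n Λ p b γ q z) * stripK n Λ p b γ q z'‖ₑ

lemma measurable_stripKK (S : Set (ℝ × ℝ)) :
    Measurable (Function.uncurry (stripKK n Λ p b γ S)) := by
  have h1 : Measurable fun w : (ℝ × ℝ) × (ℝ × ℝ) =>
      conj (stripK n Λ p b γ w.2 w.1.1) * stripK n Λ p b γ w.2 w.1.2 :=
    (measurable_conj_stripK_comp measurable_snd (by fun_prop)).mul
      (measurable_stripK_comp_pair measurable_snd (by fun_prop))
  exact (h1.stronglyMeasurable.integral_prod_right (ν := volume.restrict S)).measurable.enorm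

lemma stripKK_symm (S : Set (ℝ × ℝ)) (z z' : ℝ) :
    stripKK n Λ p b γ S z z' = stripKK n Λ p b γ S z' z := by
  unfold stripKK
  rw [← RCLike.enorm_conj (∫ q in S, conj (stripK n Λ p b γ q z) * stripK n Λ p b γ q z'),
    ← integral_conj]
  simp_rw [map_mul, Complex.conj_conj, mul_comm (stripK n Λ p b γ _ z)]

lemma lintegral_stripKK_le (hp : p.natDegree ≤ n) (hΛ : 1 ≤ Λ) (hγ : 1 / 2 ≤ |γ|) (hγΓ : |γ| ≤ Γ)
    (hb : 1 / 2 ≤ b) {r : ℝ} (hr : 1 ≤ r) {m : ℕ} (hm : (m : ℝ) ≤ 2 * r ^ 8) (a M z : ℝ)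
    (hz : z ∈ Set.Icc (-M) M) :
    ∫⁻ z' in Set.Icc (-M) M, stripKK n Λ p b γ (Set.Ioc a (a + m * r ^ 8) ×ˢ Set.Icc (-M) M) z z'
      ≤ ENNReal.ofReal (stripConst n Γ * Λ ^ 32 * r ^ 15) := by
  have hΓ : 0 ≤ Γ := (abs_nonneg γ).trans hγΓ
  have hκ : 1 ≤ r ^ 8 := one_le_pow₀ hr
  obtain ⟨R, hRc, hR⟩ := exists_goodAt_centers hp z
  have h1 := lintegral_row_le_pow (p := p) hΛ hγ hΓ hr hRc z a hm
  have hθ : 0 < (r ^ 2)⁻¹ := by positivity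
  have hθ1 : (r ^ 2)⁻¹ ≤ 1 := inv_le_one_of_one_le₀ (one_le_pow₀ hr)
  refine le_trans ?_ h1
  have hW : Measurable fun q : ℝ × ℝ =>
      ∫⁻ s in Set.Ioc a (a + m * r ^ 8), stripW n Λ p γ Γ (r ^ 8) (r ^ 2)⁻¹ R z s q :=
    (measurable_stripW R z).lintegral_prod_right' (ν := volume.restrict (Set.Ioc a (a + m * r ^ 8)))
  have hD : Measurable fun q : ℝ × ℝ => ∑ j ∈ Finset.range m,
      (stripD n Λ p (r ^ 2)⁻¹ z (a + j * r ^ 8) q + stripD n Λ p (r ^ 2)⁻¹ z (a + j * r ^ 8 + r ^ 8) q) :=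
    Finset.measurable_sum _ fun j _ => (measurable_stripD z _).add (measurable_stripD z _)
  have hWD : Measurable fun q : ℝ × ℝ =>
      (∫⁻ s in Set.Ioc a (a + m * r ^ 8), stripW n Λ p γ Γ (r ^ 8) (r ^ 2)⁻¹ R z s q) +
      ∑ j ∈ Finset.range m, (stripD n Λ p (r ^ 2)⁻¹ z (a + j * r ^ 8) q
        + stripD n Λ p (r ^ 2)⁻¹ z (a + j * r ^ 8 + r ^ 8) q) := hW.add hD
  rw [Measure.volume_eq_prod, lintegral_prod _ hWD.aemeasurable]
  refine (setLIntegral_mono' measurableSet_Icc fun z' hz' => ?_).trans (setLIntegral_le_lintegral _ _)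
  exact enorm_stripKK_le hΛ hγΓ hb hκ hθ hθ1 (fun s hs => hR _ s (by positivity) hs) a m M z' hz hz'

/-- The strip estimate. -/
lemma sqn_strip_le (hp : p.natDegree ≤ n) (hΛ : 1 ≤ Λ) (hγ : 1 / 2 ≤ |γ|) (hγΓ : |γ| ≤ Γ) (hb : 1 / 2 ≤ b)
    {r : ℝ} (hr : 1 ≤ r) {m : ℕ} (hm : (m : ℝ) ≤ 2 * r ^ 8) (a M : ℝ) {h : ℝ → ℂ}
    (hh : MemLp h 2 (volume.restrict (Set.Icc (-M) M))) :
    sqn (volume.restrict (Set.Ioc a (a + m * r ^ 8) ×ˢ Set.Icc (-M) M))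
      (op (volume.restrict (Set.Icc (-M) M)) (stripK n Λ p b γ) h)
      ≤ ENNReal.ofReal (stripConst n Γ * Λ ^ 32 * r ^ 15) * sqn (volume.restrict (Set.Icc (-M) M)) h := by
  obtain ⟨C, hC0, hC⟩ := exists_norm_stripK_le (n := n) (Λ := Λ) (p := p) (b := b) (γ := γ) a
    (a + m * r ^ 8) M
  have hrow := lintegral_stripKK_le hp hΛ hγ hγΓ hb hr hm a M
  generalize ENNReal.ofReal (stripConst n Γ * Λ ^ 32 * r ^ 15) = A at hrow ⊢
  refine sqn_op_le_of_adjoint_restrict (measurableSet_Ioc.prod measurableSet_Icc) measurableSet_Icc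
    measurable_stripK hC0 hC (fun g hg => ?_) hh
  refine sqn_op_le_of_ttstar_restrict measurableSet_Icc (measurableSet_Ioc.prod measurableSet_Icc)
    measurable_conj_stripK hC0 (fun z hz q hq => by rw [RCLike.norm_conj]; exact hC q hq z hz)
    (fun F hF => ?_) hg
  simp_rw [Complex.conj_conj]
  refine schur_form (k := stripKK n Λ p b γ (Set.Ioc a (a + m * r ^ 8) ×ˢ Set.Icc (-M) M))
    (measurable_stripKK _) (A := A) (B := A) ?_ ?_ (by rw [sq]) hF
  · filter_upwards [ae_restrict_mem measurableSet_Icc] with z hz using hrow z hz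
  · filter_upwards [ae_restrict_mem measurableSet_Icc] with z' hz'
    simp_rw [stripKK_symm _ _ z']
    exact hrow z' hz'

end StripOperator

section StepFunctions

variable {n : ℕ} {p : ℝ[X]} {Λ e γ lo hi ℓ r Γ : ℝ}

lemma cell_eq (hℓ : 0 < ℓ) (j : ℤ) {y : ℝ} (hy : y ∈ Set.Ico (ℓ * j) (ℓ * j + ℓ)) :
    cell ℓ y = ℓ * j := by
  unfold cell
  congr 2
  rw [Int.floor_eq_iff, le_div_iff₀ hℓ, div_lt_iff₀ hℓ]
  constructor <;> linarith [hy.1, hy.2]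

lemma cell_cell (hℓ : 0 < ℓ) (y : ℝ) : cell ℓ (cell ℓ y) = cell ℓ y :=
  cell_eq hℓ ⌊y / ℓ⌋ ⟨le_rfl, by unfold cell; linarith⟩

lemma setLIntegral_Ico_le_of_cells {f g : ℝ → ℝ≥0∞} (hℓ : 0 < ℓ) (j : ℤ) (m : ℕ)
    (h : ∀ j : ℤ, ∫⁻ y in Set.Ico (ℓ * j) (ℓ * j + ℓ), f y ≤ ∫⁻ y in Set.Ico (ℓ * j) (ℓ * j + ℓ), g y) :
    ∫⁻ y in Set.Ico (ℓ * j) (ℓ * j + m * ℓ), f y ≤ ∫⁻ y in Set.Ico (ℓ * j) (ℓ * j + m * ℓ), g y := by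
  induction m with
  | zero => simp
  | succ m ih =>
    have e : Set.Ico (ℓ * j) (ℓ * j + (m + 1 : ℕ) * ℓ) = Set.Ico (ℓ * j) (ℓ * j + m * ℓ) ∪
        Set.Ico (ℓ * (j + m : ℤ)) (ℓ * (j + m : ℤ) + ℓ) := by
      have h0 : 0 ≤ (m : ℝ) * ℓ := by positivity
      rw [show ℓ * ((j + m : ℤ) : ℝ) = ℓ * j + m * ℓ by push_cast; ring,
        Set.Ico_union_Ico_eq_Ico (by linarith) (by linarith)]
      push_cast
      ring_nf
    have hd : Disjoint (Set.Ico (ℓ * j) (ℓ * j + m * ℓ))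
        (Set.Ico (ℓ * (j + m : ℤ)) (ℓ * (j + m : ℤ) + ℓ)) := by
      rw [show ℓ * ((j + m : ℤ) : ℝ) = ℓ * j + m * ℓ by push_cast; ring]
      exact Set.Ico_disjoint_Ico_same
    rw [e, lintegral_union measurableSet_Ico hd, lintegral_union measurableSet_Ico hd]
    exact add_le_add ih (h _)

lemma lintegral_comp_two_mul_add_le {F : ℝ → ℝ≥0∞} (hF : Measurable F) (t : ℝ) :
    ∫⁻ y, F (2 * y + t) ≤ ∫⁻ s, F s := by
  have h1 := Real.smul_map_volume_mul_left (a := 2) (by norm_num)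
  have h2 : ∫⁻ s, F (s + t) = ENNReal.ofReal |2| * ∫⁻ y, F (2 * y + t) := by
    conv_lhs => rw [← h1]
    have hFt : Measurable fun s => F (s + t) := hF.comp (measurable_id.add_const t)
    rw [lintegral_smul_measure, lintegral_map hFt (measurable_const_mul 2), smul_eq_mul]
  rw [← lintegral_add_right_eq_self F t, h2]
  refine le_mul_of_one_le_left' ?_
  norm_num

lemma sqn_prod_eq {S T : Set ℝ} {f : ℝ × ℝ → ℂ} (hf : AEStronglyMeasurable f
    ((volume : Measure (ℝ × ℝ)).restrict (S ×ˢ T))) :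
    sqn (volume.restrict (S ×ˢ T)) f = ∫⁻ s in S, ∫⁻ x in T, ‖f (s, x)‖ₑ ^ 2 := by
  unfold sqn
  rw [Measure.volume_eq_prod, ← Measure.prod_restrict] at hf ⊢
  exact lintegral_prod _ (hf.enorm.pow_const 2)

/-- The strip estimate on a single cell. -/
lemma strip_cell_le (hp : p.natDegree ≤ n) (hΛ : 1 ≤ Λ) (hγ : 1 / 2 ≤ |γ|) (hγΓ : |γ| ≤ Γ) {b : ℝ}
    (hb : 1 / 2 ≤ b) (hr : 1 ≤ r) (hℓ : r ^ 16 = 2 * ℓ) (c t M : ℝ) {h : ℝ → ℂ}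
    (hh : AEStronglyMeasurable h (volume.restrict (Set.Icc (-M) M))) :
    ∫⁻ y in Set.Ico c (c + ℓ), ∫⁻ x in Set.Icc (-M) M,
      ‖op (volume.restrict (Set.Icc (-M) M)) (stripK n Λ p b γ) h (2 * y + t, x)‖ₑ ^ 2
      ≤ ENNReal.ofReal (stripConst n Γ * Λ ^ 32 * r ^ 15) * sqn (volume.restrict (Set.Icc (-M) M)) h := by
  have hΓ : 0 ≤ Γ := (abs_nonneg γ).trans hγΓ
  have hC := stripConst_pos n hΓ
  have hr0 : 0 < r := by linarith
  by_cases hfin : sqn (volume.restrict (Set.Icc (-M) M)) h = ⊤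
  · rw [hfin, ENNReal.mul_top (ENNReal.ofReal_pos.2 (by positivity)).ne']
    exact le_top
  have hL : MemLp h 2 (volume.restrict (Set.Icc (-M) M)) := by
    refine ⟨hh, ?_⟩
    rw [sqn_eq] at hfin
    by_contra h1
    exact hfin (by rw [not_lt, top_le_iff] at h1; rw [h1]; rfl)
  have hm1 : (⌈r ^ 8⌉₊ : ℝ) ≤ 2 * r ^ 8 := by
    have h1 := Nat.ceil_lt_add_one (R := ℝ) (a := r ^ 8) (by positivity)
    have h2 : 1 ≤ r ^ 8 := one_le_pow₀ hr
    linarith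
  have hm2 : 2 * ℓ ≤ (⌈r ^ 8⌉₊ : ℝ) * r ^ 8 := by
    rw [← hℓ]
    calc r ^ 16 = r ^ 8 * r ^ 8 := by ring
      _ ≤ _ := by gcongr; exact Nat.le_ceil _
  have hmain := sqn_strip_le hp hΛ hγ hγΓ hb hr hm1 (2 * c + t) M hL
  refine le_trans ?_ hmain
  have hmeas := op_stronglyMeasurable (ν := volume.restrict (Set.Icc (-M) M))
    (measurable_stripK (n := n) (Λ := Λ) (p := p) (b := b) (γ := γ)) hh
  rw [sqn_prod_eq hmeas.aestronglyMeasurable]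
  set G : ℝ → ℝ≥0∞ := fun s => ∫⁻ x in Set.Icc (-M) M,
    ‖op (volume.restrict (Set.Icc (-M) M)) (stripK n Λ p b γ) h (s, x)‖ₑ ^ 2 with hG
  have hGm : Measurable G :=
    (hmeas.measurable.enorm.pow_const 2).lintegral_prod_right' (ν := volume.restrict (Set.Icc (-M) M))
  have h1 := lintegral_comp_two_mul_add_le
    (F := (Set.Ico (2 * c + t) (2 * c + t + 2 * ℓ)).indicator G) (hGm.indicator measurableSet_Ico) t
  rw [lintegral_indicator measurableSet_Ico, setLIntegral_congr Ico_ae_eq_Ioc] at h1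
  have h2 : ∀ y : ℝ, (Set.Ico (2 * c + t) (2 * c + t + 2 * ℓ)).indicator G (2 * y + t)
      = (Set.Ico c (c + ℓ)).indicator (fun y => G (2 * y + t)) y := fun y => by
    by_cases hy : y ∈ Set.Ico c (c + ℓ)
    · rw [Set.indicator_of_mem hy, Set.indicator_of_mem]
      exact ⟨by linarith [hy.1], by linarith [hy.2]⟩
    · rw [Set.indicator_of_notMem hy, Set.indicator_of_notMem]
      exact fun h => hy ⟨by linarith [h.1], by linarith [h.2]⟩
  simp_rw [h2] at h1
  rw [lintegral_indicator measurableSet_Ico] at h1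
  refine h1.trans (lintegral_mono_set (Set.Ioc_subset_Ioc le_rfl ?_))
  linarith

lemma lowK_eq_stripK {t : ℝ} (ht : t ∈ win lo hi) (y1 x2 z : ℝ) :
    lowK n Λ p e γ lo hi (y1 + t, x2) (y1, z) = stripK n Λ p (bet e t) γ (2 * y1 + t, x2) z := by
  unfold lowK stripK stripG
  simp only
  rw [add_sub_cancel_left, Set.indicator_of_mem ht, coreK_eq]
  simp only
  rw [add_sub_cancel_left, show y1 + t + y1 = 2 * y1 + t by ring]
  push_cast
  ring

/-- The inner integral of `lowK` against a function. -/
def lowInner (n : ℕ) (Λ : ℝ) (p : ℝ[X]) (e γ lo hi M : ℝ) (φ : ℝ × ℝ → ℂ) (x1 x2 y1 : ℝ) : ℂ :=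
  ∫ z in Set.Icc (-M) M, lowK n Λ p e γ lo hi (x1, x2) (y1, z) * φ (y1, z)

lemma measurable_lowInner {M : ℝ} {φ : ℝ × ℝ → ℂ} (hφ : StronglyMeasurable φ) {Y : Type*}
    [MeasurableSpace Y] {x1 x2 y1 : Y → ℝ} (hx1 : Measurable x1) (hx2 : Measurable x2)
    (hy1 : Measurable y1) :
    Measurable fun q => lowInner n Λ p e γ lo hi M φ (x1 q) (x2 q) (y1 q) := by
  have h1 : Measurable fun w : Y × ℝ =>
      lowK n Λ p e γ lo hi (x1 w.1, x2 w.1) (y1 w.1, w.2) * φ (y1 w.1, w.2) :=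
    (measurable_lowK_comp (x1 := fun w : Y × ℝ => x1 w.1) (x2 := fun w => x2 w.1)
      (y1 := fun w => y1 w.1) (y2 := fun w => w.2) (hx1.comp measurable_fst) (hx2.comp measurable_fst)
      (hy1.comp measurable_fst) measurable_snd).mul
      (hφ.measurable.comp ((hy1.comp measurable_fst).prodMk measurable_snd))
  exact (h1.stronglyMeasurable.integral_prod_right' (ν := volume.restrict (Set.Icc (-M) M))).measurable

lemma lowInner_eq_zero {M : ℝ} {φ : ℝ × ℝ → ℂ} {x1 x2 y1 : ℝ} (h : x1 - y1 ∉ win lo hi) :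
    lowInner n Λ p e γ lo hi M φ x1 x2 y1 = 0 := by
  have h0 : ∀ z, lowK n Λ p e γ lo hi (x1, x2) (y1, z) = 0 := fun z => by
    unfold lowK
    rw [Set.indicator_of_notMem h]
  simp [lowInner, h0]

lemma enorm_op_lowK_sq_le {M1 M2 : ℝ} {φ : ℝ × ℝ → ℂ} (hφ : StronglyMeasurable φ)
    (hφL : MemLp φ 2 (volume.restrict (box M1 M2))) (hhi : hi ≤ 2) (x1 x2 : ℝ) :
    ‖op (volume.restrict (box M1 M2)) (lowK n Λ p e γ lo hi) φ (x1, x2)‖ₑ ^ 2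
      ≤ 4 * ∫⁻ y1 in Set.Ico (-M1) M1, ‖lowInner n Λ p e γ lo hi M2 φ x1 x2 y1‖ₑ ^ 2 := by
  have hint := integrable_lowK_mul (n := n) (Λ := Λ) (p := p) (e := e) (γ := γ) (lo := lo) (hi := hi)
    hφL (x1, x2)
  have h1 : op (volume.restrict (box M1 M2)) (lowK n Λ p e γ lo hi) φ (x1, x2)
      = ∫ y1 in Set.Ico (-M1) M1, lowInner n Λ p e γ lo hi M2 φ x1 x2 y1 := by
    unfold op lowInner
    unfold box at hint ⊢
    rw [Measure.volume_eq_prod, ← Measure.prod_restrict] at hint ⊢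
    exact integral_prod _ hint
  have hV : Measurable fun y1 => ‖lowInner n Λ p e γ lo hi M2 φ x1 x2 y1‖ₑ :=
    (measurable_lowInner hφ measurable_const measurable_const measurable_id).enorm
  set I : ℝ → ℝ≥0∞ := (Set.Icc (x1 - 2) (x1 + 2)).indicator 1 with hI
  have hIm : Measurable I := measurable_one.indicator measurableSet_Icc
  have h2 : ∀ y1, ‖lowInner n Λ p e γ lo hi M2 φ x1 x2 y1‖ₑ
      = I y1 * ‖lowInner n Λ p e γ lo hi M2 φ x1 x2 y1‖ₑ := fun y1 => by
    by_cases hy : x1 - y1 ∈ win lo hi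
    · have := abs_le.1 (hy.2.trans hhi)
      have hm : y1 ∈ Set.Icc (x1 - 2) (x1 + 2) := ⟨by linarith [this.2], by linarith [this.1]⟩
      rw [hI, Set.indicator_of_mem hm, Pi.one_apply, one_mul]
    · rw [lowInner_eq_zero hy, enorm_zero, mul_zero]
  have hI1 : ∀ y1, I y1 ≤ 1 := fun y1 => by
    rw [hI]; exact Set.indicator_le_self' (fun _ _ => zero_le_one) y1
  rw [h1]
  calc _ ≤ (∫⁻ y1 in Set.Ico (-M1) M1, ‖lowInner n Λ p e γ lo hi M2 φ x1 x2 y1‖ₑ) ^ 2 := by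
        gcongr; exact enorm_integral_le_lintegral_enorm _
    _ = (∫⁻ y1 in Set.Ico (-M1) M1, I y1 * ‖lowInner n Λ p e γ lo hi M2 φ x1 x2 y1‖ₑ) ^ 2 := by
        congr 1
        exact lintegral_congr h2
    _ ≤ (∫⁻ y1 in Set.Ico (-M1) M1, I y1) *
        ∫⁻ y1 in Set.Ico (-M1) M1, I y1 * ‖lowInner n Λ p e γ lo hi M2 φ x1 x2 y1‖ₑ ^ 2 :=
        lintegral_mul_sq_le_weight hIm.aemeasurable hV.aemeasurable
    _ ≤ _ := by
        refine mul_le_mul' ?_ (lintegral_mono fun y1 => mul_le_of_le_one_left' (hI1 y1))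
        refine (setLIntegral_le_lintegral _ _).trans ?_
        rw [hI, lintegral_indicator_one measurableSet_Icc, Real.volume_Icc]
        rw [show x1 + 2 - (x1 - 2) = 4 by ring]
        norm_num

lemma sqn_op_lowK_le_double {M1 M2 : ℝ} {φ : ℝ × ℝ → ℂ} (hφ : StronglyMeasurable φ)
    (hφL : MemLp φ 2 (volume.restrict (box M1 M2))) (hhi : hi ≤ 2) :
    sqn (volume.restrict (box M1 M2)) (op (volume.restrict (box M1 M2)) (lowK n Λ p e γ lo hi) φ)
      ≤ 4 * ∫⁻ t, ∫⁻ y1 in Set.Ico (-M1) M1, ∫⁻ x2 in Set.Icc (-M2) M2,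
        ‖lowInner n Λ p e γ lo hi M2 φ (y1 + t) x2 y1‖ₑ ^ 2 := by
  have hop := op_stronglyMeasurable (ν := volume.restrict (box M1 M2))
    (measurable_lowK (n := n) (Λ := Λ) (p := p) (e := e) (γ := γ) (lo := lo) (hi := hi)) hφL.1
  have h0 : sqn (volume.restrict (box M1 M2)) (op (volume.restrict (box M1 M2)) (lowK n Λ p e γ lo hi) φ)
      = ∫⁻ x1 in Set.Ico (-M1) M1, ∫⁻ x2 in Set.Icc (-M2) M2,
        ‖op (volume.restrict (box M1 M2)) (lowK n Λ p e γ lo hi) φ (x1, x2)‖ₑ ^ 2 :=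
    sqn_prod_eq hop.aestronglyMeasurable
  have hm : Measurable fun w : (ℝ × ℝ) × ℝ => ‖lowInner n Λ p e γ lo hi M2 φ w.1.1 w.2 w.1.2‖ₑ ^ 2 :=
    (measurable_lowInner hφ (by fun_prop) (by fun_prop) (by fun_prop)).enorm.pow_const 2
  set H : ℝ × ℝ → ℝ≥0∞ := fun w => ∫⁻ x2 in Set.Icc (-M2) M2,
    ‖lowInner n Λ p e γ lo hi M2 φ w.1 x2 w.2‖ₑ ^ 2 with hH
  have hHm : Measurable H := hm.lintegral_prod_right' (ν := volume.restrict (Set.Icc (-M2) M2))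
  rw [h0]
  calc _ ≤ ∫⁻ x1 in Set.Ico (-M1) M1, ∫⁻ x2 in Set.Icc (-M2) M2,
        4 * ∫⁻ y1 in Set.Ico (-M1) M1, ‖lowInner n Λ p e γ lo hi M2 φ x1 x2 y1‖ₑ ^ 2 :=
        lintegral_mono fun x1 => lintegral_mono fun x2 => enorm_op_lowK_sq_le hφ hφL hhi x1 x2
    _ = 4 * ∫⁻ x1 in Set.Ico (-M1) M1, ∫⁻ y1 in Set.Ico (-M1) M1, H (x1, y1) := by
        rw [← lintegral_const_mul' _ _ (by norm_num)]
        refine lintegral_congr fun x1 => ?_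
        rw [lintegral_const_mul' _ _ (by norm_num)]
        congr 1
        refine lintegral_lintegral_swap (Measurable.aemeasurable ?_)
        exact (measurable_lowInner hφ (x1 := fun _ : ℝ × ℝ => x1) (x2 := fun w => w.1)
          (y1 := fun w => w.2) (by fun_prop) (by fun_prop) (by fun_prop)).enorm.pow_const 2
    _ ≤ 4 * ∫⁻ x1, ∫⁻ y1 in Set.Ico (-M1) M1, H (x1, y1) := by
        gcongr
        exact Measure.restrict_le_self
    _ = 4 * ∫⁻ y1 in Set.Ico (-M1) M1, ∫⁻ x1, H (x1, y1) := by
        congr 1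
        exact lintegral_lintegral_swap hHm.aemeasurable
    _ = 4 * ∫⁻ y1 in Set.Ico (-M1) M1, ∫⁻ t, H (y1 + t, y1) := by
        congr 1
        refine lintegral_congr fun y1 => ?_
        exact (lintegral_add_left_eq_self (fun x1 => H (x1, y1)) y1).symm
    _ = _ := by
        congr 1
        refine lintegral_lintegral_swap (Measurable.aemeasurable ?_)
        exact hHm.comp (by fun_prop : Measurable fun w : ℝ × ℝ => (w.1 + w.2, w.1))

lemma sqn_op_lowK_step_le (hp : p.natDegree ≤ n) (he : 0 < e) (he1 : e ≤ 1) (hΛ : 1 ≤ Λ)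
    (hγ : 1 / 2 ≤ |γ|) (hγΓ : |γ| ≤ Γ) (hlo : 1 - e ^ 2 ≤ lo) (hhi : hi ≤ 2) (hr : 1 ≤ r)
    (hℓ : r ^ 16 = 2 * ℓ) {k : ℕ} {M1 M2 : ℝ} (hM : M1 = k * ℓ) {φ : ℝ × ℝ → ℂ}
    (hφ : StronglyMeasurable φ) (hφL : MemLp φ 2 (volume.restrict (box M1 M2)))
    (hφc : ∀ y, φ y = φ (cell ℓ y.1, y.2)) :
    sqn (volume.restrict (box M1 M2)) (op (volume.restrict (box M1 M2)) (lowK n Λ p e γ lo hi) φ)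
      ≤ ENNReal.ofReal (32 * stripConst n Γ * Λ ^ 32 / r) * sqn (volume.restrict (box M1 M2)) φ := by
  have hΓ : 0 ≤ Γ := (abs_nonneg γ).trans hγΓ
  have hC := stripConst_pos n hΓ
  have hr0 : 0 < r := by linarith
  have hℓ0 : 0 < ℓ := by have : 0 < r ^ 16 := by positivity
                         linarith
  set A := stripConst n Γ * Λ ^ 32 * r ^ 15 with hA
  have hA0 : 0 < A := by positivity
  have hN : sqn (volume.restrict (box M1 M2)) φ = ∫⁻ y1 in Set.Ico (-M1) M1,
      ∫⁻ z in Set.Icc (-M2) M2, ‖φ (y1, z)‖ₑ ^ 2 := sqn_prod_eq hφ.aestronglyMeasurable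
  have hMk : Set.Ico (-M1) M1 = Set.Ico (ℓ * (-(k : ℤ) : ℤ)) (ℓ * (-(k : ℤ) : ℤ) + (2 * k : ℕ) * ℓ) := by
    rw [hM]; push_cast; ring_nf
  have hper : ∀ t ∈ win lo hi, ∫⁻ y1 in Set.Ico (-M1) M1, ∫⁻ x2 in Set.Icc (-M2) M2,
        ‖lowInner n Λ p e γ lo hi M2 φ (y1 + t) x2 y1‖ₑ ^ 2
      ≤ ENNReal.ofReal (A / ℓ) * sqn (volume.restrict (box M1 M2)) φ := by
    intro t ht
    have hb := half_le_bet_of_mem_win he he1 hlo ht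
    rw [hN, ← lintegral_const_mul' _ _ ENNReal.ofReal_ne_top, hMk]
    refine setLIntegral_Ico_le_of_cells hℓ0 _ _ fun j => ?_
    have hh : StronglyMeasurable fun z => φ (ℓ * j, z) := hφ.comp_measurable (by fun_prop)
    have hcell := strip_cell_le hp hΛ hγ hγΓ hb hr hℓ (ℓ * j) t M2
      (hh.aestronglyMeasurable (μ := volume.restrict (Set.Icc (-M2) M2)))
    have hφj : ∀ y ∈ Set.Ico (ℓ * (j : ℝ)) (ℓ * j + ℓ), ∀ z, φ (y, z) = φ (ℓ * j, z) := fun y hy z => by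
      rw [hφc (y, z)]
      simp only
      rw [cell_eq hℓ0 j hy]
    have e1 : ∫⁻ y1 in Set.Ico (ℓ * (j : ℝ)) (ℓ * j + ℓ), ∫⁻ x2 in Set.Icc (-M2) M2,
        ‖lowInner n Λ p e γ lo hi M2 φ (y1 + t) x2 y1‖ₑ ^ 2
        = ∫⁻ y1 in Set.Ico (ℓ * (j : ℝ)) (ℓ * j + ℓ), ∫⁻ x2 in Set.Icc (-M2) M2,
        ‖op (volume.restrict (Set.Icc (-M2) M2)) (stripK n Λ p (bet e t) γ) (fun z => φ (ℓ * j, z))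
          (2 * y1 + t, x2)‖ₑ ^ 2 := by
      refine setLIntegral_congr_fun measurableSet_Ico fun y1 hy1 => ?_
      refine lintegral_congr fun x2 => ?_
      unfold lowInner op
      simp_rw [lowK_eq_stripK ht, hφj y1 hy1]
    have e2 : ∫⁻ y1 in Set.Ico (ℓ * (j : ℝ)) (ℓ * j + ℓ), ENNReal.ofReal (A / ℓ) *
        ∫⁻ z in Set.Icc (-M2) M2, ‖φ (y1, z)‖ₑ ^ 2
        = ENNReal.ofReal A * sqn (volume.restrict (Set.Icc (-M2) M2)) (fun z => φ (ℓ * j, z)) := by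
      have e3 : ∀ y1 ∈ Set.Ico (ℓ * (j : ℝ)) (ℓ * j + ℓ), ENNReal.ofReal (A / ℓ) *
          ∫⁻ z in Set.Icc (-M2) M2, ‖φ (y1, z)‖ₑ ^ 2 = ENNReal.ofReal (A / ℓ) *
          sqn (volume.restrict (Set.Icc (-M2) M2)) (fun z => φ (ℓ * j, z)) := fun y1 hy1 => by
        unfold sqn
        simp_rw [hφj y1 hy1]
      rw [setLIntegral_congr_fun measurableSet_Ico e3, setLIntegral_const, Real.volume_Ico,
        add_sub_cancel_left, mul_right_comm, ← ENNReal.ofReal_mul (by positivity),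
        div_mul_cancel₀ _ hℓ0.ne']
    rw [e1, e2]
    exact hcell
  refine (sqn_op_lowK_le_double hφ hφL hhi).trans ?_
  have hle : ∀ t, ∫⁻ y1 in Set.Ico (-M1) M1, ∫⁻ x2 in Set.Icc (-M2) M2,
        ‖lowInner n Λ p e γ lo hi M2 φ (y1 + t) x2 y1‖ₑ ^ 2
      ≤ (Set.Icc (-2) 2).indicator
        (fun _ => ENNReal.ofReal (A / ℓ) * sqn (volume.restrict (box M1 M2)) φ) t := fun t => by
    by_cases ht : t ∈ win lo hi
    · have hm : t ∈ Set.Icc (-2 : ℝ) 2 := abs_le.1 (ht.2.trans hhi)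
      rw [Set.indicator_of_mem hm]
      exact hper t ht
    · have : ∀ y1 x2, lowInner n Λ p e γ lo hi M2 φ (y1 + t) x2 y1 = 0 := fun y1 x2 =>
        lowInner_eq_zero (by rwa [add_sub_cancel_left])
      simp_rw [this]
      simp
  refine (mul_le_mul_right (lintegral_mono hle) 4).trans ?_
  rw [lintegral_indicator_const measurableSet_Icc, Real.volume_Icc]
  have e4 : A / ℓ * 16 = 32 * stripConst n Γ * Λ ^ 32 / r := by
    rw [hA, show ℓ = r ^ 16 / 2 by linarith]; field_simp; ring
  rw [← e4, ENNReal.ofReal_mul (by positivity)]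
  norm_num
  rw [mul_comm (ENNReal.ofReal (A / ℓ)) 16, show (16 : ℝ≥0∞) = 4 * 4 by norm_num]
  refine le_of_eq ?_
  ring

/-- A single dyadic piece is small on functions that are constant on long cells. -/
lemma exists_step_bound (n : ℕ) (hn : 1 ≤ n) (Γ : ℝ) (hΓ : 1 / 2 < Γ) :
    ∃ C : ℝ, 0 < C ∧ ∀ p : ℝ[X], p.natDegree ≤ n → ∀ e γ Λ lo hi ℓ r M1 M2 : ℝ, ∀ k : ℕ, 0 < e → e ≤ 1 →
    1 / 2 ≤ γ → γ ≤ Γ → 1 ≤ Λ → 1 - e ^ 2 ≤ lo → lo ≤ hi → hi ≤ 2 - e ^ 2 / 2 → 1 ≤ r →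
    r ^ 16 = 2 * ℓ → M1 = k * ℓ →
    ∀ φ : ℝ × ℝ → ℂ, StronglyMeasurable φ → MemLp φ 2 (volume.restrict (box M1 M2)) →
    (∀ y, φ y = φ (cell ℓ y.1, y.2)) →
    sqn (volume.restrict (box M1 M2)) (op (volume.restrict (box M1 M2)) (fullK p e γ lo hi) φ)
      ≤ ENNReal.ofReal (C * (Λ ^ 32 / r + √Λ ^ (-(1 / (32 * n) : ℝ))))
        * sqn (volume.restrict (box M1 M2)) φ := by
  obtain ⟨C, hC, h⟩ := exists_tail_bound n hn Γ hΓ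
  have hsC := stripConst_pos n (show 0 ≤ Γ by linarith)
  refine ⟨64 * stripConst n Γ + 2 * C, by positivity, ?_⟩
  intro p hp e γ Λ lo hi ℓ r M1 M2 k he he1 hγ hγΓ hΛ hlo hlohi hhi hr hℓ hM φ hφ hφL hφc
  have he2 : e ^ 2 ≤ 1 := pow_le_one₀ he.le he1
  have hγa : |γ| = γ := abs_of_pos (by linarith)
  have h1 := h p hp e γ Λ lo hi M1 M2 he he1 hγ hγΓ hΛ hlo hlohi hhi φ hφL
  have hhi2 : hi ≤ 2 := by linarith [sq_nonneg e]
  have h2 := sqn_op_lowK_step_le (Γ := Γ) hp he he1 hΛ (by rwa [hγa]) (by rwa [hγa]) hlo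
    hhi2 hr hℓ hM hφ hφL hφc
  have hlo0 : 0 ≤ lo := by linarith
  rw [fullK_eq_add (n := n) (Λ := Λ) hlo0]
  refine (sqn_op_add_le (measurableSet_box M1 M2) measurable_lowK measurable_tailK
    (bddOn_lowK M1 M2) (bddOn_tailK he he1 hΛ hlo M1 M2) hφL).trans ?_
  refine (add_le_add (mul_le_mul_right h2 _) (mul_le_mul_right h1 _)).trans ?_
  have hr0 : 0 < r := by linarith
  rw [← mul_assoc, ← mul_assoc, ← add_mul, ← ENNReal.ofReal_ofNat, ← ENNReal.ofReal_mul (by norm_num),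
    ← ENNReal.ofReal_mul (by norm_num), ← ENNReal.ofReal_add (by positivity) (by positivity)]
  refine mul_le_mul_left (ENNReal.ofReal_le_ofReal ?_) _
  have hη : 0 ≤ √Λ ^ (-(1 / (32 * n) : ℝ)) := by positivity
  have hA : 0 ≤ stripConst n Γ * √Λ ^ (-(1 / (32 * n) : ℝ)) := by positivity
  have hB : 0 ≤ C * (Λ ^ 32 / r) := by positivity
  have e2 : 32 * stripConst n Γ * Λ ^ 32 / r = 32 * stripConst n Γ * (Λ ^ 32 / r) := by ring
  rw [e2]
  linarith

end StepFunctions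

section Transport

variable {X Y : Type*} [MeasurableSpace X] [MeasurableSpace Y] {μ : Measure X} {ν : Measure Y}
  {d : Y ≃ᵐ X} {c : ℝ}

lemma sqn_comp_equiv (h : ν.map d = ENNReal.ofReal c • μ) (g : X → ℂ) :
    sqn ν (fun y => g (d y)) = ENNReal.ofReal c * sqn μ g := by
  unfold sqn
  rw [← lintegral_map_equiv (fun x => ‖g x‖ₑ ^ 2) d, h, lintegral_smul_measure, smul_eq_mul]

lemma op_comp_equiv (hc : 0 < c) (h : ν.map d = ENNReal.ofReal c • μ) {K : X → X → ℂ}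
    {K' : Y → Y → ℂ} (hK : ∀ x y, K (d x) (d y) = c * K' x y) (f : X → ℂ) (x : Y) :
    op ν K' (fun y => f (d y)) x = op μ K f (d x) := by
  unfold op
  have hc' : (c : ℂ) ≠ 0 := by exact_mod_cast hc.ne'
  have h1 : ∫ y, K (d x) (d y) * f (d y) ∂ν = c * ∫ y, K (d x) y * f y ∂μ := by
    rw [← integral_map_equiv d (fun y => K (d x) y * f y), h, integral_smul_measure,
      ENNReal.toReal_ofReal hc.le, Complex.real_smul]
  have h2 : ∫ y, K (d x) (d y) * f (d y) ∂ν = c * ∫ y, K' x y * f (d y) ∂ν := by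
    rw [← integral_const_mul]
    simp_rw [hK, mul_assoc]
  exact mul_left_cancel₀ hc' (h2.symm.trans h1)

lemma memLp_comp_equiv (h : ν.map d = ENNReal.ofReal c • μ) {f : X → ℂ} (hf : MemLp f 2 μ) :
    MemLp (fun y => f (d y)) 2 ν := by
  have h1 : MemLp f 2 (ν.map d) := h ▸ hf.smul_measure ENNReal.ofReal_ne_top
  exact h1.comp_of_map d.measurable.aemeasurable

lemma sqn_le_of_comp_equiv (hc : 0 < c) (h : ν.map d = ENNReal.ofReal c • μ) {A : ℝ≥0∞} {f g : X → ℂ}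
    (hfg : sqn ν (fun y => f (d y)) ≤ A * sqn ν (fun y => g (d y))) : sqn μ f ≤ A * sqn μ g := by
  rw [sqn_comp_equiv h, sqn_comp_equiv h, mul_left_comm] at hfg
  exact (ENNReal.mul_le_mul_iff_right (ENNReal.ofReal_pos.2 hc).ne' ENNReal.ofReal_ne_top).1 hfg

end Transport

section Dilation

variable {n : ℕ} {p : ℝ[X]} {γ lo hi ℓ M1 M2 H Γ : ℝ}

/-- The parabolic dilation `(x₁, x₂) ↦ (H x₁, H^{-1/2} x₂)`. -/
def dil (H : ℝ) (hH : 0 < H) : (ℝ × ℝ) ≃ᵐ (ℝ × ℝ) :=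
  (MeasurableEquiv.mulLeft₀ H hH.ne').prodCongr
    (MeasurableEquiv.mulLeft₀ (√H)⁻¹ (inv_pos.2 (Real.sqrt_pos.2 hH)).ne')

lemma dil_apply (hH : 0 < H) (x : ℝ × ℝ) : dil H hH x = (H * x.1, (√H)⁻¹ * x.2) := rfl

lemma map_dil (hH : 0 < H) :
    (volume.restrict (box (M1 / H) (√H * M2))).map (dil H hH)
      = ENNReal.ofReal (√H)⁻¹ • volume.restrict (box M1 M2) := by
  have hs : 0 < √H := Real.sqrt_pos.2 hH
  have hpre : dil H hH ⁻¹' box M1 M2 = box (M1 / H) (√H * M2) := by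
    ext x
    simp only [box, Set.mem_preimage, dil_apply, Set.mem_prod, Set.mem_Ico, Set.mem_Icc]
    rw [← neg_div, div_le_iff₀' hH, lt_div_iff₀' hH, inv_mul_le_iff₀ hs, le_inv_mul_iff₀ hs, mul_neg]
  rw [← hpre, ← Measure.restrict_map (dil H hH).measurable (measurableSet_box M1 M2),
    ← Measure.restrict_smul]
  congr 1
  have h1 : Measure.map (dil H hH) volume
      = (Measure.map (fun t : ℝ => H * t) volume).prod (Measure.map (fun t : ℝ => (√H)⁻¹ * t) volume) := by
    rw [Measure.map_prod_map _ _ (by fun_prop) (by fun_prop)]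
    rfl
  rw [h1, Real.map_volume_mul_left hH.ne', Real.map_volume_mul_left (inv_pos.2 hs).ne',
    Measure.prod_smul_left, Measure.prod_smul_right, smul_smul, ← Measure.volume_eq_prod,
    ← ENNReal.ofReal_mul (abs_nonneg _), inv_inv, abs_of_pos hs, abs_of_pos (inv_pos.2 hH)]
  congr 2
  field_simp
  rw [Real.sq_sqrt hH.le]

/-- The polynomial `H^{-1/2} p(H s)`. -/
def dilPoly (H : ℝ) (p : ℝ[X]) : ℝ[X] := C (√H)⁻¹ * p.comp (C H * Polynomial.X)

lemma natDegree_dilPoly_le (hp : p.natDegree ≤ n) : (dilPoly H p).natDegree ≤ n := by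
  refine (natDegree_C_mul_le _ _).trans (natDegree_comp_le.trans ?_)
  calc p.natDegree * (C H * Polynomial.X).natDegree ≤ p.natDegree * 1 :=
        Nat.mul_le_mul_left _ (((natDegree_C_mul_le _ _).trans natDegree_X_le))
    _ ≤ n := by rwa [mul_one]

lemma dd_zero_dilPoly (s : ℝ) : dd (dilPoly H p) 0 s = (√H)⁻¹ * dd p 0 (H * s) := by
  simp [dd_zero, dilPoly]

lemma dd_one_dilPoly (hH : 0 < H) (s : ℝ) : dd (dilPoly H p) 1 s = √H * dd p 1 (H * s) := by
  have hs : 0 < √H := Real.sqrt_pos.2 hH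
  simp only [dd_one, dilPoly, derivative_mul, derivative_C, zero_mul, zero_add, derivative_comp,
    derivative_X, mul_one, eval_mul, eval_C, eval_comp, eval_X]
  rw [← mul_assoc]
  congr 1
  rw [inv_mul_eq_div, Real.div_sqrt]

lemma bet_dil (hH : 0 < H) (t : ℝ) : bet 1 (H * t) = H * bet H⁻¹ t := by
  unfold bet
  rw [← Real.sqrt_sq hH.le, ← Real.sqrt_mul (sq_nonneg H), Real.sqrt_sq hH.le]
  congr 1
  field_simp

lemma fullK_dil (hH : 0 < H) (x y : ℝ × ℝ) : fullK p 1 γ lo hi (dil H hH x) (dil H hH y)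
      = ((√H)⁻¹ : ℝ) * fullK (dilPoly H p) H⁻¹ γ (lo / H) (hi / H) x y := by
  have hs : 0 < √H := Real.sqrt_pos.2 hH
  have hss : √H * √H = H := Real.mul_self_sqrt hH.le
  have hwin : H * x.1 - H * y.1 ∈ win lo hi ↔ x.1 - y.1 ∈ win (lo / H) (hi / H) := by
    rw [mem_win, mem_win, ← mul_sub, abs_mul, abs_of_pos hH, Set.mem_Ioc, Set.mem_Ioc,
      div_lt_iff₀' hH, le_div_iff₀' hH]
  unfold fullK
  simp only [dil_apply]
  by_cases h : x.1 - y.1 ∈ win (lo / H) (hi / H)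
  · rw [Set.indicator_of_mem h, Set.indicator_of_mem (hwin.2 h)]
    unfold coreK
    simp only
    rw [← mul_add, ← mul_sub, ← mul_sub, ← mul_add, bet_dil hH, dd_zero_dilPoly, dd_one_dilPoly hH,
      mul_left_comm (((√H)⁻¹ : ℝ) : ℂ), ← Complex.ofReal_mul]
    congr 3
    · congr 3
      field_simp
      linear_combination (-((x.2 - y.2) * (x.1 + y.1) * (x.2 + y.2))) * hss
    · have e1 : (√H)⁻¹ * (x.2 + y.2) + dd p 1 (H * (x.1 + y.1))
          = (√H)⁻¹ * (x.2 + y.2 + √H * dd p 1 (H * (x.1 + y.1))) := by field_simp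
      rw [e1, abs_mul, abs_of_pos (inv_pos.2 hs)]
      have e2 : ∀ b w u : ℝ, H * b * ((√H)⁻¹ * w) * ((√H)⁻¹ * u) = b * w * u := fun b w u => by
        field_simp
        rw [sq, hss]
        ring
      have e3 : ∀ b u : ℝ, H * b * ((√H)⁻¹ * u) = √H * (b * u) := fun b u => by
        field_simp
        rw [sq, hss]
        ring
      rw [e2, e3, div_mul_eq_div_div_swap, div_eq_inv_mul]
  · rw [Set.indicator_of_notMem h, Set.indicator_of_notMem (fun h' => h (hwin.1 h')), mul_zero]

lemma cell_dil (hH : 0 < H) (y : ℝ) : cell (ℓ * H) (H * y) = H * cell ℓ y := by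
  unfold cell
  rw [mul_comm ℓ H, mul_div_mul_left _ _ hH.ne', mul_assoc]

end Dilation

section Composition

variable {X : Type*} [MeasurableSpace X] {μ : Measure X} {D : Set X}

lemma sqn_ne_top {f : X → ℂ} (hf : MemLp f 2 μ) : sqn μ f ≠ ⊤ := by
  rw [sqn_eq]
  exact ENNReal.pow_ne_top hf.2.ne

lemma memLp_of_sqn_ne_top {f : X → ℂ} (hf : AEStronglyMeasurable f μ) (h : sqn μ f ≠ ⊤) :
    MemLp f 2 μ := by
  refine ⟨hf, lt_top_iff_ne_top.2 fun h1 => h ?_⟩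
  rw [sqn_eq, h1]
  rfl

lemma sqn_op_op_le [IsFiniteMeasure (μ.restrict D)] (hD : MeasurableSet D) {K1 K2 : X → X → ℂ}
    (hK1 : Measurable (Function.uncurry K1)) (hK2 : Measurable (Function.uncurry K2))
    (hb1 : BddOn D K1) {A δ : ℝ≥0∞} (hA : A ≠ ⊤) (hδ : δ ≤ A) {f φ : X → ℂ}
    (hf : MemLp f 2 (μ.restrict D)) (hφ : StronglyMeasurable φ)
    (h1 : ∀ g, MemLp g 2 (μ.restrict D) →
      sqn (μ.restrict D) (op (μ.restrict D) K1 g) ≤ A * sqn (μ.restrict D) g)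
    (h2 : sqn (μ.restrict D) (op (μ.restrict D) K2 f) ≤ A * sqn (μ.restrict D) f)
    (h3 : sqn (μ.restrict D) (fun x => op (μ.restrict D) K2 f x - φ x) ≤ δ * sqn (μ.restrict D) f)
    (h4 : MemLp φ 2 (μ.restrict D) →
      sqn (μ.restrict D) (op (μ.restrict D) K1 φ) ≤ δ * sqn (μ.restrict D) φ) :
    sqn (μ.restrict D) (op (μ.restrict D) K1 (op (μ.restrict D) K2 f))
      ≤ 10 * (A * δ) * sqn (μ.restrict D) f := by
  have hff := sqn_ne_top hf
  have hδt : δ ≠ ⊤ := ne_top_of_le_ne_top hA hδ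
  have hgm := op_stronglyMeasurable hK2 hf.1
  set g := op (μ.restrict D) K2 f with hg
  have hgφ : MemLp (fun x => g x - φ x) 2 (μ.restrict D) :=
    memLp_of_sqn_ne_top (hgm.sub hφ).aestronglyMeasurable
      (ne_top_of_le_ne_top (ENNReal.mul_ne_top hδt hff) h3)
  have hgL : MemLp g 2 (μ.restrict D) := memLp_of_sqn_ne_top hgm.aestronglyMeasurable
      (ne_top_of_le_ne_top (ENNReal.mul_ne_top hA hff) h2)
  have hφL : MemLp φ 2 (μ.restrict D) := by
    have := hgL.sub hgφ
    refine this.congr_norm hφ.aestronglyMeasurable (.of_forall fun x => ?_)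
    simp
  have hsplit : ∀ x ∈ D, op (μ.restrict D) K1 g x
      = op (μ.restrict D) K1 φ x + op (μ.restrict D) K1 (fun x => g x - φ x) x := fun x hx => by
    unfold op
    rw [← integral_add (integrable_kernel_mul_of_bddOn hD hK1 hb1 hφL hx)
      (integrable_kernel_mul_of_bddOn hD hK1 hb1 hgφ hx)]
    refine integral_congr_ae (.of_forall fun y => ?_)
    simp only
    ring
  have hφs : sqn (μ.restrict D) φ ≤ 4 * A * sqn (μ.restrict D) f := by
    have e : sqn (μ.restrict D) φ = sqn (μ.restrict D) fun x => g x + (-(g x - φ x)) := by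
      congr 1
      funext x
      ring
    have e2 : sqn (μ.restrict D) (fun x => -(g x - φ x)) = sqn (μ.restrict D) fun x => g x - φ x := by
      unfold sqn
      simp_rw [enorm_neg]
    rw [e]
    refine (sqn_add_le hgm.aestronglyMeasurable).trans ?_
    rw [e2]
    calc _ ≤ 2 * (A * sqn (μ.restrict D) f) + 2 * (A * sqn (μ.restrict D) f) := by
          gcongr
          exact h3.trans (by gcongr)
      _ = _ := by ring
  rw [sqn_restrict_congr hD hsplit]
  refine (sqn_add_le (op_stronglyMeasurable hK1 hφL.1).aestronglyMeasurable).trans ?_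
  calc _ ≤ 2 * (δ * (4 * A * sqn (μ.restrict D) f)) + 2 * (A * (δ * sqn (μ.restrict D) f)) := by
        gcongr
        · exact (h4 hφL).trans (by gcongr)
        · exact (h1 _ hgφ).trans (by gcongr)
    _ = _ := by ring

end Composition

section Pieces

variable {n : ℕ} {p : ℝ[X]} {γ Γ R : ℝ}

/-- The endpoints `2^k - 2^{-k}` of the dyadic windows, truncated at `R`. -/
def dyad (R : ℝ) (k : ℕ) : ℝ := min (2 ^ k - (2 ^ k)⁻¹) R

lemma monotone_dyad (R : ℝ) : Monotone (dyad R) := by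
  intro j k h
  have h1 : (2 : ℝ) ^ j ≤ 2 ^ k := pow_le_pow_right₀ one_le_two h
  exact min_le_min (sub_le_sub h1 (inv_anti₀ (by positivity) h1)) le_rfl

/-- The piece of the kernel on the `k`-th dyadic window. -/
def pieceK (p : ℝ[X]) (γ R : ℝ) (k : ℕ) : ℝ × ℝ → ℝ × ℝ → ℂ :=
  fullK p 1 γ (dyad R k) (dyad R (k + 1))

lemma dyad_div (k : ℕ) (hk : (2 : ℝ) ^ k - (2 ^ k)⁻¹ ≤ R) :
    1 - ((2 : ℝ) ^ k)⁻¹ ^ 2 ≤ dyad R k / 2 ^ k ∧ dyad R k / 2 ^ k ≤ dyad R (k + 1) / 2 ^ k ∧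
    dyad R (k + 1) / 2 ^ k ≤ 2 - ((2 : ℝ) ^ k)⁻¹ ^ 2 / 2 := by
  have hH : (0 : ℝ) < 2 ^ k := by positivity
  refine ⟨?_, ?_, ?_⟩
  · unfold dyad
    rw [min_eq_left hk, le_div_iff₀ hH]
    refine le_of_eq ?_
    field_simp
  · have := monotone_dyad R (Nat.le_succ k)
    gcongr
  · rw [div_le_iff₀ hH]
    refine (min_le_left _ _).trans (le_of_eq ?_)
    rw [pow_succ]
    field_simp

lemma inv_two_pow_le_one (k : ℕ) : ((2 : ℝ) ^ k)⁻¹ ≤ 1 := inv_le_one_of_one_le₀ (one_le_pow₀ one_le_two)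

lemma exists_piece_bound (n : ℕ) (hn : 1 ≤ n) (Γ : ℝ) (hΓ : 1 / 2 < Γ) :
    ∃ C : ℝ, 0 < C ∧ ∀ p : ℝ[X], p.natDegree ≤ n → ∀ γ R M1 M2 : ℝ, ∀ k : ℕ,
    1 / 2 ≤ γ → γ ≤ Γ → (2 : ℝ) ^ k - (2 ^ k)⁻¹ ≤ R →
    ∀ f : ℝ × ℝ → ℂ, MemLp f 2 (volume.restrict (box M1 M2)) →
    sqn (volume.restrict (box M1 M2)) (op (volume.restrict (box M1 M2)) (pieceK p γ R k) f)
      ≤ ENNReal.ofReal C * sqn (volume.restrict (box M1 M2)) f := by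
  obtain ⟨C, hC, h⟩ := exists_full_bound n hn Γ hΓ
  refine ⟨C, hC, fun p hp γ R M1 M2 k hγ hγΓ hk f hf => ?_⟩
  have hH : (0 : ℝ) < 2 ^ k := by positivity
  obtain ⟨h1, h2, h3⟩ := dyad_div k hk
  have hmap := map_dil (M1 := M1) (M2 := M2) hH
  have hc : 0 < (√(2 ^ k))⁻¹ := inv_pos.2 (Real.sqrt_pos.2 hH)
  refine sqn_le_of_comp_equiv hc hmap ?_
  simp_rw [← op_comp_equiv hc hmap (K := pieceK p γ R k) (fullK_dil hH) f]
  exact h _ (natDegree_dilPoly_le hp) _ _ _ _ _ _ (inv_pos.2 hH) (inv_two_pow_le_one k) hγ hγΓ h1 h2 h3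
    _ (memLp_comp_equiv hmap hf)

lemma exists_piece_step_bound (n : ℕ) (hn : 1 ≤ n) (Γ : ℝ) (hΓ : 1 / 2 < Γ) :
    ∃ C : ℝ, 0 < C ∧ ∀ p : ℝ[X], p.natDegree ≤ n → ∀ γ R Λ ℓ r M1 M2 : ℝ, ∀ k N : ℕ,
    1 / 2 ≤ γ → γ ≤ Γ → (2 : ℝ) ^ k - (2 ^ k)⁻¹ ≤ R → 1 ≤ Λ → 1 ≤ r → r ^ 16 = 2 * ℓ →
    M1 = N * (ℓ * 2 ^ k) → ∀ φ : ℝ × ℝ → ℂ, StronglyMeasurable φ →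
    MemLp φ 2 (volume.restrict (box M1 M2)) → (∀ y, φ y = φ (cell (ℓ * 2 ^ k) y.1, y.2)) →
    sqn (volume.restrict (box M1 M2)) (op (volume.restrict (box M1 M2)) (pieceK p γ R k) φ)
      ≤ ENNReal.ofReal (C * (Λ ^ 32 / r + √Λ ^ (-(1 / (32 * n) : ℝ))))
        * sqn (volume.restrict (box M1 M2)) φ := by
  obtain ⟨C, hC, h⟩ := exists_step_bound n hn Γ hΓ
  refine ⟨C, hC, fun p hp γ R Λ ℓ r M1 M2 k N hγ hγΓ hk hΛ hr hℓ hM φ hφ hφL hφc => ?_⟩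
  have hH : (0 : ℝ) < 2 ^ k := by positivity
  obtain ⟨h1, h2, h3⟩ := dyad_div k hk
  have hmap := map_dil (M1 := M1) (M2 := M2) hH
  have hc : 0 < (√(2 ^ k))⁻¹ := inv_pos.2 (Real.sqrt_pos.2 hH)
  refine sqn_le_of_comp_equiv hc hmap ?_
  simp_rw [← op_comp_equiv hc hmap (K := pieceK p γ R k) (fullK_dil hH) φ]
  refine h _ (natDegree_dilPoly_le hp) _ _ _ _ _ ℓ r _ _ N (inv_pos.2 hH) (inv_two_pow_le_one k) hγ hγΓ
    hΛ h1 h2 h3 hr hℓ ?_ _ (hφ.comp_measurable (dil _ hH).measurable) (memLp_comp_equiv hmap hφL)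
    fun y => ?_
  · rw [hM]
    field_simp
  · rw [hφc, dil_apply, dil_apply]
    simp only
    rw [cell_dil hH]

lemma exists_piece_sample_bound (n : ℕ) (hn : 1 ≤ n) (Γ : ℝ) (hΓ : 1 / 2 < Γ) :
    ∃ C : ℝ, 0 < C ∧ ∀ p : ℝ[X], p.natDegree ≤ n → ∀ γ R Λ ℓ M1 M2 : ℝ, ∀ k : ℕ,
    1 / 2 ≤ γ → γ ≤ Γ → (2 : ℝ) ^ k - (2 ^ k)⁻¹ ≤ R → 1 ≤ Λ → 0 < ℓ → ℓ ≤ 1 →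
    ∀ f : ℝ × ℝ → ℂ, MemLp f 2 (volume.restrict (box M1 M2)) →
    ∃ φ : ℝ × ℝ → ℂ, StronglyMeasurable φ ∧ (∀ y, φ y = φ (cell (ℓ * 2 ^ k) y.1, y.2)) ∧
    sqn (volume.restrict (box M1 M2))
      (fun x => op (volume.restrict (box M1 M2)) (pieceK p γ R k) f x - φ x)
      ≤ ENNReal.ofReal (C * (Λ ^ 32 * ℓ ^ 2 + √Λ ^ (-(1 / (32 * n) : ℝ))))
        * sqn (volume.restrict (box M1 M2)) f := by
  obtain ⟨C, hC, h⟩ := exists_sample_bound n hn Γ hΓ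
  refine ⟨C, hC, fun p hp γ R Λ ℓ M1 M2 k hγ hγΓ hk hΛ hℓ hℓ1 f hf => ?_⟩
  have hH : (0 : ℝ) < 2 ^ k := by positivity
  obtain ⟨h1, h2, h3⟩ := dyad_div k hk
  have hmap := map_dil (M1 := M1) (M2 := M2) hH
  have hc : 0 < (√(2 ^ k))⁻¹ := inv_pos.2 (Real.sqrt_pos.2 hH)
  have hfL := memLp_comp_equiv hmap hf
  set φ := sample n Λ (dilPoly (2 ^ k) p) (2 ^ k)⁻¹ γ (dyad R k / 2 ^ k) (dyad R (k + 1) / 2 ^ k) ℓ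
    (M1 / 2 ^ k) (√(2 ^ k) * M2) (fun y => f (dil (2 ^ k) hH y)) with hφ
  have hφm : StronglyMeasurable φ := stronglyMeasurable_sample hfL
  refine ⟨fun x => φ ((dil (2 ^ k) hH).symm x),
    hφm.comp_measurable (dil (2 ^ k) hH).symm.measurable, fun y => ?_, ?_⟩
  · obtain ⟨z, rfl⟩ := (dil (2 ^ k) hH).surjective y
    have e : (cell (ℓ * 2 ^ k) ((dil (2 ^ k) hH) z).1, ((dil (2 ^ k) hH) z).2)
        = dil (2 ^ k) hH (cell ℓ z.1, z.2) := by
      rw [dil_apply, dil_apply]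
      simp only
      rw [cell_dil hH]
    simp only
    rw [e, MeasurableEquiv.symm_apply_apply, MeasurableEquiv.symm_apply_apply, hφ]
    unfold sample
    simp only
    rw [cell_cell hℓ]
  · refine sqn_le_of_comp_equiv hc hmap ?_
    simp_rw [MeasurableEquiv.symm_apply_apply, ← op_comp_equiv hc hmap (K := pieceK p γ R k) (fullK_dil hH) f]
    exact h _ (natDegree_dilPoly_le hp) _ _ _ _ _ ℓ _ _ (inv_pos.2 hH) (inv_two_pow_le_one k) hγ hγΓ
      hΛ h1 h2 h3 hℓ hℓ1 _ hfL

/-- The decay rate of the products of dyadic pieces. -/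
def rate (n : ℕ) : ℝ := 2 ^ (-(1 / (131072 * n)) : ℝ)

lemma rate_pos (n : ℕ) : 0 < rate n := by unfold rate; positivity

lemma rate_lt_one (hn : 1 ≤ n) : rate n < 1 := by
  have h : (0 : ℝ) < n := by exact_mod_cast hn
  refine Real.rpow_lt_one_of_one_lt_of_neg one_lt_two ?_
  have : 0 < 1 / (131072 * (n : ℝ)) := by positivity
  linarith

lemma rate_pow (n m : ℕ) : rate n ^ m = 2 ^ (-(1 / (131072 * n) * m) : ℝ) := by
  rw [rate, ← Real.rpow_natCast, ← Real.rpow_mul zero_le_two, neg_mul]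

lemma exists_exponents (hn : 1 ≤ n) (m : ℕ) : ∃ Λ r : ℝ, 1 ≤ Λ ∧ 1 ≤ r ∧ r ^ 16 = 2 * 2 ^ (m / 2) ∧
    Λ ^ 32 / r ≤ rate n ^ m ∧ Λ ^ 32 * ((2 ^ (m - m / 2))⁻¹) ^ 2 ≤ rate n ^ m ∧
    √Λ ^ (-(1 / (32 * n) : ℝ)) ≤ rate n ^ m := by
  have hn1 : (1 : ℝ) ≤ n := by exact_mod_cast hn
  have hη : 1 / (131072 * (n : ℝ)) ≤ 1 / 64 := by
    refine one_div_le_one_div_of_le (by norm_num) ?_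
    linarith
  have hm0 : (0 : ℝ) ≤ m := Nat.cast_nonneg m
  have hηm : 1 / (131072 * (n : ℝ)) * m ≤ 1 / 64 * m := mul_le_mul_of_nonneg_right hη hm0
  have hΛ : ((2 : ℝ) ^ ((m : ℝ) / 2048)) ^ 32 = 2 ^ ((m : ℝ) / 64) := by
    rw [← Real.rpow_natCast, ← Real.rpow_mul zero_le_two]
    congr 1
    push_cast
    ring
  have ha : (m : ℝ) / 2 ≤ ((m / 2 : ℕ) : ℝ) + 1 := by
    have : m ≤ 2 * (m / 2) + 1 := by omega
    have : (m : ℝ) ≤ 2 * ((m / 2 : ℕ) : ℝ) + 1 := by exact_mod_cast this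
    linarith
  have hb : (m : ℝ) / 2 ≤ ((m - m / 2 : ℕ) : ℝ) := by
    have : m ≤ 2 * (m - m / 2) := by omega
    have : (m : ℝ) ≤ 2 * ((m - m / 2 : ℕ) : ℝ) := by exact_mod_cast this
    linarith
  refine ⟨2 ^ ((m : ℝ) / 2048), 2 ^ ((((m / 2 : ℕ) : ℝ) + 1) / 16),
    Real.one_le_rpow one_le_two (by positivity), Real.one_le_rpow one_le_two (by positivity), ?_, ?_, ?_, ?_⟩
  · rw [← Real.rpow_natCast, ← Real.rpow_mul zero_le_two, ← pow_succ', ← Real.rpow_natCast 2]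
    congr 1
    push_cast
    ring
  · rw [hΛ, rate_pow, ← Real.rpow_sub zero_lt_two]
    refine Real.rpow_le_rpow_of_exponent_le one_le_two ?_
    linarith
  · rw [hΛ, rate_pow, ← Real.rpow_natCast 2 (m - m / 2), ← Real.rpow_neg zero_le_two, ← Real.rpow_natCast,
      ← Real.rpow_mul zero_le_two, ← Real.rpow_add zero_lt_two]
    refine Real.rpow_le_rpow_of_exponent_le one_le_two ?_
    push_cast
    linarith
  · rw [rate_pow, Real.sqrt_eq_rpow, ← Real.rpow_mul zero_le_two, ← Real.rpow_mul zero_le_two]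
    refine le_of_eq ?_
    congr 1
    field_simp
    ring

/-- Almost orthogonality of the dyadic pieces. -/
lemma exists_piece_comp_bound (n : ℕ) (hn : 1 ≤ n) (Γ : ℝ) (hΓ : 1 / 2 < Γ) :
    ∃ C : ℝ, 0 < C ∧ ∀ p : ℝ[X], p.natDegree ≤ n → ∀ γ R M2 : ℝ, ∀ j m K N : ℕ,
    1 / 2 ≤ γ → γ ≤ Γ → (2 : ℝ) ^ (j + m) - (2 ^ (j + m))⁻¹ ≤ R → j + m ≤ K →
    ∀ f : ℝ × ℝ → ℂ, MemLp f 2 (volume.restrict (box (N * 2 ^ K) M2)) →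
    sqn (volume.restrict (box (N * 2 ^ K) M2)) (op (volume.restrict (box (N * 2 ^ K) M2)) (pieceK p γ R j)
      (op (volume.restrict (box (N * 2 ^ K) M2)) (pieceK p γ R (j + m)) f))
      ≤ ENNReal.ofReal (C * rate n ^ m) * sqn (volume.restrict (box (N * 2 ^ K) M2)) f := by
  obtain ⟨C1, hC1, ha⟩ := exists_piece_bound n hn Γ hΓ
  obtain ⟨C2, hC2, hb⟩ := exists_piece_step_bound n hn Γ hΓ
  obtain ⟨C3, hC3, hc⟩ := exists_piece_sample_bound n hn Γ hΓ
  set B := C1 + 2 * C2 + 2 * C3 with hB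
  have hB0 : 0 < B := by positivity
  refine ⟨10 * (B * B), by positivity, fun p hp γ R M2 j m K N hγ hγΓ hR hK f hf => ?_⟩
  obtain ⟨Λ, r, hΛ, hr, hr16, e1, e2, e3⟩ := exists_exponents hn m
  have hq0 : 0 < rate n ^ m := pow_pos (rate_pos n) m
  have hq1 : rate n ^ m ≤ 1 := pow_le_one₀ (rate_pos n).le (rate_lt_one hn).le
  have hRj : (2 : ℝ) ^ j - (2 ^ j)⁻¹ ≤ R := by
    have h1 : (2 : ℝ) ^ j ≤ 2 ^ (j + m) := pow_le_pow_right₀ one_le_two (Nat.le_add_right j m)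
    have h2 : ((2 : ℝ) ^ (j + m))⁻¹ ≤ (2 ^ j)⁻¹ := inv_anti₀ (by positivity) h1
    linarith
  obtain ⟨φ, hφm, hφc, hφ⟩ := hc p hp γ R Λ (2 ^ (m - m / 2))⁻¹ (N * 2 ^ K) M2 (j + m) hγ hγΓ hR hΛ
    (by positivity) (inv_two_pow_le_one _) f hf
  have hcell : ((2 : ℝ) ^ (m - m / 2))⁻¹ * 2 ^ (j + m) = 2 ^ (m / 2) * 2 ^ j := by
    rw [inv_mul_eq_iff_eq_mul₀ (by positivity), ← pow_add, ← pow_add]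
    congr 1
    omega
  have key := sqn_op_op_le (μ := volume) (A := ENNReal.ofReal B) (δ := ENNReal.ofReal (B * rate n ^ m))
    (measurableSet_box (N * 2 ^ K) M2) (K1 := pieceK p γ R j) (K2 := pieceK p γ R (j + m))
    measurable_fullK measurable_fullK (bddOn_fullK _ _) ENNReal.ofReal_ne_top
    (ENNReal.ofReal_le_ofReal (mul_le_of_le_one_right hB0.le hq1)) hf hφm
    (fun g hg => (ha p hp γ R _ M2 j hγ hγΓ hRj g hg).trans ?_)
    ((ha p hp γ R _ M2 (j + m) hγ hγΓ hR f hf).trans ?_) (hφ.trans ?_)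
    (fun hφL => (hb p hp γ R Λ (2 ^ (m / 2)) r _ M2 j (N * 2 ^ (K - (j + m / 2))) hγ hγΓ hRj hΛ hr hr16 ?_ φ
      hφm hφL (fun y => by rw [← hcell]; exact hφc y)).trans ?_)
  · refine key.trans (le_of_eq ?_)
    rw [← ENNReal.ofReal_mul hB0.le, ← ENNReal.ofReal_ofNat, ← ENNReal.ofReal_mul (by norm_num)]
    congr 2
    ring
  · exact mul_le_mul_left (ENNReal.ofReal_le_ofReal (by linarith)) _
  · exact mul_le_mul_left (ENNReal.ofReal_le_ofReal (by linarith)) _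
  · refine mul_le_mul_left (ENNReal.ofReal_le_ofReal ?_) _
    calc _ ≤ C3 * (rate n ^ m + rate n ^ m) := by gcongr
      _ = 2 * C3 * rate n ^ m := by ring
      _ ≤ _ := by gcongr; linarith
  · push_cast
    rw [mul_assoc, ← pow_add, ← pow_add]
    congr 2
    omega
  · refine mul_le_mul_left (ENNReal.ofReal_le_ofReal ?_) _
    calc _ ≤ C2 * (rate n ^ m + rate n ^ m) := by gcongr
      _ = 2 * C2 * rate n ^ m := by ring
      _ ≤ _ := by gcongr; linarith

end Pieces

section BoundedKernel

variable {X : Type*} [MeasurableSpace X] {μ : Measure X} {D : Set X}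

lemma exists_clm_of_bddOn [IsFiniteMeasure (μ.restrict D)] (hD : MeasurableSet D) {K : X → X → ℂ}
    (hK : Measurable (Function.uncurry K)) (hb : BddOn D K) (hs : ∀ x y, conj (K y x) = K x y) :
    ∃ T : Lp ℂ 2 (μ.restrict D) →L[ℂ] Lp ℂ 2 (μ.restrict D), IsSelfAdjoint T ∧
      ∀ f : Lp ℂ 2 (μ.restrict D), (T f : X → ℂ) =ᵐ[μ.restrict D] op (μ.restrict D) K f := by
  obtain ⟨C, hC0, hC⟩ := hb
  have hm : Measurable (Function.uncurry fun x y => (D ×ˢ D).indicator (Function.uncurry K) (x, y)) :=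
    show Measurable _ from hK.indicator (hD.prod hD)
  have hbd := norm_indicator_prod_le hC0 hC
  obtain ⟨T, hT⟩ := exists_clm_of_kernel (μ := μ.restrict D) hm hbd
  refine ⟨T, HasKernel.isSelfAdjoint hT hm hbd fun x y => ?_, fun f => ?_⟩
  · by_cases h : (x, y) ∈ D ×ˢ D
    · rw [Set.indicator_of_mem h, Set.indicator_of_mem (Set.mk_mem_prod h.2 h.1)]
      exact hs x y
    · rw [Set.indicator_of_notMem h, Set.indicator_of_notMem fun h' => h (Set.mk_mem_prod h'.2 h'.1),
        map_zero]
  · filter_upwards [HasKernel.ae_eq hT f, ae_restrict_mem hD] with x hx hxD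
    rw [hx, op_restrict_congr hD _ hxD]

lemma clm_mul_norm_le_of_sqn [IsFiniteMeasure μ] {T1 T2 : Lp ℂ 2 μ →L[ℂ] Lp ℂ 2 μ} {K1 K2 : X → X → ℂ}
    (h1 : ∀ f : Lp ℂ 2 μ, (T1 f : X → ℂ) =ᵐ[μ] op μ K1 f)
    (h2 : ∀ f : Lp ℂ 2 μ, (T2 f : X → ℂ) =ᵐ[μ] op μ K2 f) {A : ℝ} (hA : 0 ≤ A)
    (h : ∀ f, MemLp f 2 μ → sqn μ (op μ K1 (op μ K2 f)) ≤ ENNReal.ofReal A ^ 2 * sqn μ f) :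
    ‖T1 * T2‖ ≤ A := by
  refine clm_norm_le_of_sqn hA fun f => ?_
  rw [mul_apply_eq_comp]
  have e : op μ K1 (T2 f) = op μ K1 (op μ K2 f) := by
    funext x
    refine integral_congr_ae ?_
    filter_upwards [h2 f] with y hy
    rw [hy]
  rw [sqn_congr (h1 (T2 f)), e]
  exact h _ (Lp.memLp f)

end BoundedKernel

lemma summable_pow_natAbs {t : ℝ} (h0 : 0 ≤ t) (h1 : t < 1) : Summable fun z : ℤ => t ^ z.natAbs := by
  have h := summable_geometric_of_lt_one h0 h1
  exact Summable.of_nat_of_neg (by simpa using h) (by simpa using h)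

lemma sum_pow_natAbs_sub_le {t : ℝ} (h0 : 0 ≤ t) (h1 : t < 1) (s : Finset ℕ) (i : ℕ) :
    ∑ j ∈ s, t ^ ((i : ℤ) - j).natAbs ≤ ∑' z : ℤ, t ^ z.natAbs := by
  have hinj : Function.Injective fun j : ℕ => (i : ℤ) - j := fun a b h => by
    simp only at h
    omega
  have h2 := Summable.sum_le_tsum (s.map ⟨_, hinj⟩) (fun z _ => pow_nonneg h0 z.natAbs)
    (summable_pow_natAbs h0 h1)
  rwa [Finset.sum_map] at h2

section Sum

variable {n : ℕ} {p : ℝ[X]} {e γ Γ R lo mid hi M1 M2 : ℝ}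

lemma fullK_add (h1 : lo ≤ mid) (h2 : mid ≤ hi) (x y : ℝ × ℝ) :
    fullK p e γ lo hi x y = fullK p e γ lo mid x y + fullK p e γ mid hi x y := by
  have hu : win lo hi = win lo mid ∪ win mid hi := by
    unfold win
    rw [← Set.preimage_union, Set.Ioc_union_Ioc_eq_Ioc h1 h2]
  have hd : Disjoint (win lo mid) (win mid hi) :=
    (Set.Ioc_disjoint_Ioc_of_le le_rfl).preimage _
  unfold fullK
  rw [hu, Set.indicator_union_of_disjoint hd]

lemma sum_op_pieceK {f : ℝ × ℝ → ℂ} (hf : MemLp f 2 (volume.restrict (box M1 M2))) {x : ℝ × ℝ}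
    (hx : x ∈ box M1 M2) (m : ℕ) :
    ∑ k ∈ Finset.range m, op (volume.restrict (box M1 M2)) (pieceK p γ R k) f x
      = op (volume.restrict (box M1 M2)) (fullK p 1 γ (dyad R 0) (dyad R m)) f x := by
  induction m with
  | zero => simp [op, fullK, win]
  | succ m ih =>
    rw [Finset.sum_range_succ, ih]
    unfold op pieceK
    rw [← integral_add
      (integrable_kernel_mul_of_bddOn (measurableSet_box M1 M2) measurable_fullK (bddOn_fullK _ _) hf hx)
      (integrable_kernel_mul_of_bddOn (measurableSet_box M1 M2) measurable_fullK (bddOn_fullK _ _) hf hx)]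
    refine integral_congr_ae (.of_forall fun y => ?_)
    simp only
    rw [fullK_add (monotone_dyad R (Nat.zero_le m)) (monotone_dyad R (Nat.le_succ m)), add_mul]

lemma exists_dyad_cover (hR : 0 < R) : ∃ m : ℕ, dyad R 0 = 0 ∧ dyad R m = R ∧
    ∀ k < m, (2 : ℝ) ^ k - (2 ^ k)⁻¹ ≤ R := by
  have hex : ∃ m : ℕ, R ≤ (2 : ℝ) ^ m - (2 ^ m)⁻¹ := by
    obtain ⟨m, hm⟩ := pow_unbounded_of_one_lt (R + 1) (one_lt_two (α := ℝ))
    exact ⟨m, by linarith [inv_two_pow_le_one m]⟩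
  classical
  refine ⟨Nat.find hex, ?_, min_eq_right (Nat.find_spec hex), fun k hk => ?_⟩
  · unfold dyad
    simpa using hR.le
  · exact (not_le.1 (Nat.find_min hex hk)).le

/-- The uniform bound for the full kernel on large boxes. -/
lemma exists_box_bound (n : ℕ) (hn : 1 ≤ n) (Γ : ℝ) (hΓ : 1 / 2 < Γ) :
    ∃ C : ℝ, 0 < C ∧ ∀ p : ℝ[X], p.natDegree ≤ n → ∀ γ R : ℝ, 1 / 2 ≤ γ → γ ≤ Γ → 0 < R →
    ∃ K : ℕ, ∀ (N : ℕ) (M2 : ℝ) (f : ℝ × ℝ → ℂ), MemLp f 2 (volume.restrict (box (N * 2 ^ K) M2)) →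
    sqn (volume.restrict (box (N * 2 ^ K) M2))
      (op (volume.restrict (box (N * 2 ^ K) M2)) (fullK p 1 γ 0 R) f)
      ≤ ENNReal.ofReal C ^ 2 * sqn (volume.restrict (box (N * 2 ^ K) M2)) f := by
  obtain ⟨A, hA, ha⟩ := exists_piece_bound n hn Γ hΓ
  obtain ⟨B, hB, hb⟩ := exists_piece_comp_bound n hn Γ hΓ
  have hq := rate_pos n
  have hq1 := rate_lt_one hn
  set t := √√(rate n) with ht
  have ht0 : 0 ≤ t := Real.sqrt_nonneg _
  have ht1 : t < 1 := by
    rw [ht, Real.sqrt_lt' one_pos, one_pow, Real.sqrt_lt' one_pos, one_pow]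
    exact hq1
  have ht4 : (t ^ 2) ^ 2 = rate n := by
    rw [ht, Real.sq_sqrt (Real.sqrt_nonneg _), Real.sq_sqrt hq.le]
  set b := √√B with hbdef
  have hb4 : (b ^ 2) ^ 2 = B := by
    rw [hbdef, Real.sq_sqrt (Real.sqrt_nonneg _), Real.sq_sqrt hB.le]
  have hb0 : 0 ≤ b := Real.sqrt_nonneg _
  set M := √A + b * ∑' z : ℤ, t ^ z.natAbs with hM
  have hS0 : 0 ≤ ∑' z : ℤ, t ^ z.natAbs := tsum_nonneg fun z => pow_nonneg ht0 _
  have hM0 : 0 < M := add_pos_of_pos_of_nonneg (Real.sqrt_pos.2 hA) (mul_nonneg hb0 hS0)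
  refine ⟨M, hM0, fun p hp γ R hγ hγΓ hR => ?_⟩
  obtain ⟨K, hd0, hdK, hcov⟩ := exists_dyad_cover hR
  refine ⟨K, fun N M2 f hf => ?_⟩
  set D := box (N * 2 ^ K) M2 with hD
  have hDm : MeasurableSet D := measurableSet_box _ _
  have hT : ∀ k : ℕ, ∃ T : Lp ℂ 2 (volume.restrict D) →L[ℂ] Lp ℂ 2 (volume.restrict D),
      IsSelfAdjoint T ∧ ∀ f : Lp ℂ 2 (volume.restrict D),
        (T f : ℝ × ℝ → ℂ) =ᵐ[volume.restrict D] op (volume.restrict D) (pieceK p γ R k) f := fun k =>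
    exists_clm_of_bddOn hDm measurable_fullK (bddOn_fullK _ _) fullK_conj
  choose T hTs hTk using hT
  have hnorm : ∀ k < K, ‖T k‖ ≤ √A := fun k hk => by
    refine clm_norm_le_of_sqn (Real.sqrt_nonneg _) fun g => ?_
    rw [sqn_congr (hTk k g), ← ENNReal.ofReal_pow (Real.sqrt_nonneg _), Real.sq_sqrt hA.le]
    exact ha p hp γ R _ M2 k hγ hγΓ (hcov k hk) _ (Lp.memLp g)
  have hprod : ∀ j m : ℕ, j + m < K → ‖T j * T (j + m)‖ ≤ (b * t ^ m) ^ 2 := fun j m hjm => by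
    refine clm_mul_norm_le_of_sqn (hTk j) (hTk (j + m)) (sq_nonneg _) fun g hg => ?_
    rw [← ENNReal.ofReal_pow (sq_nonneg _)]
    have e : ((b * t ^ m) ^ 2) ^ 2 = B * rate n ^ m := by rw [← hb4, ← ht4]; ring
    rw [e]
    exact hb p hp γ R M2 j m K N hγ hγΓ (hcov _ hjm) hjm.le g hg
  have hpair : ∀ i j : ℕ, i < K → j < K →
      ‖T i * T j‖ ≤ (b * t ^ ((i : ℤ) - j).natAbs) ^ 2 := fun i j hi hj => by
    rcases le_total i j with h | h
    · obtain ⟨m, rfl⟩ := Nat.exists_eq_add_of_le h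
      have e : ((i : ℤ) - (i + m : ℕ)).natAbs = m := by omega
      rw [e]
      exact hprod i m hj
    · obtain ⟨m, rfl⟩ := Nat.exists_eq_add_of_le h
      have e : (((j + m : ℕ) : ℤ) - j).natAbs = m := by omega
      rw [e, ← norm_star, star_mul, (hTs j).star_eq, (hTs (j + m)).star_eq]
      exact hprod j m hi
  have hCS : ‖∑ k ∈ (Finset.univ : Finset (Fin K)), T k‖ ≤ M := by
    refine cotlar_stein Finset.univ (fun k : Fin K => T k) (fun k => hTs k)
      (w := fun i j => b * t ^ ((i : ℤ) - (j : ℕ)).natAbs) (fun i j => by positivity)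
      (fun k => (hnorm k k.2).trans (le_add_of_nonneg_right (mul_nonneg hb0 hS0)))
      (fun i j => hpair i j i.2 j.2) (fun i => ?_) hM0.le
    rw [← Finset.mul_sum, Fin.sum_univ_eq_sum_range (fun j => t ^ ((i : ℤ) - (j : ℕ)).natAbs) K]
    exact (mul_le_mul_of_nonneg_left (sum_pow_natAbs_sub_le ht0 ht1 _ _) hb0).trans
      (le_add_of_nonneg_left (Real.sqrt_nonneg _))
  rw [Fin.sum_univ_eq_sum_range (fun k => T k) K] at hCS
  set g : Lp ℂ 2 (volume.restrict D) := hf.toLp f with hg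
  have hfg : (g : ℝ × ℝ → ℂ) =ᵐ[volume.restrict D] f := hf.coeFn_toLp
  have hSg : ((∑ k ∈ Finset.range K, T k) g : ℝ × ℝ → ℂ) =ᵐ[volume.restrict D]
      op (volume.restrict D) (fullK p 1 γ 0 R) f := by
    rw [_root_.sum_apply]
    have h1 : ∀ᵐ x ∂volume.restrict D, ∀ k : ℕ,
        (T k g : ℝ × ℝ → ℂ) x = op (volume.restrict D) (pieceK p γ R k) g x :=
      ae_all_iff.2 fun k => hTk k g
    filter_upwards [Lp.coeFn_finsetSum (Finset.range K) fun k => T k g, h1, ae_restrict_mem hDm]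
      with x hx1 hx2 hxD
    rw [hx1, Finset.sum_apply, Finset.sum_congr rfl fun k _ => hx2 k, sum_op_pieceK (Lp.memLp g) hxD, hd0,
      hdK]
    refine integral_congr_ae ?_
    filter_upwards [hfg] with y hy
    rw [hy]
  rw [← sqn_congr hSg, ← sqn_congr hfg, ← enorm_sq_eq_sqn, ← enorm_sq_eq_sqn, ← mul_pow]
  gcongr
  rw [← ofReal_norm, ← ofReal_norm, ← ENNReal.ofReal_mul hM0.le]
  exact ENNReal.ofReal_le_ofReal ((ContinuousLinearMap.le_opNorm _ _).trans (by gcongr))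

end Sum

section Oscillatory

variable {n : ℕ} {p : ℝ[X]} {γ Γ R : ℝ}

lemma measurable_kernel : Measurable (Function.uncurry (kernel p γ R)) := by
  have h0 := p.continuous
  have h1 := p.derivative.continuous
  have hβ : Measurable fun q : (ℝ × ℝ) × (ℝ × ℝ) => beta (q.1.1 - q.2.1) := by
    unfold beta
    exact Continuous.measurable (by fun_prop)
  have hΨ : Measurable fun q : (ℝ × ℝ) × (ℝ × ℝ) => Psi p q.1 q.2 := by
    unfold Psi
    exact Continuous.measurable (by fun_prop)
  have hw : Measurable fun q : (ℝ × ℝ) × (ℝ × ℝ) =>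
      |q.1.2 + q.2.2 + p.derivative.eval (q.1.1 + q.2.1)| := Continuous.measurable (by fun_prop)
  have hθ : Measurable fun q : (ℝ × ℝ) × (ℝ × ℝ) => theta p q.1 q.2 := by
    unfold theta
    exact (hβ.mul hw).mul (by fun_prop)
  have hI : Measurable fun q : (ℝ × ℝ) × (ℝ × ℝ) =>
      (Set.Icc (-R) R).indicator (fun _ => (1 : ℂ)) (q.1.1 - q.2.1) :=
    (measurable_const.indicator measurableSet_Icc).comp (by fun_prop)
  have hd : Measurable fun q : (ℝ × ℝ) × (ℝ × ℝ) =>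
      Real.sin (theta p q.1 q.2) / (beta (q.1.1 - q.2.1) * (q.1.2 - q.2.2)) :=
    (Real.measurable_sin.comp hθ).div (hβ.mul (by fun_prop))
  have he : Measurable fun q : (ℝ × ℝ) × (ℝ × ℝ) =>
      Complex.exp (Complex.I * ((γ * Psi p q.1 q.2 : ℝ) : ℂ)) := by fun_prop
  exact (he.mul (Complex.measurable_ofReal.comp hd)).mul hI

/-- The modulation `e^{2iγ x₁ x₂²}`. -/
def modul (γ : ℝ) (x : ℝ × ℝ) : ℂ := Complex.exp (Complex.I * ((γ * (2 * x.1 * x.2 ^ 2) : ℝ) : ℂ))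

lemma norm_modul (x : ℝ × ℝ) : ‖modul γ x‖ = 1 := by
  rw [modul, mul_comm, Complex.norm_exp_ofReal_mul_I]

lemma continuous_modul : Continuous (modul γ) := by
  unfold modul
  fun_prop

lemma kernel_eq {x y : ℝ × ℝ} (h : x.1 ≠ y.1) :
    kernel p γ R x y = modul γ x * (fullK p 1 γ 0 R x y * modul (-γ) y) := by
  have hw : x.1 - y.1 ∈ win 0 R ↔ x.1 - y.1 ∈ Set.Icc (-R) R := by
    rw [mem_win, Set.mem_Ioc, Set.mem_Icc, ← abs_le]
    exact and_iff_right (abs_pos.2 (sub_ne_zero.2 h))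
  unfold kernel fullK
  by_cases hm : x.1 - y.1 ∈ Set.Icc (-R) R
  · have hb : ∀ t, bet 1 t = beta t := fun t => by unfold bet beta; rw [one_pow]
    rw [Set.indicator_of_mem hm, Set.indicator_of_mem (hw.2 hm), mul_one]
    unfold coreK modul
    rw [hb, dd_zero, dd_one, mul_right_comm (Complex.exp _) (_ : ℂ) (Complex.exp _), ← mul_assoc,
      ← Complex.exp_add, ← Complex.exp_add]
    congr 2
    rw [← mul_add, ← mul_add, ← Complex.ofReal_add, ← Complex.ofReal_add]
    congr 2
    unfold Psi
    ring
  · rw [Set.indicator_of_notMem hm, Set.indicator_of_notMem (fun h' => hm (hw.1 h'))]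
    simp

lemma kernel_conj (x y : ℝ × ℝ) : conj (kernel p γ R x y) = kernel p (-γ) R x y := by
  unfold kernel
  rw [map_mul, map_mul, conj_exp_I_mul, Complex.conj_ofReal, neg_mul]
  congr 1
  by_cases h : x.1 - y.1 ∈ Set.Icc (-R) R
  · rw [Set.indicator_of_mem h, map_one]
  · rw [Set.indicator_of_notMem h, map_zero]

lemma oscOp_eq_of_support {D : Set (ℝ × ℝ)} {f : ℝ × ℝ → ℂ}
    (hf : ∀ y ∉ D, f y = 0) (x : ℝ × ℝ) :
    oscOp p γ R f x
      = modul γ x * op (volume.restrict D) (fullK p 1 γ 0 R) (fun y => modul (-γ) y * f y) x := by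
  have hne : ∀ᵐ y : ℝ × ℝ, x.1 ≠ y.1 := by
    have h : (volume : Measure (ℝ × ℝ)) ({x.1} ×ˢ Set.univ) = 0 := by
      rw [Measure.volume_eq_prod, Measure.prod_prod, Real.volume_singleton, zero_mul]
    refine measure_mono_null (fun y hy => ?_) h
    simp only [Set.mem_compl_iff, Set.mem_ofPred_eq, not_not] at hy
    exact ⟨hy.symm, trivial⟩
  unfold oscOp op
  rw [setIntegral_eq_integral_of_forall_compl_eq_zero (fun y hy => by simp only [hf y hy, mul_zero]),
    ← integral_const_mul]
  refine integral_congr_ae ?_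
  filter_upwards [hne] with y hy
  rw [kernel_eq hy]
  ring

lemma exists_box_support {f : ℝ × ℝ → ℂ} (hs : HasCompactSupport f) (K : ℕ) : ∃ N0 : ℕ, ∀ N : ℕ,
    N0 ≤ N → ∀ y ∉ box (N * 2 ^ K) N, f y = 0 := by
  obtain ⟨B, hB⟩ := hs.isBounded.exists_norm_le
  obtain ⟨N0, hN0⟩ := exists_nat_gt B
  refine ⟨N0, fun N hN y hy => ?_⟩
  by_contra h
  refine hy ?_
  have h1 := hB y (subset_tsupport f h)
  have h2 : (N0 : ℝ) ≤ N := by exact_mod_cast hN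
  have h3 : (N : ℝ) ≤ N * 2 ^ K := le_mul_of_one_le_right (Nat.cast_nonneg N) (one_le_pow₀ one_le_two)
  have h4 := abs_le.1 ((norm_fst_le y).trans h1)
  have h5 := abs_le.1 ((norm_snd_le y).trans h1)
  exact ⟨⟨by linarith [h4.1], by linarith [h4.2]⟩, by linarith [h5.1], by linarith [h5.2]⟩

lemma sqn_le_of_boxes {g : ℝ × ℝ → ℂ} (K N0 : ℕ) {A : ℝ≥0∞}
    (h : ∀ N : ℕ, N0 ≤ N → sqn (volume.restrict (box (N * 2 ^ K) N)) g ≤ A) : sqn volume g ≤ A := by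
  have hmono : Monotone fun N : ℕ => box ((N : ℝ) * 2 ^ K) N := fun a b hab => by
    have h1 : (a : ℝ) ≤ b := by exact_mod_cast hab
    have h2 : (a : ℝ) * 2 ^ K ≤ b * 2 ^ K := by gcongr
    exact Set.prod_mono (Set.Ico_subset_Ico (neg_le_neg h2) h2) (Set.Icc_subset_Icc (neg_le_neg h1) h1)
  have hU : ⋃ N : ℕ, box ((N : ℝ) * 2 ^ K) N = Set.univ := by
    refine Set.eq_univ_of_forall fun y => Set.mem_iUnion.2 ?_
    obtain ⟨N, hN⟩ := exists_nat_gt ‖y‖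
    refine ⟨N, ?_⟩
    have h3 : (N : ℝ) ≤ N * 2 ^ K := le_mul_of_one_le_right (Nat.cast_nonneg N) (one_le_pow₀ one_le_two)
    have h4 := abs_lt.1 ((norm_fst_le y).trans_lt hN)
    have h5 := abs_lt.1 ((norm_snd_le y).trans_lt hN)
    exact ⟨⟨by linarith [h4.1], by linarith [h4.2]⟩, by linarith [h5.1], by linarith [h5.2]⟩
  unfold sqn
  rw [← setLIntegral_univ, ← hU, setLIntegral_iUnion_of_directed _ hmono.directed_le]
  refine iSup_le fun N => ?_
  exact (lintegral_mono_set (hmono (le_max_left N N0))).trans (h _ (le_max_right N N0))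

/-- The a priori estimate for compactly supported functions. -/
lemma exists_oscOp_bound (n : ℕ) (hn : 1 ≤ n) (Γ : ℝ) (hΓ : 1 / 2 < Γ) :
    ∃ C : ℝ, 0 < C ∧ ∀ p : ℝ[X], p.natDegree ≤ n → ∀ γ R : ℝ, 1 / 2 ≤ |γ| → |γ| ≤ Γ → 0 < R →
    ∀ f : ℝ × ℝ → ℂ, Continuous f → HasCompactSupport f →
    sqn volume (oscOp p γ R f) ≤ ENNReal.ofReal C ^ 2 * sqn volume f := by
  obtain ⟨C, hC, h⟩ := exists_box_bound n hn Γ hΓ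
  refine ⟨C, hC, fun p hp γ R hγ hγΓ hR f hf hs => ?_⟩
  have hpos : ∀ γ : ℝ, 1 / 2 ≤ γ → γ ≤ Γ → ∀ f : ℝ × ℝ → ℂ, Continuous f → HasCompactSupport f →
      sqn volume (oscOp p γ R f) ≤ ENNReal.ofReal C ^ 2 * sqn volume f := by
    intro γ hγ hγΓ f hf hs
    obtain ⟨K, hK⟩ := h p hp γ R hγ hγΓ hR
    obtain ⟨N0, hN0⟩ := exists_box_support hs K
    refine sqn_le_of_boxes K N0 fun N hN => ?_
    have hg : MemLp (fun y => modul (-γ) y * f y) 2 (volume.restrict (box (N * 2 ^ K) N)) :=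
      ((continuous_modul.mul hf).memLp_of_hasCompactSupport hs.mul_left).restrict _
    have e1 : sqn (volume.restrict (box (N * 2 ^ K) N)) (oscOp p γ R f)
        = sqn (volume.restrict (box (N * 2 ^ K) N)) (op (volume.restrict (box (N * 2 ^ K) N))
          (fullK p 1 γ 0 R) fun y => modul (-γ) y * f y) := by
      unfold sqn
      refine lintegral_congr fun x => ?_
      rw [oscOp_eq_of_support (hN0 N hN), enorm_mul, ← ofReal_norm (modul γ x), norm_modul,
        ENNReal.ofReal_one, one_mul]
    have e2 : sqn (volume.restrict (box (N * 2 ^ K) N)) (fun y => modul (-γ) y * f y)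
        = sqn (volume.restrict (box (N * 2 ^ K) N)) f := by
      unfold sqn
      refine lintegral_congr fun x => ?_
      rw [enorm_mul, ← ofReal_norm (modul (-γ) x), norm_modul, ENNReal.ofReal_one, one_mul]
    rw [e1]
    refine (hK N N _ hg).trans ?_
    rw [e2]
    exact mul_le_mul_right (lintegral_mono' Measure.restrict_le_self le_rfl) _
  rcases le_total 0 γ with h0 | h0
  · rw [abs_of_nonneg h0] at hγ hγΓ
    exact hpos γ hγ hγΓ f hf hs
  · rw [abs_of_nonpos h0] at hγ hγΓ
    have h1 := hpos (-γ) hγ hγΓ (fun y => conj (f y)) (RCLike.continuous_conj.comp hf)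
      (hs.comp_left (g := conj) (map_zero _))
    have e1 : ∀ x, oscOp p (-γ) R (fun y => conj (f y)) x = conj (oscOp p γ R f x) := fun x => by
      unfold oscOp
      rw [← integral_conj]
      refine integral_congr_ae (.of_forall fun y => ?_)
      simp only
      rw [map_mul, kernel_conj]
    unfold sqn at h1 ⊢
    simp_rw [e1, RCLike.enorm_conj] at h1
    exact h1

/-- The space of test functions. -/
def testFun : Submodule ℂ (ℝ × ℝ → ℂ) where
  carrier := {f | ContDiff ℝ ∞ f ∧ HasCompactSupport f}
  add_mem' hf hg := ⟨hf.1.add hg.1, hf.2.add hg.2⟩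
  zero_mem' := ⟨contDiff_const, HasCompactSupport.zero⟩
  smul_mem' c _ hf := ⟨contDiff_const.smul hf.1, hf.2.smul_left (f := fun _ => c)⟩

lemma memLp_testFun (f : testFun) : MemLp (f : ℝ × ℝ → ℂ) 2 volume :=
  f.2.1.continuous.memLp_of_hasCompactSupport f.2.2

/-- The inclusion of the test functions into `L²`. -/
def testToLp : testFun →ₗ[ℂ] L2 where
  toFun f := (memLp_testFun f).toLp _
  map_add' _ _ := rfl
  map_smul' _ _ := rfl

lemma denseRange_testToLp : DenseRange testToLp := by
  have h := Lp.dense_hasCompactSupport_contDiff (μ := (volume : Measure (ℝ × ℝ))) (F := ℂ) (p := 2)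
    (by norm_num)
  refine h.mono ?_
  rintro f ⟨g, hfg, hs, hg⟩
  refine ⟨⟨g, hg, hs⟩, Lp.ext ?_⟩
  exact (memLp_testFun ⟨g, hg, hs⟩).coeFn_toLp.trans hfg.symm

lemma exists_extends {A : ℝ} (hA : 0 ≤ A) (h : ∀ f : ℝ × ℝ → ℂ, Continuous f → HasCompactSupport f →
    sqn volume (oscOp p γ R f) ≤ ENNReal.ofReal A ^ 2 * sqn volume f) :
    ∃ T : L2 →L[ℂ] L2, Extends p γ R T ∧ ‖T‖ ≤ A := by
  have hbd : ∀ f : testFun, sqn volume (oscOp p γ R f) ≤ ENNReal.ofReal A ^ 2 * sqn volume (f : ℝ × ℝ → ℂ) :=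
    fun f => h f f.2.1.continuous f.2.2
  have hmem : ∀ f : testFun, MemLp (oscOp p γ R f) 2 volume := fun f =>
    memLp_of_sqn_ne_top
      (op_stronglyMeasurable (ν := volume) measurable_kernel (memLp_testFun f).1).aestronglyMeasurable
      (ne_top_of_le_ne_top (ENNReal.mul_ne_top (by finiteness) (sqn_ne_top (memLp_testFun f))) (hbd f))
  have hint : ∀ (f : testFun) (x : ℝ × ℝ), Integrable (fun y => kernel p γ R x y * (f : ℝ × ℝ → ℂ) y) :=
    fun f x => integrable_kernel_mul p γ R f f.2.1 f.2.2 x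
  let L : testFun →ₗ[ℂ] L2 :=
    { toFun := fun f => (hmem f).toLp _
      map_add' := fun f g => by
        rw [← MemLp.toLp_add]
        refine MemLp.toLp_congr _ _ (.of_forall fun x => ?_)
        rw [Pi.add_apply]
        unfold oscOp
        rw [← integral_add (hint f x) (hint g x)]
        refine integral_congr_ae (.of_forall fun y => ?_)
        simp [mul_add]
      map_smul' := fun c f => by
        rw [RingHom.id_apply, ← MemLp.toLp_const_smul]
        refine MemLp.toLp_congr _ _ (.of_forall fun x => ?_)
        rw [Pi.smul_apply, smul_eq_mul]
        unfold oscOp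
        rw [← integral_const_mul]
        refine integral_congr_ae (.of_forall fun y => ?_)
        simp only [Submodule.coe_smul, Pi.smul_apply, smul_eq_mul]
        ring }
  have hnorm : ∀ f : testFun, ‖L f‖ ≤ A * ‖testToLp f‖ := fun f => by
    have h1 := hbd f
    rw [← sqn_congr (hmem f).coeFn_toLp, ← sqn_congr (memLp_testFun f).coeFn_toLp, ← enorm_sq_eq_sqn,
      ← enorm_sq_eq_sqn, ← mul_pow] at h1
    have h2 := (ENNReal.pow_le_pow_left_iff (n := 2) (by norm_num)).1 h1
    rw [← ofReal_norm, ← ofReal_norm, ← ENNReal.ofReal_mul hA] at h2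
    exact (ENNReal.ofReal_le_ofReal_iff (by positivity)).1 h2
  refine ⟨L.extendOfNorm testToLp, fun f hf hs => ?_,
    LinearMap.opNorm_extendOfNorm_le denseRange_testToLp hA hnorm⟩
  have e := LinearMap.extendOfNorm_eq denseRange_testToLp ⟨A, hnorm⟩ (⟨f, hf, hs⟩ : testFun)
  have e2 : (L ⟨f, hf, hs⟩ : ℝ × ℝ → ℂ) =ᵐ[volume] oscOp p γ R f := (hmem ⟨f, hf, hs⟩).coeFn_toLp
  rw [← e] at e2
  exact e2

lemma one_le_log_log {R : ℝ} (hR : 100 ≤ R) : 1 ≤ Real.log (Real.log (10 + R)) := by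
  have h1 : Real.exp 1 ≤ 3 := Real.exp_one_lt_three.le
  have h2 : Real.exp (Real.exp 1) ≤ 10 + R := by
    calc Real.exp (Real.exp 1) ≤ Real.exp 3 := Real.exp_le_exp.2 h1
      _ = Real.exp 1 ^ 3 := by rw [← Real.exp_nat_mul]; norm_num
      _ ≤ 3 ^ 3 := by gcongr
      _ ≤ 10 + R := by linarith
  have h3 : Real.exp 1 ≤ Real.log (10 + R) := (Real.le_log_iff_exp_le (by linarith)).2 h2
  exact (Real.le_log_iff_exp_le ((Real.exp_pos 1).trans_le h3)).2 h3

lemma half_le_abs (hn : 1 ≤ n) (h : min 1 ((n : ℝ) / 2) ≤ |γ|) : 1 / 2 ≤ |γ| := by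
  have h1 : (1 : ℝ) ≤ n := by exact_mod_cast hn
  exact (le_min (by norm_num) (by linarith)).trans h

end Oscillatory

end SingOsc

end

theorem theorem3p0 (n : ℕ) (hn : 1 ≤ n) (Γ : ℝ) (hΓ : 1 / 2 < Γ) :
    (∃ C : ℝ, ∀ p : ℝ[X], p.natDegree ≤ n →
      ∀ γ : ℝ, min 1 ((n : ℝ) / 2) ≤ |γ| → |γ| ≤ Γ →
      ∀ R : ℝ, 100 ≤ R →
        ∃ T : SingOsc.L2 →L[ℂ] SingOsc.L2, SingOsc.Extends p γ R T ∧
          ‖T‖ ≤ C * Real.log (Real.log (10 + R))) ∧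
    (n = 1 → ∃ C : ℝ, ∀ p : ℝ[X], p.natDegree ≤ n →
      ∀ γ : ℝ, min 1 ((n : ℝ) / 2) ≤ |γ| → |γ| ≤ Γ →
      ∀ R : ℝ, 100 ≤ R →
        ∃ T : SingOsc.L2 →L[ℂ] SingOsc.L2, SingOsc.Extends p γ R T ∧ ‖T‖ ≤ C) := by
  obtain ⟨C, hC, h⟩ := SingOsc.exists_oscOp_bound n hn Γ hΓ
  have hT : ∀ p : ℝ[X], p.natDegree ≤ n → ∀ γ : ℝ, min 1 ((n : ℝ) / 2) ≤ |γ| → |γ| ≤ Γ →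
      ∀ R : ℝ, 100 ≤ R → ∃ T : SingOsc.L2 →L[ℂ] SingOsc.L2, SingOsc.Extends p γ R T ∧ ‖T‖ ≤ C :=
    fun p hp γ hγ hγΓ R hR =>
      SingOsc.exists_extends hC.le (h p hp γ R (SingOsc.half_le_abs hn hγ) hγΓ (by linarith))
  refine ⟨⟨C, fun p hp γ hγ hγΓ R hR => ?_⟩, fun _ => ⟨C, hT⟩⟩
  obtain ⟨T, hE, hn⟩ := hT p hp γ hγ hγΓ R hR
  exact ⟨T, hE, hn.trans (le_mul_of_one_le_right hC.le (SingOsc.one_le_log_log hR))⟩
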